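/- Consider the planar piecewise linear near-Hamiltonian system with three zones $$\dot x = H_y(x,y)+\epsilon f(x,y),\qquad \dot y=-H_x(x,y)+\epsilon g(x,y),$$ where $H=H^L,\ f=f_L,\ g=g_L$ for $x\le -1$ (left subsystem), $H=H^C,\ f=f_C,\ g=g_C$ for $-1\le x\le 1$ (central subsystem), $H=H^R,\ f=f_R,\ g=g_R$ for $x\ge 1$ (right subsystem), $$H^i(x,y)=\tfrac{b_i}{2}y^2-\tfrac{c_i}{2}x^2+a_ixy+\alpha_i y-\beta_i x,\qquad i\in\{L,C,R\},$$ with arbitrary real coefficients, and each $f_i,g_i$ is a real polynomial of degree at most one in $(x,y)$. A point of a line $x=\pm1$ is a crossing point if the $x$-components of the two adjacent vector fields have a positive product there, and a tangent point if one of these components vanishes. A crossing periodic orbit is a nonconstant periodic orbit of the piecewise system that meets the lines $x=\pm1$ only at crossing points. A limit cycle is a crossing periodic orbit having a neighbourhood that contains no other crossing periodic orbit. Suppose that the unperturbed system ($\epsilon=0$) satisfies: (H1) the central subsystem has a center and the left and right subsystems have saddles; (H2) all points of the lines $x=\pm1$ are crossing points, except for tangent points; (H3) there is a periodic annulus consisting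 of crossing periodic orbits with clockwise orientation, some of which pass through all three zones and some of which pass through exactly two zones (the central one and an outer one). Let $p=(p_x,p_y)$ be the center of the unperturbed central subsystem; it is called real if $|p_x|<1$, boundary if $|p_x|=1$, virtual if $|p_x|>1$. Put $(m,n)=(4,2)$ if the center is real or boundary, and $(m,n)=(3,1)$ if it is virtual. Then at least $m+n$ limit cycles can bifurcate from the periodic annulus under linear perturbations, $m$ of them through three zones and $n$ through two zones. That is, there are degree-one perturbations $f_i,g_i$ ($i\in\{L,C,R\}$), distinct periodic orbits $\Gamma_1,\dots,\Gamma_m$ of the annulus through three zones and distinct periodic orbits $\Gamma'_1,\dots,\Gamma'_n$ of the annulus through two zones, such that for all sufficiently small $\epsilon>0$ the perturbed system has distinct limit cycles $\gamma_1^\epsilon,\dots,\gamma_m^\epsilon$ passing through three zones and distinct limit cycles $\tilde\gamma_1^\epsilon,\dots,\tilde\gamma_n^\epsilon$ passing through two zones, with $\gamma_k^\epsilon\to\Gamma_k$ and $\tilde\gamma_l^\epsilon\to\Gamma'_l$ in the Hausdorff distance as $\epsilon\to0^+$. -/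

import Mathlib

open Set Filter Topology

namespace PWHam

noncomputable section

/-- Coefficients of the quadratic Hamiltonian
`H(x,y) = b/2 y² - c/2 x² + a x y + α y - β x` of one linear subsystem. -/
structure HamCoeff where
  b : ℝ
  c : ℝ
  a : ℝ
  α : ℝ
  β : ℝ

/-- The Hamiltonian with the given coefficients. -/
def HamCoeff.ham (P : HamCoeff) (x y : ℝ) : ℝ :=
  P.b / 2 * y ^ 2 - P.c / 2 * x ^ 2 + P.a * x * y + P.α * y - P.β * x

/-- The Hamiltonian vector field `(H_y, -H_x)`. -/
def HamCoeff.field (P : HamCoeff) (p : ℝ × ℝ) : ℝ × ℝ :=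
  (deriv (fun y => P.ham p.1 y) p.2, - deriv (fun x => P.ham x p.2) p.1)

/-- Coefficients of a linear (affine) perturbation `(f, g)` in one zone. -/
structure PertCoeff where
  f10 : ℝ
  f01 : ℝ
  f00 : ℝ
  g10 : ℝ
  g01 : ℝ
  g00 : ℝ

/-- The perturbation `(f, g)` with `f = f10 x + f01 y + f00`, `g = g10 x + g01 y + g00`. -/
def PertCoeff.field (Q : PertCoeff) (p : ℝ × ℝ) : ℝ × ℝ :=
  (Q.f10 * p.1 + Q.f01 * p.2 + Q.f00, Q.g10 * p.1 + Q.g01 * p.2 + Q.g00)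

/-- A piecewise vector field with three zones: `left` governs `x ≤ -1`, `central` governs
`-1 ≤ x ≤ 1`, and `right` governs `1 ≤ x`. -/
structure PWField where
  left : ℝ × ℝ → ℝ × ℝ
  central : ℝ × ℝ → ℝ × ℝ
  right : ℝ × ℝ → ℝ × ℝ

/-- The unperturbed piecewise Hamiltonian system. -/
def unperturbed (HL HC HR : HamCoeff) : PWField :=
  ⟨HL.field, HC.field, HR.field⟩

/-- The near-Hamiltonian system `x' = H_y + ε f`, `y' = -H_x + ε g`. -/
def perturbed (HL HC HR : HamCoeff) (QL QC QR : PertCoeff) (ε : ℝ) : PWField :=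
  ⟨fun p => HL.field p + ε • QL.field p,
   fun p => HC.field p + ε • QC.field p,
   fun p => HR.field p + ε • QR.field p⟩

/-! ### Singular points of the linear subsystems -/

/-- The Jacobian matrix of a planar vector field. -/
def jacobian (X : ℝ × ℝ → ℝ × ℝ) (p : ℝ × ℝ) : Matrix (Fin 2) (Fin 2) ℝ :=
  !![deriv (fun x => (X (x, p.2)).1) p.1, deriv (fun y => (X (p.1, y)).1) p.2;
     deriv (fun x => (X (x, p.2)).2) p.1, deriv (fun y => (X (p.1, y)).2) p.2]

/-- `p` is a center of the linear (affine) system `X`: a singular point with a pair of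
nonzero purely imaginary eigenvalues. -/
def IsLinearCenter (X : ℝ × ℝ → ℝ × ℝ) (p : ℝ × ℝ) : Prop :=
  X p = 0 ∧ ∃ ω : ℝ, 0 < ω ∧
    Module.End.HasEigenvalue
      (Matrix.toLin' ((jacobian X p).map (fun r : ℝ => (r : ℂ)))) (ω * Complex.I) ∧
    Module.End.HasEigenvalue
      (Matrix.toLin' ((jacobian X p).map (fun r : ℝ => (r : ℂ)))) (-(ω * Complex.I))

/-- `p` is a saddle of the linear (affine) system `X`: a singular point with two real
eigenvalues of opposite signs. -/
def IsLinearSaddle (X : ℝ × ℝ → ℝ × ℝ) (p : ℝ × ℝ) : Prop :=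
  X p = 0 ∧ ∃ μ ν : ℝ, μ < 0 ∧ 0 < ν ∧
    Module.End.HasEigenvalue (Matrix.toLin' (jacobian X p)) μ ∧
    Module.End.HasEigenvalue (Matrix.toLin' (jacobian X p)) ν

/-- A singular point of the central subsystem lying in the open central zone. -/
def IsRealCentral (p : ℝ × ℝ) : Prop := -1 < p.1 ∧ p.1 < 1

/-- A singular point of the central subsystem lying on one of the lines `x = ±1`. -/
def IsBoundaryCentral (p : ℝ × ℝ) : Prop := p.1 = -1 ∨ p.1 = 1

/-- A singular point of the central subsystem lying outside the closed central zone. -/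
def IsVirtualCentral (p : ℝ × ℝ) : Prop := p.1 < -1 ∨ 1 < p.1

/-! ### Crossing orbits -/

/-- A point of `x = ±1` at which both adjacent fields cross the line in the same direction. -/
def IsCrossingPoint (X : PWField) (p : ℝ × ℝ) : Prop :=
  (p.1 = -1 ∧ 0 < (X.left p).1 * (X.central p).1) ∨
  (p.1 = 1 ∧ 0 < (X.central p).1 * (X.right p).1)

/-- A point of `x = ±1` at which at least one of the adjacent fields is tangent to the line. -/
def IsTangentPoint (X : PWField) (p : ℝ × ℝ) : Prop :=
  (p.1 = -1 ∧ ((X.left p).1 = 0 ∨ (X.central p).1 = 0)) ∨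
  (p.1 = 1 ∧ ((X.central p).1 = 0 ∨ (X.right p).1 = 0))

/-- `γ` passes at time `t` through a point of a separation line, arriving with the velocity of
the field `Y` and leaving with the velocity of the field `Z`. -/
def SwitchesAt (Y Z : ℝ × ℝ → ℝ × ℝ) (γ : ℝ → ℝ × ℝ) (t : ℝ) : Prop :=
  HasDerivWithinAt γ (Y (γ t)) (Iic t) t ∧ HasDerivWithinAt γ (Z (γ t)) (Ici t) t

/-- `γ` is a (global) solution of the piecewise system that meets the lines `x = ±1` only at
crossing points: it solves the corresponding subsystem inside each open zone, and on a line it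
goes over from one of the adjacent subsystems to the other, in the common direction of the
two fields. -/
structure IsCrossingSolution (X : PWField) (γ : ℝ → ℝ × ℝ) : Prop where
  in_left : ∀ t, (γ t).1 < -1 → HasDerivAt γ (X.left (γ t)) t
  in_central : ∀ t, -1 < (γ t).1 → (γ t).1 < 1 → HasDerivAt γ (X.central (γ t)) t
  in_right : ∀ t, 1 < (γ t).1 → HasDerivAt γ (X.right (γ t)) t
  crossing : ∀ t, (γ t).1 = -1 ∨ (γ t).1 = 1 → IsCrossingPoint X (γ t)
  left_to_central : ∀ t, (γ t).1 = -1 → 0 < (X.central (γ t)).1 →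
    SwitchesAt X.left X.central γ t
  central_to_left : ∀ t, (γ t).1 = -1 → (X.central (γ t)).1 < 0 →
    SwitchesAt X.central X.left γ t
  central_to_right : ∀ t, (γ t).1 = 1 → 0 < (X.central (γ t)).1 →
    SwitchesAt X.central X.right γ t
  right_to_central : ∀ t, (γ t).1 = 1 → (X.central (γ t)).1 < 0 →
    SwitchesAt X.right X.central γ t

/-- `γ` is a nonconstant crossing solution with period `T > 0`. -/
def IsCrossingPeriodic (X : PWField) (γ : ℝ → ℝ × ℝ) (T : ℝ) : Prop :=
  IsCrossingSolution X γ ∧ 0 < T ∧ Function.Periodic γ T ∧ ∃ t, γ t ≠ γ 0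

/-- `Γ` is a crossing periodic orbit, as a subset of the plane. -/
def IsCrossingPeriodicOrbit (X : PWField) (Γ : Set (ℝ × ℝ)) : Prop :=
  ∃ γ T, IsCrossingPeriodic X γ T ∧ Γ = range γ

open Classical in
/-- The horizontal velocity of the piecewise system at a point; the value chosen on the lines
`x = ±1` is irrelevant below, since crossing solutions are there at isolated times only. -/
def horizVelocity (X : PWField) (p : ℝ × ℝ) : ℝ :=
  if p.1 < -1 then (X.left p).1 else if 1 < p.1 then (X.right p).1 else (X.central p).1

/-- The closed curve is run through clockwise: the area integral `∮ y dx` is positive. -/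
def IsClockwise (X : PWField) (γ : ℝ → ℝ × ℝ) (T : ℝ) : Prop :=
  0 < ∫ t in (0 : ℝ)..T, (γ t).2 * horizVelocity X (γ t)

/-- `Γ` is a clockwise crossing periodic orbit. -/
def IsClockwiseOrbit (X : PWField) (Γ : Set (ℝ × ℝ)) : Prop :=
  ∃ γ T, IsCrossingPeriodic X γ T ∧ IsClockwise X γ T ∧ Γ = range γ

/-- `Γ` enters the left zone. -/
def MeetsLeft (Γ : Set (ℝ × ℝ)) : Prop := ∃ p ∈ Γ, p.1 < -1

/-- `Γ` enters the central zone. -/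
def MeetsCentral (Γ : Set (ℝ × ℝ)) : Prop := ∃ p ∈ Γ, -1 < p.1 ∧ p.1 < 1

/-- `Γ` enters the right zone. -/
def MeetsRight (Γ : Set (ℝ × ℝ)) : Prop := ∃ p ∈ Γ, 1 < p.1

/-- `Γ` passes through the three zones. -/
def ThreeZones (Γ : Set (ℝ × ℝ)) : Prop := MeetsLeft Γ ∧ MeetsCentral Γ ∧ MeetsRight Γ

/-- `Γ` passes through exactly two zones: the central one and one of the outer ones. -/
def TwoZones (Γ : Set (ℝ × ℝ)) : Prop :=
  MeetsCentral Γ ∧ ((MeetsRight Γ ∧ ¬ MeetsLeft Γ) ∨ (MeetsLeft Γ ∧ ¬ MeetsRight Γ))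

/-- The orbits of the periodic annulus that pass through three zones. -/
def annulusThree (X : PWField) : Set (Set (ℝ × ℝ)) :=
  {Γ | IsClockwiseOrbit X Γ ∧ ThreeZones Γ}

/-- The orbits of the periodic annulus that pass through two zones. -/
def annulusTwo (X : PWField) : Set (Set (ℝ × ℝ)) :=
  {Γ | IsClockwiseOrbit X Γ ∧ TwoZones Γ}

/-- `Γ` is a crossing limit cycle: a crossing periodic orbit with a neighbourhood that contains
no other crossing periodic orbit. -/
def IsLimitCycle (X : PWField) (Γ : Set (ℝ × ℝ)) : Prop :=
  IsCrossingPeriodicOrbit X Γ ∧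
    ∃ U : Set (ℝ × ℝ), IsOpen U ∧ Γ ⊆ U ∧
      ∀ Γ', IsCrossingPeriodicOrbit X Γ' → Γ' ⊆ U → Γ' = Γ

/-! ### The hypotheses -/

/-- (H1) The central subsystem has a center, the two outer subsystems have saddles. -/
def Hyp1 (HL HC HR : HamCoeff) : Prop :=
  (∃ p, IsLinearCenter HC.field p) ∧ (∃ p, IsLinearSaddle HL.field p) ∧
    (∃ p, IsLinearSaddle HR.field p)

/-- (H2) All points of the lines `x = ±1` are crossing points, except for tangent points. -/
def Hyp2 (X : PWField) : Prop :=
  ∀ p : ℝ × ℝ, p.1 = -1 ∨ p.1 = 1 → IsCrossingPoint X p ∨ IsTangentPoint X p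

/-- (H3) There is a periodic annulus of clockwise crossing periodic orbits, with orbits through
three zones and orbits through two zones. (One orbit of each kind is all that is asked for:
the orbits of each kind then form a whole annulus.) -/
def Hyp3 (X : PWField) : Prop :=
  (annulusThree X).Nonempty ∧ (annulusTwo X).Nonempty

/-! ### Bifurcation of limit cycles -/

/-- There are a linear perturbation, `m` distinct three-zone orbits `Γ₃ i` and `n` distinct
two-zone orbits `Γ₂ j` of the periodic annulus such that for all small `ε > 0` the perturbed
system has `m` distinct limit cycles `c₃ i ε` through three zones and `n` distinct limit cycles
`c₂ j ε` through two zones, which tend to the orbits `Γ₃ i`, `Γ₂ j` as `ε → 0⁺`. -/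
def LimitCyclesBifurcate (HL HC HR : HamCoeff) (m n : ℕ) : Prop :=
  ∃ QL QC QR : PertCoeff,
  ∃ (Γ₃ : Fin m → Set (ℝ × ℝ)) (Γ₂ : Fin n → Set (ℝ × ℝ)),
    Function.Injective Γ₃ ∧ Function.Injective Γ₂ ∧
    (∀ i, Γ₃ i ∈ annulusThree (unperturbed HL HC HR)) ∧
    (∀ j, Γ₂ j ∈ annulusTwo (unperturbed HL HC HR)) ∧
    ∃ (c₃ : Fin m → ℝ → Set (ℝ × ℝ)) (c₂ : Fin n → ℝ → Set (ℝ × ℝ)),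
      (∃ ε₀ : ℝ, 0 < ε₀ ∧ ∀ ε : ℝ, 0 < ε → ε < ε₀ →
        Function.Injective (fun i => c₃ i ε) ∧ Function.Injective (fun j => c₂ j ε) ∧
        (∀ i, IsLimitCycle (perturbed HL HC HR QL QC QR ε) (c₃ i ε) ∧ ThreeZones (c₃ i ε)) ∧
        (∀ j, IsLimitCycle (perturbed HL HC HR QL QC QR ε) (c₂ j ε) ∧ TwoZones (c₂ j ε))) ∧
      (∀ i, Tendsto (fun ε => Metric.hausdorffEDist (c₃ i ε) (Γ₃ i)) (𝓝[>] (0 : ℝ)) (𝓝 0)) ∧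
      (∀ j, Tendsto (fun ε => Metric.hausdorffEDist (c₂ j ε) (Γ₂ j)) (𝓝[>] (0 : ℝ)) (𝓝 0))

end

end PWHam

namespace PWHam

/-! ### One-sided derivatives and local monotonicity -/

/-! Normal form. On each line `x = ±1` hypothesis (H2) says that two affine functions of `y`, the
horizontal components of the adjacent fields, never have opposite signs; hence they are positively
proportional (`proportional`). A continuous map `(x, y) ↦ (x, κ y + ψ x)`, affine in each zone, can
therefore take the horizontal velocity, up to a positive factor in the outer zones, as new height
`Y`. It carries the system to `NF.sys` (`exists_normal_form`): the center becomes `x' = Y`, `Y' =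
-ω²(x - p)`, and each saddle becomes diagonal in the eigencoordinates `u`, `v`. The unperturbed
orbits are then symmetric under `Y ↦ -Y`. With `c = ω(1 - p)` and `e = ω(1 + p)`, heights `y` on `x
= 1` and `δ` on `x = -1` belong to the same orbit when `c² + y² = e² + δ²`. By (H3), after a point
reflection if necessary, `p > 0`, and the critical height `s = √(e² - c²)` lies below the
separatrices of the right saddle (`NF.p_pos`, `NF.sq_e_lt`). Heights below `s` give loops through
the central and the right zone, heights above `s` give orbits through three zones, with `δ = √(y² -
s²)` (`del`).

Limit cycles. The perturbation changes the divergence of the center, one eigenvalue of each saddle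
and the position of one separatrix of each saddle. The return maps are analytic in `(ε, y)` and
equal the identity at `ε = 0`; their first order displacements are, up to a positive factor and a
sign, the explicit functions `mel₂` and `mel₃`. Where such a function changes sign, the displacement
has for small `ε > 0` a zero that is isolated by analyticity (`exists_isolated_zero`), so no simple
zero is needed. Any crossing periodic orbit near the resulting cycle meets `x = 1` in a finite set
invariant under an increasing return map; such a set consists of fixed points
(`fixed_of_finite_invariant`), so the cycle is isolated among all crossing periodic orbits
(`NF.bifurcates_three`, `NF.bifurcates_two`).

Counting. Near `s` one has `y - s` of order `δ²`. Suitable parameters (`NF.tuned`) turn `mel₃` into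
a combination of `y`, `-δ`, `evenPart`, `cubicPart` and `E + oddPart`, of orders 0, 1, 2, 3 and at
least 4 in `δ`, while `mel₂` becomes the combination of `y`, `evenPart` and `E` with the same
coefficients, of orders 0, 1 and at least 2 in `y - s`. Adding the lower order terms one after the
other with tiny coefficients creates alternating signs on both sides of `s` at once
(`exists_sign_chain`): four changes above `s` and two below. The sign of the top term has to be
favourable on both sides. If `E''(s) ≠ 0`, multiplication by `σ = E''(s)` achieves this; if `E''(s)
= 0`, the fifth order term `oddPart` decides above `s`, and the limit `c² π > 0` of `E` at height
zero decides below. The last argument needs `c > 0`, and for `c = 0` the second derivative does not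
vanish; this is where a real or boundary center enters. For a virtual center the top term is
dropped, which leaves three changes and one (`exists_pattern_real`, `exists_pattern_virtual`). -/

lemma eventually_gt_of_hasDerivWithinAt_Ici {f : ℝ → ℝ} {f' t : ℝ}
    (h : HasDerivWithinAt f f' (Ici t) t) (hf : 0 < f') : ∀ᶠ s in 𝓝[>] t, f t < f s := by
  rw [hasDerivWithinAt_iff_tendsto_slope, Ici_sdiff_left] at h
  filter_upwards [h.eventually_const_lt hf, self_mem_nhdsWithin] with s hs hst
  rw [slope_def_field] at hs
  have : 0 < s - t := sub_pos.2 hst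
  have := (div_pos_iff_of_pos_right this).1 hs
  linarith

lemma eventually_lt_of_hasDerivWithinAt_Iic {f : ℝ → ℝ} {f' t : ℝ}
    (h : HasDerivWithinAt f f' (Iic t) t) (hf : 0 < f') : ∀ᶠ s in 𝓝[<] t, f s < f t := by
  rw [hasDerivWithinAt_iff_tendsto_slope, Iic_sdiff_right] at h
  filter_upwards [h.eventually_const_lt hf, self_mem_nhdsWithin] with s hs hst
  rw [slope_def_field] at hs
  have h1 : s - t < 0 := sub_neg.2 hst
  by_contra! h2
  have := div_nonpos_of_nonneg_of_nonpos (sub_nonneg.2 h2) h1.le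
  linarith

lemma eventually_lt_of_hasDerivWithinAt_Ici {f : ℝ → ℝ} {f' t : ℝ}
    (h : HasDerivWithinAt f f' (Ici t) t) (hf : f' < 0) : ∀ᶠ s in 𝓝[>] t, f s < f t := by
  filter_upwards [eventually_gt_of_hasDerivWithinAt_Ici h.neg (neg_pos.2 hf)] with s hs
  simpa using hs

lemma eventually_gt_of_hasDerivWithinAt_Iic {f : ℝ → ℝ} {f' t : ℝ}
    (h : HasDerivWithinAt f f' (Iic t) t) (hf : f' < 0) : ∀ᶠ s in 𝓝[<] t, f t < f s := by
  filter_upwards [eventually_lt_of_hasDerivWithinAt_Iic h.neg (neg_pos.2 hf)] with s hs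
  simpa using hs

lemma _root_.HasDerivWithinAt.prodFst {γ : ℝ → ℝ × ℝ} {v : ℝ × ℝ} {s : Set ℝ} {t : ℝ}
    (h : HasDerivWithinAt γ v s t) : HasDerivWithinAt (fun t => (γ t).1) v.1 s t :=
  (hasFDerivAt_fst (𝕜 := ℝ) (p := γ t)).comp_hasDerivWithinAt t h

lemma _root_.HasDerivWithinAt.prodSnd {γ : ℝ → ℝ × ℝ} {v : ℝ × ℝ} {s : Set ℝ} {t : ℝ}
    (h : HasDerivWithinAt γ v s t) : HasDerivWithinAt (fun t => (γ t).2) v.2 s t :=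
  (hasFDerivAt_snd (𝕜 := ℝ) (p := γ t)).comp_hasDerivWithinAt t h

lemma _root_.HasDerivAt.prodFst {γ : ℝ → ℝ × ℝ} {v : ℝ × ℝ} {t : ℝ}
    (h : HasDerivAt γ v t) : HasDerivAt (fun t => (γ t).1) v.1 t :=
  (hasFDerivAt_fst (𝕜 := ℝ) (p := γ t)).comp_hasDerivAt t h

lemma hasDerivAt_of_Iic_Ici {E : Type*} [NormedAddCommGroup E] [NormedSpace ℝ E] {γ : ℝ → E}
    {v : E} {t : ℝ} (h₁ : HasDerivWithinAt γ v (Iic t) t) (h₂ : HasDerivWithinAt γ v (Ici t) t) :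
    HasDerivAt γ v t := by
  rw [← hasDerivWithinAt_univ, ← Iic_union_Ici (a := t)]
  exact h₁.union h₂

/-! ### Forward and backward fields -/

open Classical in
/-- The subsystem that a crossing solution follows just after it is at the point `p`. -/
noncomputable def fwdZone (X : PWField) (p : ℝ × ℝ) : ℝ × ℝ → ℝ × ℝ :=
  if p.1 < -1 ∨ (p.1 = -1 ∧ (X.central p).1 < 0) then X.left
  else if 1 < p.1 ∨ (p.1 = 1 ∧ 0 < (X.central p).1) then X.right else X.central

open Classical in
/-- The subsystem that a crossing solution follows just before it is at the point `p`. -/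
noncomputable def bwdZone (X : PWField) (p : ℝ × ℝ) : ℝ × ℝ → ℝ × ℝ :=
  if p.1 < -1 ∨ (p.1 = -1 ∧ 0 < (X.central p).1) then X.left
  else if 1 < p.1 ∨ (p.1 = 1 ∧ (X.central p).1 < 0) then X.right else X.central

section zones

variable {X : PWField} {p : ℝ × ℝ}

lemma fwdZone_of_lt (h : p.1 < -1) : fwdZone X p = X.left := by simp [fwdZone, h]

lemma bwdZone_of_lt (h : p.1 < -1) : bwdZone X p = X.left := by simp [bwdZone, h]

lemma fwdZone_of_gt (h : 1 < p.1) : fwdZone X p = X.right := by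
  have h1 : ¬ p.1 < -1 := by linarith
  have h2 : p.1 ≠ -1 := by linarith
  simp [fwdZone, h, h1, h2]

lemma bwdZone_of_gt (h : 1 < p.1) : bwdZone X p = X.right := by
  have h1 : ¬ p.1 < -1 := by linarith
  have h2 : p.1 ≠ -1 := by linarith
  simp [bwdZone, h, h1, h2]

lemma fwdZone_of_mem (h : -1 < p.1) (h' : p.1 < 1) : fwdZone X p = X.central := by
  have h1 : ¬ p.1 < -1 := by linarith
  have h2 : p.1 ≠ -1 := by linarith
  have h3 : ¬ 1 < p.1 := by linarith
  have h4 : p.1 ≠ 1 := by linarith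
  simp [fwdZone, h1, h2, h3, h4]

lemma bwdZone_of_mem (h : -1 < p.1) (h' : p.1 < 1) : bwdZone X p = X.central := by
  have h1 : ¬ p.1 < -1 := by linarith
  have h2 : p.1 ≠ -1 := by linarith
  have h3 : ¬ 1 < p.1 := by linarith
  have h4 : p.1 ≠ 1 := by linarith
  simp [bwdZone, h1, h2, h3, h4]

lemma fwdZone_left_pos (h : p.1 = -1) (h' : 0 < (X.central p).1) : fwdZone X p = X.central := by
  simp only [fwdZone, h]; norm_num; intro h2; linarith

lemma fwdZone_left_neg (h : p.1 = -1) (h' : (X.central p).1 < 0) : fwdZone X p = X.left := by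
  simp [fwdZone, h, h']

lemma bwdZone_left_pos (h : p.1 = -1) (h' : 0 < (X.central p).1) : bwdZone X p = X.left := by
  simp [bwdZone, h, h']

lemma bwdZone_left_neg (h : p.1 = -1) (h' : (X.central p).1 < 0) : bwdZone X p = X.central := by
  simp only [bwdZone, h]; norm_num; intro h2; linarith

lemma fwdZone_right_pos (h : p.1 = 1) (h' : 0 < (X.central p).1) : fwdZone X p = X.right := by
  simp only [fwdZone, h]; norm_num [h']

lemma fwdZone_right_neg (h : p.1 = 1) (h' : (X.central p).1 < 0) : fwdZone X p = X.central := by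
  simp only [fwdZone, h]; norm_num; intro h2; linarith

lemma bwdZone_right_pos (h : p.1 = 1) (h' : 0 < (X.central p).1) : bwdZone X p = X.central := by
  simp only [bwdZone, h]; norm_num; intro h2; linarith

lemma bwdZone_right_neg (h : p.1 = 1) (h' : (X.central p).1 < 0) : bwdZone X p = X.right := by
  simp only [bwdZone, h]; norm_num [h']

lemma IsCrossingPoint.central_ne (h : IsCrossingPoint X p) : (X.central p).1 ≠ 0 := by
  intro h0
  rcases h with ⟨-, h⟩ | ⟨-, h⟩ <;> simp [h0] at h

lemma IsCrossingPoint.left_pos (h : IsCrossingPoint X p) (hp : p.1 = -1)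
    (h' : 0 < (X.central p).1) : 0 < (X.left p).1 := by
  rcases h with ⟨-, h⟩ | ⟨h1, -⟩
  · exact (pos_iff_pos_of_mul_pos h).2 h'
  · linarith

lemma IsCrossingPoint.left_neg (h : IsCrossingPoint X p) (hp : p.1 = -1)
    (h' : (X.central p).1 < 0) : (X.left p).1 < 0 := by
  rcases h with ⟨-, h⟩ | ⟨h1, -⟩
  · exact (neg_iff_neg_of_mul_pos h).2 h'
  · linarith

lemma IsCrossingPoint.right_pos (h : IsCrossingPoint X p) (hp : p.1 = 1)
    (h' : 0 < (X.central p).1) : 0 < (X.right p).1 := by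
  rcases h with ⟨h1, -⟩ | ⟨-, h⟩
  · linarith
  · exact (pos_iff_pos_of_mul_pos h).1 h'

lemma IsCrossingPoint.right_neg (h : IsCrossingPoint X p) (hp : p.1 = 1)
    (h' : (X.central p).1 < 0) : (X.right p).1 < 0 := by
  rcases h with ⟨h1, -⟩ | ⟨-, h⟩
  · linarith
  · exact (neg_iff_neg_of_mul_pos h).1 h'

end zones

/-- The position of a point relative to the two separation lines. -/
lemma zone_cases (x : ℝ) : x < -1 ∨ x = -1 ∨ (-1 < x ∧ x < 1) ∨ x = 1 ∨ 1 < x := by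
  rcases lt_trichotomy x (-1) with h | h | h
  · exact Or.inl h
  · exact Or.inr (Or.inl h)
  · rcases lt_trichotomy x 1 with h' | h' | h'
    · exact Or.inr (Or.inr (Or.inl ⟨h, h'⟩))
    · exact Or.inr (Or.inr (Or.inr (Or.inl h')))
    · exact Or.inr (Or.inr (Or.inr (Or.inr h')))

/-! ### Crossing solutions: one-sided equations, continuity, isolated crossing times -/

namespace IsCrossingSolution

variable {X : PWField} {γ : ℝ → ℝ × ℝ}

lemma hasDerivWithinAt_fwd (h : IsCrossingSolution X γ) (t : ℝ) :
    HasDerivWithinAt γ (fwdZone X (γ t) (γ t)) (Ici t) t := by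
  rcases zone_cases (γ t).1 with h1 | h1 | h1 | h1 | h1
  · rw [fwdZone_of_lt h1]; exact (h.in_left t h1).hasDerivWithinAt
  · rcases (h.crossing t (Or.inl h1)).central_ne.lt_or_gt with h2 | h2
    · rw [fwdZone_left_neg h1 h2]; exact (h.central_to_left t h1 h2).2
    · rw [fwdZone_left_pos h1 h2]; exact (h.left_to_central t h1 h2).2
  · rw [fwdZone_of_mem h1.1 h1.2]; exact (h.in_central t h1.1 h1.2).hasDerivWithinAt
  · rcases (h.crossing t (Or.inr h1)).central_ne.lt_or_gt with h2 | h2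
    · rw [fwdZone_right_neg h1 h2]; exact (h.right_to_central t h1 h2).2
    · rw [fwdZone_right_pos h1 h2]; exact (h.central_to_right t h1 h2).2
  · rw [fwdZone_of_gt h1]; exact (h.in_right t h1).hasDerivWithinAt

lemma hasDerivWithinAt_bwd (h : IsCrossingSolution X γ) (t : ℝ) :
    HasDerivWithinAt γ (bwdZone X (γ t) (γ t)) (Iic t) t := by
  rcases zone_cases (γ t).1 with h1 | h1 | h1 | h1 | h1
  · rw [bwdZone_of_lt h1]; exact (h.in_left t h1).hasDerivWithinAt
  · rcases (h.crossing t (Or.inl h1)).central_ne.lt_or_gt with h2 | h2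
    · rw [bwdZone_left_neg h1 h2]; exact (h.central_to_left t h1 h2).1
    · rw [bwdZone_left_pos h1 h2]; exact (h.left_to_central t h1 h2).1
  · rw [bwdZone_of_mem h1.1 h1.2]; exact (h.in_central t h1.1 h1.2).hasDerivWithinAt
  · rcases (h.crossing t (Or.inr h1)).central_ne.lt_or_gt with h2 | h2
    · rw [bwdZone_right_neg h1 h2]; exact (h.right_to_central t h1 h2).1
    · rw [bwdZone_right_pos h1 h2]; exact (h.central_to_right t h1 h2).1
  · rw [bwdZone_of_gt h1]; exact (h.in_right t h1).hasDerivWithinAt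

/-- Two one-sided equations with selected fields carry the same information as the clauses of
`IsCrossingSolution`. Shifts in time and gluing of arcs are easier to check in this form, since no
distinction of zones is needed. -/
lemma of_fwd_bwd (hc : ∀ t, (γ t).1 = -1 ∨ (γ t).1 = 1 → IsCrossingPoint X (γ t))
    (hf : ∀ t, HasDerivWithinAt γ (fwdZone X (γ t) (γ t)) (Ici t) t)
    (hb : ∀ t, HasDerivWithinAt γ (bwdZone X (γ t) (γ t)) (Iic t) t) :
    IsCrossingSolution X γ where
  in_left t h := by
    have h1 := hf t; have h2 := hb t
    rw [fwdZone_of_lt h] at h1; rw [bwdZone_of_lt h] at h2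
    exact hasDerivAt_of_Iic_Ici h2 h1
  in_central t h h' := by
    have h1 := hf t; have h2 := hb t
    rw [fwdZone_of_mem h h'] at h1; rw [bwdZone_of_mem h h'] at h2
    exact hasDerivAt_of_Iic_Ici h2 h1
  in_right t h := by
    have h1 := hf t; have h2 := hb t
    rw [fwdZone_of_gt h] at h1; rw [bwdZone_of_gt h] at h2
    exact hasDerivAt_of_Iic_Ici h2 h1
  crossing := hc
  left_to_central t h h' := by
    have h1 := hf t; have h2 := hb t
    rw [fwdZone_left_pos h h'] at h1; rw [bwdZone_left_pos h h'] at h2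
    exact ⟨h2, h1⟩
  central_to_left t h h' := by
    have h1 := hf t; have h2 := hb t
    rw [fwdZone_left_neg h h'] at h1; rw [bwdZone_left_neg h h'] at h2
    exact ⟨h2, h1⟩
  central_to_right t h h' := by
    have h1 := hf t; have h2 := hb t
    rw [fwdZone_right_pos h h'] at h1; rw [bwdZone_right_pos h h'] at h2
    exact ⟨h2, h1⟩
  right_to_central t h h' := by
    have h1 := hf t; have h2 := hb t
    rw [fwdZone_right_neg h h'] at h1; rw [bwdZone_right_neg h h'] at h2
    exact ⟨h2, h1⟩

lemma continuous (h : IsCrossingSolution X γ) : Continuous γ := by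
  rw [continuous_iff_continuousAt]
  intro t
  rw [← continuousWithinAt_univ, ← Iic_union_Ici (a := t)]
  exact (h.hasDerivWithinAt_bwd t).continuousWithinAt.union
    (h.hasDerivWithinAt_fwd t).continuousWithinAt

lemma continuous_fst (h : IsCrossingSolution X γ) : Continuous fun t => (γ t).1 :=
  _root_.continuous_fst.comp h.continuous

lemma continuous_snd (h : IsCrossingSolution X γ) : Continuous fun t => (γ t).2 :=
  _root_.continuous_snd.comp h.continuous

/-- At a crossing time with positive horizontal velocity the first coordinate increases. -/
lemma eventually_of_pos (h : IsCrossingSolution X γ) {t : ℝ}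
    (h1 : (γ t).1 = -1 ∨ (γ t).1 = 1) (h2 : 0 < (X.central (γ t)).1) :
    (∀ᶠ s in 𝓝[<] t, (γ s).1 < (γ t).1) ∧ (∀ᶠ s in 𝓝[>] t, (γ t).1 < (γ s).1) := by
  have hc := h.crossing t h1
  rcases h1 with h1 | h1
  · have h3 := h.left_to_central t h1 h2
    exact ⟨eventually_lt_of_hasDerivWithinAt_Iic h3.1.prodFst (hc.left_pos h1 h2),
      eventually_gt_of_hasDerivWithinAt_Ici h3.2.prodFst h2⟩
  · have h3 := h.central_to_right t h1 h2
    exact ⟨eventually_lt_of_hasDerivWithinAt_Iic h3.1.prodFst h2,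
      eventually_gt_of_hasDerivWithinAt_Ici h3.2.prodFst (hc.right_pos h1 h2)⟩

/-- At a crossing time with negative horizontal velocity the first coordinate decreases. -/
lemma eventually_of_neg (h : IsCrossingSolution X γ) {t : ℝ}
    (h1 : (γ t).1 = -1 ∨ (γ t).1 = 1) (h2 : (X.central (γ t)).1 < 0) :
    (∀ᶠ s in 𝓝[<] t, (γ t).1 < (γ s).1) ∧ (∀ᶠ s in 𝓝[>] t, (γ s).1 < (γ t).1) := by
  have hc := h.crossing t h1
  rcases h1 with h1 | h1
  · have h3 := h.central_to_left t h1 h2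
    exact ⟨eventually_gt_of_hasDerivWithinAt_Iic h3.1.prodFst h2,
      eventually_lt_of_hasDerivWithinAt_Ici h3.2.prodFst (hc.left_neg h1 h2)⟩
  · have h3 := h.right_to_central t h1 h2
    exact ⟨eventually_gt_of_hasDerivWithinAt_Iic h3.1.prodFst (hc.right_neg h1 h2),
      eventually_lt_of_hasDerivWithinAt_Ici h3.2.prodFst h2⟩

/-- Crossing times are isolated. -/
lemma eventually_ne (h : IsCrossingSolution X γ) {t : ℝ} (h1 : (γ t).1 = -1 ∨ (γ t).1 = 1) :
    ∀ᶠ s in 𝓝[≠] t, ¬ ((γ s).1 = -1 ∨ (γ s).1 = 1) := by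
  -- The lines are at distance 2, so a window of radius 1 around the present abscissa excludes the
  -- other line.
  have hc : ∀ᶠ s in 𝓝[≠] t, (γ s).1 ∈ Ioo ((γ t).1 - 1) ((γ t).1 + 1) :=
    (h.continuous_fst.continuousAt.eventually_mem
      (Ioo_mem_nhds (by linarith) (by linarith))).filter_mono nhdsWithin_le_nhds
  have hne : ∀ᶠ s in 𝓝[≠] t, (γ s).1 ≠ (γ t).1 := by
    rw [← Iio_union_Ioi, nhdsWithin_union]
    rcases (h.crossing t h1).central_ne.lt_or_gt with h2 | h2
    · obtain ⟨h3, h4⟩ := h.eventually_of_neg h1 h2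
      exact eventually_sup.2 ⟨h3.mono fun s hs => hs.ne', h4.mono fun s hs => hs.ne⟩
    · obtain ⟨h3, h4⟩ := h.eventually_of_pos h1 h2
      exact eventually_sup.2 ⟨h3.mono fun s hs => hs.ne, h4.mono fun s hs => hs.ne'⟩
  filter_upwards [hc, hne] with s hs hs' h5
  rcases h1 with h1 | h1 <;> rcases h5 with h5 | h5 <;> rw [h1, h5] at hs hs' <;>
    simp at hs hs' <;> linarith

lemma isClosed_lineTimes (h : IsCrossingSolution X γ) :
    IsClosed {t | (γ t).1 = -1 ∨ (γ t).1 = 1} :=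
  (isClosed_eq h.continuous_fst continuous_const).union
    (isClosed_eq h.continuous_fst continuous_const)

lemma isDiscrete_lineTimes (h : IsCrossingSolution X γ) :
    IsDiscrete {t | (γ t).1 = -1 ∨ (γ t).1 = 1} := by
  rw [isDiscrete_iff_nhdsNE]
  intro t ht
  rw [inf_principal_eq_bot]
  exact h.eventually_ne ht

/-- A closed discrete set meets a compact interval in a finite set. The finiteness of the section of
a periodic orbit rests on this. -/
lemma finite_lineTimes (h : IsCrossingSolution X γ) (a b : ℝ) :
    ({t | (γ t).1 = -1 ∨ (γ t).1 = 1} ∩ Icc a b).Finite :=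
  (isCompact_Icc.inter_left h.isClosed_lineTimes).finite
    (h.isDiscrete_lineTimes.mono inter_subset_left)

lemma countable_lineTimes (h : IsCrossingSolution X γ) :
    {t | (γ t).1 = -1 ∨ (γ t).1 = 1}.Countable := by
  have : {t | (γ t).1 = -1 ∨ (γ t).1 = 1} =
      ⋃ n : ℕ, {t | (γ t).1 = -1 ∨ (γ t).1 = 1} ∩ Icc (-(n : ℝ)) n := by
    rw [← inter_iUnion, eq_comm, inter_eq_left]
    intro t _
    obtain ⟨n, hn⟩ := exists_nat_ge |t|
    exact mem_iUnion.2 ⟨n, abs_le.1 hn⟩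
  rw [this]
  exact countable_iUnion fun n => (h.finite_lineTimes _ _).countable

/-- For a short time a crossing solution follows the subsystem selected by its present point. -/
lemma eventually_hasDerivWithinAt (h : IsCrossingSolution X γ) (t : ℝ) :
    ∀ᶠ s in 𝓝[≥] t, HasDerivWithinAt γ (fwdZone X (γ t) (γ s)) (Ici s) s := by
  -- The subsystem is frozen at time `t`, so that on a short interval the solution solves an
  -- equation with one fixed Lipschitz field, including at the crossing time itself.
  have key : ∀ F : ℝ × ℝ → ℝ × ℝ, fwdZone X (γ t) = F → (∀ᶠ s in 𝓝[>] t, fwdZone X (γ s) = F) →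
      ∀ᶠ s in 𝓝[≥] t, HasDerivWithinAt γ (fwdZone X (γ t) (γ s)) (Ici s) s := by
    intro F hF hF'
    rw [← Ioi_insert, nhdsWithin_insert]
    refine eventually_sup.2 ⟨?_, ?_⟩
    · simpa using h.hasDerivWithinAt_fwd t
    · filter_upwards [hF'] with s hs
      rw [hF, ← hs]; exact h.hasDerivWithinAt_fwd s
  have hx : ContinuousAt (fun t => (γ t).1) t := h.continuous_fst.continuousAt
  rcases zone_cases (γ t).1 with h1 | h1 | h1 | h1 | h1
  · refine key _ (fwdZone_of_lt h1) ?_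
    filter_upwards [nhdsWithin_le_nhds (hx.eventually_lt_const h1)] with s hs
    exact fwdZone_of_lt hs
  · rcases (h.crossing t (Or.inl h1)).central_ne.lt_or_gt with h2 | h2
    · refine key _ (fwdZone_left_neg h1 h2) ?_
      filter_upwards [(h.eventually_of_neg (Or.inl h1) h2).2] with s hs
      exact fwdZone_of_lt (by linarith)
    · refine key _ (fwdZone_left_pos h1 h2) ?_
      filter_upwards [(h.eventually_of_pos (Or.inl h1) h2).2,
        nhdsWithin_le_nhds (hx.eventually_lt_const (by linarith : (γ t).1 < 1))] with s hs hs'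
      exact fwdZone_of_mem (by linarith) hs'
  · refine key _ (fwdZone_of_mem h1.1 h1.2) ?_
    filter_upwards [nhdsWithin_le_nhds (hx.eventually_const_lt h1.1),
        nhdsWithin_le_nhds (hx.eventually_lt_const h1.2)] with s hs hs'
    exact fwdZone_of_mem hs hs'
  · rcases (h.crossing t (Or.inr h1)).central_ne.lt_or_gt with h2 | h2
    · refine key _ (fwdZone_right_neg h1 h2) ?_
      filter_upwards [(h.eventually_of_neg (Or.inr h1) h2).2,
        nhdsWithin_le_nhds (hx.eventually_const_lt (by linarith : -1 < (γ t).1))] with s hs hs'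
      exact fwdZone_of_mem hs' (by linarith)
    · refine key _ (fwdZone_right_pos h1 h2) ?_
      filter_upwards [(h.eventually_of_pos (Or.inr h1) h2).2] with s hs
      exact fwdZone_of_gt (by linarith)
  · refine key _ (fwdZone_of_gt h1) ?_
    filter_upwards [nhdsWithin_le_nhds (hx.eventually_const_lt h1)] with s hs
    exact fwdZone_of_gt hs

end IsCrossingSolution

/-! ### Uniqueness of crossing solutions and of the periodic orbit through a point -/

/-- All three subsystems are Lipschitz. -/
def PWField.IsLipschitz (X : PWField) : Prop :=
  ∃ K, LipschitzWith K X.left ∧ LipschitzWith K X.central ∧ LipschitzWith K X.right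

lemma PWField.IsLipschitz.fwdZone {X : PWField} (hX : X.IsLipschitz) :
    ∃ K, ∀ p, LipschitzWith K (fwdZone X p) := by
  obtain ⟨K, h1, h2, h3⟩ := hX
  refine ⟨K, fun p => ?_⟩
  unfold PWHam.fwdZone
  split_ifs <;> assumption

/-- Crossing solutions are determined by their initial point, forward in time. -/
theorem IsCrossingSolution.eq_of_eq {X : PWField} (hX : X.IsLipschitz) {γ₁ γ₂ : ℝ → ℝ × ℝ}
    (h₁ : IsCrossingSolution X γ₁) (h₂ : IsCrossingSolution X γ₂) {a b : ℝ} (hab : a ≤ b)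
    (h : γ₁ a = γ₂ a) : γ₁ b = γ₂ b := by
  obtain ⟨K, hK⟩ := hX.fwdZone
  have hcl : IsClosed ({t | γ₁ t = γ₂ t} ∩ Icc a b) :=
    (isClosed_eq h₁.continuous h₂.continuous).inter isClosed_Icc
  have := hcl.Icc_subset_of_forall_exists_gt h ?_
  · exact this ⟨hab, le_rfl⟩
  -- The set of times of agreement is closed. From a common point both solutions follow the same
  -- frozen subsystem for a short time, so uniqueness for Lipschitz equations extends the agreement
  -- to the right of it.
  rintro t ⟨ht, -⟩ y hy
  have ht : γ₁ t = γ₂ t := ht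
  have e1 := h₁.eventually_hasDerivWithinAt t
  have e2 := h₂.eventually_hasDerivWithinAt t
  rw [← ht] at e2
  obtain ⟨u, hu, hu'⟩ := (mem_nhdsGE_iff_exists_Ico_subset.1 (e1.and e2))
  have hu : t < u := hu
  set s := min y ((t + u) / 2) with hs
  have hts : t < s := lt_min hy (by linarith)
  have hsu : s < u := (min_le_right _ _).trans_lt (by linarith)
  have hE := ODE_solution_unique_of_mem_Icc_right (v := fun _ => PWHam.fwdZone X (γ₁ t))
    (s := fun _ => univ) (K := K) (f := γ₁) (g := γ₂) (a := t) (b := s)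
    (fun _ _ => (hK _).lipschitzOnWith) h₁.continuous.continuousOn
    (fun r hr => (hu' ⟨hr.1, hr.2.trans hsu⟩).1) (fun _ _ => mem_univ _)
    h₂.continuous.continuousOn (fun r hr => (hu' ⟨hr.1, hr.2.trans hsu⟩).2)
    (fun _ _ => mem_univ _) ht
  exact ⟨s, hE ⟨hts.le, le_rfl⟩, hts, min_le_left _ _⟩

lemma IsCrossingPeriodic.range_eq {X : PWField} {γ : ℝ → ℝ × ℝ} {T : ℝ}
    (h : IsCrossingPeriodic X γ T) (a : ℝ) : range γ = γ '' Ici a := by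
  apply Subset.antisymm
  · rintro _ ⟨t, rfl⟩
    obtain ⟨n, hn⟩ := exists_nat_ge ((a - t) / T)
    rw [div_le_iff₀ h.2.1] at hn
    exact ⟨t + n * T, by simp only [mem_Ici]; linarith, h.2.2.1.nat_mul n t⟩
  · exact image_subset_range _ _

/-- Two crossing periodic orbits with a common point coincide. -/
theorem IsCrossingPeriodicOrbit.eq_of_mem {X : PWField} (hX : X.IsLipschitz) {Γ₁ Γ₂ : Set (ℝ × ℝ)}
    (h₁ : IsCrossingPeriodicOrbit X Γ₁) (h₂ : IsCrossingPeriodicOrbit X Γ₂) {p : ℝ × ℝ}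
    (hp₁ : p ∈ Γ₁) (hp₂ : p ∈ Γ₂) : Γ₁ = Γ₂ := by
  have shift : ∀ {γ : ℝ → ℝ × ℝ} {T : ℝ}, IsCrossingPeriodic X γ T → ∀ t₀,
      IsCrossingSolution X (fun t => γ (t + t₀)) := by
    intro γ T h t₀
    have hd : ∀ s : Set ℝ, ∀ v t, HasDerivWithinAt γ v ((fun r => r - t₀) ⁻¹' s) (t + t₀) →
        HasDerivWithinAt (fun t => γ (t + t₀)) v s t := by
      intro s v t hv
      have := hv.scomp t (h := fun t => t + t₀) (h' := 1) (s := s)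
        ((hasDerivAt_id t).add_const t₀).hasDerivWithinAt (fun r hr => by simpa using hr)
      rw [one_smul] at this
      exact this
    refine IsCrossingSolution.of_fwd_bwd (fun t ht => h.1.crossing _ ht) (fun t => ?_) fun t => ?_
    · apply hd
      convert h.1.hasDerivWithinAt_fwd (t + t₀) using 1
      ext r; simp
    · apply hd
      convert h.1.hasDerivWithinAt_bwd (t + t₀) using 1
      ext r; simp
  obtain ⟨γ₁, T₁, c₁, rfl⟩ := h₁
  obtain ⟨γ₂, T₂, c₂, rfl⟩ := h₂
  obtain ⟨t₁, ht₁⟩ := hp₁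
  obtain ⟨t₂, ht₂⟩ := hp₂
  -- Forward uniqueness suffices: by periodicity the forward half of a periodic solution already
  -- covers its range.
  have key : ∀ s, 0 ≤ s → γ₁ (s + t₁) = γ₂ (s + t₂) := fun s hs =>
    (shift c₁ t₁).eq_of_eq hX (shift c₂ t₂) hs (by simp [ht₁, ht₂])
  rw [c₁.range_eq t₁, c₂.range_eq t₂]
  ext q
  constructor
  · rintro ⟨t, ht, rfl⟩
    have ht : t₁ ≤ t := ht
    refine ⟨t - t₁ + t₂, by simp only [mem_Ici]; linarith, ?_⟩
    rw [← key _ (by linarith)]; simp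
  · rintro ⟨t, ht, rfl⟩
    have ht : t₂ ≤ t := ht
    refine ⟨t - t₂ + t₁, by simp only [mem_Ici]; linarith, ?_⟩
    rw [key _ (by linarith)]; simp

end PWHam

/-! ### Arcs: concatenation and periodic extension -/

namespace PWHam

lemma _root_.HasDerivWithinAt.shift_Ici {E : Type*} [NormedAddCommGroup E] [NormedSpace ℝ E]
    {γ : ℝ → E} {v : E} {t a : ℝ}
    (h : HasDerivWithinAt γ v (Ici (t - a)) (t - a)) :
    HasDerivWithinAt (fun s => γ (s - a)) v (Ici t) t := by
  have := h.scomp t (h := fun t => t - a) (h' := 1) (s := Ici t)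
    ((hasDerivAt_id t).sub_const a).hasDerivWithinAt (fun r hr => by simpa using hr)
  rw [one_smul] at this
  exact this

lemma _root_.HasDerivWithinAt.shift_Iic {E : Type*} [NormedAddCommGroup E] [NormedSpace ℝ E]
    {γ : ℝ → E} {v : E} {t a : ℝ}
    (h : HasDerivWithinAt γ v (Iic (t - a)) (t - a)) :
    HasDerivWithinAt (fun s => γ (s - a)) v (Iic t) t := by
  have := h.scomp t (h := fun t => t - a) (h' := 1) (s := Iic t)
    ((hasDerivAt_id t).sub_const a).hasDerivWithinAt (fun r hr => by simpa using hr)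
  rw [one_smul] at this
  exact this

/-- `γ` is a crossing solution on the time interval `[0, T]`. -/
structure IsArc (X : PWField) (γ : ℝ → ℝ × ℝ) (T : ℝ) : Prop where
  pos : 0 < T
  crossing : ∀ t ∈ Icc 0 T, (γ t).1 = -1 ∨ (γ t).1 = 1 → IsCrossingPoint X (γ t)
  fwd : ∀ t ∈ Ico 0 T, HasDerivWithinAt γ (fwdZone X (γ t) (γ t)) (Ici t) t
  bwd : ∀ t ∈ Ioc 0 T, HasDerivWithinAt γ (bwdZone X (γ t) (γ t)) (Iic t) t

/-- A trajectory of one subsystem between two crossing points is an arc. -/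
lemma IsArc.of_field {X : PWField} {γ : ℝ → ℝ × ℝ} {T : ℝ} {F : ℝ × ℝ → ℝ × ℝ} (hT : 0 < T)
    (hd : ∀ t, HasDerivAt γ (F (γ t)) t) (h0 : IsCrossingPoint X (γ 0))
    (h1 : IsCrossingPoint X (γ T)) (hf : fwdZone X (γ 0) = F) (hb : bwdZone X (γ T) = F)
    (hi : ∀ t ∈ Ioo 0 T, ((γ t).1 ≠ -1 ∧ (γ t).1 ≠ 1) ∧
      fwdZone X (γ t) = F ∧ bwdZone X (γ t) = F) : IsArc X γ T where
  pos := hT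
  crossing t ht h := by
    rcases eq_or_lt_of_le ht.1 with rfl | h2
    · exact h0
    rcases eq_or_lt_of_le ht.2 with rfl | h3
    · exact h1
    · have := (hi t ⟨h2, h3⟩).1; tauto
  fwd t ht := by
    have : fwdZone X (γ t) = F := by
      rcases eq_or_lt_of_le ht.1 with rfl | h2
      · exact hf
      · exact (hi t ⟨h2, ht.2⟩).2.1
    rw [this]; exact (hd t).hasDerivWithinAt
  bwd t ht := by
    have : bwdZone X (γ t) = F := by
      rcases eq_or_lt_of_le ht.2 with rfl | h2
      · exact hb
      · exact (hi t ⟨ht.1, h2⟩).2.2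
    rw [this]; exact (hd t).hasDerivWithinAt

open Classical in
/-- Run through `γ₁` up to time `T`, then through `γ₂`. -/
noncomputable def concat (γ₁ : ℝ → ℝ × ℝ) (T : ℝ) (γ₂ : ℝ → ℝ × ℝ) (t : ℝ) : ℝ × ℝ :=
  if t ≤ T then γ₁ t else γ₂ (t - T)

section concat

variable {γ₁ γ₂ : ℝ → ℝ × ℝ} {T₁ T₂ t : ℝ}

lemma concat_of_le (h : t ≤ T₁) : concat γ₁ T₁ γ₂ t = γ₁ t := if_pos h

lemma concat_of_ge (h : γ₁ T₁ = γ₂ 0) (ht : T₁ ≤ t) : concat γ₁ T₁ γ₂ t = γ₂ (t - T₁) := by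
  rcases eq_or_lt_of_le ht with rfl | ht
  · rw [concat_of_le le_rfl, sub_self, h]
  · exact if_neg ht.not_ge

lemma concat_image (h : γ₁ T₁ = γ₂ 0) (h1 : 0 ≤ T₁) (h2 : 0 ≤ T₂) :
    concat γ₁ T₁ γ₂ '' Icc 0 (T₁ + T₂) = γ₁ '' Icc 0 T₁ ∪ γ₂ '' Icc 0 T₂ := by
  have : Icc 0 (T₁ + T₂) = Icc 0 T₁ ∪ Icc T₁ (T₁ + T₂) :=
    (Icc_union_Icc_eq_Icc h1 (by linarith)).symm
  rw [this, image_union]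
  congr 1
  · exact image_congr fun t ht => concat_of_le ht.2
  · rw [image_congr fun t ht => concat_of_ge h ht.1, ← image_image γ₂ (fun t => t - T₁)]
    simp

/-- At the joint the backward derivative comes from the first arc and the forward derivative from
the second. This is why the two cases are split with `t < T₁` in one and `t ≤ T₁` in the other. -/
lemma IsArc.concat {X : PWField} (h₁ : IsArc X γ₁ T₁) (h₂ : IsArc X γ₂ T₂)
    (h : γ₁ T₁ = γ₂ 0) : IsArc X (concat γ₁ T₁ γ₂) (T₁ + T₂) where
  pos := add_pos h₁.pos h₂.pos
  crossing t ht := by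
    rcases le_total t T₁ with h3 | h3
    · rw [concat_of_le h3]; exact h₁.crossing t ⟨ht.1, h3⟩
    · rw [concat_of_ge h h3]
      exact h₂.crossing _ ⟨by linarith, by linarith [ht.2]⟩
  fwd t ht := by
    rcases lt_or_ge t T₁ with h3 | h3
    · rw [concat_of_le h3.le]
      refine (h₁.fwd t ⟨ht.1, h3⟩).congr_of_eventuallyEq ?_ (concat_of_le h3.le)
      filter_upwards [nhdsWithin_le_nhds (Iio_mem_nhds h3)] with s hs
      exact concat_of_le (le_of_lt hs)
    · rw [concat_of_ge h h3]
      exact (h₂.fwd (t - T₁) ⟨by linarith, by linarith [ht.2]⟩).shift_Ici.congr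
        (fun s hs => concat_of_ge h (h3.trans hs)) (concat_of_ge h h3)
  bwd t ht := by
    rcases le_or_gt t T₁ with h3 | h3
    · rw [concat_of_le h3]
      exact (h₁.bwd t ⟨ht.1, h3⟩).congr (fun s hs => concat_of_le (le_trans hs h3))
        (concat_of_le h3)
    · rw [concat_of_ge h h3.le]
      refine (h₂.bwd (t - T₁) ⟨by linarith, by linarith [ht.2]⟩).shift_Iic.congr_of_eventuallyEq
        ?_ (concat_of_ge h h3.le)
      filter_upwards [nhdsWithin_le_nhds (Ioi_mem_nhds h3)] with s hs
      exact concat_of_ge h (le_of_lt hs)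

end concat

/-- The `T`-periodic extension of `γ` from `[0, T)`. -/
noncomputable def perExt (γ : ℝ → ℝ × ℝ) (T t : ℝ) : ℝ × ℝ := γ (Int.fract (t / T) * T)

/-- The closed period is the point: at its right end the fractional part has already jumped to 0,
and `γ T = γ 0` reconciles the two values. Both one-sided derivatives can then be computed in a
single period. -/
lemma perExt_eq {γ : ℝ → ℝ × ℝ} {T t : ℝ} (hT : 0 < T) (h : γ T = γ 0) (n : ℤ)
    (h1 : n * T ≤ t) (h2 : t ≤ (n + 1) * T) : perExt γ T t = γ (t - n * T) := by
  rcases eq_or_lt_of_le h2 with rfl | h3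
  · have : ((n : ℝ) + 1) * T / T = ((n + 1 : ℤ) : ℝ) := by push_cast; field_simp
    rw [perExt, this, Int.fract_intCast, zero_mul, ← h]
    congr 1; ring
  · have : ⌊t / T⌋ = n := by
      rw [Int.floor_eq_iff, le_div_iff₀ hT, div_lt_iff₀ hT]; exact ⟨h1, h3⟩
    rw [perExt, Int.fract, this]
    congr 1; field_simp

lemma perExt_periodic {γ : ℝ → ℝ × ℝ} {T : ℝ} (hT : 0 < T) :
    Function.Periodic (perExt γ T) T := by
  intro t
  rw [perExt, perExt, add_div, div_self hT.ne', Int.fract_add_one]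

lemma perExt_range {γ : ℝ → ℝ × ℝ} {T : ℝ} (hT : 0 < T) (h : γ T = γ 0) :
    range (perExt γ T) = γ '' Icc 0 T := by
  apply Subset.antisymm
  · rintro _ ⟨t, rfl⟩
    exact ⟨_, ⟨mul_nonneg (Int.fract_nonneg _) hT.le,
      by nlinarith [(Int.fract_lt_one (t / T)).le]⟩, rfl⟩
  · rintro _ ⟨t, ht, rfl⟩
    refine ⟨t, ?_⟩
    rw [perExt_eq hT h 0 (by simpa using ht.1) (by simpa using ht.2)]
    simp

/-- Forward derivatives are taken in the period `[nT, (n+1)T)` and backward derivatives in `(nT,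
(n+1)T]`. At multiples of `T` these are different copies of the arc, which fit together as in a
concatenation. -/
lemma IsArc.isCrossingSolution {X : PWField} {γ : ℝ → ℝ × ℝ} {T : ℝ} (hγ : IsArc X γ T)
    (h : γ T = γ 0) : IsCrossingSolution X (perExt γ T) := by
  have hT := hγ.pos
  have per : ∀ t : ℝ, ∃ n : ℤ, n * T ≤ t ∧ t < (n + 1) * T := fun t => by
    refine ⟨⌊t / T⌋, ?_, ?_⟩
    · rw [← le_div_iff₀ hT]; exact Int.floor_le _
    · rw [← div_lt_iff₀ hT]; exact Int.lt_floor_add_one _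
  have per' : ∀ t : ℝ, ∃ n : ℤ, n * T < t ∧ t ≤ (n + 1) * T := fun t => by
    refine ⟨⌈t / T⌉ - 1, ?_, ?_⟩
    · rw [← lt_div_iff₀ hT]; push_cast; linarith [Int.ceil_lt_add_one (t / T)]
    · rw [← div_le_iff₀ hT]; push_cast; linarith [Int.le_ceil (t / T)]
  refine IsCrossingSolution.of_fwd_bwd (fun t => ?_) (fun t => ?_) fun t => ?_
  · obtain ⟨n, h1, h2⟩ := per t
    rw [perExt_eq hT h n h1 h2.le]
    exact hγ.crossing _ ⟨by linarith, by linarith⟩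
  · obtain ⟨n, h1, h2⟩ := per t
    rw [perExt_eq hT h n h1 h2.le]
    refine (hγ.fwd (t - n * T) ⟨by linarith, by linarith⟩).shift_Ici.congr_of_eventuallyEq
      ?_ (perExt_eq hT h n h1 h2.le)
    filter_upwards [nhdsWithin_le_nhds (Iio_mem_nhds h2), self_mem_nhdsWithin] with s hs hs'
    exact perExt_eq hT h n (h1.trans hs') (le_of_lt hs)
  · obtain ⟨n, h1, h2⟩ := per' t
    rw [perExt_eq hT h n h1.le h2]
    refine (hγ.bwd (t - n * T) ⟨by linarith, by linarith⟩).shift_Iic.congr_of_eventuallyEq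
      ?_ (perExt_eq hT h n h1.le h2)
    filter_upwards [nhdsWithin_le_nhds (Ioi_mem_nhds h1), self_mem_nhdsWithin] with s hs hs'
    exact perExt_eq hT h n (le_of_lt hs) (le_trans hs' h2)

/-- A closed arc which is not constant is a crossing periodic orbit. -/
theorem IsArc.isCrossingPeriodicOrbit {X : PWField} {γ : ℝ → ℝ × ℝ} {T : ℝ} (hγ : IsArc X γ T)
    (h : γ T = γ 0) (hne : ∃ t ∈ Icc 0 T, γ t ≠ γ 0) :
    IsCrossingPeriodicOrbit X (γ '' Icc 0 T) := by
  have hT := hγ.pos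
  refine ⟨perExt γ T, T, ⟨hγ.isCrossingSolution h, hT, perExt_periodic hT, ?_⟩,
    (perExt_range hT h).symm⟩
  obtain ⟨t, ht, hne⟩ := hne
  refine ⟨t, ?_⟩
  rw [perExt_eq hT h 0 (by simpa using ht.1) (by simpa using ht.2),
    perExt_eq hT h 0 (by simp) (by simpa using hT.le)]
  simpa using hne

/-! ### Conjugacies -/

/-- The point reflection of a vector field at the origin. -/
def negField (F : ℝ × ℝ → ℝ × ℝ) (p : ℝ × ℝ) : ℝ × ℝ := -F (-p)

/-- The point reflection of a piecewise field at the origin. -/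
def PWField.neg (X : PWField) : PWField := ⟨negField X.right, negField X.central, negField X.left⟩

lemma negField_negField (F : ℝ × ℝ → ℝ × ℝ) : negField (negField F) = F := by
  funext p; simp [negField]

lemma PWField.neg_neg (X : PWField) : X.neg.neg = X := by
  simp [PWField.neg, negField_negField]

lemma IsCrossingPoint.neg {X : PWField} {p : ℝ × ℝ} (h : IsCrossingPoint X p) :
    IsCrossingPoint X.neg (-p) := by
  rcases h with ⟨h, h'⟩ | ⟨h, h'⟩
  · refine Or.inr ⟨by simp [h], ?_⟩
    simp only [PWField.neg, negField, _root_.neg_neg, Prod.fst_neg]; nlinarith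
  · refine Or.inl ⟨by simp [h], ?_⟩
    simp only [PWField.neg, negField, _root_.neg_neg, Prod.fst_neg]; nlinarith

lemma hasDerivWithinAt_negField {F : ℝ × ℝ → ℝ × ℝ} {γ : ℝ → ℝ × ℝ} {S : Set ℝ} {t : ℝ}
    (h : HasDerivWithinAt γ (F (γ t)) S t) :
    HasDerivWithinAt (fun t => -γ t) (negField F (-γ t)) S t := by
  rw [negField, neg_neg]; exact h.neg

lemma hasDerivAt_negField {F : ℝ × ℝ → ℝ × ℝ} {γ : ℝ → ℝ × ℝ} {t : ℝ}
    (h : HasDerivAt γ (F (γ t)) t) : HasDerivAt (fun t => -γ t) (negField F (-γ t)) t := by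
  rw [negField, neg_neg]; exact h.neg

lemma negField_neg_fst (F : ℝ × ℝ → ℝ × ℝ) (p : ℝ × ℝ) : (negField F (-p)).1 = -(F p).1 := by
  simp [negField]

lemma IsCrossingSolution.neg {X : PWField} {γ : ℝ → ℝ × ℝ} (h : IsCrossingSolution X γ) :
    IsCrossingSolution X.neg (fun t => -γ t) where
  in_left t ht := hasDerivAt_negField (h.in_right t (by simp at ht; linarith))
  in_central t ht ht' :=
    hasDerivAt_negField (h.in_central t (by simp at ht'; linarith) (by simp at ht; linarith))
  in_right t ht := hasDerivAt_negField (h.in_left t (by simp at ht; linarith))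
  crossing t ht := by
    refine (h.crossing t ?_).neg
    simp only [Prod.fst_neg] at ht
    rcases ht with ht | ht
    · right; linarith
    · left; linarith
  left_to_central t ht ht' := by
    have := h.right_to_central t (by simp at ht; linarith)
      (by simp only [PWField.neg, negField_neg_fst] at ht'; linarith)
    exact ⟨hasDerivWithinAt_negField this.1, hasDerivWithinAt_negField this.2⟩
  central_to_left t ht ht' := by
    have := h.central_to_right t (by simp at ht; linarith)
      (by simp only [PWField.neg, negField_neg_fst] at ht'; linarith)
    exact ⟨hasDerivWithinAt_negField this.1, hasDerivWithinAt_negField this.2⟩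
  central_to_right t ht ht' := by
    have := h.central_to_left t (by simp at ht; linarith)
      (by simp only [PWField.neg, negField_neg_fst] at ht'; linarith)
    exact ⟨hasDerivWithinAt_negField this.1, hasDerivWithinAt_negField this.2⟩
  right_to_central t ht ht' := by
    have := h.left_to_central t (by simp at ht; linarith)
      (by simp only [PWField.neg, negField_neg_fst] at ht'; linarith)
    exact ⟨hasDerivWithinAt_negField this.1, hasDerivWithinAt_negField this.2⟩

end PWHam

/-! ### Transport of periodic orbits and limit cycles by conjugacies and shears -/

namespace PWHam

/-- A homeomorphism that carries crossing solutions to crossing solutions, in both directions. -/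
structure IsConjugacy (φ φ' : ℝ × ℝ → ℝ × ℝ) (X N : PWField) : Prop where
  cont : UniformContinuous φ
  cont' : UniformContinuous φ'
  left_inv : ∀ p, φ' (φ p) = p
  right_inv : ∀ p, φ (φ' p) = p
  sol : ∀ γ, IsCrossingSolution X γ → IsCrossingSolution N (fun t => φ (γ t))
  sol' : ∀ γ, IsCrossingSolution N γ → IsCrossingSolution X (fun t => φ' (γ t))

namespace IsConjugacy

variable {φ φ' : ℝ × ℝ → ℝ × ℝ} {X N : PWField}

lemma symm (h : IsConjugacy φ φ' X N) : IsConjugacy φ' φ N X :=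
  ⟨h.cont', h.cont, h.right_inv, h.left_inv, h.sol', h.sol⟩

lemma isCrossingPeriodic (h : IsConjugacy φ φ' X N) {γ : ℝ → ℝ × ℝ} {T : ℝ}
    (hγ : IsCrossingPeriodic X γ T) : IsCrossingPeriodic N (fun t => φ (γ t)) T := by
  obtain ⟨h1, h2, h3, t, h4⟩ := hγ
  refine ⟨h.sol γ h1, h2, fun t => congrArg φ (h3 t), t, fun h5 => h4 ?_⟩
  have h5 : φ (γ t) = φ (γ 0) := h5
  rw [← h.left_inv (γ t), h5, h.left_inv]

lemma isCrossingPeriodicOrbit (h : IsConjugacy φ φ' X N) {Γ : Set (ℝ × ℝ)}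
    (hΓ : IsCrossingPeriodicOrbit X Γ) : IsCrossingPeriodicOrbit N (φ '' Γ) := by
  obtain ⟨γ, T, h1, rfl⟩ := hΓ
  exact ⟨_, T, h.isCrossingPeriodic h1, (range_comp φ γ).symm⟩

lemma image_image (h : IsConjugacy φ φ' X N) (Γ : Set (ℝ × ℝ)) : φ' '' (φ '' Γ) = Γ := by
  rw [Set.image_image]; simp [h.left_inv]

lemma isLimitCycle (h : IsConjugacy φ φ' X N) {Γ : Set (ℝ × ℝ)} (hΓ : IsLimitCycle X Γ) :
    IsLimitCycle N (φ '' Γ) := by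
  obtain ⟨h1, U, hU, hΓU, hiso⟩ := hΓ
  refine ⟨h.isCrossingPeriodicOrbit h1, φ' ⁻¹' U, hU.preimage h.cont'.continuous, ?_, ?_⟩
  · rintro _ ⟨p, hp, rfl⟩
    simpa [h.left_inv] using hΓU hp
  · intro Γ' hΓ' hsub
    rw [← hiso _ (h.symm.isCrossingPeriodicOrbit hΓ') (image_subset_iff.2 hsub), h.symm.image_image]

end IsConjugacy

/-- Uniform continuity moves the estimate from each pair of close points to its images, without any
compactness of the varying sets. -/
lemma tendsto_hausdorffEDist_image {ι : Type*} {l : Filter ι} {φ : ℝ × ℝ → ℝ × ℝ}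
    (hφ : UniformContinuous φ) {c : ι → Set (ℝ × ℝ)} {Γ : Set (ℝ × ℝ)}
    (h : Tendsto (fun i => Metric.hausdorffEDist (c i) Γ) l (𝓝 0)) :
    Tendsto (fun i => Metric.hausdorffEDist (φ '' c i) (φ '' Γ)) l (𝓝 0) := by
  rw [ENNReal.tendsto_nhds_zero] at h ⊢
  intro r hr
  obtain ⟨δ, hδ, hφ⟩ := EMetric.uniformContinuous_iff.1 hφ r hr
  obtain ⟨δ', hδ', hδ''⟩ := exists_between hδ
  filter_upwards [h δ' hδ'] with i hi
  have hi := hi.trans_lt hδ''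
  refine Metric.hausdorffEDist_le_of_mem_edist ?_ ?_
  · rintro _ ⟨p, hp, rfl⟩
    obtain ⟨q, hq, hpq⟩ := Metric.exists_edist_lt_of_hausdorffEDist_lt hp hi
    exact ⟨_, mem_image_of_mem _ hq, (hφ hpq).le⟩
  · rintro _ ⟨p, hp, rfl⟩
    rw [Metric.hausdorffEDist_comm] at hi
    obtain ⟨q, hq, hpq⟩ := Metric.exists_edist_lt_of_hausdorffEDist_lt hp hi
    exact ⟨_, mem_image_of_mem _ hq, (hφ hpq).le⟩

lemma isConjugacy_neg (X : PWField) : IsConjugacy (fun p => -p) (fun p => -p) X X.neg where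
  cont := uniformContinuous_neg
  cont' := uniformContinuous_neg
  left_inv := by simp
  right_inv := by simp
  sol γ h := h.neg
  sol' γ h := by have := h.neg; rwa [PWField.neg_neg] at this

/-! ### Piecewise linear shears -/

/-- Data of a continuous map `(x, y) ↦ (x, κ y + ψ x)` with `ψ` linear in each zone. -/
structure Shear where
  κ : ℝ
  mL : ℝ
  nL : ℝ
  mC : ℝ
  nC : ℝ
  mR : ℝ
  nR : ℝ
  κ_ne : κ ≠ 0
  left_match : -mL + nL = -mC + nC
  right_match : mR + nR = mC + nC

namespace Shear

/-- The offset of a shear. -/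
noncomputable def ψ (S : Shear) (x : ℝ) : ℝ :=
  S.mC * x + S.nC + (S.mL - S.mC) * min (x + 1) 0 + (S.mR - S.mC) * max (x - 1) 0

variable (S : Shear)

lemma ψ_left {x : ℝ} (h : x ≤ -1) : S.ψ x = S.mL * x + S.nL := by
  rw [ψ, min_eq_left (by linarith), max_eq_right (by linarith)]
  linarith [S.left_match]

lemma ψ_central {x : ℝ} (h : -1 ≤ x) (h' : x ≤ 1) : S.ψ x = S.mC * x + S.nC := by
  rw [ψ, min_eq_right (by linarith), max_eq_right (by linarith)]
  ring

lemma ψ_right {x : ℝ} (h : 1 ≤ x) : S.ψ x = S.mR * x + S.nR := by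
  rw [ψ, min_eq_right (by linarith), max_eq_left (by linarith)]
  linarith [S.right_match]

/-- The map of the plane given by a shear. -/
noncomputable def map (p : ℝ × ℝ) : ℝ × ℝ := (p.1, S.κ * p.2 + S.ψ p.1)

lemma uniformContinuous_ψ : UniformContinuous S.ψ := by
  have h2 : UniformContinuous fun x : ℝ => min (x + 1) 0 :=
    ((LipschitzWith.id.add (LipschitzWith.const (1 : ℝ))).min_const 0).uniformContinuous
  have h3 : UniformContinuous fun x : ℝ => max (x - 1) 0 :=
    ((LipschitzWith.id.sub (LipschitzWith.const (1 : ℝ))).max_const 0).uniformContinuous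
  have h4 : ∀ c : ℝ, UniformContinuous fun x : ℝ => c * x := fun c =>
    uniformContinuous_id.const_smul c
  exact ((((h4 _).comp uniformContinuous_id).add_const _).add ((h4 _).comp h2)).add ((h4 _).comp h3)

lemma uniformContinuous_map : UniformContinuous S.map := by
  have h4 : UniformContinuous fun x : ℝ => S.κ * x :=
    uniformContinuous_id.const_smul S.κ
  exact uniformContinuous_fst.prodMk
    ((h4.comp uniformContinuous_snd).add (S.uniformContinuous_ψ.comp uniformContinuous_fst))

/-- The inverse shear. -/
noncomputable def inv : Shear where
  κ := S.κ⁻¹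
  mL := -S.mL / S.κ
  nL := -S.nL / S.κ
  mC := -S.mC / S.κ
  nC := -S.nC / S.κ
  mR := -S.mR / S.κ
  nR := -S.nR / S.κ
  κ_ne := inv_ne_zero S.κ_ne
  left_match := by
    have := S.κ_ne; have := S.left_match; field_simp; linarith
  right_match := by
    have := S.κ_ne; have := S.right_match; field_simp; linarith

lemma inv_ψ (x : ℝ) : S.inv.ψ x = -S.ψ x / S.κ := by
  have := S.κ_ne
  simp only [ψ, inv]; field_simp; ring

lemma inv_map_map (p : ℝ × ℝ) : S.inv.map (S.map p) = p := by
  have := S.κ_ne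
  ext
  · rfl
  · simp only [map, inv_ψ]; simp only [inv]; field_simp; ring

lemma map_inv_map (p : ℝ × ℝ) : S.map (S.inv.map p) = p := by
  have := S.κ_ne
  ext
  · rfl
  · simp only [map, inv_ψ]; simp only [inv]; field_simp; ring

/-- The derivative of the shear in one zone, applied to the velocity `v`. -/
def push (m : ℝ) (v : ℝ × ℝ) : ℝ × ℝ := (v.1, S.κ * v.2 + m * v.1)

/-- The shear carries the subsystems of `X` to those of `N`, each in its closed zone. -/
structure Carries (X N : PWField) : Prop where
  left : ∀ p : ℝ × ℝ, p.1 ≤ -1 → N.left (S.map p) = S.push S.mL (X.left p)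
  central : ∀ p : ℝ × ℝ, -1 ≤ p.1 → p.1 ≤ 1 → N.central (S.map p) = S.push S.mC (X.central p)
  right : ∀ p : ℝ × ℝ, 1 ≤ p.1 → N.right (S.map p) = S.push S.mR (X.right p)

variable {S} {X N : PWField}

lemma push_inv_push (m : ℝ) (v : ℝ × ℝ) : S.inv.push (-m / S.κ) (S.push m v) = v := by
  have := S.κ_ne
  ext
  · rfl
  · simp only [push, inv]; field_simp; ring

lemma Carries.symm (h : S.Carries X N) : S.inv.Carries N X where
  left p hp := by
    have := h.left (S.inv.map p) hp
    rw [map_inv_map] at this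
    rw [this]; exact (push_inv_push _ _).symm
  central p hp hp' := by
    have := h.central (S.inv.map p) hp hp'
    rw [map_inv_map] at this
    rw [this]; exact (push_inv_push _ _).symm
  right p hp := by
    have := h.right (S.inv.map p) hp
    rw [map_inv_map] at this
    rw [this]; exact (push_inv_push _ _).symm

/-- A shear has a kink on each line, but on one side of a crossing time the solution stays where `ψ`
is a single affine function, and that is enough for a one-sided derivative. -/
lemma hasDerivWithinAt_map {γ : ℝ → ℝ × ℝ} {v : ℝ × ℝ} {A : Set ℝ} {t m n : ℝ}
    (h : HasDerivWithinAt γ v A t) (hev : ∀ᶠ s in 𝓝[A] t, S.ψ (γ s).1 = m * (γ s).1 + n)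
    (ht : S.ψ (γ t).1 = m * (γ t).1 + n) :
    HasDerivWithinAt (fun t => S.map (γ t)) (S.push m v) A t := by
  have h1 : HasDerivWithinAt (fun t => ((γ t).1, S.κ * (γ t).2 + (m * (γ t).1 + n)))
      (S.push m v) A t :=
    h.prodFst.prodMk ((h.prodSnd.const_mul _).add ((h.prodFst.const_mul m).add_const n))
  refine h1.congr_of_eventuallyEq ?_ ?_
  · filter_upwards [hev] with s hs
    simp [map, hs]
  · simp [map, ht]

lemma eventually_Iic {P : ℝ → Prop} {t : ℝ} (h : ∀ᶠ s in 𝓝[<] t, P s) (ht : P t) :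
    ∀ᶠ s in 𝓝[≤] t, P s := by
  rw [← Iio_insert, nhdsWithin_insert]
  exact eventually_sup.2 ⟨by simpa using ht, h⟩

lemma eventually_Ici {P : ℝ → Prop} {t : ℝ} (h : ∀ᶠ s in 𝓝[>] t, P s) (ht : P t) :
    ∀ᶠ s in 𝓝[≥] t, P s := by
  rw [← Ioi_insert, nhdsWithin_insert]
  exact eventually_sup.2 ⟨by simpa using ht, h⟩

/-- The shear keeps the abscissa and the horizontal velocity, so zones, crossing points and
directions are unchanged. At a crossing the solution lies in one closed zone before and in the
adjacent one after, and the one-sided chain rule applies in each. -/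
lemma Carries.isCrossingSolution (h : S.Carries X N) {γ : ℝ → ℝ × ℝ}
    (hγ : IsCrossingSolution X γ) : IsCrossingSolution N (fun t => S.map (γ t)) := by
  have hx : ∀ t, ContinuousAt (fun t => (γ t).1) t := fun t => hγ.continuous_fst.continuousAt
  have hl : ∀ t, (γ t).1 = -1 → (N.central (S.map (γ t))).1 = (X.central (γ t)).1 := fun t ht => by
    rw [h.central _ ht.ge (by linarith)]; rfl
  have hr : ∀ t, (γ t).1 = 1 → (N.central (S.map (γ t))).1 = (X.central (γ t)).1 := fun t ht => by
    rw [h.central _ (by linarith) ht.le]; rfl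
  have L : ∀ {t A}, (γ t).1 ≤ -1 → HasDerivWithinAt γ (X.left (γ t)) A t →
      (∀ᶠ s in 𝓝[A] t, (γ s).1 ≤ -1) →
      HasDerivWithinAt (fun t => S.map (γ t)) (N.left (S.map (γ t))) A t := by
    intro t A ht h1 h2
    rw [h.left _ ht]
    exact hasDerivWithinAt_map h1 (h2.mono fun s hs => S.ψ_left hs) (S.ψ_left ht)
  have R : ∀ {t A}, 1 ≤ (γ t).1 → HasDerivWithinAt γ (X.right (γ t)) A t →
      (∀ᶠ s in 𝓝[A] t, 1 ≤ (γ s).1) →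
      HasDerivWithinAt (fun t => S.map (γ t)) (N.right (S.map (γ t))) A t := by
    intro t A ht h1 h2
    rw [h.right _ ht]
    exact hasDerivWithinAt_map h1 (h2.mono fun s hs => S.ψ_right hs) (S.ψ_right ht)
  have C : ∀ {t A}, -1 ≤ (γ t).1 → (γ t).1 ≤ 1 → HasDerivWithinAt γ (X.central (γ t)) A t →
      (∀ᶠ s in 𝓝[A] t, -1 ≤ (γ s).1 ∧ (γ s).1 ≤ 1) →
      HasDerivWithinAt (fun t => S.map (γ t)) (N.central (S.map (γ t))) A t := by
    intro t A ht ht' h1 h2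
    rw [h.central _ ht ht']
    exact hasDerivWithinAt_map h1 (h2.mono fun s hs => S.ψ_central hs.1 hs.2) (S.ψ_central ht ht')
  have nl : ∀ {t}, (γ t).1 = -1 → ∀ᶠ s in 𝓝 t, (γ s).1 ≤ 1 := fun ht =>
    ((hx _).eventually_lt_const (by linarith)).mono fun s hs => le_of_lt hs
  have nr : ∀ {t}, (γ t).1 = 1 → ∀ᶠ s in 𝓝 t, -1 ≤ (γ s).1 := fun ht =>
    ((hx _).eventually_const_lt (by linarith)).mono fun s hs => le_of_lt hs
  refine ⟨fun t ht => ?_, fun t ht ht' => ?_, fun t ht => ?_, fun t ht => ?_,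
    fun t ht ht' => ?_, fun t ht ht' => ?_, fun t ht ht' => ?_, fun t ht ht' => ?_⟩
  · have ht : (γ t).1 < -1 := ht
    rw [← hasDerivWithinAt_univ]
    refine L ht.le (hγ.in_left t ht).hasDerivWithinAt ?_
    rw [nhdsWithin_univ]
    exact ((hx t).eventually_lt_const ht).mono fun s hs => le_of_lt hs
  · have ht : -1 < (γ t).1 := ht
    have ht' : (γ t).1 < 1 := ht'
    rw [← hasDerivWithinAt_univ]
    refine C ht.le ht'.le (hγ.in_central t ht ht').hasDerivWithinAt ?_
    rw [nhdsWithin_univ]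
    filter_upwards [(hx t).eventually_const_lt ht, (hx t).eventually_lt_const ht'] with s h1 h2
    exact ⟨le_of_lt h1, le_of_lt h2⟩
  · have ht : 1 < (γ t).1 := ht
    rw [← hasDerivWithinAt_univ]
    refine R ht.le (hγ.in_right t ht).hasDerivWithinAt ?_
    rw [nhdsWithin_univ]
    exact ((hx t).eventually_const_lt ht).mono fun s hs => le_of_lt hs
  · have ht : (γ t).1 = -1 ∨ (γ t).1 = 1 := ht
    rcases hγ.crossing t ht with ⟨h1, h2⟩ | ⟨h1, h2⟩
    · refine Or.inl ⟨h1, ?_⟩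
      rw [hl t h1, h.left _ h1.le]; exact h2
    · refine Or.inr ⟨h1, ?_⟩
      rw [hr t h1, h.right _ h1.ge]; exact h2
  · have ht : (γ t).1 = -1 := ht
    rw [hl t ht] at ht'
    obtain ⟨h1, h2⟩ := hγ.left_to_central t ht ht'
    obtain ⟨h3, h4⟩ := hγ.eventually_of_pos (Or.inl ht) ht'
    rw [ht] at h3 h4
    exact ⟨L ht.le h1 (eventually_Iic (h3.mono fun s hs => le_of_lt hs) ht.le),
      C ht.ge (by linarith) h2 ((eventually_Ici (h4.mono fun s hs => le_of_lt hs) ht.ge).and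
        (nhdsWithin_le_nhds (nl ht)))⟩
  · have ht : (γ t).1 = -1 := ht
    rw [hl t ht] at ht'
    obtain ⟨h1, h2⟩ := hγ.central_to_left t ht ht'
    obtain ⟨h3, h4⟩ := hγ.eventually_of_neg (Or.inl ht) ht'
    rw [ht] at h3 h4
    exact ⟨C ht.ge (by linarith) h1 ((eventually_Iic (h3.mono fun s hs => le_of_lt hs) ht.ge).and
        (nhdsWithin_le_nhds (nl ht))),
      L ht.le h2 (eventually_Ici (h4.mono fun s hs => le_of_lt hs) ht.le)⟩
  · have ht : (γ t).1 = 1 := ht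
    rw [hr t ht] at ht'
    obtain ⟨h1, h2⟩ := hγ.central_to_right t ht ht'
    obtain ⟨h3, h4⟩ := hγ.eventually_of_pos (Or.inr ht) ht'
    rw [ht] at h3 h4
    exact ⟨C (by linarith) ht.le h1 (Filter.Eventually.and (nhdsWithin_le_nhds (nr ht))
        (eventually_Iic (h3.mono fun s hs => le_of_lt hs) ht.le)),
      R ht.ge h2 (eventually_Ici (h4.mono fun s hs => le_of_lt hs) ht.ge)⟩
  · have ht : (γ t).1 = 1 := ht
    rw [hr t ht] at ht'
    obtain ⟨h1, h2⟩ := hγ.right_to_central t ht ht'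
    obtain ⟨h3, h4⟩ := hγ.eventually_of_neg (Or.inr ht) ht'
    rw [ht] at h3 h4
    exact ⟨R ht.ge h1 (eventually_Iic (h3.mono fun s hs => le_of_lt hs) ht.ge),
      C (by linarith) ht.le h2 (Filter.Eventually.and (nhdsWithin_le_nhds (nr ht))
        (eventually_Ici (h4.mono fun s hs => le_of_lt hs) ht.le))⟩

theorem Carries.isConjugacy (h : S.Carries X N) : IsConjugacy S.map S.inv.map X N where
  cont := S.uniformContinuous_map
  cont' := S.inv.uniformContinuous_map
  left_inv := S.inv_map_map
  right_inv := S.map_inv_map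
  sol _ hγ := h.isCrossingSolution hγ
  sol' _ hγ := h.symm.isCrossingSolution hγ

end Shear

end PWHam

namespace PWHam

/-! ### The normal form -/

/-- Parameters of an outer zone in normal form: `k` and `S` fix the eigendirections and the height
at which the separatrices of the unperturbed saddle meet the line, `lam` is the eigenvalue, and
`d`, `s` are perturbation parameters. -/
structure Outer where
  k : ℝ
  S : ℝ
  lam : ℝ
  d : ℝ
  s : ℝ
  k_pos : 0 < k
  lam_pos : 0 < lam

namespace Outer

variable (O : Outer) (ε : ℝ)

/-- The first eigencoordinate. -/
def u (p : ℝ × ℝ) : ℝ := p.2 + O.k * (p.1 - 1) - O.S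

/-- The second eigencoordinate. -/
def v (p : ℝ × ℝ) : ℝ := p.2 - O.k * (p.1 - 1) + O.S

/-- The perturbed saddle of the right zone: `u' = lam (1 + ε d) u`, `v' = -lam (v - ε s)`. -/
noncomputable def field (p : ℝ × ℝ) : ℝ × ℝ :=
  ((O.lam * (1 + ε * O.d) * O.u p + O.lam * (O.v p - ε * O.s)) / (2 * O.k),
    (O.lam * (1 + ε * O.d) * O.u p - O.lam * (O.v p - ε * O.s)) / 2)

/-- The trajectory that starts at the point `(1, y)`. -/
noncomputable def path (y t : ℝ) : ℝ × ℝ :=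
  (1 + ((y - O.S) * Real.exp (O.lam * (1 + ε * O.d) * t) -
      (ε * O.s + (y + O.S - ε * O.s) * Real.exp (-(O.lam * t))) + 2 * O.S) / (2 * O.k),
    ((y - O.S) * Real.exp (O.lam * (1 + ε * O.d) * t) +
      (ε * O.s + (y + O.S - ε * O.s) * Real.exp (-(O.lam * t)))) / 2)

/-- The first integral of the outer zone on the line `x = 1`. -/
noncomputable def F (y : ℝ) : ℝ :=
  Real.log (O.S - y) + (1 + ε * O.d) * Real.log (O.S + y - ε * O.s)

/-- The time of passage from `(1, y)` to `(1, -y')`. -/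
noncomputable def time (y y' : ℝ) : ℝ :=
  (Real.log (O.S + y') - Real.log (O.S - y)) / (O.lam * (1 + ε * O.d))

variable {O ε}

lemma hasDerivAt_path (y t : ℝ) : HasDerivAt (O.path ε y) (O.field ε (O.path ε y t)) t := by
  have hk := O.k_pos.ne'
  have h1 : HasDerivAt (fun t => (y - O.S) * Real.exp (O.lam * (1 + ε * O.d) * t))
      ((y - O.S) * (Real.exp (O.lam * (1 + ε * O.d) * t) * (O.lam * (1 + ε * O.d)))) t := by
    have := ((hasDerivAt_id t).const_mul (O.lam * (1 + ε * O.d))).exp.const_mul (y - O.S)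
    simpa using this
  have h2 : HasDerivAt (fun t => ε * O.s + (y + O.S - ε * O.s) * Real.exp (-(O.lam * t)))
      ((y + O.S - ε * O.s) * (Real.exp (-(O.lam * t)) * (-O.lam))) t := by
    have := (((hasDerivAt_id t).const_mul O.lam).neg.exp.const_mul (y + O.S - ε * O.s)).const_add
      (ε * O.s)
    simpa using this
  have h3 := ((((h1.sub h2).add_const (2 * O.S)).div_const (2 * O.k)).const_add 1).prodMk
    ((h1.add h2).div_const 2)
  refine h3.congr_deriv ?_
  ext
  · simp only [field, path, u, v]; field_simp; ring
  · simp only [field, path, u, v]; field_simp; ring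

lemma path_zero (y : ℝ) : O.path ε y 0 = (1, y) := by
  ext
  · simp [path]; left; ring
  · simp [path]

/-- The passage time is chosen so that `u` runs from `y - S` to `-y' - S`. Equality of the first
integral `F` then says precisely that `v` reaches the right value at the same time. -/
lemma path_time {y y' : ℝ} (hy : y < O.S) (hy' : 0 < O.S + y') (hd : 0 < 1 + ε * O.d)
    (h1 : 0 < O.S + y - ε * O.s) (h2 : 0 < O.S - y' - ε * O.s)
    (hF : O.F ε y = O.F ε (-y')) : O.path ε y (O.time ε y y') = (1, -y') := by
  have hl := O.lam_pos.ne'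
  have hk := O.k_pos.ne'
  have e1 : (y - O.S) * Real.exp (O.lam * (1 + ε * O.d) * O.time ε y y') = -y' - O.S := by
    have : O.lam * (1 + ε * O.d) * O.time ε y y' = Real.log (O.S + y') - Real.log (O.S - y) := by
      rw [time]; field_simp
    rw [this, Real.exp_sub, Real.exp_log hy', Real.exp_log (by linarith)]
    have : O.S - y ≠ 0 := by linarith
    field_simp; ring
  have e2 : (y + O.S - ε * O.s) * Real.exp (-(O.lam * O.time ε y y')) = -y' + O.S - ε * O.s := by
    have h3 : Real.log (O.S + y - ε * O.s) - O.lam * O.time ε y y' =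
        Real.log (O.S - y' - ε * O.s) := by
      have h4 : O.lam * O.time ε y y' =
          (Real.log (O.S + y') - Real.log (O.S - y)) / (1 + ε * O.d) := by
        rw [time]; field_simp
      rw [h4]
      simp only [F, sub_neg_eq_add, ← sub_eq_add_neg] at hF
      have := hd.ne'
      field_simp
      linarith
    have h5 : (y + O.S - ε * O.s) = Real.exp (Real.log (O.S + y - ε * O.s)) := by
      rw [Real.exp_log h1]; ring
    rw [h5, ← Real.exp_add, ← sub_eq_add_neg, h3, Real.exp_log h2]; ring
  ext
  · simp only [path, e1, e2]; field_simp; ring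
  · simp only [path, e1, e2]; ring

lemma time_pos {y y' : ℝ} (hy : y < O.S) (hyy : 0 < y + y') (hd : 0 < 1 + ε * O.d) :
    0 < O.time ε y y' :=
  div_pos (sub_pos.2 (Real.log_lt_log (by linarith) (by linarith))) (mul_pos O.lam_pos hd)

/-- Up to constants, `1 - x` is a sum of two exponentials of time with positive coefficients, hence
strictly convex. It vanishes at both ends, so it is negative in between. -/
lemma one_lt_path {y T t : ℝ} (hy : y < O.S) (hd : 0 < 1 + ε * O.d)
    (h1 : 0 < O.S + y - ε * O.s) (hT : (O.path ε y T).1 = 1) (ht : t ∈ Ioo 0 T) :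
    1 < (O.path ε y t).1 := by
  have hk := O.k_pos
  set A := O.lam * (1 + ε * O.d) with hA
  have hA0 : 0 < A := mul_pos O.lam_pos hd
  have hl := O.lam_pos
  let g : ℝ → ℝ := fun t => (O.S - y) * Real.exp (A * t) +
    (y + O.S - ε * O.s) * Real.exp (-(O.lam * t))
  have hx : ∀ t, (O.path ε y t).1 = 1 + (2 * O.S - ε * O.s - g t) / (2 * O.k) := fun t => by
    simp only [path, g, ← hA]; ring
  have hg0 : g 0 = 2 * O.S - ε * O.s := by simp only [g]; simp; ring
  have hgT : g T = 2 * O.S - ε * O.s := by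
    rw [hx] at hT
    have : (2 * O.S - ε * O.s - g T) / (2 * O.k) = 0 := by linarith
    rcases div_eq_zero_iff.1 this with h | h <;> linarith
  have hT0 : 0 < T := ht.1.trans ht.2
  have hT' := hT0.ne'
  set θ := t / T with hθ
  have hθ0 : 0 < θ := div_pos ht.1 hT0
  have hθ1 : θ < 1 := (div_lt_one hT0).2 ht.2
  have htθ : t = (1 - θ) * 0 + θ * T := by rw [hθ]; field_simp; ring
  have hexp : ∀ a : ℝ, a ≠ 0 → Real.exp (a * t) < (1 - θ) + θ * Real.exp (a * T) := by
    intro a ha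
    have := strictConvexOn_exp.2 (mem_univ (a * 0)) (mem_univ (a * T))
      (by simpa using ⟨Ne.symm ha |> Ne.symm, hT'⟩) (sub_pos.2 hθ1) hθ0 (by ring)
    simp only [smul_eq_mul, mul_zero, zero_add, Real.exp_zero, mul_one] at this
    rw [show a * t = θ * (a * T) by rw [hθ]; field_simp]
    exact this
  have e1 := hexp A hA0.ne'
  have e2 := hexp (-O.lam) (by linarith)
  have hgt : g t < (1 - θ) * g 0 + θ * g T := by
    simp only [g]
    simp only [mul_zero, neg_zero, Real.exp_zero, mul_one]
    simp only [neg_mul] at e2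
    have f1 := mul_lt_mul_of_pos_left e1 (by linarith : 0 < O.S - y)
    have f2 := mul_lt_mul_of_pos_left e2 (by linarith : 0 < y + O.S - ε * O.s)
    nlinarith
  rw [hg0, hgT] at hgt
  rw [hx]
  have : 0 < (2 * O.S - ε * O.s - g t) / (2 * O.k) := div_pos (by linarith) (by linarith)
  linarith

lemma field_fst_one (y : ℝ) : (O.field ε (1, y)).1 =
    O.lam / (2 * O.k) * (2 * y + ε * (O.d * (y - O.S) - O.s)) := by
  have := O.k_pos.ne'
  simp only [field, u, v]; field_simp; ring

/-- Passage through the outer zone: the trajectory from `(1, y)` to `(1, -y')`. -/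
lemma isArc {X : PWField} {y y' : ℝ} (hX : X.right = O.field ε) (hy : y < O.S)
    (hy' : 0 < O.S + y') (hyy : 0 < y + y') (hd : 0 < 1 + ε * O.d)
    (h1 : 0 < O.S + y - ε * O.s) (h2 : 0 < O.S - y' - ε * O.s) (hF : O.F ε y = O.F ε (-y'))
    (c0 : IsCrossingPoint X (1, y)) (c1 : IsCrossingPoint X (1, -y'))
    (s0 : 0 < (X.central (1, y)).1) (s1 : (X.central (1, -y')).1 < 0) :
    IsArc X (O.path ε y) (O.time ε y y') := by
  have hT := path_time hy hy' hd h1 h2 hF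
  refine IsArc.of_field (F := O.field ε) (time_pos hy hyy hd) (hasDerivAt_path y) ?_ ?_ ?_ ?_ ?_
  · rwa [path_zero]
  · rwa [hT]
  · rw [path_zero, fwdZone_right_pos rfl s0, hX]
  · rw [hT, bwdZone_right_neg rfl s1, hX]
  · intro t ht
    have := one_lt_path hy hd h1 (by rw [hT]) ht
    exact ⟨⟨by linarith, by linarith⟩, by rw [fwdZone_of_gt this, hX],
      by rw [bwdZone_of_gt this, hX]⟩

variable (O) in
lemma lipschitz_field : ∃ K, LipschitzWith K (O.field ε) := by
  let A : ℝ × ℝ →L[ℝ] ℝ × ℝ :=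
    ((((O.lam * (1 + ε * O.d) + O.lam) / (2 * O.k)) • ContinuousLinearMap.snd ℝ ℝ ℝ +
      (((O.lam * (1 + ε * O.d) - O.lam) / 2)) • ContinuousLinearMap.fst ℝ ℝ ℝ)).prod
    ((((O.lam * (1 + ε * O.d) - O.lam) / 2) • ContinuousLinearMap.snd ℝ ℝ ℝ +
      (((O.lam * (1 + ε * O.d) + O.lam) / 2 * O.k)) • ContinuousLinearMap.fst ℝ ℝ ℝ))
  refine ⟨‖A‖₊ + 0, ?_⟩
  have : O.field ε = fun p => A p + O.field ε 0 := by
    have := O.k_pos.ne'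
    funext p
    ext
    · simp [A, field, u, v]; field_simp; ring
    · simp [A, field, u, v]; field_simp; ring
  rw [this]
  exact A.lipschitz.add (LipschitzWith.const _)

/-- The evolution of the eigencoordinates along a solution. -/
lemma evolution {γ : ℝ → ℝ × ℝ} {a b : ℝ} (hab : a ≤ b) (hc : ContinuousOn γ (Icc a b))
    (hd : ∀ t ∈ Ico a b, HasDerivWithinAt γ (O.field ε (γ t)) (Ici t) t) :
    O.u (γ b) = O.u (γ a) * Real.exp (O.lam * (1 + ε * O.d) * (b - a)) ∧
    O.v (γ b) - ε * O.s = (O.v (γ a) - ε * O.s) * Real.exp (-(O.lam * (b - a))) := by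
  have hk := O.k_pos.ne'
  have cu : Continuous O.u := by unfold u; fun_prop
  have cv : Continuous O.v := by unfold v; fun_prop
  have du : ∀ t ∈ Ico a b, HasDerivWithinAt (fun t => O.u (γ t))
      (O.lam * (1 + ε * O.d) * O.u (γ t)) (Ici t) t := fun t ht => by
    have h := hd t ht
    have := (h.prodSnd.add ((h.prodFst.sub_const 1).const_mul O.k)).sub_const O.S
    refine this.congr_deriv ?_
    simp only [field]; field_simp; ring
  have dv : ∀ t ∈ Ico a b, HasDerivWithinAt (fun t => O.v (γ t))
      (-(O.lam * (O.v (γ t) - ε * O.s))) (Ici t) t := fun t ht => by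
    have h := hd t ht
    have := (h.prodSnd.sub ((h.prodFst.sub_const 1).const_mul O.k)).add_const O.S
    refine this.congr_deriv ?_
    simp only [field]; field_simp; ring
  have de : ∀ (c t : ℝ) , HasDerivWithinAt (fun t => Real.exp (c * (t - a)))
      (Real.exp (c * (t - a)) * c) (Ici t) t := fun c t => by
    have := (((hasDerivAt_id t).sub_const a).const_mul c).exp
    simpa using this.hasDerivWithinAt
  constructor
  · have := constant_of_has_deriv_right_zero (a := a) (b := b)
      (f := fun t => O.u (γ t) * Real.exp (-(O.lam * (1 + ε * O.d)) * (t - a)))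
      ((cu.comp_continuousOn hc).mul (by fun_prop)) (fun t ht => by
        refine ((du t ht).mul (de _ t)).congr_deriv ?_
        ring) b ⟨hab, le_rfl⟩
    simp only [sub_self, mul_zero, Real.exp_zero, mul_one] at this
    rw [← this, mul_assoc, ← Real.exp_add]
    simp
  · have := constant_of_has_deriv_right_zero (a := a) (b := b)
      (f := fun t => (O.v (γ t) - ε * O.s) * Real.exp (O.lam * (t - a)))
      (((cv.comp_continuousOn hc).sub continuousOn_const).mul (by fun_prop)) (fun t ht => by
        refine (((dv t ht).sub_const (ε * O.s)).mul (de _ t)).congr_deriv ?_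
        ring) b ⟨hab, le_rfl⟩
    simp only [sub_self, mul_zero, Real.exp_zero, mul_one] at this
    rw [← this, mul_assoc, ← Real.exp_add]
    simp

/-- A solution in the outer zone from the line to the line preserves the first integral. -/
lemma F_eq {γ : ℝ → ℝ × ℝ} {a b : ℝ} (hab : a ≤ b) (hc : ContinuousOn γ (Icc a b))
    (hd : ∀ t ∈ Ico a b, HasDerivWithinAt γ (O.field ε (γ t)) (Ici t) t)
    (ha : (γ a).1 = 1) (hb : (γ b).1 = 1) (hu : (γ a).2 < O.S) (hv : 0 < O.S + (γ a).2 - ε * O.s) :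
    O.F ε (γ a).2 = O.F ε (γ b).2 := by
  obtain ⟨h1, h2⟩ := evolution hab hc hd
  simp only [u, v, ha, hb, sub_self, mul_zero, add_zero, sub_zero] at h1 h2
  have e1 : O.S - (γ b).2 =
      (O.S - (γ a).2) * Real.exp (O.lam * (1 + ε * O.d) * (b - a)) := by linarith
  have e2 : O.S + (γ b).2 - ε * O.s =
      (O.S + (γ a).2 - ε * O.s) * Real.exp (-(O.lam * (b - a))) := by
    rw [show O.S + (γ b).2 - ε * O.s = (γ b).2 + O.S - ε * O.s by ring, h2]; ring
  rw [F, F, e1, e2, Real.log_mul (by linarith) (Real.exp_pos _).ne',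
    Real.log_mul hv.ne' (Real.exp_pos _).ne', Real.log_exp, Real.log_exp]
  ring

/-- A solution that enters the outer zone below the separatrix leaves it again. -/
lemma exists_le_one {γ : ℝ → ℝ × ℝ} {a : ℝ} (hc : Continuous γ) (hε : 0 < 1 + ε * O.d)
    (hd : ∀ t, a ≤ t → HasDerivWithinAt γ (O.field ε (γ t)) (Ici t) t)
    (hu : O.u (γ a) < 0) : ∃ t, a < t ∧ (γ t).1 ≤ 1 := by
  have hl := O.lam_pos
  have hk := O.k_pos
  have hA : 0 < O.lam * (1 + ε * O.d) := mul_pos hl hε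
  -- Below the separatrix `u` tends to `-∞` while `v` stays bounded, and `u - v = 2k(x - 1) - 2S`,
  -- so `x` must drop below 1.
  have lim : Tendsto (fun t => O.u (γ a) * Real.exp (O.lam * (1 + ε * O.d) * (t - a)))
      atTop atBot := by
    refine Tendsto.const_mul_atTop_of_neg hu (Real.tendsto_exp_atTop.comp ?_)
    exact Tendsto.const_mul_atTop hA (tendsto_atTop_add_const_right _ _ tendsto_id)
  obtain ⟨t, ht, hta⟩ := ((lim.eventually_le_atBot
    (-(|O.v (γ a) - ε * O.s| + |ε * O.s| + 2 * |O.S|))).and (eventually_gt_atTop a)).exists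
  refine ⟨t, hta, ?_⟩
  obtain ⟨h1, h2⟩ := evolution hta.le hc.continuousOn (fun s hs => hd s hs.1)
  rw [← h1] at ht
  have hE : Real.exp (-(O.lam * (t - a))) ≤ 1 :=
    Real.exp_le_one_iff.2 (by nlinarith)
  have hE0 := Real.exp_pos (-(O.lam * (t - a)))
  have h3 : |O.v (γ t) - ε * O.s| ≤ |O.v (γ a) - ε * O.s| := by
    rw [h2, abs_mul, abs_of_pos hE0]
    exact mul_le_of_le_one_right (abs_nonneg _) hE
  have h4 : O.u (γ t) - O.v (γ t) = 2 * O.k * ((γ t).1 - 1) - 2 * O.S := by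
    simp only [u, v]; ring
  have h5 := neg_abs_le (O.v (γ t) - ε * O.s)
  have h6 := neg_abs_le (ε * O.s)
  have h7 := le_abs_self O.S
  have h8 : 2 * O.k * ((γ t).1 - 1) ≤ 0 := by linarith
  nlinarith

/-- A periodic solution that never leaves the outer zone is constant. -/
lemma const_of_periodic {γ : ℝ → ℝ × ℝ} {T : ℝ} (hc : Continuous γ) (hε : 0 < 1 + ε * O.d)
    (hT : 0 < T) (hp : Function.Periodic γ T)
    (hd : ∀ t, HasDerivWithinAt γ (O.field ε (γ t)) (Ici t) t) (t : ℝ) : γ t = γ 0 := by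
  have hl := O.lam_pos
  have hk := O.k_pos
  -- Over one period `u` is multiplied by a factor above 1 and `v - ε s` by a factor below 1;
  -- periodicity forces both to vanish.
  have key : ∀ t, O.u (γ t) = 0 ∧ O.v (γ t) = ε * O.s := fun t => by
    obtain ⟨h1, h2⟩ := evolution (a := t) (b := t + T) (by linarith) hc.continuousOn
      (fun s _ => hd s)
    rw [hp t, add_sub_cancel_left] at h1 h2
    have e1 : 1 < Real.exp (O.lam * (1 + ε * O.d) * T) := by
      rw [Real.one_lt_exp_iff]; positivity
    have e2 : Real.exp (-(O.lam * T)) < 1 := by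
      rw [Real.exp_lt_one_iff]; nlinarith
    constructor
    · have : O.u (γ t) * (Real.exp (O.lam * (1 + ε * O.d) * T) - 1) = 0 := by linarith
      rcases mul_eq_zero.1 this with h | h
      · exact h
      · linarith
    · have : (O.v (γ t) - ε * O.s) * (1 - Real.exp (-(O.lam * T))) = 0 := by linarith
      rcases mul_eq_zero.1 this with h | h
      · linarith
      · linarith
  have h1 := key t
  have h2 := key 0
  simp only [u, v] at h1 h2
  ext
  · have : O.k * ((γ t).1 - (γ 0).1) = 0 := by linarith
    rcases mul_eq_zero.1 this with h | h <;> linarith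
  · linarith

end Outer

/-! ### Zone selection and arcs under point reflection -/

lemma fwdZone_neg (X : PWField) (p : ℝ × ℝ) :
    fwdZone X.neg (-p) = negField (fwdZone X p) := by
  rcases zone_cases p.1 with h | h | h | h | h
  · rw [fwdZone_of_lt h, fwdZone_of_gt (by simp; linarith)]; rfl
  · rcases lt_trichotomy (X.central p).1 0 with h' | h' | h'
    · rw [fwdZone_left_neg h h', fwdZone_right_pos (by simp [h])
        (by simp only [PWField.neg, negField_neg_fst]; linarith)]; rfl
    · simp only [fwdZone, PWField.neg, negField_neg_fst, h, h', Prod.fst_neg]; norm_num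
    · rw [fwdZone_left_pos h h', fwdZone_right_neg (by simp [h])
        (by simp only [PWField.neg, negField_neg_fst]; linarith)]; rfl
  · rw [fwdZone_of_mem h.1 h.2, fwdZone_of_mem (by simp; linarith) (by simp; linarith)]; rfl
  · rcases lt_trichotomy (X.central p).1 0 with h' | h' | h'
    · rw [fwdZone_right_neg h h', fwdZone_left_pos (by simp [h])
        (by simp only [PWField.neg, negField_neg_fst]; linarith)]; rfl
    · simp only [fwdZone, PWField.neg, negField_neg_fst, h, h', Prod.fst_neg]; norm_num
    · rw [fwdZone_right_pos h h', fwdZone_left_neg (by simp [h])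
        (by simp only [PWField.neg, negField_neg_fst]; linarith)]; rfl
  · rw [fwdZone_of_gt h, fwdZone_of_lt (by simp; linarith)]; rfl

lemma bwdZone_neg (X : PWField) (p : ℝ × ℝ) :
    bwdZone X.neg (-p) = negField (bwdZone X p) := by
  rcases zone_cases p.1 with h | h | h | h | h
  · rw [bwdZone_of_lt h, bwdZone_of_gt (by simp; linarith)]; rfl
  · rcases lt_trichotomy (X.central p).1 0 with h' | h' | h'
    · rw [bwdZone_left_neg h h', bwdZone_right_pos (by simp [h])
        (by simp only [PWField.neg, negField_neg_fst]; linarith)]; rfl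
    · simp only [bwdZone, PWField.neg, negField_neg_fst, h, h', Prod.fst_neg]; norm_num
    · rw [bwdZone_left_pos h h', bwdZone_right_neg (by simp [h])
        (by simp only [PWField.neg, negField_neg_fst]; linarith)]; rfl
  · rw [bwdZone_of_mem h.1 h.2, bwdZone_of_mem (by simp; linarith) (by simp; linarith)]; rfl
  · rcases lt_trichotomy (X.central p).1 0 with h' | h' | h'
    · rw [bwdZone_right_neg h h', bwdZone_left_pos (by simp [h])
        (by simp only [PWField.neg, negField_neg_fst]; linarith)]; rfl
    · simp only [bwdZone, PWField.neg, negField_neg_fst, h, h', Prod.fst_neg]; norm_num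
    · rw [bwdZone_right_pos h h', bwdZone_left_neg (by simp [h])
        (by simp only [PWField.neg, negField_neg_fst]; linarith)]; rfl
  · rw [bwdZone_of_gt h, bwdZone_of_lt (by simp; linarith)]; rfl

lemma IsArc.neg {X : PWField} {γ : ℝ → ℝ × ℝ} {T : ℝ} (h : IsArc X γ T) :
    IsArc X.neg (fun t => -γ t) T where
  pos := h.pos
  crossing t ht h' := by
    refine (h.crossing t ht ?_).neg
    simp only [Prod.fst_neg] at h'
    rcases h' with h' | h'
    · right; linarith
    · left; linarith
  fwd t ht := by rw [fwdZone_neg]; exact hasDerivWithinAt_negField (h.fwd t ht)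
  bwd t ht := by rw [bwdZone_neg]; exact hasDerivWithinAt_negField (h.bwd t ht)

end PWHam

namespace PWHam

/-! ### The angle of a point on a separation line -/

/-- The angle of the point `-m + i y`, `y > 0`. -/
noncomputable def ang (m y : ℝ) : ℝ := Real.pi / 2 + Real.arctan (m / y)

lemma ang_pos (m y : ℝ) : 0 < ang m y := by
  have := Real.neg_pi_div_two_lt_arctan (m / y); unfold ang; linarith

lemma ang_lt_pi (m y : ℝ) : ang m y < Real.pi := by
  have := Real.arctan_lt_pi_div_two (m / y); unfold ang; linarith

lemma sqrt_one_add_div_sq {m y : ℝ} (hy : 0 < y) :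
    Real.sqrt (1 + (m / y) ^ 2) = Real.sqrt (m ^ 2 + y ^ 2) / y := by
  rw [← Real.sqrt_sq hy.le, ← Real.sqrt_div' _ (sq_nonneg y), Real.sqrt_sq hy.le]
  congr 1; field_simp; ring

lemma sqrt_mul_cos_ang {m y : ℝ} (hy : 0 < y) : √(m ^ 2 + y ^ 2) * Real.cos (ang m y) = -m := by
  have h : 0 < √(m ^ 2 + y ^ 2) := Real.sqrt_pos.2 (by positivity)
  rw [ang, add_comm (Real.pi / 2), Real.cos_add_pi_div_two, Real.sin_arctan, sqrt_one_add_div_sq hy]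
  field_simp

lemma sqrt_mul_sin_ang {m y : ℝ} (hy : 0 < y) : √(m ^ 2 + y ^ 2) * Real.sin (ang m y) = y := by
  have h : 0 < √(m ^ 2 + y ^ 2) := Real.sqrt_pos.2 (by positivity)
  rw [ang, add_comm (Real.pi / 2), Real.sin_add_pi_div_two, Real.cos_arctan, sqrt_one_add_div_sq hy]
  field_simp

/-- Identifies the explicit angle, convenient for derivatives and analyticity, with the complex
argument, which is what the flow of the central zone translates. -/
lemma arg_eq_ang {m y : ℝ} (hy : 0 < y) : Complex.arg ⟨-m, y⟩ = ang m y := by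
  have h : 0 < √(m ^ 2 + y ^ 2) := Real.sqrt_pos.2 (by positivity)
  have : (⟨-m, y⟩ : ℂ) = (√(m ^ 2 + y ^ 2) : ℝ) *
      (Complex.cos (ang m y) + Complex.sin (ang m y) * Complex.I) := by
    rw [← Complex.ofReal_cos, ← Complex.ofReal_sin]
    apply Complex.ext
    · rw [Complex.re_ofReal_mul]
      simpa [-Complex.ofReal_cos, -Complex.ofReal_sin] using (sqrt_mul_cos_ang (m := m) hy).symm
    · rw [Complex.im_ofReal_mul]
      simpa [-Complex.ofReal_cos, -Complex.ofReal_sin] using (sqrt_mul_sin_ang (m := m) hy).symm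
  rw [this, Complex.arg_mul_cos_add_sin_mul_I h
    ⟨by linarith [ang_pos m y, Real.pi_pos], (ang_lt_pi m y).le⟩]

lemma arg_eq_neg_ang {m y : ℝ} (hy : 0 < y) : Complex.arg ⟨-m, -y⟩ = -ang m y := by
  have h : (⟨-m, -y⟩ : ℂ) = (starRingEnd ℂ) ⟨-m, y⟩ := rfl
  have hne : Complex.arg ⟨-m, y⟩ ≠ Real.pi := by rw [arg_eq_ang hy]; exact (ang_lt_pi m y).ne
  rw [h, Complex.arg_conj, if_neg hne, arg_eq_ang hy]

lemma log_norm_eq (m y : ℝ) : Real.log ‖(⟨m, y⟩ : ℂ)‖ = Real.log (m ^ 2 + y ^ 2) / 2 := by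
  rw [← Real.sqrt_sq (norm_nonneg _), Complex.sq_norm, Complex.normSq_mk, Real.log_sqrt
    (add_nonneg (mul_self_nonneg _) (mul_self_nonneg _))]
  ring_nf

/-- The first integral of the central zone, in terms of the height `y > 0` on a line. -/
noncomputable def spiral (κ m y : ℝ) : ℝ := Real.log (m ^ 2 + y ^ 2) / 2 - κ * ang m y

/-! ### The function `exp (κ θ) cos θ` -/

section expcos

variable (κ : ℝ)

lemma hasDerivAt_expcos (θ : ℝ) : HasDerivAt (fun θ => Real.exp (κ * θ) * Real.cos θ)
    (Real.exp (κ * θ) * (κ * Real.cos θ - Real.sin θ)) θ := by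
  have h1 : HasDerivAt (fun θ => Real.exp (κ * θ)) (Real.exp (κ * θ) * κ) θ := by
    simpa using ((hasDerivAt_id θ).const_mul κ).exp
  refine (h1.mul (Real.hasDerivAt_cos θ)).congr_deriv ?_
  ring

/-- As a single shifted sine, the slope has its zeros at `arctan κ + πℤ`. This yields the intervals
of length `π` on which `exp (κ θ) cos θ` is monotone. -/
lemma expcos_slope (θ : ℝ) : κ * Real.cos θ - Real.sin θ =
    √(1 + κ ^ 2) * Real.sin (Real.arctan κ - θ) := by
  have h : 0 < √(1 + κ ^ 2) := Real.sqrt_pos.2 (by positivity)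
  rw [Real.sin_sub, Real.sin_arctan, Real.cos_arctan]
  field_simp

lemma expcos_strictAntiOn : StrictAntiOn (fun θ => Real.exp (κ * θ) * Real.cos θ)
    (Icc (Real.arctan κ) (Real.arctan κ + Real.pi)) := by
  refine strictAntiOn_of_deriv_neg (convex_Icc _ _) (by fun_prop) fun θ hθ => ?_
  rw [interior_Icc] at hθ
  rw [(hasDerivAt_expcos κ θ).deriv, expcos_slope]
  refine mul_neg_of_pos_of_neg (Real.exp_pos _)
    (mul_neg_of_pos_of_neg (Real.sqrt_pos.2 (by positivity)) ?_)
  exact Real.sin_neg_of_neg_of_neg_pi_lt (by linarith [hθ.1]) (by linarith [hθ.2])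

lemma expcos_strictMonoOn : StrictMonoOn (fun θ => Real.exp (κ * θ) * Real.cos θ)
    (Icc (Real.arctan κ - Real.pi) (Real.arctan κ)) := by
  refine strictMonoOn_of_deriv_pos (convex_Icc _ _) (by fun_prop) fun θ hθ => ?_
  rw [interior_Icc] at hθ
  rw [(hasDerivAt_expcos κ θ).deriv, expcos_slope]
  refine mul_pos (Real.exp_pos _) (mul_pos (Real.sqrt_pos.2 (by positivity)) ?_)
  exact Real.sin_pos_of_pos_of_lt_pi (by linarith [hθ.2]) (by linarith [hθ.1])

end expcos

/-! ### The central zone -/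

/-- Parameters of the normal form: center `p`, frequency `ω`, perturbation `dC` of the central
zone, and the two outer zones (the left one after reflection at the origin). -/
structure NF where
  p : ℝ
  ω : ℝ
  dC : ℝ
  R : Outer
  L : Outer
  ω_pos : 0 < ω

namespace NF

variable (M : NF) (ε : ℝ)

/-- The perturbed center. -/
def central (q : ℝ × ℝ) : ℝ × ℝ :=
  (q.2 + ε * M.dC * (q.1 - M.p), -M.ω ^ 2 * (q.1 - M.p) + ε * M.dC * q.2)

/-- The perturbed piecewise linear system in normal form. -/
noncomputable def sys : PWField := ⟨negField (M.L.field ε), M.central ε, M.R.field ε⟩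

/-- The signed distance from the center to `x = 1`, times the frequency. -/
def c : ℝ := M.ω * (1 - M.p)

/-- The signed distance from the center to `x = -1`, times the frequency. -/
def e : ℝ := M.ω * (1 + M.p)

/-- The quotient of the real and the imaginary part of the central eigenvalues. -/
noncomputable def κ : ℝ := ε * M.dC / M.ω

/-- The central zone in a complex coordinate. -/
def w (q : ℝ × ℝ) : ℂ := ⟨-(M.ω * (q.1 - M.p)), q.2⟩

/-- The point with polar coordinates `ρ, φ` around the center. -/
noncomputable def polar (ρ φ : ℝ) : ℝ × ℝ := (M.p - ρ * Real.cos φ / M.ω, ρ * Real.sin φ)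

/-- The trajectory of the central zone that starts at the point with polar coordinates `ρ, φ`. -/
noncomputable def path (ρ φ t : ℝ) : ℝ × ℝ :=
  M.polar (ρ * Real.exp (ε * M.dC * t)) (φ + M.ω * t)

variable {M ε}

lemma w_one (y : ℝ) : M.w (1, y) = ⟨-M.c, y⟩ := rfl

lemma w_neg_one (y : ℝ) : M.w (-1, y) = ⟨-(-M.e), y⟩ := by
  simp only [w, e]; congr 1; ring

lemma polar_one {y : ℝ} (hy : 0 < y) : M.polar √(M.c ^ 2 + y ^ 2) (ang M.c y) = (1, y) := by
  have := M.ω_pos.ne'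
  rw [polar, sqrt_mul_cos_ang hy, sqrt_mul_sin_ang hy]
  ext
  · simp only [c]; field_simp; ring
  · rfl

lemma polar_one_neg {y : ℝ} (hy : 0 < y) :
    M.polar √(M.c ^ 2 + y ^ 2) (-ang M.c y) = (1, -y) := by
  have := M.ω_pos.ne'
  rw [polar, Real.cos_neg, Real.sin_neg, mul_neg, sqrt_mul_cos_ang hy, sqrt_mul_sin_ang hy]
  ext
  · simp only [c]; field_simp; ring
  · rfl

lemma polar_neg_one_neg {y : ℝ} (hy : 0 < y) :
    M.polar √((-M.e) ^ 2 + y ^ 2) (-ang (-M.e) y) = (-1, -y) := by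
  have := M.ω_pos.ne'
  rw [polar, Real.cos_neg, Real.sin_neg, mul_neg, sqrt_mul_cos_ang hy, sqrt_mul_sin_ang hy]
  ext
  · simp only [e]; field_simp; ring
  · rfl

lemma path_zero (ρ φ : ℝ) : M.path ε ρ φ 0 = M.polar ρ φ := by simp [path]

lemma hasDerivAt_path (ρ φ t : ℝ) :
    HasDerivAt (M.path ε ρ φ) (M.central ε (M.path ε ρ φ t)) t := by
  have hω := M.ω_pos.ne'
  have h1 : HasDerivAt (fun t => ρ * Real.exp (ε * M.dC * t))
      (ρ * (Real.exp (ε * M.dC * t) * (ε * M.dC))) t := by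
    simpa using ((hasDerivAt_id t).const_mul (ε * M.dC)).exp.const_mul ρ
  have h2 : HasDerivAt (fun t => φ + M.ω * t) M.ω t := by
    simpa using ((hasDerivAt_id t).const_mul M.ω).const_add φ
  have h3 := (((h1.mul h2.cos).div_const M.ω).const_sub M.p).prodMk (h1.mul h2.sin)
  refine h3.congr_deriv ?_
  ext
  · simp only [central, path, polar]; field_simp; ring
  · simp only [central, path, polar]; field_simp; ring

/-- Along a logarithmic spiral `log ρ - κ φ` is constant. Two points with the same value therefore
lie on one trajectory, and the angle alone determines the time. -/
lemma path_end {ρ₀ ρ₁ φ₀ φ₁ : ℝ} (h0 : 0 < ρ₀) (h1 : 0 < ρ₁)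
    (h : Real.log ρ₁ - M.κ ε * φ₁ = Real.log ρ₀ - M.κ ε * φ₀) :
    M.path ε ρ₀ φ₀ ((φ₁ - φ₀) / M.ω) = M.polar ρ₁ φ₁ := by
  have hω := M.ω_pos.ne'
  rw [path]
  congr 1
  · have : ε * M.dC * ((φ₁ - φ₀) / M.ω) = Real.log ρ₁ - Real.log ρ₀ := by
      have : ε * M.dC * ((φ₁ - φ₀) / M.ω) = M.κ ε * (φ₁ - φ₀) := by rw [κ]; ring
      rw [this]; linarith
    rw [this, Real.exp_sub, Real.exp_log h0, Real.exp_log h1]; field_simp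
  · field_simp; ring

lemma path_fst (ρ φ t : ℝ) : (M.path ε ρ φ t).1 = M.p - ρ * Real.exp (-(M.κ ε * φ)) / M.ω *
    (Real.exp (M.κ ε * (φ + M.ω * t)) * Real.cos (φ + M.ω * t)) := by
  have hω := M.ω_pos.ne'
  have : Real.exp (ε * M.dC * t) =
      Real.exp (-(M.κ ε * φ)) * Real.exp (M.κ ε * (φ + M.ω * t)) := by
    rw [← Real.exp_add]; congr 1; rw [κ]; field_simp; ring
  simp only [path, polar, this]; ring

lemma mem_time {φ₀ φ₁ t : ℝ} (ht : t ∈ Ioo 0 ((φ₁ - φ₀) / M.ω)) :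
    φ₀ < φ₀ + M.ω * t ∧ φ₀ + M.ω * t < φ₁ := by
  have hω := M.ω_pos
  have h2 := ht.2
  rw [lt_div_iff₀ hω] at h2
  constructor
  · nlinarith [ht.1]
  · nlinarith

/-- On the lower half turn the first coordinate decreases along a trajectory. -/
lemma path_strictAnti {ρ φ₀ φ₁ s t : ℝ} (hρ : 0 < ρ) (h0 : Real.arctan (M.κ ε) - Real.pi ≤ φ₀)
    (h1 : φ₁ ≤ Real.arctan (M.κ ε)) (hs : 0 ≤ s) (hst : s < t)
    (ht : t ≤ (φ₁ - φ₀) / M.ω) : (M.path ε ρ φ₀ t).1 < (M.path ε ρ φ₀ s).1 := by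
  have hω := M.ω_pos
  rw [le_div_iff₀ hω] at ht
  have h2 : M.ω * s < M.ω * t := by gcongr
  have h3 : 0 ≤ M.ω * s := by positivity
  have := expcos_strictMonoOn (M.κ ε) (a := φ₀ + M.ω * s) ⟨by linarith, by nlinarith⟩
    (b := φ₀ + M.ω * t) ⟨by linarith, by nlinarith⟩ (by linarith)
  rw [path_fst, path_fst]
  have := mul_lt_mul_of_pos_left this
    (by positivity : 0 < ρ * Real.exp (-(M.κ ε * φ₀)) / M.ω)
  linarith

/-- A trajectory of the central zone between crossing points that stays between the lines. -/
lemma isArc_path {X : PWField} {ρ₀ ρ₁ φ₀ φ₁ : ℝ} (hX : X.central = M.central ε)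
    (hφ : φ₀ < φ₁) (h0 : 0 < ρ₀) (h1 : 0 < ρ₁)
    (h : Real.log ρ₁ - M.κ ε * φ₁ = Real.log ρ₀ - M.κ ε * φ₀)
    (c0 : IsCrossingPoint X (M.polar ρ₀ φ₀)) (c1 : IsCrossingPoint X (M.polar ρ₁ φ₁))
    (f0 : fwdZone X (M.polar ρ₀ φ₀) = X.central) (f1 : bwdZone X (M.polar ρ₁ φ₁) = X.central)
    (hi : ∀ t ∈ Ioo 0 ((φ₁ - φ₀) / M.ω),
      -1 < (M.path ε ρ₀ φ₀ t).1 ∧ (M.path ε ρ₀ φ₀ t).1 < 1) :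
    IsArc X (M.path ε ρ₀ φ₀) ((φ₁ - φ₀) / M.ω) := by
  refine IsArc.of_field (F := M.central ε) (div_pos (by linarith) M.ω_pos) (hasDerivAt_path ρ₀ φ₀)
    ?_ ?_ ?_ ?_ ?_
  · rwa [path_zero]
  · rwa [path_end h0 h1 h]
  · rw [path_zero, f0, hX]
  · rw [path_end h0 h1 h, f1, hX]
  · intro t ht
    obtain ⟨h2, h3⟩ := hi t ht
    exact ⟨⟨h2.ne', h3.ne⟩, by rw [fwdZone_of_mem h2 h3, hX], by rw [bwdZone_of_mem h2 h3, hX]⟩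

/-- The evolution of the logarithm of the complex coordinate along a solution. -/
lemma log_evolution {γ : ℝ → ℝ × ℝ} {a b : ℝ} (hab : a ≤ b) (hc : ContinuousOn γ (Icc a b))
    (hd : ∀ t ∈ Ico a b, HasDerivWithinAt γ (M.central ε (γ t)) (Ici t) t)
    (hs : ∀ t ∈ Icc a b, M.w (γ t) ∈ Complex.slitPlane) :
    Complex.log (M.w (γ b)) = Complex.log (M.w (γ a)) + (b - a) * ⟨ε * M.dC, M.ω⟩ := by
  have hω := M.ω_pos.ne'
  have cw : Continuous M.w := by
    have : M.w = fun q => ((-(M.ω * (q.1 - M.p)) : ℝ) : ℂ) + (q.2 : ℝ) * Complex.I := by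
      funext q; apply Complex.ext <;> simp [w]
    rw [this]; fun_prop
  have dw : ∀ t ∈ Ico a b, HasDerivWithinAt (fun t => M.w (γ t))
      (⟨ε * M.dC, M.ω⟩ * M.w (γ t)) (Ici t) t := fun t ht => by
    have h := hd t ht
    have h1 := (((h.prodFst.sub_const M.p).const_mul M.ω).neg.ofReal_comp).add
      (h.prodSnd.ofReal_comp.mul_const Complex.I)
    have h2 : (fun t => M.w (γ t)) =
        fun t => ((-(M.ω * ((γ t).1 - M.p)) : ℝ) : ℂ) + ((γ t).2 : ℝ) * Complex.I := by
      funext t; apply Complex.ext <;> simp [w]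
    rw [h2]
    refine h1.congr_deriv ?_
    apply Complex.ext
    · simp [central, w, -Complex.ofReal_mul, -Complex.ofReal_neg]; ring
    · simp [central, w, -Complex.ofReal_mul, -Complex.ofReal_neg]
      ring
  have key := constant_of_has_deriv_right_zero (a := a) (b := b)
    (f := fun t : ℝ => Complex.log (M.w (γ t)) - ((t : ℂ) - a) * ⟨ε * M.dC, M.ω⟩)
    (((cw.comp_continuousOn hc).clog hs).sub (by fun_prop)) (fun t ht => by
      have h1 := (dw t ht).clog_real (hs t ⟨ht.1, ht.2.le⟩)
      have h2 : HasDerivWithinAt (fun t : ℝ => ((t : ℂ) - a) * (⟨ε * M.dC, M.ω⟩ : ℂ))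
          ⟨ε * M.dC, M.ω⟩ (Ici t) t := by
        simpa using ((Complex.ofRealCLM.hasDerivAt (x := t)).sub_const (a : ℂ)).mul_const
          (⟨ε * M.dC, M.ω⟩ : ℂ) |>.hasDerivWithinAt
      refine (h1.sub h2).congr_deriv ?_
      have hne : M.w (γ t) ≠ 0 := Complex.slitPlane_ne_zero (hs t ⟨ht.1, ht.2.le⟩)
      field_simp; ring) b ⟨hab, le_rfl⟩
  simp only [sub_self, zero_mul, sub_zero] at key
  rw [← key]; ring

/-- Imaginary and real part of the linear evolution of `log w`; eliminating time leaves the first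
integral `log ‖w‖ - κ arg w`. The branch cut of the logarithm is the ray of height zero starting at
the center and pointing to the right. -/
lemma arg_evolution {γ : ℝ → ℝ × ℝ} {a b : ℝ} (hab : a ≤ b) (hc : ContinuousOn γ (Icc a b))
    (hd : ∀ t ∈ Ico a b, HasDerivWithinAt γ (M.central ε (γ t)) (Ici t) t)
    (hs : ∀ t ∈ Icc a b, M.w (γ t) ∈ Complex.slitPlane) :
    (M.w (γ b)).arg = (M.w (γ a)).arg + M.ω * (b - a) ∧
    Real.log ‖M.w (γ b)‖ - M.κ ε * (M.w (γ b)).arg =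
      Real.log ‖M.w (γ a)‖ - M.κ ε * (M.w (γ a)).arg := by
  have hω := M.ω_pos.ne'
  have h := log_evolution hab hc hd hs
  have h1 := congrArg Complex.re h
  have h2 := congrArg Complex.im h
  simp [Complex.log_re, Complex.log_im] at h1 h2
  refine ⟨by linarith, ?_⟩
  rw [h1, h2, κ]; field_simp; ring

/-- A solution in the central zone that avoids the slit has to leave the zone. -/
lemma not_forall_slit {γ : ℝ → ℝ × ℝ} {a : ℝ} (hc : Continuous γ)
    (hd : ∀ t, a ≤ t → HasDerivWithinAt γ (M.central ε (γ t)) (Ici t) t) :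
    ¬ ∀ t, a ≤ t → M.w (γ t) ∈ Complex.slitPlane := by
  intro hs
  have hω := M.ω_pos
  have hπ := Real.pi_pos
  have hb : 0 < 2 * Real.pi / M.ω := by positivity
  -- During the time `2π/ω` the argument would grow by `2π`, which the range `(-π, π]` does not
  -- allow.
  have := (arg_evolution (M := M) (ε := ε) (a := a) (b := a + 2 * Real.pi / M.ω) (by linarith)
    hc.continuousOn (fun t ht => hd t ht.1) (fun t ht => hs t ht.1)).1
  have h1 := Complex.arg_le_pi (M.w (γ (a + 2 * Real.pi / M.ω)))
  have h2 := Complex.neg_pi_lt_arg (M.w (γ a))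
  rw [add_sub_cancel_left, mul_div_cancel₀ _ hω.ne'] at this
  linarith

lemma lipschitz_central : ∃ K, LipschitzWith K (M.central ε) := by
  let A : ℝ × ℝ →L[ℝ] ℝ × ℝ :=
    (ContinuousLinearMap.snd ℝ ℝ ℝ + (ε * M.dC) • ContinuousLinearMap.fst ℝ ℝ ℝ).prod
    ((-M.ω ^ 2) • ContinuousLinearMap.fst ℝ ℝ ℝ + (ε * M.dC) • ContinuousLinearMap.snd ℝ ℝ ℝ)
  refine ⟨‖A‖₊ + 0, ?_⟩
  have : M.central ε = fun q => A q + M.central ε 0 := by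
    funext q
    ext
    · simp [A, central]; ring
    · simp [A, central]; ring
  rw [this]
  exact A.lipschitz.add (LipschitzWith.const _)

lemma isLipschitz_sys : (M.sys ε).IsLipschitz := by
  obtain ⟨K₁, h1⟩ := M.L.lipschitz_field (ε := ε)
  obtain ⟨K₂, h2⟩ := lipschitz_central (M := M) (ε := ε)
  obtain ⟨K₃, h3⟩ := M.R.lipschitz_field (ε := ε)
  refine ⟨max (max K₁ K₂) K₃, ?_, ?_, ?_⟩
  · intro p q
    have := (h1.weaken ((le_max_left K₁ K₂).trans (le_max_left _ K₃))) (-p) (-q)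
    rw [edist_neg_neg] at this
    simp only [sys, negField]
    rwa [edist_neg_neg]
  · exact h2.weaken ((le_max_right K₁ K₂).trans (le_max_left _ K₃))
  · exact h3.weaken (le_max_right _ _)

end NF

end PWHam

namespace PWHam

/-! ### Excursions of crossing solutions into the zones -/

lemma exists_first_zero {f : ℝ → ℝ} {a : ℝ} (hf : Continuous f) (h0 : ∀ᶠ s in 𝓝[>] a, 0 < f s)
    (h : ∃ t, a < t ∧ f t ≤ 0) : ∃ b, a < b ∧ f b = 0 ∧ ∀ t ∈ Ioo a b, 0 < f t := by
  obtain ⟨t, hat, ht⟩ := h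
  obtain ⟨u, hu, hu'⟩ := mem_nhdsGT_iff_exists_Ioo_subset.1 h0
  have hu : a < u := hu
  have hut : u ≤ t := by
    by_contra! hlt
    exact absurd (hu' ⟨hat, hlt⟩) (not_lt.2 ht)
  set m := (a + u) / 2 with hm
  have ham : a < m := by rw [hm]; linarith
  have hmu : m < u := by rw [hm]; linarith
  have hK : IsCompact (Icc m t ∩ {s | f s ≤ 0}) :=
    isCompact_Icc.inter_right (isClosed_le hf continuous_const)
  obtain ⟨b, ⟨hb1, hb2⟩, hbmin⟩ := hK.exists_isLeast ⟨t, ⟨by linarith, le_rfl⟩, ht⟩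
  have hpos : ∀ s ∈ Ioo a b, 0 < f s := by
    intro s hs
    rcases lt_or_ge s u with h1 | h1
    · exact hu' ⟨hs.1, h1⟩
    · by_contra! h2
      have := hbmin ⟨⟨by linarith, by linarith [hs.2, hb1.2]⟩, h2⟩
      linarith [hs.2]
  have hab : a < b := by linarith [hb1.1]
  refine ⟨b, hab, le_antisymm hb2 ?_, hpos⟩
  have hcl : b ∈ closure (Ioo a b) := by rw [closure_Ioo hab.ne]; exact ⟨hab.le, le_rfl⟩
  exact closure_minimal (fun s hs => (hpos s hs).le) (isClosed_le continuous_const hf) hcl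

namespace IsCrossingSolution

variable {X : PWField} {γ : ℝ → ℝ × ℝ} {a b : ℝ}

lemma central_neg_of_gt (h : IsCrossingSolution X γ) (hab : a < b) (hb : (γ b).1 = -1 ∨ (γ b).1 = 1)
    (hi : ∀ t ∈ Ioo a b, (γ b).1 < (γ t).1) : (X.central (γ b)).1 < 0 := by
  by_contra! h1
  have h2 := lt_of_le_of_ne h1 (h.crossing b hb).central_ne.symm
  obtain ⟨s, hs, hs'⟩ := ((h.eventually_of_pos hb h2).1.and (Ioo_mem_nhdsLT hab)).exists
  exact lt_asymm hs (hi s hs')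

lemma central_pos_of_lt (h : IsCrossingSolution X γ) (hab : a < b) (hb : (γ b).1 = -1 ∨ (γ b).1 = 1)
    (hi : ∀ t ∈ Ioo a b, (γ t).1 < (γ b).1) : 0 < (X.central (γ b)).1 := by
  by_contra! h1
  have h2 := lt_of_le_of_ne h1 (h.crossing b hb).central_ne
  obtain ⟨s, hs, hs'⟩ := ((h.eventually_of_neg hb h2).1.and (Ioo_mem_nhdsLT hab)).exists
  exact lt_asymm hs (hi s hs')

lemma deriv_right (h : IsCrossingSolution X γ) (ha : (γ a).1 = 1) (hp : 0 < (X.central (γ a)).1)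
    {t : ℝ} (hi : a < t → 1 < (γ t).1) (hat : a ≤ t) :
    HasDerivWithinAt γ (X.right (γ t)) (Ici t) t := by
  have h1 := h.hasDerivWithinAt_fwd t
  rcases hat.eq_or_lt with rfl | h2
  · rwa [fwdZone_right_pos ha hp] at h1
  · rwa [fwdZone_of_gt (hi h2)] at h1

lemma deriv_central (h : IsCrossingSolution X γ)
    (ha : ((γ a).1 = 1 ∧ (X.central (γ a)).1 < 0) ∨ ((γ a).1 = -1 ∧ 0 < (X.central (γ a)).1))
    {t : ℝ} (hi : a < t → -1 < (γ t).1 ∧ (γ t).1 < 1) (hat : a ≤ t) :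
    HasDerivWithinAt γ (X.central (γ t)) (Ici t) t := by
  have h1 := h.hasDerivWithinAt_fwd t
  rcases hat.eq_or_lt with rfl | h2
  · rcases ha with ⟨ha, hp⟩ | ⟨ha, hp⟩
    · rwa [fwdZone_right_neg ha hp] at h1
    · rwa [fwdZone_left_pos ha hp] at h1
  · rwa [fwdZone_of_mem (hi h2).1 (hi h2).2] at h1

/-- The excursion into the right zone after a crossing to the right. -/
lemma exists_right_excursion (h : IsCrossingSolution X γ) (ha : (γ a).1 = 1)
    (hp : 0 < (X.central (γ a)).1) (hex : ∃ t, a < t ∧ (γ t).1 ≤ 1) :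
    ∃ b, a < b ∧ (γ b).1 = 1 ∧ (X.central (γ b)).1 < 0 ∧ (∀ t ∈ Ioo a b, 1 < (γ t).1) ∧
      ∀ t ∈ Ico a b, HasDerivWithinAt γ (X.right (γ t)) (Ici t) t := by
  obtain ⟨b, hab, hb, hi⟩ := exists_first_zero (f := fun t => (γ t).1 - 1)
    (h.continuous_fst.sub continuous_const)
    ((h.eventually_of_pos (Or.inr ha) hp).2.mono fun s hs => by linarith)
    (by obtain ⟨t, h1, h2⟩ := hex; exact ⟨t, h1, by linarith⟩)
  have hb : (γ b).1 = 1 := by linarith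
  have hi : ∀ t ∈ Ioo a b, 1 < (γ t).1 := fun t ht => by linarith [hi t ht]
  refine ⟨b, hab, hb, h.central_neg_of_gt hab (Or.inr hb) (by rwa [hb]), hi, fun t ht => ?_⟩
  exact h.deriv_right ha hp (fun h1 => hi t ⟨h1, ht.2⟩) ht.1

/-- The excursion into the central zone after a crossing into it. -/
lemma exists_central_excursion (h : IsCrossingSolution X γ)
    (ha : ((γ a).1 = 1 ∧ (X.central (γ a)).1 < 0) ∨ ((γ a).1 = -1 ∧ 0 < (X.central (γ a)).1))
    (hex : ∃ t, a < t ∧ ¬ (-1 < (γ t).1 ∧ (γ t).1 < 1)) :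
    ∃ b, a < b ∧ (((γ b).1 = 1 ∧ 0 < (X.central (γ b)).1) ∨
        ((γ b).1 = -1 ∧ (X.central (γ b)).1 < 0)) ∧
      (∀ t ∈ Ioo a b, -1 < (γ t).1 ∧ (γ t).1 < 1) ∧
      ∀ t ∈ Ico a b, HasDerivWithinAt γ (X.central (γ t)) (Ici t) t := by
  have key : ∀ x : ℝ, 0 < 1 - x ^ 2 ↔ (-1 < x ∧ x < 1) := fun x => by
    rw [sub_pos, sq_lt_one_iff_abs_lt_one, abs_lt]
  have hev : ∀ᶠ s in 𝓝[>] a, -1 < (γ s).1 ∧ (γ s).1 < 1 := by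
    rcases ha with ⟨ha, hp⟩ | ⟨ha, hp⟩
    · filter_upwards [(h.eventually_of_neg (Or.inr ha) hp).2, nhdsWithin_le_nhds
        (h.continuous_fst.continuousAt.eventually_const_lt (by linarith : -1 < (γ a).1))]
        with s h1 h2
      exact ⟨h2, by linarith⟩
    · filter_upwards [(h.eventually_of_pos (Or.inl ha) hp).2, nhdsWithin_le_nhds
        (h.continuous_fst.continuousAt.eventually_lt_const (by linarith : (γ a).1 < 1))]
        with s h1 h2
      exact ⟨by linarith, h2⟩
  obtain ⟨b, hab, hb, hi⟩ := exists_first_zero (f := fun t => 1 - (γ t).1 ^ 2)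
    (continuous_const.sub (h.continuous_fst.pow 2)) (hev.mono fun s hs => (key _).2 hs)
    (by obtain ⟨t, h1, h2⟩ := hex; exact ⟨t, h1, by rwa [← key, not_lt] at h2⟩)
  have hi : ∀ t ∈ Ioo a b, -1 < (γ t).1 ∧ (γ t).1 < 1 := fun t ht => (key _).1 (hi t ht)
  refine ⟨b, hab, ?_, hi, fun t ht => h.deriv_central ha (fun h1 => hi t ⟨h1, ht.2⟩) ht.1⟩
  have : ((γ b).1 - 1) * ((γ b).1 + 1) = 0 := by linarith
  rcases mul_eq_zero.1 this with h1 | h1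
  · have hb : (γ b).1 = 1 := by linarith
    exact Or.inl ⟨hb, h.central_pos_of_lt hab (Or.inr hb) fun t ht => by rw [hb]; exact (hi t ht).2⟩
  · have hb : (γ b).1 = -1 := by linarith
    exact Or.inr ⟨hb, h.central_neg_of_gt hab (Or.inl hb) fun t ht => by rw [hb]; exact (hi t ht).1⟩

/-- Entering the right zone below the separatrix, a solution comes back to the line, and the
first integral of the outer zone relates the two heights. -/
lemma outer_return (h : IsCrossingSolution X γ) {O : Outer} {ε : ℝ} (hX : X.right = O.field ε)
    (hε : 0 < 1 + ε * O.d) (ha : (γ a).1 = 1) (hp : 0 < (X.central (γ a)).1)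
    (hy : (γ a).2 < O.S) (hv : 0 < O.S + (γ a).2 - ε * O.s) :
    ∃ b, a < b ∧ (γ b).1 = 1 ∧ (X.central (γ b)).1 < 0 ∧ O.F ε (γ a).2 = O.F ε (γ b).2 := by
  have hex : ∃ t, a < t ∧ (γ t).1 ≤ 1 := by
    by_contra! hno
    obtain ⟨t, h1, h2⟩ := Outer.exists_le_one (O := O) h.continuous hε
      (fun t ht => by rw [← hX]; exact h.deriv_right ha hp (hno t) ht)
      (by simp only [Outer.u, ha]; linarith)
    exact absurd (hno t h1) (not_lt.2 h2)
  obtain ⟨b, hab, hb, hneg, -, hd⟩ := h.exists_right_excursion ha hp hex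
  rw [hX] at hd
  exact ⟨b, hab, hb, hneg, Outer.F_eq hab.le h.continuous.continuousOn hd ha hb hy hv⟩

/-- The passage through the central zone of a solution that avoids the slit. -/
lemma central_passage (h : IsCrossingSolution X γ) {M : NF} {ε : ℝ} (hX : X.central = M.central ε)
    (ha : ((γ a).1 = 1 ∧ (X.central (γ a)).1 < 0) ∨ ((γ a).1 = -1 ∧ 0 < (X.central (γ a)).1))
    (hs : ∀ t, -1 ≤ (γ t).1 → (γ t).1 ≤ 1 → M.w (γ t) ∈ Complex.slitPlane) :
    ∃ b, a < b ∧ (((γ b).1 = 1 ∧ 0 < (X.central (γ b)).1) ∨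
        ((γ b).1 = -1 ∧ (X.central (γ b)).1 < 0)) ∧
      (∀ t ∈ Icc a b, -1 ≤ (γ t).1 ∧ (γ t).1 ≤ 1) ∧
      (M.w (γ a)).arg < (M.w (γ b)).arg ∧
      Real.log ‖M.w (γ b)‖ - M.κ ε * (M.w (γ b)).arg =
        Real.log ‖M.w (γ a)‖ - M.κ ε * (M.w (γ a)).arg := by
  have ha' : -1 ≤ (γ a).1 ∧ (γ a).1 ≤ 1 := by
    rcases ha with ⟨h, -⟩ | ⟨h, -⟩ <;> rw [h] <;> norm_num
  have hex : ∃ t, a < t ∧ ¬ (-1 < (γ t).1 ∧ (γ t).1 < 1) := by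
    by_contra! hno
    refine NF.not_forall_slit (M := M) (ε := ε) (a := a) h.continuous
      (fun t ht => by rw [← hX]; exact h.deriv_central ha (hno t) ht) fun t ht => ?_
    rcases ht.eq_or_lt with rfl | h1
    · exact hs _ ha'.1 ha'.2
    · exact hs t (hno t h1).1.le (hno t h1).2.le
  obtain ⟨b, hab, hb, hi, hd⟩ := h.exists_central_excursion ha hex
  have hi' : ∀ t ∈ Icc a b, -1 ≤ (γ t).1 ∧ (γ t).1 ≤ 1 := by
    intro t ht
    rcases ht.1.eq_or_lt with rfl | h1
    · exact ha'
    rcases ht.2.eq_or_lt with rfl | h2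
    · rcases hb with ⟨h, -⟩ | ⟨h, -⟩ <;> rw [h] <;> norm_num
    · exact ⟨(hi t ⟨h1, h2⟩).1.le, (hi t ⟨h1, h2⟩).2.le⟩
  rw [hX] at hd
  obtain ⟨h1, h2⟩ := NF.arg_evolution hab.le h.continuous.continuousOn hd
    (fun t ht => hs t (hi' t ht).1 (hi' t ht).2)
  refine ⟨b, hab, hb, hi', ?_, h2⟩
  rw [h1]; have := mul_pos M.ω_pos (sub_pos.2 hab); linarith

end IsCrossingSolution

/-- A crossing periodic solution of the normal form that avoids the slit meets the lines. -/
lemma IsCrossingPeriodic.exists_lineTime {M : NF} {ε : ℝ} {γ : ℝ → ℝ × ℝ} {T : ℝ}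
    (h : IsCrossingPeriodic (M.sys ε) γ T) (hR : 0 < 1 + ε * M.R.d) (hL : 0 < 1 + ε * M.L.d)
    (hs : ∀ t, -1 ≤ (γ t).1 → (γ t).1 ≤ 1 → M.w (γ t) ∈ Complex.slitPlane) :
    ∃ t, (γ t).1 = -1 ∨ (γ t).1 = 1 := by
  obtain ⟨hγ, hT, hper, t₁, hne⟩ := h
  by_contra! hno
  have hc := hγ.continuous_fst
  -- A solution that avoids both lines stays in one open zone. In an outer zone a periodic solution
  -- is constant, and in the central zone it cannot avoid the slit forever.
  have side : ∀ c : ℝ, (∀ t, (γ t).1 ≠ c) → (∀ t, (γ t).1 < c) ∨ (∀ t, c < (γ t).1) := by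
    intro c hcne
    by_contra! hcon
    obtain ⟨⟨t, ht⟩, s, hs⟩ := hcon
    obtain ⟨r, hr⟩ := mem_range_of_exists_le_of_exists_ge hc ⟨s, hs⟩ ⟨t, ht⟩
    exact hcne r hr
  rcases side (-1) (fun t => (hno t).1) with h1 | h1
  · have hneg := hγ.neg
    have := Outer.const_of_periodic (O := M.L) (ε := ε) (γ := fun t => -γ t) hneg.continuous hL hT
      (fun t => by simp [hper t]) (fun t => by
        have := (hneg.in_right t (by simp; linarith [h1 t])).hasDerivWithinAt (s := Ici t)
        simpa [PWField.neg, NF.sys, negField_negField] using this) t₁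
    exact hne (neg_injective this)
  · rcases side 1 (fun t => (hno t).2) with h2 | h2
    · exact NF.not_forall_slit (M := M) (ε := ε) (a := 0) hγ.continuous
        (fun t _ => (hγ.in_central t (h1 t) (h2 t)).hasDerivWithinAt)
        (fun t _ => hs t (h1 t).le (h2 t).le)
    · exact hne (Outer.const_of_periodic (O := M.R) (ε := ε) hγ.continuous hR hT hper
        (fun t => (hγ.in_right t (h2 t)).hasDerivWithinAt) t₁)

/-- The heights at which a crossing periodic orbit meets `x = 1` are finitely many. -/
lemma IsCrossingPeriodic.finite_section {X : PWField} {γ : ℝ → ℝ × ℝ} {T : ℝ}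
    (h : IsCrossingPeriodic X γ T) : {y | (1, y) ∈ range γ}.Finite := by
  have hfin := h.1.finite_lineTimes 0 T
  refine (hfin.image fun t => (γ t).2).subset ?_
  rintro y ⟨t, ht⟩
  obtain ⟨s, hs, hst⟩ := h.2.2.1.exists_mem_Ico₀ h.2.1 t
  rw [ht] at hst
  exact ⟨s, ⟨Or.inr (by rw [← hst]), hs.1, hs.2.le⟩, by simp [← hst]⟩

/-- A finite set that is invariant under a monotone correspondence consists of fixed points. -/
lemma fixed_of_finite_invariant {S W : Set ℝ} {A B : ℝ → ℝ} (hS : S.Finite) (hSW : S ⊆ W)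
    (hA : StrictAntiOn A W) (hB : StrictAntiOn B W) (hN : ∀ y ∈ S, ∃ z ∈ S, A y = B z)
    {y₀ : ℝ} (h0 : ∀ y ∈ W, A y = B y → y = y₀) : S ⊆ {y₀} := by
  choose! N hN1 hN2 using hN
  have hinj : InjOn N S := fun y hy z hz hyz => by
    refine hA.injOn (hSW hy) (hSW hz) ?_
    rw [hN2 y hy, hN2 z hz, hyz]
  -- An injective self-map of a finite set is onto, so the extreme points have preimages in the set.
  have hsurj : SurjOn N S S := ((hS.injOn_iff_bijOn_of_mapsTo hN1).1 hinj).surjOn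
  intro y hy
  have hne : S.Nonempty := ⟨y, hy⟩
  obtain ⟨m, hm, hmax⟩ := hS.isCompact.exists_isGreatest hne
  obtain ⟨l, hl, hmin⟩ := hS.isCompact.exists_isLeast hne
  -- Let `N x = m`. Since `x ≤ m` and `N m ≤ m`, antitonicity gives `A m ≤ A x = B m` and `B m ≤ B
  -- (N m) = A m`, so `A m = B m`. The minimum is treated in the same way.
  have fix_m : m = y₀ := by
    obtain ⟨x, hx, hxm⟩ := hsurj hm
    have h1 := hA.antitoneOn (hSW hx) (hSW hm) (hmax hx)
    have h2 := hB.antitoneOn (hSW (hN1 m hm)) (hSW hm) (hmax (hN1 m hm))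
    have h3 := hN2 x hx
    rw [hxm] at h3
    have h4 := hN2 m hm
    exact h0 m (hSW hm) (by linarith)
  have fix_l : l = y₀ := by
    obtain ⟨x, hx, hxl⟩ := hsurj hl
    have h1 := hA.antitoneOn (hSW hl) (hSW hx) (hmin hx)
    have h2 := hB.antitoneOn (hSW hl) (hSW (hN1 l hl)) (hmin (hN1 l hl))
    have h3 := hN2 x hx
    rw [hxl] at h3
    have h4 := hN2 l hl
    exact h0 l (hSW hl) (by linarith)
  have h1 := hmax hy
  have h2 := hmin hy
  exact le_antisymm (by linarith) (by linarith)

end PWHam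

namespace PWHam

/-! ### The analytic implicit function theorem and bifurcation functions -/

/-- The implicit function `h` defined by `g (ε, h (ε, y)) = f (ε, y)`. -/
lemma exists_analytic_implicit {f g : ℝ × ℝ → ℝ} {a b g' : ℝ} (hf : AnalyticAt ℝ f (0, a))
    (hg : AnalyticAt ℝ g (0, b)) (hfg : f (0, a) = g (0, b))
    (hg' : HasDerivAt (fun y => g (0, y)) g' b) (hne : g' ≠ 0) :
    ∃ h : ℝ × ℝ → ℝ, AnalyticAt ℝ h (0, a) ∧ h (0, a) = b ∧
      (∀ᶠ q in 𝓝 ((0, a) : ℝ × ℝ), g (q.1, h q) = f q) ∧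
      ∀ᶠ r in 𝓝 (((0, a), b) : (ℝ × ℝ) × ℝ), g (r.1.1, r.2) = f r.1 → r.2 = h r.1 := by
  -- The inverse function theorem is applied to this triangular map; the implicit function is the
  -- last coordinate of the local inverse on the slice where the second component is zero.
  let T : (ℝ × ℝ) × ℝ → (ℝ × ℝ) × ℝ := fun r => (r.1, g (r.1.1, r.2) - f r.1)
  have hG : AnalyticAt ℝ (fun r : (ℝ × ℝ) × ℝ => g (r.1.1, r.2) - f r.1) ((0, a), b) := by
    refine AnalyticAt.sub ?_ ?_
    · exact AnalyticAt.fun_comp (g := g) (f := fun r : (ℝ × ℝ) × ℝ => (r.1.1, r.2)) hg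
        ((AnalyticAt.fun_comp (g := Prod.fst) (f := Prod.fst) analyticAt_fst analyticAt_fst).prod
          analyticAt_snd)
    · exact AnalyticAt.fun_comp (g := f) (f := fun r : (ℝ × ℝ) × ℝ => r.1) hf analyticAt_fst
  have hT : AnalyticAt ℝ T ((0, a), b) := AnalyticAt.prod analyticAt_fst hG
  set A : (ℝ × ℝ) × ℝ →L[ℝ] ℝ :=
    fderiv ℝ (fun r : (ℝ × ℝ) × ℝ => g (r.1.1, r.2) - f r.1) ((0, a), b) with hA
  have hGd : HasFDerivAt (fun r : (ℝ × ℝ) × ℝ => g (r.1.1, r.2) - f r.1) A ((0, a), b) :=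
    hG.differentiableAt.hasFDerivAt
  have hA2 : ∀ t : ℝ, A (0, t) = g' * t := by
    intro t
    have h1 : HasDerivAt (fun y : ℝ => (((0, a), y) : (ℝ × ℝ) × ℝ)) (0, 1) b :=
      (hasDerivAt_const b ((0, a) : ℝ × ℝ)).prodMk (hasDerivAt_id b)
    have h2 : HasDerivAt (fun y => g (0, y) - f (0, a)) (A (0, 1)) b :=
      HasFDerivAt.comp_hasDerivAt (f := fun y : ℝ => (((0, a), y) : (ℝ × ℝ) × ℝ))
        (l := fun r : (ℝ × ℝ) × ℝ => g (r.1.1, r.2) - f r.1) b hGd h1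
    have h3 := h2.unique (hg'.sub_const _)
    have : ((0, t) : (ℝ × ℝ) × ℝ) = t • (0, 1) := by simp
    rw [this, map_smul, h3, smul_eq_mul, mul_comm]
  have hAsplit : ∀ x : ℝ × ℝ, ∀ t : ℝ, A (x, t) = A (x, 0) + g' * t := by
    intro x t
    rw [← hA2 t, ← map_add]; simp
  -- The derivative of `T` is block triangular with diagonal entry `g'`, so its inverse can be
  -- written down.
  let E : ((ℝ × ℝ) × ℝ) ≃L[ℝ] ((ℝ × ℝ) × ℝ) := ContinuousLinearEquiv.equivOfInverse
    ((ContinuousLinearMap.fst ℝ (ℝ × ℝ) ℝ).prod A)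
    ((ContinuousLinearMap.fst ℝ (ℝ × ℝ) ℝ).prod (g'⁻¹ • (ContinuousLinearMap.snd ℝ (ℝ × ℝ) ℝ -
      A.comp ((ContinuousLinearMap.fst ℝ (ℝ × ℝ) ℝ).prod 0))))
    (fun ⟨x, t⟩ => by simp [hAsplit x t]; field_simp)
    (fun ⟨x, t⟩ => by simp [hAsplit x (g'⁻¹ * _)]; field_simp; ring)
  have hTd : HasFDerivAt T (E : (ℝ × ℝ) × ℝ →L[ℝ] (ℝ × ℝ) × ℝ) ((0, a), b) :=
    hasFDerivAt_fst.prodMk hGd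
  -- The exponent `⊤` stands for analyticity, not merely for infinite differentiability; the local
  -- inverse inherits it.
  have hTc : ContDiffAt ℝ ⊤ T ((0, a), b) := hT.contDiffAt
  set J := hTc.localInverse hTd (by simp) with hJ
  have hT0 : T ((0, a), b) = ((0, a), 0) := by simp [T, hfg]
  have hJan : AnalyticAt ℝ J ((0, a), 0) := by
    rw [← hT0]; exact (hTc.to_localInverse hTd (by simp)).analyticAt
  have hJ0 : J ((0, a), 0) = ((0, a), b) := by
    rw [← hT0]; exact hTc.localInverse_apply_image hTd (by simp)
  set R := hTc.toOpenPartialHomeomorph T hTd (by simp) with hR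
  have hmem : ((0, a), b) ∈ R.source := hTc.mem_toOpenPartialHomeomorph_source hTd (by simp)
  have hleft : ∀ᶠ r in 𝓝 (((0, a), b) : (ℝ × ℝ) × ℝ), J (T r) = r := R.eventually_left_inverse hmem
  have hright : ∀ᶠ s in 𝓝 (((0, a), 0) : (ℝ × ℝ) × ℝ), T (J s) = s := by
    rw [← hT0]; exact R.eventually_right_inverse' hmem
  have hemb : Tendsto (fun q : ℝ × ℝ => ((q, 0) : (ℝ × ℝ) × ℝ)) (𝓝 (0, a)) (𝓝 ((0, a), 0)) :=
    (Continuous.tendsto (by fun_prop) _)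
  refine ⟨fun q => (J (q, 0)).2, ?_, by simp [hJ0], ?_, ?_⟩
  · have h1 : AnalyticAt ℝ (fun q : ℝ × ℝ => J (q, 0)) (0, a) :=
      AnalyticAt.fun_comp (g := J) (f := fun q : ℝ × ℝ => ((q, 0) : (ℝ × ℝ) × ℝ)) hJan (by fun_prop)
    exact AnalyticAt.fun_comp (g := Prod.snd) (f := fun q : ℝ × ℝ => J (q, 0)) analyticAt_snd h1
  · filter_upwards [hemb.eventually hright] with q hq
    have h1 := congrArg Prod.fst hq
    have h2 := congrArg Prod.snd hq
    simp only [T] at h1 h2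
    rw [h1] at h2
    linarith
  · filter_upwards [hleft] with r hr h
    have : T r = (r.1, 0) := by simp only [T, h, sub_self]
    rw [this] at hr
    rw [hr]

/-- Partial derivatives of an analytic function of two variables in the second variable. -/
lemma hasDerivAt_snd_of_analyticAt {f : ℝ × ℝ → ℝ} {q : ℝ × ℝ} (hf : AnalyticAt ℝ f q) :
    HasDerivAt (fun y => f (q.1, y)) (fderiv ℝ f q (0, 1)) q.2 :=
  HasFDerivAt.comp_hasDerivAt (f := fun y : ℝ => (q.1, y)) (l := f) q.2
    hf.differentiableAt.hasFDerivAt ((hasDerivAt_const q.2 q.1).prodMk (hasDerivAt_id q.2))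

lemma eventually_box {P : ℝ × ℝ → Prop} {z : ℝ} (h : ∀ᶠ q in 𝓝 ((0, z) : ℝ × ℝ), P q) :
    ∃ r > 0, ∀ ε y : ℝ, |ε| < r → |y - z| < r → P (ε, y) := by
  obtain ⟨r, hr, h⟩ := Metric.eventually_nhds_iff.1 h
  refine ⟨r, hr, fun ε y h1 h2 => h ?_⟩
  rw [Prod.dist_eq, max_lt_iff, Real.dist_eq, Real.dist_eq]
  exact ⟨by simpa using h1, h2⟩

/-- A strictly negative partial derivative gives strict monotonicity nearby. -/
lemma exists_strictAntiOn {f : ℝ × ℝ → ℝ} {z f' : ℝ} (hf : AnalyticAt ℝ f (0, z))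
    (hf' : HasDerivAt (fun y => f (0, y)) f' z) (hneg : f' < 0) :
    ∃ r > 0, ∀ ε, |ε| < r → StrictAntiOn (fun y => f (ε, y)) (Ioo (z - r) (z + r)) := by
  have h0 : fderiv ℝ f (0, z) (0, 1) = f' := (hasDerivAt_snd_of_analyticAt hf).unique hf'
  have hc : ContinuousAt (fun q => fderiv ℝ f q (0, 1)) (0, z) :=
    hf.fderiv.continuousAt.clm_apply continuousAt_const
  have hev : ∀ᶠ q in 𝓝 ((0, z) : ℝ × ℝ), AnalyticAt ℝ f q ∧ fderiv ℝ f q (0, 1) < 0 :=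
    hf.eventually_analyticAt.and (hc.eventually_lt_const (by simpa only [h0] using hneg))
  obtain ⟨r, hr, h⟩ := eventually_box hev
  refine ⟨r, hr, fun ε hε => ?_⟩
  have hy : ∀ y ∈ Ioo (z - r) (z + r), |y - z| < r := fun y hy => by
    rw [abs_lt]; constructor <;> linarith [hy.1, hy.2]
  have hd : ∀ y ∈ Ioo (z - r) (z + r),
      HasDerivAt (fun y => f (ε, y)) (fderiv ℝ f (ε, y) (0, 1)) y := fun y hy' =>
    hasDerivAt_snd_of_analyticAt (q := (ε, y)) (h ε y hε (hy y hy')).1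
  refine strictAntiOn_of_deriv_neg (convex_Ioo _ _)
    (fun y hy' => (hd y hy').continuousAt.continuousWithinAt) fun y hy' => ?_
  rw [interior_Ioo] at hy'
  rw [(hd y hy').deriv]
  exact (h ε y hε (hy y hy')).2

/-- `m` takes both signs on opposite sides of `z`, arbitrarily close to `z`. -/
def SignChange (m : ℝ → ℝ) (z : ℝ) : Prop :=
  ∀ r > 0, ∃ a ∈ Ioo (z - r) z, ∃ b ∈ Ioo z (z + r), m a * m b < 0

/-- Choice of a convergent family from eventual local existence. -/
lemma exists_tendsto_of_eventually {P : ℝ → ℝ → Prop} {z : ℝ}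
    (h : ∀ r > 0, ∀ᶠ ε in 𝓝[>] (0 : ℝ), ∃ y, |y - z| < r ∧ P ε y) :
    ∃ Y : ℝ → ℝ, Tendsto Y (𝓝[>] 0) (𝓝 z) ∧ ∀ᶠ ε in 𝓝[>] (0 : ℝ), P ε (Y ε) := by
  classical
  -- `d ε` is the least distance from `z` at which the property holds. A choice within `ε` of this
  -- infimum is eventually closer than any prescribed radius, although the radius is not known when
  -- choosing.
  let d : ℝ → ℝ := fun ε => sInf {r | ∃ y, |y - z| = r ∧ P ε y}
  have hbdd : ∀ ε, BddBelow {r | ∃ y, |y - z| = r ∧ P ε y} := fun ε =>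
    ⟨0, by rintro _ ⟨y, rfl, -⟩; exact abs_nonneg _⟩
  have hex : ∀ ε, 0 < ε → (∃ y, P ε y) → ∃ y, |y - z| < d ε + ε ∧ P ε y := by
    rintro ε hε ⟨y, hy⟩
    obtain ⟨_, ⟨y', rfl, hy'⟩, hlt⟩ := exists_lt_of_csInf_lt
      (s := {r | ∃ y, |y - z| = r ∧ P ε y}) ⟨_, y, rfl, hy⟩ (lt_add_of_pos_right (d ε) hε)
    exact ⟨y', hlt, hy'⟩
  choose! Y hY1 hY2 using hex
  refine ⟨Y, ?_, ?_⟩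
  · rw [Metric.tendsto_nhds]
    intro r hr
    filter_upwards [h (r / 2) (by positivity), Ioo_mem_nhdsGT (by positivity : (0 : ℝ) < r / 2)]
      with ε hε hε'
    obtain ⟨y, hy, hP⟩ := hε
    have h1 := hY1 ε hε'.1 ⟨y, hP⟩
    have h2 : d ε ≤ |y - z| := csInf_le (hbdd ε) ⟨y, rfl, hP⟩
    rw [Real.dist_eq]
    linarith [hε'.2]
  · filter_upwards [h 1 one_pos, self_mem_nhdsWithin] with ε hε hε'
    obtain ⟨y, -, hP⟩ := hε
    exact hY2 ε hε' ⟨y, hP⟩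

/-- Near a sign change of the first order term, an analytic bifurcation function has an isolated
zero for every small positive parameter. -/
theorem exists_isolated_zero {D : ℝ × ℝ → ℝ} {m wt : ℝ → ℝ} {z : ℝ} (hD : AnalyticAt ℝ D (0, z))
    (h0 : ∀ᶠ y in 𝓝 z, D (0, y) = 0)
    (hm : ∀ᶠ y in 𝓝 z, 0 < wt y ∧ HasDerivAt (fun ε => D (ε, y)) (wt y * m y) 0)
    (hs : SignChange m z) :
    ∃ Y : ℝ → ℝ, Tendsto Y (𝓝[>] 0) (𝓝 z) ∧ ∀ᶠ ε in 𝓝[>] (0 : ℝ), D (ε, Y ε) = 0 ∧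
      ∃ ρ > 0, ∀ y, |y - Y ε| < ρ → D (ε, y) = 0 → y = Y ε := by
  obtain ⟨r₀, hr₀, han⟩ := eventually_box hD.eventually_analyticAt
  obtain ⟨r₁, hr₁, hall⟩ := Metric.eventually_nhds_iff.1 (h0.and hm)
  have sgn : ∀ y, |y - z| < r₁ → (0 < m y → ∀ᶠ ε in 𝓝[>] (0 : ℝ), 0 < D (ε, y)) ∧
      (m y < 0 → ∀ᶠ ε in 𝓝[>] (0 : ℝ), D (ε, y) < 0) := by
    intro y hy
    obtain ⟨h1, h2, h3⟩ := hall (by rwa [Real.dist_eq])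
    have h4 := h3.hasDerivWithinAt (s := Ici 0)
    constructor
    · intro hmy
      have := eventually_gt_of_hasDerivWithinAt_Ici h4 (mul_pos h2 hmy)
      simpa [h1] using this
    · intro hmy
      have := eventually_lt_of_hasDerivWithinAt_Ici h4 (mul_neg_of_pos_of_neg h2 hmy)
      simpa [h1] using this
  have small : ∀ r > (0 : ℝ), ∀ᶠ ε in 𝓝[>] (0 : ℝ), |ε| < r := fun r hr => by
    filter_upwards [Ioo_mem_nhdsGT hr] with ε hε
    rw [abs_of_pos hε.1]; exact hε.2
  refine exists_tendsto_of_eventually (P := fun ε y => D (ε, y) = 0 ∧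
      ∃ ρ > 0, ∀ y', |y' - y| < ρ → D (ε, y') = 0 → y' = y) fun r hr => ?_
  set r₂ := min (min r₀ r₁) r with hr₂
  have hr₂0 : 0 < r₂ := lt_min (lt_min hr₀ hr₁) hr
  obtain ⟨a, ha, b, hb, hab⟩ := hs r₂ hr₂0
  have near : ∀ y ∈ Icc a b, |y - z| < r₂ := fun y hy => by
    rw [abs_lt]; constructor <;> linarith [hy.1, hy.2, ha.1, ha.2, hb.1, hb.2]
  have le0 : r₂ ≤ r₀ := (min_le_left _ _).trans (min_le_left _ _)
  have le1 : r₂ ≤ r₁ := (min_le_left _ _).trans (min_le_right _ _)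
  have hab' : a ≤ b := by linarith [ha.2, hb.1]
  have hprod : ∀ᶠ ε in 𝓝[>] (0 : ℝ), D (ε, a) * D (ε, b) < 0 := by
    have sa := sgn a ((near a ⟨le_rfl, hab'⟩).trans_le le1)
    have sb := sgn b ((near b ⟨hab', le_rfl⟩).trans_le le1)
    rcases mul_neg_iff.1 hab with ⟨h1, h2⟩ | ⟨h1, h2⟩
    · filter_upwards [sa.1 h1, sb.2 h2] with ε h3 h4 using mul_neg_of_pos_of_neg h3 h4
    · filter_upwards [sa.2 h1, sb.1 h2] with ε h3 h4 using mul_neg_of_neg_of_pos h3 h4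
  filter_upwards [hprod, small r₀ hr₀] with ε hε hε₀
  have hanε : AnalyticOnNhd ℝ (fun y => D (ε, y)) (Icc a b) := fun y hy =>
    AnalyticAt.fun_comp (g := D) (f := fun y : ℝ => (ε, y))
      (han ε y hε₀ ((near y hy).trans_le le0)) (by fun_prop)
  have hcont : ContinuousOn (fun y => D (ε, y)) (Icc a b) := fun y hy =>
    (hanε y hy).continuousAt.continuousWithinAt
  obtain ⟨y, hy, hy0⟩ : ∃ y ∈ Icc a b, D (ε, y) = 0 := by
    rcases mul_neg_iff.1 hε with ⟨h1, h2⟩ | ⟨h1, h2⟩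
    · exact intermediate_value_Icc' hab' hcont ⟨h2.le, h1.le⟩
    · exact intermediate_value_Icc hab' hcont ⟨h1.le, h2.le⟩
  refine ⟨y, (near y hy).trans_le (min_le_right _ _), hy0, ?_⟩
  -- If zeros accumulated at `y`, the displacement would vanish on all of `[a, b]` by the identity
  -- theorem, against the opposite signs at the ends.
  rcases (hanε y hy).eventually_eq_zero_or_eventually_ne_zero with h | h
  · exfalso
    have := hanε.eqOn_zero_of_preconnected_of_eventuallyEq_zero isPreconnected_Icc hy h
    have h1 := this ⟨le_rfl, hab'⟩
    simp only [Pi.zero_apply] at h1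
    rw [h1, zero_mul] at hε
    exact lt_irrefl _ hε
  · rw [eventually_nhdsWithin_iff, Metric.eventually_nhds_iff] at h
    obtain ⟨ρ, hρ, h⟩ := h
    refine ⟨ρ, hρ, fun y' hy' h' => ?_⟩
    by_contra hne
    exact h (by rwa [Real.dist_eq]) hne h'

/-- A function analytic on an interval with values of opposite sign has a sign change. -/
lemma exists_signChange {m : ℝ → ℝ} {a b : ℝ} (hab : a < b) (hm : AnalyticOnNhd ℝ m (Icc a b))
    (h : m a * m b < 0) : ∃ z ∈ Ioo a b, SignChange m z := by
  wlog ha : 0 < m a generalizing m with H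
  · have ha' : 0 < (-m) a := by
      rcases mul_neg_iff.1 h with ⟨h1, -⟩ | ⟨h1, -⟩
      · exact absurd h1 ha
      · simpa using h1
    obtain ⟨z, hz, hs⟩ := H (m := -m) hm.neg (by simpa using h) ha'
    refine ⟨z, hz, fun r hr => ?_⟩
    simpa using hs r hr
  have hb : m b < 0 := by
    rcases mul_neg_iff.1 h with ⟨-, h1⟩ | ⟨h1, -⟩
    · exact h1
    · exact absurd ha (not_lt.2 h1.le)
  have hcont : ContinuousOn m (Icc a b) := fun y hy => (hm y hy).continuousAt.continuousWithinAt
  -- The sign change is sought at the last point that has positive values arbitrarily close on its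
  -- left.
  set P : Set ℝ := {t | t ∈ Icc a b ∧ 0 < m t} with hP
  have haP : a ∈ P := ⟨⟨le_rfl, hab.le⟩, ha⟩
  have hbdd : BddAbove P := ⟨b, fun t ht => ht.1.2⟩
  set z := sSup P with hz
  have haz : a ≤ z := le_csSup hbdd haP
  have hzb : z ≤ b := csSup_le ⟨a, haP⟩ fun t ht => ht.1.2
  have hcz := (hm z ⟨haz, hzb⟩).continuousAt
  have hright : ∀ t ∈ Icc a b, z < t → m t ≤ 0 := fun t ht hlt => by
    by_contra! h
    exact absurd (le_csSup hbdd (show t ∈ P from ⟨ht, h⟩)) (not_le.2 hlt)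
  have hnear : ∀ r > 0, ∃ t ∈ P, z - r < t ∧ t ≤ z := fun r hr => by
    obtain ⟨t, ht, hlt⟩ := exists_lt_of_lt_csSup (s := P) ⟨a, haP⟩ (sub_lt_self z hr)
    exact ⟨t, ht, hlt, le_csSup hbdd ht⟩
  have hzb' : z < b := by
    rcases hzb.lt_or_eq with h | h
    · exact h
    · exfalso
      rw [h] at hcz
      obtain ⟨r, hr, hlt⟩ := Metric.eventually_nhds_iff.1 (hcz.eventually_lt_const hb)
      obtain ⟨t, ht, h1, h2⟩ := hnear r hr
      have := hlt (y := t) (by rw [Real.dist_eq, abs_lt]; constructor <;> linarith)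
      exact absurd ht.2 this.not_gt
  have hznp : ¬ 0 < m z := fun hpos => by
    obtain ⟨r, hr, hlt⟩ := Metric.eventually_nhds_iff.1 (hcz.eventually_const_lt hpos)
    have h1 : z < min (z + r / 2) b := lt_min (by linarith) hzb'
    have h2 := min_le_left (z + r / 2) b
    have := hlt (y := min (z + r / 2) b) (by rw [Real.dist_eq, abs_lt]; constructor <;> linarith)
    exact absurd (hright _ ⟨haz.trans h1.le, min_le_right _ _⟩ h1) (not_le.2 this)
  have haz' : a < z := haz.lt_of_ne fun h => hznp (h ▸ ha)
  refine ⟨z, ⟨haz', hzb'⟩, fun r hr => ?_⟩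
  obtain ⟨s, hs, h1, h2⟩ := hnear r hr
  have h2' : s < z := h2.lt_of_ne fun h => hznp (h ▸ hs.2)
  -- Without negative values just to the right of `z` the function would vanish on an interval
  -- there, hence on all of `[a, b]`, contradicting `m b < 0`.
  obtain ⟨t, ht1, ht2, ht3⟩ : ∃ t, z < t ∧ t < z + r ∧ (t ≤ b ∧ m t < 0) := by
    by_contra! hno
    have hzero : ∀ t, z < t → t < z + r → t ≤ b → m t = 0 := fun t h1 h2 h3 =>
      le_antisymm (hright t ⟨haz.trans h1.le, h3⟩ h1) (hno t h1 h2 h3)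
    set w := (z + min (z + r) b) / 2 with hw
    have hmin : z < min (z + r) b := lt_min (by linarith) hzb'
    have hw1 : z < w := by rw [hw]; linarith
    have hw2 : w < min (z + r) b := by rw [hw]; linarith
    have hev : m =ᶠ[𝓝 w] 0 := by
      filter_upwards [Ioo_mem_nhds hw1 hw2] with t ht
      exact hzero t ht.1 (ht.2.trans_le (min_le_left _ _)) (ht.2.le.trans (min_le_right _ _))
    have hb0 := hm.eqOn_zero_of_preconnected_of_eventuallyEq_zero isPreconnected_Icc
      (⟨haz.trans hw1.le, hw2.le.trans (min_le_right _ _)⟩ : w ∈ Icc a b) hev ⟨hab.le, le_rfl⟩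
    simp only [Pi.zero_apply] at hb0
    exact hb.ne hb0
  exact ⟨s, ⟨h1, h2'⟩, t, ⟨ht1, ht2⟩, mul_neg_of_pos_of_neg hs.2 ht3.2⟩

end PWHam

namespace PWHam

/-! ### The half-return relations and their first order terms -/

/-- Two successive implicit functions. -/
lemma exists_implicit_pair {f₁ g₁ f₂ g₂ : ℝ × ℝ → ℝ} {a b c g₁' g₂' : ℝ}
    (hf₁ : AnalyticAt ℝ f₁ (0, a)) (hg₁ : AnalyticAt ℝ g₁ (0, b)) (h₁ : f₁ (0, a) = g₁ (0, b))
    (hd₁ : HasDerivAt (fun y => g₁ (0, y)) g₁' b) (hne₁ : g₁' ≠ 0)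
    (hf₂ : AnalyticAt ℝ f₂ (0, b)) (hg₂ : AnalyticAt ℝ g₂ (0, c)) (h₂ : f₂ (0, b) = g₂ (0, c))
    (hd₂ : HasDerivAt (fun y => g₂ (0, y)) g₂' c) (hne₂ : g₂' ≠ 0) :
    ∃ h P : ℝ × ℝ → ℝ, AnalyticAt ℝ h (0, a) ∧ AnalyticAt ℝ P (0, a) ∧ h (0, a) = b ∧
      P (0, a) = c ∧
      (∀ᶠ q in 𝓝 ((0, a) : ℝ × ℝ), g₁ (q.1, h q) = f₁ q ∧ g₂ (q.1, P q) = f₂ (q.1, h q)) ∧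
      ∃ r > 0, ∀ ε y y₂ y₃ : ℝ, |ε| < r → |y - a| < r → |y₂ - b| < r → |y₃ - c| < r →
        g₁ (ε, y₂) = f₁ (ε, y) → g₂ (ε, y₃) = f₂ (ε, y₂) → y₃ = P (ε, y) := by
  obtain ⟨h, hh, hb, he, hu⟩ := exists_analytic_implicit hf₁ hg₁ h₁ hd₁ hne₁
  obtain ⟨k, hk, hc, ke, ku⟩ := exists_analytic_implicit hf₂ hg₂ h₂ hd₂ hne₂
  have hpair : AnalyticAt ℝ (fun q : ℝ × ℝ => (q.1, h q)) (0, a) := analyticAt_fst.prod hh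
  have hlim : Tendsto (fun q : ℝ × ℝ => (q.1, h q)) (𝓝 (0, a)) (𝓝 (0, b)) := by
    have := hpair.continuousAt.tendsto
    rwa [hb] at this
  refine ⟨h, fun q => k (q.1, h q), hh, ?_, hb, by simp only [hb, hc], ?_, ?_⟩
  · exact AnalyticAt.fun_comp (g := k) (f := fun q : ℝ × ℝ => (q.1, h q)) (by simpa only [hb]) hpair
  · filter_upwards [he, hlim.eventually ke] with q h1 h2 using ⟨h1, h2⟩
  · obtain ⟨r₁, hr₁, hu⟩ := Metric.eventually_nhds_iff.1 hu
    obtain ⟨r₂, hr₂, ku⟩ := Metric.eventually_nhds_iff.1 ku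
    refine ⟨min r₁ r₂, lt_min hr₁ hr₂, fun ε y y₂ y₃ h1 h2 h3 h4 h5 h6 => ?_⟩
    rw [lt_min_iff] at h1 h2 h3 h4
    have e1 := hu (y := ((ε, y), y₂)) (by
      simp only [Prod.dist_eq, Real.dist_eq, max_lt_iff, sub_zero]
      exact ⟨⟨h1.1, h2.1⟩, h3.1⟩) h5
    have e2 := ku (y := ((ε, y₂), y₃)) (by
      simp only [Prod.dist_eq, Real.dist_eq, max_lt_iff, sub_zero]
      exact ⟨⟨h1.2, h3.2⟩, h4.2⟩) h6
    simp only at e1 e2 ⊢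
    rw [e2, e1]

section analytic

lemma Outer.analyticAt_F {O : Outer} {z : ℝ} (h1 : z < O.S) (h2 : -O.S < z) :
    AnalyticAt ℝ (fun q : ℝ × ℝ => O.F q.1 q.2) (0, z) := by
  have e1 : O.S - z ≠ 0 := by linarith
  have e2 : O.S + z ≠ 0 := by linarith
  refine ContDiffAt.analyticAt ?_
  unfold Outer.F
  fun_prop (disch := simpa)

lemma Outer.analyticAt_F_neg {O : Outer} {z : ℝ} (h1 : z < O.S) (h2 : -O.S < z) :
    AnalyticAt ℝ (fun q : ℝ × ℝ => O.F q.1 (-q.2)) (0, z) := by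
  have e1 : O.S - z ≠ 0 := by linarith
  have e2 : O.S + z ≠ 0 := by linarith
  refine ContDiffAt.analyticAt ?_
  unfold Outer.F
  fun_prop (disch := simpa [← sub_eq_add_neg])

lemma analyticAt_spiral (M : NF) (σ m : ℝ) {z : ℝ} (hz : z ≠ 0) :
    AnalyticAt ℝ (fun q : ℝ × ℝ => spiral (σ * M.κ q.1) m q.2) (0, z) := by
  have h1 : m ^ 2 + z ^ 2 ≠ 0 := by positivity
  have h2 : ContDiffAt ℝ ⊤ (fun q : ℝ × ℝ => m / q.2) (0, z) := by
    fun_prop (disch := simpa)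
  have h3 : ContDiffAt ℝ ⊤ (fun q : ℝ × ℝ => Real.arctan (m / q.2)) (0, z) :=
    Real.contDiff_arctan.contDiffAt.fun_comp (0, z) h2
  refine ContDiffAt.analyticAt ?_
  unfold spiral ang NF.κ
  fun_prop (disch := simpa)

lemma hasDerivAt_ang (m : ℝ) {y : ℝ} (hy : y ≠ 0) : ∃ a, HasDerivAt (ang m) a y :=
  ⟨_, (((hasDerivAt_const y m).div (hasDerivAt_id y) hy).arctan).const_add _⟩

lemma hasDerivAt_spiral_zero (m : ℝ) {y : ℝ} (hy : y ≠ 0) :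
    HasDerivAt (fun y => spiral 0 m y) (y / (m ^ 2 + y ^ 2)) y := by
  have h1 : m ^ 2 + y ^ 2 ≠ 0 := by positivity
  have := ((((hasDerivAt_pow 2 y).const_add (m ^ 2)).log h1).div_const 2)
  simp only [spiral, zero_mul, sub_zero]
  refine this.congr_deriv ?_
  field_simp; simp [mul_comm]

lemma Outer.hasDerivAt_F_neg_zero (O : Outer) {y : ℝ} (h1 : y < O.S) (h2 : -O.S < y) :
    HasDerivAt (fun y => O.F 0 (-y)) (-(2 * y) / (O.S ^ 2 - y ^ 2)) y := by
  have e1 : O.S - y ≠ 0 := by linarith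
  have e2 : O.S + y ≠ 0 := by linarith
  have e3 : O.S ^ 2 - y ^ 2 ≠ 0 := by
    rw [show O.S ^ 2 - y ^ 2 = (O.S - y) * (O.S + y) by ring]; positivity
  have := (((hasDerivAt_id y).const_add O.S).log e2).add (((hasDerivAt_id y).const_sub O.S).log e1)
  simp only [F, sub_neg_eq_add, zero_mul, add_zero, one_mul, sub_zero, ← sub_eq_add_neg]
  refine this.congr_deriv ?_
  simp only [id]
  rw [show O.S ^ 2 - y ^ 2 = (O.S - y) * (O.S + y) by ring]
  field_simp; ring

end analytic

/-- The first order displacement of the passage through an outer zone. -/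
noncomputable def Outer.mel (O : Outer) (y : ℝ) : ℝ :=
  O.d * ((O.S ^ 2 - y ^ 2) / 2 * (Real.log (O.S + y) - Real.log (O.S - y))) + O.s * y

/-- For `ε = 0` the first integral is `log (S² - y²)`, which is even: the unperturbed passage
reverses the height. -/
lemma Outer.F_zero_neg (O : Outer) (y : ℝ) : O.F 0 (-y) = O.F 0 y := by
  simp only [F]; simp only [sub_neg_eq_add, zero_mul, add_zero, one_mul, sub_zero]
  rw [← sub_eq_add_neg, add_comm]

lemma Outer.hasDerivAt_F (O : Outer) {Y : ℝ → ℝ} {y a : ℝ} (hY : HasDerivAt Y a 0) (h0 : Y 0 = y)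
    (h1 : y < O.S) (h2 : -O.S < y) : HasDerivAt (fun ε => O.F ε (Y ε))
      (-a / (O.S - y) + (O.d * Real.log (O.S + y) + (a - O.s) / (O.S + y))) 0 := by
  subst h0
  have e1 : O.S - Y 0 ≠ 0 := by linarith
  have e2 : O.S + Y 0 - 0 * O.s ≠ 0 := by rw [zero_mul]; linarith
  have := ((hY.const_sub O.S).log e1).add
    ((((hasDerivAt_id (0 : ℝ)).mul_const O.d).const_add 1).mul
      (((hY.const_add O.S).sub ((hasDerivAt_id (0 : ℝ)).mul_const O.s)).log e2))
  refine this.congr_deriv ?_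
  simp

/-- Differentiating the relation in `ε` and multiplying by `(S² - y²)/2` gives the change of `y²/2`.
This normalisation makes the contributions of successive zones simply add up. -/
lemma Outer.deriv_rel (O : Outer) {Y₁ Y₂ : ℝ → ℝ} {y a b : ℝ} (hy : 0 < y) (hS : y < O.S)
    (hY₁ : HasDerivAt Y₁ a 0) (hY₂ : HasDerivAt Y₂ b 0) (h₁ : Y₁ 0 = y) (h₂ : Y₂ 0 = y)
    (h : ∀ᶠ ε in 𝓝 (0 : ℝ), O.F ε (Y₁ ε) = O.F ε (-Y₂ ε)) :
    y * b - y * a = -O.mel y := by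
  have d1 := O.hasDerivAt_F hY₁ h₁ hS (by linarith)
  have d2 := O.hasDerivAt_F (Y := fun ε => -Y₂ ε) (y := -y) hY₂.neg (by simp [h₂]) (by linarith)
    (by linarith)
  have := (d2.congr_of_eventuallyEq h).unique d1
  have e1 : O.S - y ≠ 0 := by linarith
  have e2 : O.S + y ≠ 0 := by linarith
  simp only [sub_neg_eq_add, ← sub_eq_add_neg, neg_neg] at this
  rw [mel]
  field_simp at this
  field_simp
  linear_combination (-1) * this

/-- Since `κ` vanishes at `ε = 0`, the variation of the angle does not contribute; only the
derivative of `κ` times the angle does. The change of half the squared height is thus `dC/ω` times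
the squared radius times the swept angle. The factors `σ` are the signs of the angles, negative on
the lower half plane. -/
lemma deriv_spiral_rel (M : NF) {σ₁ σ₂ m₁ m₂ : ℝ} {Y₁ Y₂ : ℝ → ℝ} {y₁ y₂ a b : ℝ} (hy₁ : 0 < y₁)
    (hy₂ : 0 < y₂) (hm : m₁ ^ 2 + y₁ ^ 2 = m₂ ^ 2 + y₂ ^ 2)
    (hY₁ : HasDerivAt Y₁ a 0) (hY₂ : HasDerivAt Y₂ b 0) (h₁ : Y₁ 0 = y₁) (h₂ : Y₂ 0 = y₂)
    (h : ∀ᶠ ε in 𝓝 (0 : ℝ),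
      spiral (σ₁ * M.κ ε) m₁ (Y₁ ε) = spiral (σ₂ * M.κ ε) m₂ (Y₂ ε)) :
    y₂ * b - y₁ * a =
      M.dC / M.ω * (m₁ ^ 2 + y₁ ^ 2) * (σ₂ * ang m₂ y₂ - σ₁ * ang m₁ y₁) := by
  have key : ∀ {σ m : ℝ} {Y : ℝ → ℝ} {y a : ℝ}, 0 < y → HasDerivAt Y a 0 → Y 0 = y →
      HasDerivAt (fun ε => spiral (σ * M.κ ε) m (Y ε))
        (y * a / (m ^ 2 + y ^ 2) - σ * (M.dC / M.ω) * ang m y) 0 := by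
    intro σ m Y y a hy hY h0
    subst h0
    obtain ⟨a', ha'⟩ := hasDerivAt_ang m hy.ne'
    have d1 : HasDerivAt (fun ε => ang m (Y ε)) (a' * a) 0 := ha'.comp 0 hY
    have d2 : HasDerivAt (fun ε => σ * M.κ ε) (σ * (M.dC / M.ω)) 0 := by
      have := (((hasDerivAt_id (0 : ℝ)).mul_const M.dC).div_const M.ω).const_mul σ
      exact this.congr_deriv (by simp)
    have h1 : m ^ 2 + Y 0 ^ 2 ≠ 0 := by positivity
    have d3 := ((((hY.pow 2).const_add (m ^ 2)).log h1).div_const 2).sub (d2.mul d1)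
    refine d3.congr_deriv ?_
    simp [NF.κ]
    field_simp
  have := ((key (σ := σ₂) (m := m₂) hy₂ hY₂ h₂).congr_of_eventuallyEq h).unique (key hy₁ hY₁ h₁)
  rw [← hm] at this
  have hne : m₁ ^ 2 + y₁ ^ 2 ≠ 0 := by positivity
  have hω := M.ω_pos.ne'
  field_simp at this
  field_simp
  linear_combination this

/-! ### Half returns and loops: relations, first order terms, return maps -/

namespace NF

variable (M : NF)

/-- The point reflection of the normal form. -/
def refl : NF := ⟨-M.p, M.ω, M.dC, M.L, M.R, M.ω_pos⟩

lemma refl_sys (ε : ℝ) : M.refl.sys ε = (M.sys ε).neg := by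
  simp only [sys, PWField.neg, negField_negField, refl]
  congr 1
  funext q
  simp only [central, negField, Prod.fst_neg, Prod.snd_neg, Prod.neg_mk]
  ext
  · simp only; ring
  · simp only; ring

lemma refl_c : M.refl.c = M.e := by simp [c, e, refl]

lemma refl_e : M.refl.e = M.c := by simp only [c, e, refl]; ring

lemma refl_κ (ε : ℝ) : M.refl.κ ε = M.κ ε := rfl

/-- The heights of a half return from `(1, y)` through `(1, -y₂)` to `(-1, -y₃)`. -/
def HalfRel (ε y y₂ y₃ : ℝ) : Prop :=
  M.R.F ε y = M.R.F ε (-y₂) ∧ spiral (-1 * M.κ ε) M.c y₂ = spiral (-1 * M.κ ε) (-M.e) y₃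

/-- The heights of a return from `(1, y)` through `(1, -y₂)` to `(1, y₃)`. -/
def LoopRel (ε y y₂ y₃ : ℝ) : Prop :=
  M.R.F ε y = M.R.F ε (-y₂) ∧ spiral (-1 * M.κ ε) M.c y₂ = spiral (1 * M.κ ε) M.c y₃

variable {M}

/-- The angle swept by half a return. -/
noncomputable def sweep (M : NF) (y y' : ℝ) : ℝ := ang M.c y - ang (-M.e) y'

/-- The changes of `y²/2` in the outer and in the central passage are added; the intermediate height
drops out. -/
lemma halfRel_deriv {Y₁ Y₂ Y₃ : ℝ → ℝ} {y δ a b b' : ℝ} (hy : 0 < y) (hS : y < M.R.S) (hδ : 0 < δ)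
    (hr : M.c ^ 2 + y ^ 2 = M.e ^ 2 + δ ^ 2)
    (hY₁ : HasDerivAt Y₁ a 0) (hY₂ : HasDerivAt Y₂ b 0) (hY₃ : HasDerivAt Y₃ b' 0)
    (h₁ : Y₁ 0 = y) (h₂ : Y₂ 0 = y) (h₃ : Y₃ 0 = δ)
    (h : ∀ᶠ ε in 𝓝 (0 : ℝ), M.HalfRel ε (Y₁ ε) (Y₂ ε) (Y₃ ε)) :
    δ * b' - y * a = -M.R.mel y + M.dC / M.ω * (M.c ^ 2 + y ^ 2) * M.sweep y δ := by
  have e1 := M.R.deriv_rel hy hS hY₁ hY₂ h₁ h₂ (h.mono fun ε h => h.1)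
  have e2 := deriv_spiral_rel M (m₁ := M.c) (m₂ := -M.e) hy hδ (by rw [neg_sq, hr]) hY₂ hY₃ h₂ h₃
    (h.mono fun ε h => h.2)
  rw [sweep]
  linear_combination e1 + e2

lemma loopRel_deriv {Y₁ Y₂ Y₃ : ℝ → ℝ} {y a b b' : ℝ} (hy : 0 < y) (hS : y < M.R.S)
    (hY₁ : HasDerivAt Y₁ a 0) (hY₂ : HasDerivAt Y₂ b 0) (hY₃ : HasDerivAt Y₃ b' 0)
    (h₁ : Y₁ 0 = y) (h₂ : Y₂ 0 = y) (h₃ : Y₃ 0 = y)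
    (h : ∀ᶠ ε in 𝓝 (0 : ℝ), M.LoopRel ε (Y₁ ε) (Y₂ ε) (Y₃ ε)) :
    y * b' - y * a = -M.R.mel y + 2 * (M.dC / M.ω) * (M.c ^ 2 + y ^ 2) * ang M.c y := by
  have e1 := M.R.deriv_rel hy hS hY₁ hY₂ h₁ h₂ (h.mono fun ε h => h.1)
  have e2 := deriv_spiral_rel M (m₁ := M.c) (m₂ := M.c) hy hy rfl hY₂ hY₃ h₂ h₃
    (h.mono fun ε h => h.2)
  linear_combination e1 + e2

lemma spiral_zero_inj {m₁ m₂ y₁ y₂ : ℝ} (h1 : 0 < y₁) (h2 : 0 < y₂)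
    (h : spiral 0 m₁ y₁ = spiral 0 m₂ y₂) : m₁ ^ 2 + y₁ ^ 2 = m₂ ^ 2 + y₂ ^ 2 := by
  simp only [spiral, zero_mul, sub_zero] at h
  exact Real.log_injOn_pos (mem_Ioi.2 (by positivity)) (mem_Ioi.2 (by positivity))
    (by linarith)

lemma κ_zero : M.κ 0 = 0 := by simp [κ]

/-- The half-return map. -/
lemma exists_half_map {z δ : ℝ} (hz : 0 < z) (hS : z < M.R.S) (hδ : 0 < δ)
    (hr : M.c ^ 2 + z ^ 2 = M.e ^ 2 + δ ^ 2) :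
    ∃ h P : ℝ × ℝ → ℝ, AnalyticAt ℝ h (0, z) ∧ AnalyticAt ℝ P (0, z) ∧ h (0, z) = z ∧
      P (0, z) = δ ∧ (∀ᶠ q in 𝓝 ((0, z) : ℝ × ℝ), M.HalfRel q.1 q.2 (h q) (P q)) ∧
      ∃ r > 0, ∀ ε y y₂ y₃ : ℝ, |ε| < r → |y - z| < r → |y₂ - z| < r → |y₃ - δ| < r →
        M.HalfRel ε y y₂ y₃ → y₃ = P (ε, y) := by
  have hz2 : 0 < M.R.S ^ 2 - z ^ 2 := by nlinarith
  obtain ⟨h, P, ha, hP, h0, P0, hrel, r, hr, hu⟩ := exists_implicit_pair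
    (f₁ := fun q => M.R.F q.1 q.2) (g₁ := fun q => M.R.F q.1 (-q.2)) (a := z) (b := z) (c := δ)
    (f₂ := fun q => spiral (-1 * M.κ q.1) M.c q.2)
    (g₂ := fun q => spiral (-1 * M.κ q.1) (-M.e) q.2)
    (g₁' := -(2 * z) / (M.R.S ^ 2 - z ^ 2)) (g₂' := δ / ((-M.e) ^ 2 + δ ^ 2))
    (Outer.analyticAt_F hS (by linarith)) (Outer.analyticAt_F_neg hS (by linarith))
    (Outer.F_zero_neg _ _).symm (Outer.hasDerivAt_F_neg_zero _ hS (by linarith))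
    (div_ne_zero (by linarith) hz2.ne')
    (analyticAt_spiral M _ _ hz.ne') (analyticAt_spiral M _ _ hδ.ne')
    (by simp only [κ_zero, mul_zero, spiral, zero_mul, sub_zero, neg_sq, hr])
    (by simpa only [κ_zero, mul_zero] using hasDerivAt_spiral_zero (-M.e) hδ.ne')
    (by positivity)
  exact ⟨h, P, ha, hP, h0, P0, hrel.mono fun q hq => ⟨hq.1.symm, hq.2.symm⟩, r, hr,
    fun ε y y₂ y₃ h1 h2 h3 h4 h5 => hu ε y y₂ y₃ h1 h2 h3 h4 h5.1.symm h5.2.symm⟩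

/-- The return map of loops through the right zone. -/
lemma exists_loop_map {z : ℝ} (hz : 0 < z) (hS : z < M.R.S) :
    ∃ h P : ℝ × ℝ → ℝ, AnalyticAt ℝ h (0, z) ∧ AnalyticAt ℝ P (0, z) ∧ h (0, z) = z ∧
      P (0, z) = z ∧ (∀ᶠ q in 𝓝 ((0, z) : ℝ × ℝ), M.LoopRel q.1 q.2 (h q) (P q)) ∧
      ∃ r > 0, ∀ ε y y₂ y₃ : ℝ, |ε| < r → |y - z| < r → |y₂ - z| < r → |y₃ - z| < r →
        M.LoopRel ε y y₂ y₃ → y₃ = P (ε, y) := by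
  have hz2 : 0 < M.R.S ^ 2 - z ^ 2 := by nlinarith
  obtain ⟨h, P, ha, hP, h0, P0, hrel, r, hr, hu⟩ := exists_implicit_pair
    (f₁ := fun q => M.R.F q.1 q.2) (g₁ := fun q => M.R.F q.1 (-q.2)) (a := z) (b := z) (c := z)
    (f₂ := fun q => spiral (-1 * M.κ q.1) M.c q.2)
    (g₂ := fun q => spiral (1 * M.κ q.1) M.c q.2)
    (g₁' := -(2 * z) / (M.R.S ^ 2 - z ^ 2)) (g₂' := z / (M.c ^ 2 + z ^ 2))
    (Outer.analyticAt_F hS (by linarith)) (Outer.analyticAt_F_neg hS (by linarith))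
    (Outer.F_zero_neg _ _).symm (Outer.hasDerivAt_F_neg_zero _ hS (by linarith))
    (div_ne_zero (by linarith) hz2.ne')
    (analyticAt_spiral M _ _ hz.ne') (analyticAt_spiral M _ _ hz.ne')
    (by simp only [κ_zero, mul_zero])
    (by simpa only [κ_zero, mul_zero] using hasDerivAt_spiral_zero M.c hz.ne')
    (by positivity)
  exact ⟨h, P, ha, hP, h0, P0, hrel.mono fun q hq => ⟨hq.1.symm, hq.2.symm⟩, r, hr,
    fun ε y y₂ y₃ h1 h2 h3 h4 h5 => hu ε y y₂ y₃ h1 h2 h3 h4 h5.1.symm h5.2.symm⟩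

/-- On the unperturbed outer zone heights are preserved. -/
lemma _root_.PWHam.Outer.eq_of_F_zero {O : Outer} {y y₂ : ℝ} (h1 : 0 < y) (h2 : y < O.S)
    (h3 : 0 < y₂) (h4 : y₂ < O.S) (h : O.F 0 y = O.F 0 (-y₂)) : y₂ = y := by
  rw [O.F_zero_neg] at h
  simp only [Outer.F, zero_mul, add_zero, one_mul, sub_zero] at h
  rw [← Real.log_mul (by linarith) (by linarith), ← Real.log_mul (by linarith) (by linarith)] at h
  have := Real.log_injOn_pos (mem_Ioi.2 (by nlinarith)) (mem_Ioi.2 (by nlinarith)) h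
  nlinarith

end NF

end PWHam

namespace PWHam

/-! ### Admissible heights and the arcs of the orbits -/

/-- Conditions on a height `y > 0` under which the points `(1, ± y)` are crossing points below the
separatrices of an outer zone; `g` is the first order velocity of the central zone. -/
structure Outer.Good (O : Outer) (g ε y : ℝ) : Prop where
  pos : 0 < y
  lt : y < O.S
  d_pos : 0 < 1 + ε * O.d
  s_pos : 0 < O.S + y - ε * O.s
  s_pos' : 0 < O.S - y - ε * O.s
  central_pos : 0 < y + ε * g
  central_neg : -y + ε * g < 0
  outer_pos : 0 < 2 * y + ε * (O.d * (y - O.S) - O.s)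
  outer_neg : 2 * (-y) + ε * (O.d * (-y - O.S) - O.s) < 0

lemma Outer.Good.eventually {O : Outer} {g z : ℝ} (hz : 0 < z) (hS : z < O.S) :
    ∀ᶠ q in 𝓝 ((0, z) : ℝ × ℝ), O.Good g q.1 q.2 := by
  have key : ∀ f : ℝ × ℝ → ℝ, Continuous f → 0 < f (0, z) → ∀ᶠ q in 𝓝 ((0, z) : ℝ × ℝ), 0 < f q :=
    fun f hf h => hf.continuousAt.eventually_const_lt h
  filter_upwards [key (fun q => q.2) (by fun_prop) hz,
    key (fun q => O.S - q.2) (by fun_prop) (by simpa),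
    key (fun q => 1 + q.1 * O.d) (by fun_prop) (by simp),
    key (fun q => O.S + q.2 - q.1 * O.s) (by fun_prop) (by simp only [zero_mul]; linarith),
    key (fun q => O.S - q.2 - q.1 * O.s) (by fun_prop) (by simpa),
    key (fun q => q.2 + q.1 * g) (by fun_prop) (by simpa),
    key (fun q => q.2 - q.1 * g) (by fun_prop) (by simpa),
    key (fun q => 2 * q.2 + q.1 * (O.d * (q.2 - O.S) - O.s)) (by fun_prop) (by simpa),
    key (fun q => 2 * q.2 - q.1 * (O.d * (-q.2 - O.S) - O.s)) (by fun_prop) (by simpa)]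
    with q h1 h2 h3 h4 h5 h6 h7 h8 h9
  exact ⟨h1, by linarith, h3, h4, h5, h6, by linarith, h8, by linarith⟩

namespace NF

variable {M : NF} {ε τ : ℝ}

/-- Admissible heights on the line `x = 1`. -/
structure Good (M : NF) (τ ε y : ℝ) : Prop where
  outer : M.R.Good (M.dC * (1 - M.p)) ε y
  -- Keeps the angle of the point at distance at least `|arctan κ|` from `±π`, so that central arcs
  -- stay in the angular range where the abscissa is controlled by the monotonicity of `exp (κ θ)
  -- cos θ`.
  arg_le : |Real.arctan (M.κ ε)| ≤ Real.pi - ang M.c y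
  -- A lower arc from `x = 1` to `x = -1` must start at the smaller angle, that is `-e / y₃ < c /
  -- y₂`. A threshold `τ` between the two quotients makes this a separate open condition on each
  -- height.
  slope : τ < M.c / y

lemma Good.eventually {z : ℝ} (hz : 0 < z) (hS : z < M.R.S) (hτ : τ < M.c / z) :
    ∀ᶠ q in 𝓝 ((0, z) : ℝ × ℝ), M.Good τ q.1 q.2 := by
  have c1 : ContinuousAt (fun q : ℝ × ℝ => M.c / q.2) (0, z) := by
    fun_prop (disch := simpa using hz.ne')
  have c2 : ContinuousAt (fun q : ℝ × ℝ => Real.arctan (M.c / q.2)) (0, z) :=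
    ContinuousAt.comp (g := Real.arctan) (f := fun q : ℝ × ℝ => M.c / q.2)
      Real.continuous_arctan.continuousAt c1
  have c3 : ContinuousAt (fun q : ℝ × ℝ => Real.arctan (M.κ q.1)) (0, z) :=
    ContinuousAt.comp (g := Real.arctan) (f := fun q : ℝ × ℝ => M.κ q.1)
      Real.continuous_arctan.continuousAt (by unfold κ; fun_prop)
  have c4 : ContinuousAt (fun q : ℝ × ℝ => Real.pi - ang M.c q.2 - |Real.arctan (M.κ q.1)|)
      (0, z) := by
    unfold ang; fun_prop
  filter_upwards [Outer.Good.eventually hz hS, c1.eventually_const_lt hτ,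
    c4.eventually_const_lt (u := 0) (by simpa [κ] using ang_lt_pi M.c z)] with q h1 h2 h3
  exact ⟨h1, by linarith, h2⟩

lemma Good.crossing {y : ℝ} (h : M.Good τ ε y) : IsCrossingPoint (M.sys ε) (1, y) ∧
    IsCrossingPoint (M.sys ε) (1, -y) ∧ 0 < ((M.sys ε).central (1, y)).1 ∧
    ((M.sys ε).central (1, -y)).1 < 0 := by
  obtain ⟨h, -, -⟩ := h
  have c1 : 0 < ((M.sys ε).central (1, y)).1 := by
    have := h.central_pos; simp only [sys, central]; linarith
  have c2 : ((M.sys ε).central (1, -y)).1 < 0 := by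
    have := h.central_neg; simp only [sys, central]; linarith
  have hk : 0 < M.R.lam / (2 * M.R.k) := div_pos M.R.lam_pos (by linarith [M.R.k_pos])
  refine ⟨Or.inr ⟨rfl, mul_pos c1 ?_⟩, Or.inr ⟨rfl, mul_pos_of_neg_of_neg c2 ?_⟩, c1, c2⟩
  · simp only [sys, Outer.field_fst_one]; exact mul_pos hk h.outer_pos
  · simp only [sys, Outer.field_fst_one]; exact mul_neg_of_pos_of_neg hk h.outer_neg

lemma Good.crossing_refl {y : ℝ} (h : M.refl.Good τ ε y) : IsCrossingPoint (M.sys ε) (-1, -y) ∧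
    IsCrossingPoint (M.sys ε) (-1, y) ∧ ((M.sys ε).central (-1, -y)).1 < 0 ∧
    0 < ((M.sys ε).central (-1, y)).1 := by
  obtain ⟨h1, h2, h3, h4⟩ := h.crossing
  rw [refl_sys] at h1 h2 h3 h4
  have e : ∀ a : ℝ, ((-1, a) : ℝ × ℝ) = -(1, -a) := fun a => by simp
  have h1 := h1.neg
  have h2 := h2.neg
  rw [PWField.neg_neg] at h1 h2
  simp only [PWField.neg, negField, Prod.fst_neg] at h3 h4
  simp only [Prod.neg_mk, neg_neg] at h1 h2 h3 h4
  exact ⟨h1, h2, by linarith, by linarith⟩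

/-- The trajectory of the right zone from `(1, y)` to `(1, -y₂)`, over the unit interval. -/
noncomputable def outerArc (M : NF) (ε y y₂ s : ℝ) : ℝ × ℝ :=
  M.R.path ε y (M.R.time ε y y₂ * s)

/-- The trajectory of the central zone from `(1, -y₂)` to `(-1, -y₃)`, over the unit interval. -/
noncomputable def lowerArc (M : NF) (ε y₂ y₃ s : ℝ) : ℝ × ℝ :=
  M.path ε √(M.c ^ 2 + y₂ ^ 2) (-ang M.c y₂) ((-ang (-M.e) y₃ - -ang M.c y₂) / M.ω * s)

/-- The trajectory of the central zone from `(1, -y₂)` to `(1, y₃)`, over the unit interval. -/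
noncomputable def loopArc (M : NF) (ε y₂ y₃ s : ℝ) : ℝ × ℝ :=
  M.path ε √(M.c ^ 2 + y₂ ^ 2) (-ang M.c y₂) ((ang M.c y₃ - -ang M.c y₂) / M.ω * s)

/-- All arcs are parametrised over `[0, 1]`, so that Hausdorff convergence follows from joint
continuity on a compact interval although the passage times vary. -/
lemma image_unit {γ : ℝ → ℝ × ℝ} {T : ℝ} (hT : 0 ≤ T) :
    (fun s => γ (T * s)) '' Icc 0 1 = γ '' Icc 0 T := by
  rw [← image_image γ (fun s => T * s), image_mul_left_Icc hT zero_le_one, mul_zero, mul_one]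

lemma outerArc_isArc {y y₂ : ℝ} (h : M.Good τ ε y) (h₂ : M.Good τ ε y₂)
    (hF : M.R.F ε y = M.R.F ε (-y₂)) :
    IsArc (M.sys ε) (M.R.path ε y) (M.R.time ε y y₂) ∧ M.R.path ε y 0 = (1, y) ∧
      M.R.path ε y (M.R.time ε y y₂) = (1, -y₂) ∧
      M.R.path ε y '' Icc 0 (M.R.time ε y y₂) = M.outerArc ε y y₂ '' Icc 0 1 ∧
      ∀ t ∈ Icc 0 (M.R.time ε y y₂), 1 < (M.R.path ε y t).1 ∨ M.R.path ε y t = (1, y) ∨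
        M.R.path ε y t = (1, -y₂) := by
  have hS : 0 < M.R.S + y₂ := by linarith [h₂.outer.pos, h₂.outer.lt]
  have hT := Outer.path_time h.outer.lt hS h.outer.d_pos h.outer.s_pos h₂.outer.s_pos' hF
  have harc := Outer.isArc (X := M.sys ε) rfl h.outer.lt hS (add_pos h.outer.pos h₂.outer.pos)
    h.outer.d_pos h.outer.s_pos h₂.outer.s_pos' hF h.crossing.1 h₂.crossing.2.1
    h.crossing.2.2.1 h₂.crossing.2.2.2
  refine ⟨harc, Outer.path_zero y, hT, (image_unit harc.pos.le).symm, fun t ht => ?_⟩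
  rcases eq_or_lt_of_le ht.1 with rfl | h1
  · exact Or.inr (Or.inl (Outer.path_zero y))
  rcases eq_or_lt_of_le ht.2 with rfl | h2
  · exact Or.inr (Or.inr hT)
  exact Or.inl (Outer.one_lt_path h.outer.lt h.outer.d_pos h.outer.s_pos (by rw [hT]) ⟨h1, h2⟩)

lemma ang_neg (m y : ℝ) : ang (-m) y = Real.pi - ang m y := by
  simp only [ang, neg_div, Real.arctan_neg]; ring

lemma log_sqrt_sub (κ : ℝ) {m y : ℝ} (σ : ℝ) :
    Real.log √(m ^ 2 + y ^ 2) - κ * (σ * ang m y) = spiral (σ * κ) m y := by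
  rw [Real.log_sqrt (by positivity), spiral]; ring

/-- The angles of the arc lie between `arctan κ - π` and `arctan κ`, where `exp (κ θ) cos θ`
increases. The abscissa therefore decreases from 1 to -1 and the arc stays strictly between the
lines. -/
lemma lowerArc_isArc {y₂ y₃ : ℝ} (h₂ : M.Good τ ε y₂) (h₃ : M.refl.Good (-τ) ε y₃)
    (hs : spiral (-1 * M.κ ε) M.c y₂ = spiral (-1 * M.κ ε) (-M.e) y₃) :
    ∃ γ T, IsArc (M.sys ε) γ T ∧ γ 0 = (1, -y₂) ∧ γ T = (-1, -y₃) ∧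
      γ '' Icc 0 T = M.lowerArc ε y₂ y₃ '' Icc 0 1 ∧
      ∀ t ∈ Icc 0 T, (γ t).2 < 0 ∧ ((-1 < (γ t).1 ∧ (γ t).1 < 1) ∨ γ t = (1, -y₂) ∨
        γ t = (-1, -y₃)) := by
  have hω := M.ω_pos
  have hy₂ := h₂.outer.pos
  have hy₃ := h₃.outer.pos
  have e0 := M.polar_one_neg hy₂
  have e1 := M.polar_neg_one_neg hy₃
  have a2 := h₂.arg_le
  have a3 := h₃.arg_le
  rw [refl_c, ← ang_neg, refl_κ] at a3
  have s2 := h₂.slope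
  have s3 := h₃.slope
  rw [refl_c] at s3
  -- The two slope conditions separate the quotients by `τ`, and the arctangent preserves the order.
  have hφ : -ang M.c y₂ < -ang (-M.e) y₃ := by
    rw [neg_lt_neg_iff]
    unfold ang
    have : Real.arctan (-M.e / y₃) < Real.arctan (M.c / y₂) := by
      apply Real.arctan_strictMono
      rw [neg_div]; linarith
    linarith
  have hρ₂ : 0 < √(M.c ^ 2 + y₂ ^ 2) := Real.sqrt_pos.2 (by positivity)
  have hρ₃ : 0 < √((-M.e) ^ 2 + y₃ ^ 2) := Real.sqrt_pos.2 (by positivity)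
  have hlog : Real.log √((-M.e) ^ 2 + y₃ ^ 2) - M.κ ε * -ang (-M.e) y₃ =
      Real.log √(M.c ^ 2 + y₂ ^ 2) - M.κ ε * -ang M.c y₂ := by
    have l2 := log_sqrt_sub (M.κ ε) (m := M.c) (y := y₂) (-1)
    have l3 := log_sqrt_sub (M.κ ε) (m := -M.e) (y := y₃) (-1)
    rw [neg_one_mul] at l2 l3
    rw [l2, l3, hs]
  have k1 := le_abs_self (Real.arctan (M.κ ε))
  have k2 := neg_abs_le (Real.arctan (M.κ ε))
  have hT : 0 < (-ang (-M.e) y₃ - -ang M.c y₂) / M.ω := div_pos (by linarith) hω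
  have hend := path_end hρ₂ hρ₃ hlog
  have hint : ∀ t ∈ Ioo 0 ((-ang (-M.e) y₃ - -ang M.c y₂) / M.ω),
      -1 < (M.path ε √(M.c ^ 2 + y₂ ^ 2) (-ang M.c y₂) t).1 ∧
        (M.path ε √(M.c ^ 2 + y₂ ^ 2) (-ang M.c y₂) t).1 < 1 := by
    intro t ht
    have b1 := path_strictAnti (M := M) (ε := ε) hρ₂ (φ₀ := -ang M.c y₂) (φ₁ := -ang (-M.e) y₃)
      (by linarith) (by linarith) le_rfl ht.1 ht.2.le
    have b2 := path_strictAnti (M := M) (ε := ε) hρ₂ (φ₀ := -ang M.c y₂) (φ₁ := -ang (-M.e) y₃)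
      (by linarith) (by linarith) ht.1.le ht.2 le_rfl
    rw [path_zero, e0] at b1
    rw [hend, e1] at b2
    exact ⟨b2, b1⟩
  have harc : IsArc (M.sys ε) (M.path ε √(M.c ^ 2 + y₂ ^ 2) (-ang M.c y₂))
      ((-ang (-M.e) y₃ - -ang M.c y₂) / M.ω) := by
    refine isArc_path rfl hφ hρ₂ hρ₃ hlog ?_ ?_ ?_ ?_ hint
    · rw [e0]; exact h₂.crossing.2.1
    · rw [e1]; exact h₃.crossing_refl.1
    · rw [e0]; exact fwdZone_right_neg rfl h₂.crossing.2.2.2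
    · rw [e1]; exact bwdZone_left_neg rfl h₃.crossing_refl.2.2.1
  refine ⟨_, _, harc, by rw [path_zero, e0], by rw [hend, e1], (image_unit hT.le).symm,
    fun t ht => ?_⟩
  rcases eq_or_lt_of_le ht.1 with rfl | t1
  · rw [path_zero, e0]; exact ⟨by simpa, Or.inr (Or.inl rfl)⟩
  rcases eq_or_lt_of_le ht.2 with rfl | t2
  · rw [hend, e1]; exact ⟨by simpa, Or.inr (Or.inr rfl)⟩
  refine ⟨?_, Or.inl (hint t ⟨t1, t2⟩)⟩
  obtain ⟨m1, m2⟩ := mem_time (M := M) ⟨t1, t2⟩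
  simp only [path, polar]
  refine mul_neg_of_pos_of_neg (by positivity) (Real.sin_neg_of_neg_of_neg_pi_lt ?_ ?_)
  · linarith [ang_pos (-M.e) y₃]
  · linarith [ang_lt_pi M.c y₂]

/-- The half orbit from `(1, y)` through `(1, -y₂)` to `(-1, -y₃)`. -/
def halfSet (M : NF) (ε y y₂ y₃ : ℝ) : Set (ℝ × ℝ) :=
  M.outerArc ε y y₂ '' Icc 0 1 ∪ M.lowerArc ε y₂ y₃ '' Icc 0 1

lemma exists_half_arc {y y₂ y₃ : ℝ} (h : M.Good τ ε y) (h₂ : M.Good τ ε y₂)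
    (h₃ : M.refl.Good (-τ) ε y₃) (hr : M.HalfRel ε y y₂ y₃) :
    ∃ γ T, IsArc (M.sys ε) γ T ∧ γ 0 = (1, y) ∧ γ T = (-1, -y₃) ∧
      γ '' Icc 0 T = M.halfSet ε y y₂ y₃ ∧
      (∀ q ∈ M.halfSet ε y y₂ y₃, 1 < q.1 ∨ q = (1, y) ∨ q = (1, -y₂) ∨
        (q.2 < 0 ∧ -1 < q.1 ∧ q.1 < 1) ∨ q = (-1, -y₃)) ∧
      MeetsRight (M.halfSet ε y y₂ y₃) ∧ MeetsCentral (M.halfSet ε y y₂ y₃) := by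
  obtain ⟨a1, a2, a3, a4, a5⟩ := outerArc_isArc h h₂ hr.1
  obtain ⟨γ, T, b1, b2, b3, b4, b5⟩ := lowerArc_isArc h₂ h₃ hr.2
  have hT := a1.pos
  have hT' := b1.pos
  refine ⟨concat (M.R.path ε y) (M.R.time ε y y₂) γ, M.R.time ε y y₂ + T,
    a1.concat b1 (by rw [a3, b2]), ?_, ?_, ?_, ?_, ?_, ?_⟩
  · rw [concat_of_le a1.pos.le, a2]
  · rw [concat_of_ge (by rw [a3, b2]) (by linarith), add_sub_cancel_left, b3]
  · rw [concat_image (by rw [a3, b2]) a1.pos.le b1.pos.le, a4, b4, halfSet]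
  · rintro q (hq | hq)
    · rw [← a4] at hq
      obtain ⟨t, ht, rfl⟩ := hq
      rcases a5 t ht with h | h | h
      · exact Or.inl h
      · exact Or.inr (Or.inl h)
      · exact Or.inr (Or.inr (Or.inl h))
    · rw [← b4] at hq
      obtain ⟨t, ht, rfl⟩ := hq
      obtain ⟨h', h | h | h⟩ := b5 t ht
      · exact Or.inr (Or.inr (Or.inr (Or.inl ⟨h', h⟩)))
      · exact Or.inr (Or.inr (Or.inl h))
      · exact Or.inr (Or.inr (Or.inr (Or.inr h)))
  · refine ⟨M.R.path ε y (M.R.time ε y y₂ / 2), Or.inl ?_, ?_⟩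
    · rw [← a4]; exact ⟨_, ⟨by linarith, by linarith⟩, rfl⟩
    · exact Outer.one_lt_path h.outer.lt h.outer.d_pos h.outer.s_pos (by rw [a3])
        ⟨by linarith, by linarith⟩
  · have hc : ContinuousOn (fun t => (γ t).1) (Icc 0 T) := fun t ht => by
      have : ContinuousWithinAt γ (Icc 0 T) t := by
        rcases eq_or_lt_of_le ht.1 with rfl | t1
        · exact (b1.fwd 0 ⟨le_rfl, hT'⟩).continuousWithinAt.mono Icc_subset_Ici_self
        rcases eq_or_lt_of_le ht.2 with rfl | t2
        · exact (b1.bwd t ⟨t1, le_rfl⟩).continuousWithinAt.mono Icc_subset_Iic_self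
        · have := (b1.bwd t ⟨t1, t2.le⟩).continuousWithinAt.union
            (b1.fwd t ⟨t1.le, t2⟩).continuousWithinAt
          rw [Iic_union_Ici, continuousWithinAt_univ] at this
          exact this.continuousWithinAt
      exact continuous_fst.continuousAt.comp_continuousWithinAt this
    obtain ⟨t, ht, h0⟩ : (0 : ℝ) ∈ (fun t => (γ t).1) '' Icc 0 T :=
      intermediate_value_Icc' hT'.le hc ⟨by simp [b3], by simp [b2]⟩
    simp only at h0
    exact ⟨γ t, Or.inr (by rw [← b4]; exact ⟨t, ht, rfl⟩), by rw [h0]; norm_num,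
      by rw [h0]; norm_num⟩

/-- The orbit through the three zones with the given heights. -/
def threeSet (M : NF) (ε y y₂ y₃ y₄ : ℝ) : Set (ℝ × ℝ) :=
  M.halfSet ε y y₂ y₃ ∪ (fun q => -q) '' M.refl.halfSet ε y₃ y₄ y

/-- The second half of the orbit is a half orbit of the reflected normal form, reflected back. The
list of possible positions is recorded because the isolating neighbourhood must contain the orbit:
it never has height zero in the central strip, and it meets the lines only at the four given points.
-/
theorem threeSet_spec {y y₂ y₃ y₄ : ℝ} (h : M.Good τ ε y) (h₂ : M.Good τ ε y₂)
    (h₃ : M.refl.Good (-τ) ε y₃) (h₄ : M.refl.Good (-τ) ε y₄)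
    (hr : M.HalfRel ε y y₂ y₃) (hr' : M.refl.HalfRel ε y₃ y₄ y) :
    IsCrossingPeriodicOrbit (M.sys ε) (M.threeSet ε y y₂ y₃ y₄) ∧
      ThreeZones (M.threeSet ε y y₂ y₃ y₄) ∧ (1, y) ∈ M.threeSet ε y y₂ y₃ y₄ ∧
      ∀ q ∈ M.threeSet ε y y₂ y₃ y₄, 1 < q.1 ∨ q = (1, y) ∨ q = (1, -y₂) ∨
        (q.2 ≠ 0 ∧ -1 < q.1 ∧ q.1 < 1) ∨ q = (-1, -y₃) ∨ q = (-1, y₄) ∨ q.1 < -1 := by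
  have hM : M.refl.refl = M := by simp [refl]
  obtain ⟨γ, T, a1, a2, a3, a4, a5, a6, a7⟩ := exists_half_arc h h₂ h₃ hr
  obtain ⟨γ', T', b1, b2, b3, b4, b5, b6, b7⟩ := exists_half_arc (M := M.refl) h₃ h₄
    (by rwa [hM, neg_neg]) hr'
  have b1 := b1.neg
  rw [refl_sys, PWField.neg_neg] at b1
  have hj : γ T = (fun t => -γ' t) 0 := by simp only [a3, b2]; simp
  have hc := a1.concat b1 hj
  have him : concat γ T (fun t => -γ' t) '' Icc 0 (T + T') = M.threeSet ε y y₂ y₃ y₄ := by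
    rw [concat_image hj a1.pos.le b1.pos.le, a4, threeSet, ← b4, image_image]
  have h0 : concat γ T (fun t => -γ' t) 0 = (1, y) := by rw [concat_of_le a1.pos.le, a2]
  have hT := a1.pos
  have hT' := b1.pos
  have h1 : concat γ T (fun t => -γ' t) (T + T') = (1, y) := by
    rw [concat_of_ge hj (by linarith), add_sub_cancel_left, b3]; simp
  refine ⟨?_, ⟨?_, ?_, ?_⟩, ?_, ?_⟩
  · rw [← him]
    refine hc.isCrossingPeriodicOrbit (by rw [h1, h0]) ⟨T, ⟨hT.le, by linarith⟩, ?_⟩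
    rw [h0, concat_of_le le_rfl, a3]
    simp only [ne_eq, Prod.mk.injEq, not_and]
    intro h; norm_num at h
  · obtain ⟨q, hq, hq'⟩ := b6
    exact ⟨-q, Or.inr ⟨q, hq, rfl⟩, by rw [Prod.fst_neg]; linarith⟩
  · obtain ⟨q, hq, hq'⟩ := a7
    exact ⟨q, Or.inl hq, hq'⟩
  · obtain ⟨q, hq, hq'⟩ := a6
    exact ⟨q, Or.inl hq, hq'⟩
  · rw [← him]
    exact ⟨0, ⟨le_rfl, by linarith⟩, h0⟩
  · rintro q (hq | ⟨q, hq, rfl⟩)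
    · rcases a5 q hq with h | h | h | h | h
      · exact Or.inl h
      · exact Or.inr (Or.inl h)
      · exact Or.inr (Or.inr (Or.inl h))
      · exact Or.inr (Or.inr (Or.inr (Or.inl ⟨h.1.ne, h.2⟩)))
      · exact Or.inr (Or.inr (Or.inr (Or.inr (Or.inl h))))
    · rcases b5 q hq with h | h | h | h | h
      · exact Or.inr (Or.inr (Or.inr (Or.inr (Or.inr (Or.inr (by rw [Prod.fst_neg]; linarith))))))
      · exact Or.inr (Or.inr (Or.inr (Or.inr (Or.inl (by rw [h]; simp)))))
      · exact Or.inr (Or.inr (Or.inr (Or.inr (Or.inr (Or.inl (by rw [h]; simp))))))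
      · refine Or.inr (Or.inr (Or.inr (Or.inl ⟨?_, ?_, ?_⟩)))
        · rw [Prod.snd_neg]; linarith [h.1]
        · rw [Prod.fst_neg]; linarith [h.2.2]
        · rw [Prod.fst_neg]; linarith [h.2.1]
      · exact Or.inr (Or.inl (by rw [h]; simp))

end NF

end PWHam

namespace PWHam

/-! ### Bifurcation of limit cycles through three zones -/

/-- By compactness of `[0, 1]` pointwise continuity in the parameter becomes uniform in `s`, and
points with equal parameter `s` are matched. -/
lemma tendsto_hausdorffEDist_image_unit {E : Type*} [TopologicalSpace E] {φ : E → ℝ → ℝ × ℝ}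
    {e₀ : E} (h : ∀ s ∈ Icc (0 : ℝ) 1, ContinuousAt (fun q : E × ℝ => φ q.1 q.2) (e₀, s)) :
    Tendsto (fun e => Metric.hausdorffEDist (φ e '' Icc 0 1) (φ e₀ '' Icc 0 1)) (𝓝 e₀) (𝓝 0) := by
  rw [ENNReal.tendsto_nhds_zero]
  intro δ hδ
  have key : ∀ᶠ e in 𝓝 e₀, ∀ s ∈ Icc (0 : ℝ) 1, edist (φ e s) (φ e₀ s) ≤ δ := by
    refine isCompact_Icc.eventually_forall_of_forall_eventually
      (P := fun e s => edist (φ e s) (φ e₀ s) ≤ δ) fun s hs => ?_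
    have h1 := h s hs
    have h2 : ContinuousAt (fun q : E × ℝ => φ e₀ q.2) (e₀, s) :=
      ContinuousAt.comp (g := fun q : E × ℝ => φ q.1 q.2) (f := fun q : E × ℝ => (e₀, q.2)) h1
        (continuousAt_const.prodMk continuousAt_snd)
    have h3 : Tendsto (fun q : E × ℝ => edist (φ q.1 q.2) (φ e₀ q.2)) (𝓝 (e₀, s)) (𝓝 0) := by
      have := h1.tendsto.edist h2.tendsto
      simpa using this
    exact h3.eventually (eventually_le_nhds hδ)
  filter_upwards [key] with e he
  refine Metric.hausdorffEDist_le_of_mem_edist ?_ ?_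
  · rintro _ ⟨s, hs, rfl⟩
    exact ⟨_, ⟨s, hs, rfl⟩, he s hs⟩
  · rintro _ ⟨s, hs, rfl⟩
    exact ⟨_, ⟨s, hs, rfl⟩, by rw [edist_comm]; exact he s hs⟩

lemma tendsto_hausdorffEDist_union {ι : Type*} {l : Filter ι} {A B : ι → Set (ℝ × ℝ)}
    {A₀ B₀ : Set (ℝ × ℝ)} (hA : Tendsto (fun i => Metric.hausdorffEDist (A i) A₀) l (𝓝 0))
    (hB : Tendsto (fun i => Metric.hausdorffEDist (B i) B₀) l (𝓝 0)) :
    Tendsto (fun i => Metric.hausdorffEDist (A i ∪ B i) (A₀ ∪ B₀)) l (𝓝 0) := by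
  have h := hA.max hB
  rw [max_self] at h
  exact tendsto_of_tendsto_of_tendsto_of_le_of_le tendsto_const_nhds h (fun _ => zero_le)
    fun _ => Metric.hausdorffEDist_union_le

namespace NF

variable {M : NF} {ε τ : ℝ}

lemma tendsto_outerArc {z : ℝ} (hz : 0 < z) (hS : z < M.R.S) :
    Tendsto (fun q : ℝ × ℝ × ℝ => Metric.hausdorffEDist (M.outerArc q.1 q.2.1 q.2.2 '' Icc 0 1)
      (M.outerArc 0 z z '' Icc 0 1)) (𝓝 (0, z, z)) (𝓝 0) := by
  refine tendsto_hausdorffEDist_image_unit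
    (φ := fun q : ℝ × ℝ × ℝ => M.outerArc q.1 q.2.1 q.2.2) (e₀ := (0, z, z)) fun s _ => ?_
  have e1 : M.R.S + z ≠ 0 := by linarith
  have e2 : M.R.S - z ≠ 0 := by linarith
  have e3 := M.R.lam_pos.ne'
  have e4 := M.R.k_pos.ne'
  unfold outerArc Outer.path Outer.time
  fun_prop (disch := simp [*])

lemma continuousAt_ang (m : ℝ) {z : ℝ} (hz : z ≠ 0) : ContinuousAt (ang m) z := by
  obtain ⟨a, ha⟩ := hasDerivAt_ang m hz
  exact ha.continuousAt

lemma tendsto_lowerArc {z δ : ℝ} (hz : 0 < z) (hδ : 0 < δ) :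
    Tendsto (fun q : ℝ × ℝ × ℝ => Metric.hausdorffEDist (M.lowerArc q.1 q.2.1 q.2.2 '' Icc 0 1)
      (M.lowerArc 0 z δ '' Icc 0 1)) (𝓝 (0, z, δ)) (𝓝 0) := by
  refine tendsto_hausdorffEDist_image_unit
    (φ := fun q : ℝ × ℝ × ℝ => M.lowerArc q.1 q.2.1 q.2.2) (e₀ := (0, z, δ)) fun s _ => ?_
  have c1 : ContinuousAt (fun q : (ℝ × ℝ × ℝ) × ℝ => ang M.c q.1.2.1) ((0, z, δ), s) :=
    ContinuousAt.comp (g := ang M.c) (f := fun q : (ℝ × ℝ × ℝ) × ℝ => q.1.2.1)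
      (continuousAt_ang _ hz.ne') (by fun_prop)
  have c2 : ContinuousAt (fun q : (ℝ × ℝ × ℝ) × ℝ => ang (-M.e) q.1.2.2) ((0, z, δ), s) :=
    ContinuousAt.comp (g := ang (-M.e)) (f := fun q : (ℝ × ℝ × ℝ) × ℝ => q.1.2.2)
      (continuousAt_ang _ hδ.ne') (by fun_prop)
  have e4 := M.ω_pos.ne'
  unfold lowerArc path polar
  fun_prop (disch := simpa)

lemma tendsto_loopArc {z : ℝ} (hz : 0 < z) :
    Tendsto (fun q : ℝ × ℝ × ℝ => Metric.hausdorffEDist (M.loopArc q.1 q.2.1 q.2.2 '' Icc 0 1)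
      (M.loopArc 0 z z '' Icc 0 1)) (𝓝 (0, z, z)) (𝓝 0) := by
  refine tendsto_hausdorffEDist_image_unit
    (φ := fun q : ℝ × ℝ × ℝ => M.loopArc q.1 q.2.1 q.2.2) (e₀ := (0, z, z)) fun s _ => ?_
  have c1 : ContinuousAt (fun q : (ℝ × ℝ × ℝ) × ℝ => ang M.c q.1.2.1) ((0, z, z), s) :=
    ContinuousAt.comp (g := ang M.c) (f := fun q : (ℝ × ℝ × ℝ) × ℝ => q.1.2.1)
      (continuousAt_ang _ hz.ne') (by fun_prop)
  have c2 : ContinuousAt (fun q : (ℝ × ℝ × ℝ) × ℝ => ang M.c q.1.2.2) ((0, z, z), s) :=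
    ContinuousAt.comp (g := ang M.c) (f := fun q : (ℝ × ℝ × ℝ) × ℝ => q.1.2.2)
      (continuousAt_ang _ hz.ne') (by fun_prop)
  have e4 := M.ω_pos.ne'
  unfold loopArc path polar
  fun_prop (disch := simpa)

lemma tendsto_halfSet {ι : Type*} {l : Filter ι} {E Y Y₂ Y₃ : ι → ℝ} {z δ : ℝ} (hz : 0 < z)
    (hS : z < M.R.S) (hδ : 0 < δ) (hE : Tendsto E l (𝓝 0)) (hY : Tendsto Y l (𝓝 z))
    (hY₂ : Tendsto Y₂ l (𝓝 z)) (hY₃ : Tendsto Y₃ l (𝓝 δ)) :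
    Tendsto (fun i => Metric.hausdorffEDist (M.halfSet (E i) (Y i) (Y₂ i) (Y₃ i))
      (M.halfSet 0 z z δ)) l (𝓝 0) := by
  have t1 : Tendsto (fun i => (E i, Y i, Y₂ i)) l (𝓝 (0, z, z)) :=
    hE.prodMk_nhds (hY.prodMk_nhds hY₂)
  have t2 : Tendsto (fun i => (E i, Y₂ i, Y₃ i)) l (𝓝 (0, z, δ)) :=
    hE.prodMk_nhds (hY₂.prodMk_nhds hY₃)
  have h1 := (tendsto_outerArc hz hS).comp t1
  have h2 := (tendsto_lowerArc (M := M) hz hδ).comp t2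
  unfold halfSet
  exact tendsto_hausdorffEDist_union h1 h2

/-- After crossing `x = 1` to the right, a solution comes back at a comparable height. -/
lemma outer_step {γ : ℝ → ℝ × ℝ} (h : IsCrossingSolution (M.sys ε) γ) {a y z r : ℝ}
    (ha : γ a = (1, y)) (hy : |y - z| < r) (hg : ∀ y, |y - z| < r → M.Good τ ε y)
    (hK : ∀ t, (γ t).1 = 1 → |(γ t).2 - z| < r ∨ |-(γ t).2 - z| < r) :
    ∃ b y₂, γ b = (1, -y₂) ∧ |y₂ - z| < r ∧ M.R.F ε y = M.R.F ε (-y₂) := by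
  have g := hg y hy
  obtain ⟨b, -, hb, hneg, hF⟩ := h.outer_return (O := M.R) (ε := ε) rfl g.outer.d_pos (a := a)
    (by rw [ha]) (by rw [ha]; exact g.crossing.2.2.1) (by rw [ha]; exact g.outer.lt)
    (by rw [ha]; exact g.outer.s_pos)
  have eb : γ b = (1, (γ b).2) := Prod.ext hb rfl
  refine ⟨b, -(γ b).2, by rw [neg_neg]; exact eb, ?_, by rw [neg_neg, ← hF, ha]⟩
  -- On the line the height is close to `z` or to `-z`; the direction of the crossing decides.
  rcases hK b hb with h1 | h1
  · have := (hg _ h1).crossing.2.2.1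
    rw [← eb] at this
    exact absurd this hneg.not_gt
  · exact h1

/-- After crossing `x = 1` to the left, a solution off the axis arrives at `x = -1`. -/
lemma lower_step {γ : ℝ → ℝ × ℝ} (h : IsCrossingSolution (M.sys ε) γ) {a y₂ z δ r : ℝ}
    (ha : γ a = (1, -y₂)) (hy : |y₂ - z| < r) (hg : ∀ y, |y - z| < r → M.Good τ ε y)
    (hg' : ∀ y, |y - δ| < r → M.refl.Good (-τ) ε y)
    (hs : ∀ t, -1 ≤ (γ t).1 → (γ t).1 ≤ 1 → (γ t).2 ≠ 0)
    (hK : ∀ t, (γ t).1 = 1 → |(γ t).2 - z| < r ∨ |-(γ t).2 - z| < r)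
    (hK' : ∀ t, (γ t).1 = -1 → |(γ t).2 - δ| < r ∨ |-(γ t).2 - δ| < r) :
    ∃ b y₃, γ b = (-1, -y₃) ∧ |y₃ - δ| < r ∧
      spiral (-1 * M.κ ε) M.c y₂ = spiral (-1 * M.κ ε) (-M.e) y₃ := by
  have g := hg y₂ hy
  obtain ⟨b, hab, hb, hi, -, hlog⟩ := h.central_passage (M := M) (ε := ε) (a := a) rfl
    (Or.inl ⟨by rw [ha], by rw [ha]; exact g.crossing.2.2.2⟩)
    (fun t h1 h2 => Or.inr (hs t h1 h2))
  -- In the closed strip the height has no zero, so it keeps its negative sign. This rules out a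
  -- return to `x = 1`, where the outgoing heights are positive.
  have hneg : (γ b).2 < 0 := by
    by_contra! hge
    obtain ⟨t, ht, h0⟩ : (0 : ℝ) ∈ (fun t => (γ t).2) '' Icc a b :=
      intermediate_value_Icc hab.le h.continuous_snd.continuousOn
        ⟨by simp [ha, g.outer.pos.le], hge⟩
    exact hs t (hi t ht).1 (hi t ht).2 h0
  rcases hb with ⟨hb, hpos⟩ | ⟨hb, hpos⟩
  · exfalso
    rcases hK b hb with h1 | h1
    · linarith [(hg _ h1).outer.pos]
    · have := (hg _ h1).crossing.2.2.2
      rw [neg_neg, show ((1, (γ b).2) : ℝ × ℝ) = γ b from Prod.ext hb.symm rfl] at this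
      exact absurd this hpos.not_gt
  · have eb : γ b = (-1, - -(γ b).2) := by rw [neg_neg]; exact Prod.ext hb rfl
    refine ⟨b, -(γ b).2, eb, ?_, ?_⟩
    · rcases hK' b hb with h1 | h1
      · linarith [(hg' _ h1).outer.pos]
      · exact h1
    · have p2 := g.outer.pos
      have p3 : 0 < -(γ b).2 := by linarith
      rw [eb, ha, w_one, w_neg_one, arg_eq_neg_ang p2, arg_eq_neg_ang p3, log_norm_eq,
        log_norm_eq] at hlog
      simp only [spiral]
      simp only [neg_sq] at hlog ⊢
      linarith

/-- A periodic solution close to a three-zone orbit follows the return map. -/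
lemma three_zone_return {γ : ℝ → ℝ × ℝ} {T : ℝ} (h : IsCrossingPeriodic (M.sys ε) γ T) {z δ r : ℝ}
    (hr : 0 < r) (hg : ∀ y, |y - z| < r → M.Good τ ε y)
    (hg' : ∀ y, |y - δ| < r → M.refl.Good (-τ) ε y)
    (hs : ∀ t, -1 ≤ (γ t).1 → (γ t).1 ≤ 1 → (γ t).2 ≠ 0)
    (hK : ∀ t, (γ t).1 = 1 → |(γ t).2 - z| < r ∨ |-(γ t).2 - z| < r)
    (hK' : ∀ t, (γ t).1 = -1 → |(γ t).2 - δ| < r ∨ |-(γ t).2 - δ| < r) :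
    (∃ y, |y - z| < r ∧ (1, y) ∈ range γ) ∧
    ∀ y, |y - z| < r → (1, y) ∈ range γ → ∃ y₂ y₃ y₄ y', |y₂ - z| < r ∧ |y₃ - δ| < r ∧
      |y₄ - δ| < r ∧ |y' - z| < r ∧ (1, y') ∈ range γ ∧ M.HalfRel ε y y₂ y₃ ∧
      M.refl.HalfRel ε y₃ y₄ y' := by
  have hM : M.refl.refl = M := by simp [refl]
  have hγ := h.1
  -- The upper central arc and the left outer arc are the lower and the right arc of the reflected
  -- solution, with the roles of `z` and `δ` exchanged.
  have hn : IsCrossingSolution (M.refl.sys ε) (fun t => -γ t) := by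
    rw [refl_sys]; exact hγ.neg
  have hn_s : ∀ t, -1 ≤ (-γ t).1 → (-γ t).1 ≤ 1 → (-γ t).2 ≠ 0 := fun t h1 h2 => by
    rw [Prod.fst_neg] at h1 h2
    rw [Prod.snd_neg, neg_ne_zero]
    exact hs t (by linarith) (by linarith)
  have hn_K : ∀ t, (-γ t).1 = 1 → |(-γ t).2 - δ| < r ∨ |-(-γ t).2 - δ| < r := fun t h1 => by
    rw [Prod.fst_neg] at h1
    rw [Prod.snd_neg, neg_neg]
    exact (hK' t (by linarith)).symm
  have hn_K' : ∀ t, (-γ t).1 = -1 → |(-γ t).2 - z| < r ∨ |-(-γ t).2 - z| < r := fun t h1 => by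
    rw [Prod.fst_neg] at h1
    rw [Prod.snd_neg, neg_neg]
    exact (hK t (by linarith)).symm
  have hg'' : ∀ y, |y - z| < r → M.refl.refl.Good (- -τ) ε y := by rwa [hM, neg_neg]
  have low : ∀ a y₂, γ a = (1, -y₂) → |y₂ - z| < r → ∃ b y₃, γ b = (-1, -y₃) ∧ |y₃ - δ| < r ∧
      spiral (-1 * M.κ ε) M.c y₂ = spiral (-1 * M.κ ε) (-M.e) y₃ := fun a y₂ ha hy =>
    lower_step hγ ha hy hg hg' hs hK hK'
  have out : ∀ a y, γ a = (1, y) → |y - z| < r →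
      ∃ b y₂, γ b = (1, -y₂) ∧ |y₂ - z| < r ∧ M.R.F ε y = M.R.F ε (-y₂) := fun a y ha hy =>
    outer_step hγ ha hy hg hK
  have up : ∀ a y₄, γ a = (-1, y₄) → |y₄ - δ| < r → ∃ b y', γ b = (1, y') ∧ |y' - z| < r ∧
      spiral (-1 * M.refl.κ ε) M.refl.c y₄ = spiral (-1 * M.refl.κ ε) (-M.refl.e) y' := by
    intro a y₄ ha hy
    obtain ⟨b, y', h1, h2, h3⟩ := lower_step (M := M.refl) (τ := -τ) hn (a := a) (y₂ := y₄)
      (by simp [ha]) hy hg' hg'' hn_s hn_K hn_K'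
    refine ⟨b, y', ?_, h2, h3⟩
    rw [← neg_neg (γ b), h1]; simp
  have left : ∀ a y₃, γ a = (-1, -y₃) → |y₃ - δ| < r → ∃ b y₄, γ b = (-1, y₄) ∧ |y₄ - δ| < r ∧
      M.refl.R.F ε y₃ = M.refl.R.F ε (-y₄) := by
    intro a y₃ ha hy
    obtain ⟨b, y₄, h1, h2, h3⟩ := outer_step (M := M.refl) (τ := -τ) hn (a := a) (y := y₃)
      (by simp [ha]) hy hg' hn_K
    refine ⟨b, y₄, ?_, h2, h3⟩
    rw [← neg_neg (γ b), h1]; simp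
  refine ⟨?_, ?_⟩
  · have r1 : ∀ a y₄, γ a = (-1, y₄) → |y₄ - δ| < r → ∃ y, |y - z| < r ∧ (1, y) ∈ range γ :=
      fun a y₄ ha hy => by
        obtain ⟨b, y', h1, h2, -⟩ := up a y₄ ha hy
        exact ⟨y', h2, b, h1⟩
    have r2 : ∀ a y₃, γ a = (-1, -y₃) → |y₃ - δ| < r → ∃ y, |y - z| < r ∧ (1, y) ∈ range γ :=
      fun a y₃ ha hy => by
        obtain ⟨b, y₄, h1, h2, -⟩ := left a y₃ ha hy
        exact r1 b y₄ h1 h2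
    have hL : 0 < 1 + ε * M.L.d := (hg' δ (by simpa)).outer.d_pos
    obtain ⟨t, ht | ht⟩ := h.exists_lineTime (hg z (by simpa)).outer.d_pos hL
      (fun t h1 h2 => Or.inr (hs t h1 h2))
    · rcases hK' t ht with h1 | h1
      · exact r1 t (γ t).2 (Prod.ext ht rfl) h1
      · exact r2 t (-(γ t).2) (by rw [neg_neg]; exact Prod.ext ht rfl) h1
    · rcases hK t ht with h1 | h1
      · exact ⟨_, h1, t, Prod.ext ht rfl⟩
      · obtain ⟨b, y₃, h2, h3, -⟩ := low t (-(γ t).2) (by rw [neg_neg]; exact Prod.ext ht rfl) h1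
        exact r2 b y₃ h2 h3
  · rintro y hy ⟨a, ha⟩
    obtain ⟨b, y₂, hb, h2, hF⟩ := out a y ha hy
    obtain ⟨c, y₃, hc, h3, hS⟩ := low b y₂ hb h2
    obtain ⟨d, y₄, hd, h4, hF'⟩ := left c y₃ hc h3
    obtain ⟨f, y', hf, h5, hS'⟩ := up d y₄ hd h4
    exact ⟨y₂, y₃, y₄, y', h2, h3, h4, h5, ⟨f, hf⟩, ⟨hF, hS⟩, hF', hS'⟩

/-- Limit cycles with the property `Q` that bifurcate from a periodic orbit through `(1, z)`. -/
def Bifurcates (M : NF) (Q : Set (ℝ × ℝ) → Prop) (z : ℝ) : Prop :=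
  0 < z ∧ ∃ (Γ : Set (ℝ × ℝ)) (c : ℝ → Set (ℝ × ℝ)) (Y : ℝ → ℝ),
    (IsCrossingPeriodicOrbit (M.sys 0) Γ ∧ Q Γ ∧ (1, z) ∈ Γ ∧ ∀ y > 0, (1, y) ∈ Γ → y = z) ∧
    Tendsto Y (𝓝[>] 0) (𝓝 z) ∧
    (∀ᶠ ε in 𝓝[>] (0 : ℝ), IsLimitCycle (M.sys ε) (c ε) ∧ Q (c ε) ∧ 0 < Y ε ∧ (1, Y ε) ∈ c ε ∧
      ∀ y > 0, (1, y) ∈ c ε → y = Y ε) ∧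
    Tendsto (fun ε => Metric.hausdorffEDist (c ε) Γ) (𝓝[>] 0) (𝓝 0)

end NF

end PWHam

/-! ### Limit cycles through three zones from sign changes of `mel₃` -/

namespace PWHam

namespace NF

variable {M : NF}

/-- The first order displacement of the return map through three zones, up to sign. -/
noncomputable def mel₃ (M : NF) (y : ℝ) : ℝ :=
  M.R.mel y + M.L.mel √(M.c ^ 2 + y ^ 2 - M.e ^ 2) -
    2 * (M.dC / M.ω) * (M.c ^ 2 + y ^ 2) * M.sweep y √(M.c ^ 2 + y ^ 2 - M.e ^ 2)

lemma refl_sweep (y δ : ℝ) : M.refl.sweep δ y = M.sweep y δ := by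
  simp only [sweep, refl_c, refl_e, ang_neg]; ring

lemma HalfRel.zero {τ y y₂ y₃ : ℝ} (h : M.HalfRel 0 y y₂ y₃) (g : M.Good τ 0 y)
    (g₂ : M.Good τ 0 y₂) (h₃ : 0 < y₃) : y₂ = y ∧ M.c ^ 2 + y ^ 2 = M.e ^ 2 + y₃ ^ 2 := by
  have e2 := Outer.eq_of_F_zero g.outer.pos g.outer.lt g₂.outer.pos g₂.outer.lt h.1
  have e3 := h.2
  rw [κ_zero, mul_zero] at e3
  have := spiral_zero_inj g₂.outer.pos h₃ e3
  rw [e2, neg_sq] at this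
  exact ⟨e2, this⟩

/-- Fixed points of the return map near a sign change of its first order displacement. -/
lemma exists_fixed_points {P : ℝ × ℝ → ℝ} {m wt : ℝ → ℝ} {z : ℝ} (hP : AnalyticAt ℝ P (0, z))
    (h0 : ∀ᶠ y in 𝓝 z, P (0, y) = y)
    (hm : ∀ᶠ y in 𝓝 z, 0 < wt y ∧ HasDerivAt (fun ε => P (ε, y)) (-(wt y * m y)) 0)
    (hs : SignChange m z) :
    (∃ r > 0, ∀ ε, |ε| < r → StrictAntiOn (fun y => -P (ε, y)) (Ioo (z - r) (z + r))) ∧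
    ∃ Y : ℝ → ℝ, Tendsto Y (𝓝[>] 0) (𝓝 z) ∧ ∀ᶠ ε in 𝓝[>] (0 : ℝ), P (ε, Y ε) = Y ε ∧
      ∃ ρ > 0, ∀ y, |y - Y ε| < ρ → P (ε, y) = y → y = Y ε := by
  constructor
  · refine exists_strictAntiOn (f := fun q => -P q) (f' := -1) hP.neg ?_ (by norm_num)
    have : (fun y => -P (0, y)) =ᶠ[𝓝 z] fun y => -y := h0.mono fun y hy => by simp only [hy]
    exact (hasDerivAt_id z).neg.congr_of_eventuallyEq this
  · obtain ⟨Y, hY, h⟩ := exists_isolated_zero (D := fun q => q.2 - P q) (m := m) (wt := wt)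
      (analyticAt_snd.sub hP) (h0.mono fun y hy => by simp only [hy, sub_self])
      (hm.mono fun y hy => ⟨hy.1, by simpa using hy.2.const_sub y⟩) hs
    refine ⟨Y, hY, h.mono fun ε hε => ⟨by linarith [hε.1], ?_⟩⟩
    obtain ⟨-, ρ, hρ, hu⟩ := hε
    exact ⟨ρ, hρ, fun y h1 h2 => hu y h1 (by simp only [h2, sub_self])⟩

lemma slice_fst {p : ℝ × ℝ → Prop} {y : ℝ} (h : ∀ᶠ q in 𝓝 ((0, y) : ℝ × ℝ), p q) :
    ∀ᶠ ε in 𝓝 (0 : ℝ), p (ε, y) :=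
  (by fun_prop : Continuous fun ε : ℝ => (ε, y)).tendsto 0 |>.eventually h

lemma slice_snd {p : ℝ × ℝ → Prop} {y : ℝ} (h : ∀ᶠ q in 𝓝 ((0, y) : ℝ × ℝ), p q) :
    ∀ᶠ x in 𝓝 y, p (0, x) :=
  (by fun_prop : Continuous fun x : ℝ => ((0 : ℝ), x)).tendsto y |>.eventually h

lemma hasDerivAt_fst_of_analyticAt {f : ℝ × ℝ → ℝ} {y : ℝ} (hf : AnalyticAt ℝ f (0, y)) :
    ∃ a, HasDerivAt (fun ε => f (ε, y)) a 0 :=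
  ⟨_, HasFDerivAt.comp_hasDerivAt (f := fun ε : ℝ => (ε, y)) (l := f) 0
    hf.differentiableAt.hasFDerivAt ((hasDerivAt_id 0).prodMk (hasDerivAt_const 0 y))⟩

/-- Closedness of the set of points of a line outside a window. -/
lemma isClosed_line_diff (a : ℝ) {W : Set ℝ} (hW : IsOpen W) :
    IsClosed {q : ℝ × ℝ | q.1 = a ∧ q.2 ∉ W} :=
  (isClosed_eq continuous_fst continuous_const).inter
    (hW.isClosed_compl.preimage continuous_snd)

lemma isOpen_window (z r : ℝ) : IsOpen {y : ℝ | |y - z| < r} :=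
  isOpen_lt (f := fun y => |y - z|) (g := fun _ => r) (by fun_prop) (by fun_prop)

lemma isOpen_window_neg (z r : ℝ) : IsOpen {y : ℝ | |-y - z| < r} :=
  isOpen_lt (f := fun y => |-y - z|) (g := fun _ => r) (by fun_prop) (by fun_prop)

/-- The return map is the composition of the half-return maps of the normal form and of its
reflection. A sign change of `mel₃` gives isolated fixed points `Y ε` tending to `z`. The remaining
work is to turn isolation as a fixed point into isolation among all crossing periodic orbits: a
suitable neighbourhood forces any such orbit to follow the return map. -/
theorem bifurcates_three {z δ τ : ℝ} (hz : 0 < z) (hS : z < M.R.S) (hδ : 0 < δ)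
    (hδS : δ < M.L.S) (hr : M.c ^ 2 + z ^ 2 = M.e ^ 2 + δ ^ 2) (hτ : τ < M.c / z)
    (hτ' : -τ < M.e / δ) (hs : SignChange M.mel₃ z) : M.Bifurcates ThreeZones z := by
  obtain ⟨h, P, ha, hP, h0, P0, hrel, r₁, hr₁, hu⟩ := M.exists_half_map hz hS hδ hr
  obtain ⟨h', P', ha', hP', h0', P0', hrel', r₂, hr₂, hu'⟩ := M.refl.exists_half_map hδ hδS hz
    (by rw [refl_c, refl_e, hr])
  have aP : AnalyticAt ℝ (fun q : ℝ × ℝ => (q.1, P q)) (0, z) := analyticAt_fst.prod hP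
  have aQ : AnalyticAt ℝ (fun q : ℝ × ℝ => P' (q.1, P q)) (0, z) :=
    AnalyticAt.fun_comp (g := P') (f := fun q : ℝ × ℝ => (q.1, P q)) (by simpa only [P0]) aP
  have ah' : AnalyticAt ℝ (fun q : ℝ × ℝ => h' (q.1, P q)) (0, z) :=
    AnalyticAt.fun_comp (g := h') (f := fun q : ℝ × ℝ => (q.1, P q)) (by simpa only [P0]) aP
  have lim : ∀ {f : ℝ × ℝ → ℝ} {v : ℝ}, AnalyticAt ℝ f (0, z) → f (0, z) = v →
      Tendsto (fun q : ℝ × ℝ => (q.1, f q)) (𝓝 (0, z)) (𝓝 (0, v)) := by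
    rintro f v hf rfl
    exact (analyticAt_fst.prod hf).continuousAt.tendsto
  have good : ∀ᶠ q in 𝓝 ((0, z) : ℝ × ℝ), M.Good τ q.1 q.2 := Good.eventually hz hS hτ
  have good' : ∀ᶠ q in 𝓝 ((0, δ) : ℝ × ℝ), M.refl.Good (-τ) q.1 q.2 :=
    Good.eventually hδ hδS (by rwa [refl_c])
  have hA : ∀ᶠ q in 𝓝 ((0, z) : ℝ × ℝ), AnalyticAt ℝ h q ∧ AnalyticAt ℝ P q ∧
      AnalyticAt ℝ (fun q : ℝ × ℝ => h' (q.1, P q)) q ∧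
      AnalyticAt ℝ (fun q : ℝ × ℝ => P' (q.1, P q)) q :=
    ha.eventually_analyticAt.and (hP.eventually_analyticAt.and
      (ah'.eventually_analyticAt.and aQ.eventually_analyticAt))
  have hR : ∀ᶠ q in 𝓝 ((0, z) : ℝ × ℝ), M.HalfRel q.1 q.2 (h q) (P q) ∧
      M.refl.HalfRel q.1 (P q) (h' (q.1, P q)) (P' (q.1, P q)) :=
    hrel.and ((lim hP P0).eventually hrel')
  have hG : ∀ᶠ q in 𝓝 ((0, z) : ℝ × ℝ), M.Good τ q.1 q.2 ∧ M.Good τ q.1 (h q) ∧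
      M.refl.Good (-τ) q.1 (P q) ∧ M.refl.Good (-τ) q.1 (h' (q.1, P q)) ∧
      M.Good τ q.1 (P' (q.1, P q)) :=
    good.and (((lim ha h0).eventually good).and (((lim hP P0).eventually good').and
      (((lim ah' (by simp only [P0, h0'])).eventually good').and
        ((lim aQ (by simp only [P0, P0'])).eventually good))))
  have hall := hA.and (hR.and hG)
  -- For `ε = 0` the first integrals are even in the height, so every nearby orbit closes up and the
  -- return map is the identity.
  have zero : ∀ᶠ y in 𝓝 z, h (0, y) = y ∧ M.c ^ 2 + y ^ 2 = M.e ^ 2 + P (0, y) ^ 2 ∧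
      h' (0, P (0, y)) = P (0, y) ∧ P' (0, P (0, y)) = y := by
    filter_upwards [slice_snd (hR.and hG)] with y hy
    obtain ⟨⟨b1, b2⟩, g1, g2, g3, g4, g5⟩ := hy
    obtain ⟨c1, c2⟩ := b1.zero g1 g2 g3.outer.pos
    obtain ⟨d1, d2⟩ := b2.zero g3 g4 g5.outer.pos
    rw [refl_c, refl_e] at d2
    refine ⟨c1, c2, d1, ?_⟩
    have p1 := g1.outer.pos
    have p5 := g5.outer.pos
    have : P' (0, P (0, y)) ^ 2 = y ^ 2 := by linarith
    rwa [sq_eq_sq₀ p5.le p1.le] at this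
  -- The two half displacements of `y²/2` telescope at height `δ`; dividing by `y` converts the
  -- result to the displacement of the height itself.
  have hderiv : ∀ᶠ y in 𝓝 z, 0 < 1 / y ∧
      HasDerivAt (fun ε => P' (ε, P (ε, y))) (-(1 / y * M.mel₃ y)) 0 := by
    filter_upwards [zero, slice_snd hall.eventually_nhds] with y hy hq
    obtain ⟨⟨a1, a2, a3, a4⟩, -, g1, g2, g3, g4, g5⟩ := hq.self_of_nhds
    obtain ⟨z1, z2, z3, z4⟩ := hy
    obtain ⟨b1, hb1⟩ := hasDerivAt_fst_of_analyticAt a1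
    obtain ⟨b2, hb2⟩ := hasDerivAt_fst_of_analyticAt a2
    obtain ⟨b3, hb3⟩ := hasDerivAt_fst_of_analyticAt a3
    obtain ⟨b4, hb4⟩ := hasDerivAt_fst_of_analyticAt a4
    have p1 := g1.outer.pos
    have p3 := g3.outer.pos
    have l3 := g3.outer.lt
    simp only at p1 p3 l3 hb3 hb4
    have hsl := slice_fst hq
    have f1 := halfRel_deriv (M := M) p1 g1.outer.lt p3 z2 (hasDerivAt_const 0 y) hb1 hb2 rfl z1 rfl
      (hsl.mono fun ε hε => hε.2.1.1)
    have f2 := halfRel_deriv (M := M.refl) p3 l3 p1 (by rw [refl_c, refl_e, z2]) hb2 hb3 hb4 rfl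
      z3 z4 (hsl.mono fun ε hε => hε.2.1.2)
    rw [refl_sweep, refl_c] at f2
    have hP0 : √(M.c ^ 2 + y ^ 2 - M.e ^ 2) = P (0, y) := by
      rw [z2, add_sub_cancel_left, Real.sqrt_sq p3.le]
    refine ⟨by positivity, hb4.congr_deriv ?_⟩
    rw [mel₃, hP0]
    have hω := M.ω_pos.ne'
    have : y * b4 = -(M.R.mel y + M.L.mel (P (0, y)) -
        2 * (M.dC / M.ω) * (M.c ^ 2 + y ^ 2) * M.sweep y (P (0, y))) := by
      have e3 : M.refl.dC / M.refl.ω * (M.e ^ 2 + P (0, y) ^ 2) =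
        M.dC / M.ω * (M.c ^ 2 + y ^ 2) := by rw [z2]; rfl
      rw [e3] at f2
      have e4 : M.refl.R.mel (P (0, y)) = M.L.mel (P (0, y)) := rfl
      rw [e4] at f2
      linear_combination f1 + f2
    have hy := p1.ne'
    rw [one_div, ← mul_neg, ← this]
    field_simp
  obtain ⟨⟨r₃, hr₃, hanti⟩, Y, hY, hfix⟩ := exists_fixed_points aQ (zero.mono fun y hy => hy.2.2.2)
    hderiv hs
  obtain ⟨r₄, hr₄, hgood⟩ := eventually_box good
  obtain ⟨r₅, hr₅, hgood'⟩ := eventually_box good'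
  have hε : Tendsto (fun ε : ℝ => (ε, Y ε)) (𝓝[>] 0) (𝓝 (0, z)) :=
    (tendsto_nhdsWithin_of_tendsto_nhds tendsto_id).prodMk_nhds hY
  have tP : Tendsto (fun ε => P (ε, Y ε)) (𝓝[>] 0) (𝓝 δ) := by
    rw [← P0]; exact hP.continuousAt.tendsto.comp hε
  have th : Tendsto (fun ε => h (ε, Y ε)) (𝓝[>] 0) (𝓝 z) := by
    have := ha.continuousAt.tendsto.comp hε
    rwa [h0] at this
  have th' : Tendsto (fun ε => h' (ε, P (ε, Y ε))) (𝓝[>] 0) (𝓝 δ) := by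
    have := ah'.continuousAt.tendsto.comp hε
    simp only [P0, h0'] at this
    exact this
  refine ⟨hz, M.threeSet 0 z z δ δ, fun ε => M.threeSet ε (Y ε) (h (ε, Y ε)) (P (ε, Y ε))
    (h' (ε, P (ε, Y ε))), Y, ?_, hY, ?_, ?_⟩
  · obtain ⟨-, ⟨b1, b2⟩, g1, g2, g3, g4, g5⟩ := hall.self_of_nhds
    simp only [h0, P0, h0', P0'] at b1 b2 g1 g2 g3 g4 g5
    obtain ⟨c1, c2, c3, c4⟩ := threeSet_spec g1 g2 g3 g4 b1 b2
    refine ⟨c1, c2, c3, fun y hy hmem => ?_⟩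
    rcases c4 _ hmem with h | h | h | h | h | h | h
    · exact absurd h (lt_irrefl _)
    · exact congrArg Prod.snd h
    · have := congrArg Prod.snd h; simp only at this; linarith
    · exact absurd h.2.2 (lt_irrefl _)
    · have := congrArg Prod.fst h; norm_num at this
    · have := congrArg Prod.fst h; norm_num at this
    · norm_num at h
  · set r := min (min r₁ r₂) (min r₃ (min r₄ r₅)) with hrdef
    have hr0 : 0 < r := lt_min (lt_min hr₁ hr₂) (lt_min hr₃ (lt_min hr₄ hr₅))
    have le1 : r ≤ r₁ := (min_le_left _ _).trans (min_le_left _ _)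
    have le2 : r ≤ r₂ := (min_le_left _ _).trans (min_le_right _ _)
    have le3 : r ≤ r₃ := (min_le_right _ _).trans (min_le_left _ _)
    have le4 : r ≤ r₄ := (min_le_right _ _).trans ((min_le_right _ _).trans (min_le_left _ _))
    have le5 : r ≤ r₅ := (min_le_right _ _).trans ((min_le_right _ _).trans (min_le_right _ _))
    have near : ∀ {f : ℝ → ℝ} {v : ℝ}, Tendsto f (𝓝[>] 0) (𝓝 v) →
        ∀ᶠ ε in 𝓝[>] (0 : ℝ), |f ε - v| < r := fun hf => by
      have := (Metric.tendsto_nhds.1 hf) r hr0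
      simpa only [Real.dist_eq] using this
    filter_upwards [hfix, hε.eventually hall, near hY, near th, near tP, near th',
      near (f := fun ε => ε) (tendsto_nhdsWithin_of_tendsto_nhds tendsto_id)]
      with ε hfx hal n1 n2 n3 n4 n5
    rw [sub_zero] at n5
    obtain ⟨hPY, ρ, hρ, huniq⟩ := hfx
    obtain ⟨-, ⟨b1, b2⟩, g1, g2, g3, g4, g5⟩ := hal
    have hPY : P' (ε, P (ε, Y ε)) = Y ε := hPY
    rw [hPY] at b2
    obtain ⟨c1, c2, c3, c4⟩ := threeSet_spec g1 g2 g3 g4 b1 b2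
    set Γ := M.threeSet ε (Y ε) (h (ε, Y ε)) (P (ε, Y ε)) (h' (ε, P (ε, Y ε)))
    have hgr : ∀ y, |y - z| < r → M.Good τ ε y := fun y hy =>
      hgood ε y (n5.trans_le le4) (hy.trans_le le4)
    have hgr' : ∀ y, |y - δ| < r → M.refl.Good (-τ) ε y := fun y hy =>
      hgood' ε y (n5.trans_le le5) (hy.trans_le le5)
    refine ⟨⟨c1, ?_⟩, c2, g1.outer.pos, c3, fun y hy hmem => ?_⟩
    · let W₁ : Set ℝ := {y | (|y - z| < r ∧ |y - Y ε| < ρ) ∨ |-y - z| < r}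
      let W₂ : Set ℝ := {y | |y - δ| < r ∨ |-y - δ| < r}
      have hW₁ : IsOpen W₁ := ((isOpen_window z r).inter (isOpen_window (Y ε) ρ)).union
        (isOpen_window_neg z r)
      have hW₂ : IsOpen W₂ := (isOpen_window δ r).union (isOpen_window_neg δ r)
      -- Removing the segment of height zero between the lines prevents shortcuts inside the strip;
      -- removing the lines outside the windows prevents crossings elsewhere. Periodic orbits in the
      -- complement must run through the four arcs in order.
      let K : Set (ℝ × ℝ) := {q | (-1 ≤ q.1 ∧ q.1 ≤ 1) ∧ q.2 = 0} ∪
        ({q | q.1 = 1 ∧ q.2 ∉ W₁} ∪ {q | q.1 = -1 ∧ q.2 ∉ W₂})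
      have hK : IsClosed K := by
        refine IsClosed.union (IsClosed.inter (IsClosed.inter ?_ ?_) ?_)
          ((isClosed_line_diff 1 hW₁).union (isClosed_line_diff (-1) hW₂))
        · exact isClosed_le continuous_const continuous_fst
        · exact isClosed_le continuous_fst continuous_const
        · exact isClosed_eq continuous_snd continuous_const
      refine ⟨Kᶜ, hK.isOpen_compl, ?_, ?_⟩
      · intro q hq
        have m1 : Y ε ∈ W₁ := Or.inl ⟨n1, by simpa⟩
        have m2 : -h (ε, Y ε) ∈ W₁ := Or.inr (by rwa [neg_neg])
        have m3 : -P (ε, Y ε) ∈ W₂ := Or.inr (by rwa [neg_neg])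
        have m4 : h' (ε, P (ε, Y ε)) ∈ W₂ := Or.inl n4
        have p1 := g1.outer.pos
        have p2 := g2.outer.pos
        have p3 := g3.outer.pos
        have p4 := g4.outer.pos
        rintro (⟨⟨k1, k2⟩, k3⟩ | ⟨k1, k2⟩ | ⟨k1, k2⟩)
        · rcases c4 q hq with h | rfl | rfl | h | rfl | rfl | h
          · linarith
          · simp only at k3; linarith
          · simp only at k3; linarith
          · exact h.1 k3
          · simp only at k3; linarith
          · simp only at k3; linarith
          · linarith
        · rcases c4 q hq with h | rfl | rfl | h | rfl | rfl | h
          · linarith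
          · exact k2 m1
          · exact k2 m2
          · linarith [h.2.2]
          · norm_num at k1
          · norm_num at k1
          · linarith
        · rcases c4 q hq with h | rfl | rfl | h | rfl | rfl | h
          · linarith
          · norm_num at k1
          · norm_num at k1
          · linarith [h.2.1]
          · exact k2 m3
          · exact k2 m4
          · linarith
      · rintro Γ' hΓ' hsub
        have hΓ'0 := hΓ'
        obtain ⟨γ, T, hγ, rfl⟩ := hΓ'
        have hnK : ∀ t, γ t ∉ K := fun t => hsub ⟨t, rfl⟩
        have k1 : ∀ t, -1 ≤ (γ t).1 → (γ t).1 ≤ 1 → (γ t).2 ≠ 0 := fun t h1 h2 h3 =>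
          hnK t (Or.inl ⟨⟨h1, h2⟩, h3⟩)
        have k2 : ∀ t, (γ t).1 = 1 → (γ t).2 ∈ W₁ := fun t h1 => by
          by_contra hno; exact hnK t (Or.inr (Or.inl ⟨h1, hno⟩))
        have k3 : ∀ t, (γ t).1 = -1 → (γ t).2 ∈ W₂ := fun t h1 => by
          by_contra hno; exact hnK t (Or.inr (Or.inr ⟨h1, hno⟩))
        obtain ⟨⟨y₀, hy₀, hy₀'⟩, hret⟩ := three_zone_return hγ hr0 hgr hgr' k1
          (fun t h1 => (k2 t h1).imp_left fun h => h.1) k3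
        set S : Set ℝ := {y | |y - z| < r ∧ (1, y) ∈ range γ} with hSdef
        have hfin : S.Finite := hγ.finite_section.subset fun y hy => hy.2
        have hSW : ∀ y ∈ S, |y - z| < r ∧ |y - Y ε| < ρ := by
          rintro y ⟨h1, t, ht⟩
          have := k2 t (by rw [ht])
          rw [ht] at this
          rcases this with h2 | h2
          · exact h2
          · exfalso
            have := (hgr _ h1).outer.pos
            have := (hgr _ h2).outer.pos
            linarith
        have hIoo : ∀ y, |y - z| < r → y ∈ Ioo (z - r₃) (z + r₃) := fun y hy => by
          have := abs_lt.1 (hy.trans_le le3)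
          constructor <;> linarith
        -- The upper heights of the competing orbit form a finite set mapped into itself by the
        -- return map, hence all equal `Y ε`. The two orbits then share a point.
        have hfixS := fixed_of_finite_invariant (S := S)
          (W := {y | |y - z| < r ∧ |y - Y ε| < ρ}) (A := fun y => -P' (ε, P (ε, y)))
          (B := fun y => -y) (y₀ := Y ε) hfin hSW
          ((hanti ε (n5.trans_le le3)).mono fun y hy => hIoo y hy.1)
          (fun a _ b _ hab => neg_lt_neg hab)
          (fun y hy => by
            obtain ⟨y₂, y₃, y₄, y', h2, h3, h4, h5, h6, h7, h8⟩ := hret y hy.1 hy.2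
            refine ⟨y', ⟨h5, h6⟩, ?_⟩
            have e1 := hu ε y y₂ y₃ (n5.trans_le le1) (hy.1.trans_le le1) (h2.trans_le le1)
              (h3.trans_le le1) h7
            have e2 := hu' ε y₃ y₄ y' (n5.trans_le le2) (h3.trans_le le2) (h4.trans_le le2)
              (h5.trans_le le2) h8
            rw [← e1, ← e2])
          (fun y hy hAB => huniq y hy.2 (neg_injective hAB))
        have hyY : y₀ = Y ε := hfixS ⟨hy₀, hy₀'⟩
        rw [hyY] at hy₀'
        exact IsCrossingPeriodicOrbit.eq_of_mem isLipschitz_sys hΓ'0 c1 hy₀' c3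
    · rcases c4 _ hmem with h | h | h | h | h | h | h
      · exact absurd h (lt_irrefl _)
      · exact congrArg Prod.snd h
      · have := congrArg Prod.snd h; simp only at this; linarith [g2.outer.pos]
      · exact absurd h.2.2 (lt_irrefl _)
      · have := congrArg Prod.fst h; norm_num at this
      · have := congrArg Prod.fst h; norm_num at this
      · norm_num at h
  · have e0 : Tendsto (fun ε : ℝ => ε) (𝓝[>] 0) (𝓝 0) :=
      tendsto_nhdsWithin_of_tendsto_nhds tendsto_id
    unfold threeSet
    refine tendsto_hausdorffEDist_union (tendsto_halfSet hz hS hδ e0 hY th tP) ?_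
    have := tendsto_halfSet (M := M.refl) hδ hδS hz e0 tP th' hY
    refine this.congr fun ε => ?_
    exact (Metric.hausdorffEDist_image (IsometryEquiv.neg (ℝ × ℝ)).isometry).symm

end NF

end PWHam

namespace PWHam

/-! ### Bifurcation of limit cycles through two zones -/

namespace NF

variable {M : NF} {ε τ : ℝ}

/-- The first order displacement of the return map through two zones, up to sign. -/
noncomputable def mel₂ (M : NF) (y : ℝ) : ℝ :=
  M.R.mel y - 2 * (M.dC / M.ω) * (M.c ^ 2 + y ^ 2) * ang M.c y

/-- The condition that loops stay to the right of `x = -1`. -/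
def Inner (M : NF) (ε y : ℝ) : Prop :=
  √(M.c ^ 2 + y ^ 2) * Real.exp (|M.κ ε| * (2 * Real.pi)) < M.e

lemma Inner.eventually {z : ℝ} (he : 0 < M.e) (hz : M.c ^ 2 + z ^ 2 < M.e ^ 2) :
    ∀ᶠ q in 𝓝 ((0, z) : ℝ × ℝ), M.Inner q.1 q.2 := by
  have hc : Continuous fun q : ℝ × ℝ =>
      √(M.c ^ 2 + q.2 ^ 2) * Real.exp (|M.κ q.1| * (2 * Real.pi)) := by
    unfold κ; fun_prop
  refine hc.continuousAt.eventually_lt_const ?_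
  simp only [κ_zero, abs_zero, zero_mul, Real.exp_zero, mul_one]
  rw [Real.sqrt_lt' he]
  exact hz

/-- The line `x = -1` is not reached because the distance from the center stays below `e/ω`. The
abscissa is below 1 because it first decreases from 1, up to the angle `arctan κ`, and afterwards
increases to the final value 1. Height zero occurs only at angle 0, to the left of the center, so
the loop avoids the slit. -/
lemma loopArc_isArc {y₂ y₃ : ℝ} (h₂ : M.Good τ ε y₂) (h₃ : M.Good τ ε y₃) (hi : M.Inner ε y₂)
    (hs : spiral (-1 * M.κ ε) M.c y₂ = spiral (1 * M.κ ε) M.c y₃) :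
    ∃ γ T, IsArc (M.sys ε) γ T ∧ γ 0 = (1, -y₂) ∧ γ T = (1, y₃) ∧
      γ '' Icc 0 T = M.loopArc ε y₂ y₃ '' Icc 0 1 ∧
      (∀ t ∈ Icc 0 T, ((γ t).2 = 0 → (γ t).1 < M.p) ∧ ((-1 < (γ t).1 ∧ (γ t).1 < 1) ∨
        γ t = (1, -y₂) ∨ γ t = (1, y₃))) ∧ -1 < (γ (T / 2)).1 ∧ (γ (T / 2)).1 < 1 := by
  have hω := M.ω_pos
  have hπ := Real.pi_pos
  have hy₂ := h₂.outer.pos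
  have hy₃ := h₃.outer.pos
  have e0 := M.polar_one_neg hy₂
  have e1 := M.polar_one hy₃
  have a2 := h₂.arg_le
  have a3 := h₃.arg_le
  have b2 := ang_pos M.c y₂
  have b3 := ang_pos M.c y₃
  have b2' := ang_lt_pi M.c y₂
  have b3' := ang_lt_pi M.c y₃
  have hφ : -ang M.c y₂ < ang M.c y₃ := by linarith
  have hρ₂ : 0 < √(M.c ^ 2 + y₂ ^ 2) := Real.sqrt_pos.2 (by positivity)
  have hρ₃ : 0 < √(M.c ^ 2 + y₃ ^ 2) := Real.sqrt_pos.2 (by positivity)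
  have hlog : Real.log √(M.c ^ 2 + y₃ ^ 2) - M.κ ε * ang M.c y₃ =
      Real.log √(M.c ^ 2 + y₂ ^ 2) - M.κ ε * -ang M.c y₂ := by
    have l2 := log_sqrt_sub (M.κ ε) (m := M.c) (y := y₂) (-1)
    have l3 := log_sqrt_sub (M.κ ε) (m := M.c) (y := y₃) 1
    rw [neg_one_mul] at l2
    rw [one_mul] at l3
    rw [l2, l3, hs]
  have k1 := le_abs_self (Real.arctan (M.κ ε))
  have k2 := neg_abs_le (Real.arctan (M.κ ε))
  have hT : 0 < (ang M.c y₃ - -ang M.c y₂) / M.ω := div_pos (by linarith) hω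
  have hend := path_end hρ₂ hρ₃ hlog
  have hint : ∀ t ∈ Ioo 0 ((ang M.c y₃ - -ang M.c y₂) / M.ω),
      -1 < (M.path ε √(M.c ^ 2 + y₂ ^ 2) (-ang M.c y₂) t).1 ∧
        (M.path ε √(M.c ^ 2 + y₂ ^ 2) (-ang M.c y₂) t).1 < 1 := by
    intro t ht
    obtain ⟨m1, m2⟩ := mem_time (M := M) ht
    constructor
    · simp only [path, polar]
      -- Both end angles lie in `(-π, π)`, so the swept angle is less than `2π`. This is the
      -- constant in `Inner`.
      have hle : √(M.c ^ 2 + y₂ ^ 2) * Real.exp (ε * M.dC * t) *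
          Real.cos (-ang M.c y₂ + M.ω * t) < M.e := by
        refine lt_of_le_of_lt ?_ hi
        refine (mul_le_of_le_one_right (by positivity) (Real.cos_le_one _)).trans ?_
        have : ε * M.dC * t = M.κ ε * (M.ω * t) := by rw [κ]; field_simp
        rw [this]
        have h0 : 0 ≤ M.ω * t := by have := ht.1; positivity
        have : M.κ ε * (M.ω * t) ≤ |M.κ ε| * (2 * Real.pi) :=
          mul_le_mul (le_abs_self _) (by linarith) h0 (abs_nonneg _)
        gcongr
      have : √(M.c ^ 2 + y₂ ^ 2) * Real.exp (ε * M.dC * t) *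
          Real.cos (-ang M.c y₂ + M.ω * t) / M.ω < M.e / M.ω := by gcongr
      have he : M.e / M.ω = 1 + M.p := by rw [e]; field_simp
      linarith
    · rcases le_total (-ang M.c y₂ + M.ω * t) (Real.arctan (M.κ ε)) with hle | hle
      · have := path_strictAnti (M := M) (ε := ε) hρ₂ (φ₀ := -ang M.c y₂)
          (φ₁ := -ang M.c y₂ + M.ω * t) (by linarith) hle le_rfl ht.1
          (by rw [add_sub_cancel_left]; field_simp; rfl)
        rwa [path_zero, e0] at this
      · have h1 : (M.path ε √(M.c ^ 2 + y₂ ^ 2) (-ang M.c y₂)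
            ((ang M.c y₃ - -ang M.c y₂) / M.ω)).1 = 1 := by rw [hend, e1]
        have e3 : -ang M.c y₂ + M.ω * ((ang M.c y₃ - -ang M.c y₂) / M.ω) = ang M.c y₃ := by
          field_simp; ring
        rw [path_fst, e3] at h1
        have := expcos_strictAntiOn (M.κ ε) ⟨hle, by linarith⟩
          (b := ang M.c y₃) ⟨by linarith, by linarith⟩ m2
        rw [path_fst, ← h1]
        have := mul_lt_mul_of_pos_left this
          (by positivity : 0 < √(M.c ^ 2 + y₂ ^ 2) * Real.exp (-(M.κ ε * -ang M.c y₂)) / M.ω)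
        linarith
  have harc : IsArc (M.sys ε) (M.path ε √(M.c ^ 2 + y₂ ^ 2) (-ang M.c y₂))
      ((ang M.c y₃ - -ang M.c y₂) / M.ω) := by
    refine isArc_path rfl hφ hρ₂ hρ₃ hlog ?_ ?_ ?_ ?_ hint
    · rw [e0]; exact h₂.crossing.2.1
    · rw [e1]; exact h₃.crossing.1
    · rw [e0]; exact fwdZone_right_neg rfl h₂.crossing.2.2.2
    · rw [e1]; exact bwdZone_right_pos rfl h₃.crossing.2.2.1
  refine ⟨_, _, harc, by rw [path_zero, e0], by rw [hend, e1], (image_unit hT.le).symm,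
    fun t ht => ?_, hint _ ⟨by linarith, by linarith⟩⟩
  rcases eq_or_lt_of_le ht.1 with rfl | t1
  · rw [path_zero, e0]
    exact ⟨fun h0 => by simp only at h0; linarith, Or.inr (Or.inl rfl)⟩
  rcases eq_or_lt_of_le ht.2 with rfl | t2
  · rw [hend, e1]
    exact ⟨fun h0 => by simp only at h0; linarith, Or.inr (Or.inr rfl)⟩
  refine ⟨fun h0 => ?_, Or.inl (hint t ⟨t1, t2⟩)⟩
  obtain ⟨m1, m2⟩ := mem_time (M := M) ⟨t1, t2⟩
  simp only [path, polar] at h0 ⊢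
  -- The only zero of the sine in `(-π, π)` is 0, where the cosine is 1 and the abscissa is less
  -- than that of the center.
  have hsin : Real.sin (-ang M.c y₂ + M.ω * t) = 0 :=
    (mul_eq_zero.1 h0).resolve_left (by positivity)
  rw [Real.sin_eq_zero_iff_of_lt_of_lt (by linarith) (by linarith)] at hsin
  rw [hsin, Real.cos_zero, mul_one, sub_lt_self_iff]
  positivity

/-- The orbit through two zones with the given heights. -/
def loopSet (M : NF) (ε y y₂ : ℝ) : Set (ℝ × ℝ) :=
  M.outerArc ε y y₂ '' Icc 0 1 ∪ M.loopArc ε y₂ y '' Icc 0 1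

theorem loopSet_spec {y y₂ : ℝ} (h : M.Good τ ε y) (h₂ : M.Good τ ε y₂) (hi : M.Inner ε y₂)
    (hr : M.LoopRel ε y y₂ y) :
    IsCrossingPeriodicOrbit (M.sys ε) (M.loopSet ε y y₂) ∧
      (MeetsCentral (M.loopSet ε y y₂) ∧ MeetsRight (M.loopSet ε y y₂) ∧
        ¬ MeetsLeft (M.loopSet ε y y₂)) ∧ (1, y) ∈ M.loopSet ε y y₂ ∧
      ∀ q ∈ M.loopSet ε y y₂, 1 < q.1 ∨ q = (1, y) ∨ q = (1, -y₂) ∨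
        ((q.2 = 0 → q.1 < M.p) ∧ -1 < q.1 ∧ q.1 < 1) := by
  obtain ⟨a1, a2, a3, a4, a5⟩ := outerArc_isArc h h₂ hr.1
  obtain ⟨γ, T, b1, b2, b3, b4, b5, b6⟩ := loopArc_isArc h₂ h hi hr.2
  have hT := a1.pos
  have hT' := b1.pos
  have hj : M.R.path ε y (M.R.time ε y y₂) = γ 0 := by rw [a3, b2]
  have hc := a1.concat b1 hj
  have him : concat (M.R.path ε y) (M.R.time ε y y₂) γ '' Icc 0 (M.R.time ε y y₂ + T) =
      M.loopSet ε y y₂ := by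
    rw [concat_image hj a1.pos.le b1.pos.le, a4, b4, loopSet]
  have h0 : concat (M.R.path ε y) (M.R.time ε y y₂) γ 0 = (1, y) := by
    rw [concat_of_le a1.pos.le, a2]
  have h1 : concat (M.R.path ε y) (M.R.time ε y y₂) γ (M.R.time ε y y₂ + T) = (1, y) := by
    rw [concat_of_ge hj (by linarith), add_sub_cancel_left, b3]
  have hpts : ∀ q ∈ M.loopSet ε y y₂, 1 < q.1 ∨ q = (1, y) ∨ q = (1, -y₂) ∨
        ((q.2 = 0 → q.1 < M.p) ∧ -1 < q.1 ∧ q.1 < 1) := by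
    rintro q (hq | hq)
    · rw [← a4] at hq
      obtain ⟨t, ht, rfl⟩ := hq
      rcases a5 t ht with h | h | h
      · exact Or.inl h
      · exact Or.inr (Or.inl h)
      · exact Or.inr (Or.inr (Or.inl h))
    · rw [← b4] at hq
      obtain ⟨t, ht, rfl⟩ := hq
      obtain ⟨h', h | h | h⟩ := b5 t ht
      · exact Or.inr (Or.inr (Or.inr ⟨h', h⟩))
      · exact Or.inr (Or.inr (Or.inl h))
      · exact Or.inr (Or.inl h)
  refine ⟨?_, ⟨?_, ?_, ?_⟩, ?_, hpts⟩
  · rw [← him]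
    refine hc.isCrossingPeriodicOrbit (by rw [h1, h0])
      ⟨M.R.time ε y y₂, ⟨hT.le, by linarith⟩, ?_⟩
    rw [h0, concat_of_le le_rfl, a3]
    simp only [ne_eq, Prod.mk.injEq, not_and]
    intro _; linarith [h.outer.pos, h₂.outer.pos]
  · exact ⟨γ (T / 2), Or.inr (by rw [← b4]; exact ⟨_, ⟨by linarith, by linarith⟩, rfl⟩), b6⟩
  · refine ⟨M.R.path ε y (M.R.time ε y y₂ / 2), Or.inl ?_, ?_⟩
    · rw [← a4]; exact ⟨_, ⟨by linarith, by linarith⟩, rfl⟩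
    · exact Outer.one_lt_path h.outer.lt h.outer.d_pos h.outer.s_pos (by rw [a3])
        ⟨by linarith, by linarith⟩
  · rintro ⟨q, hq, hlt⟩
    rcases hpts q hq with h | rfl | rfl | h
    · linarith
    · norm_num at hlt
    · norm_num at hlt
    · linarith [h.2.1]
  · rw [← him]
    exact ⟨0, ⟨le_rfl, by linarith⟩, h0⟩

/-- After crossing `x = 1` to the left, a solution near a loop comes back to `x = 1`. -/
lemma loop_step {γ : ℝ → ℝ × ℝ} (h : IsCrossingSolution (M.sys ε) γ) {a y₂ z r : ℝ}
    (ha : γ a = (1, -y₂)) (hy : |y₂ - z| < r) (hg : ∀ y, |y - z| < r → M.Good τ ε y)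
    (hx : ∀ t, -1 < (γ t).1) (hs : ∀ t, M.p ≤ (γ t).1 → (γ t).1 ≤ 1 → (γ t).2 ≠ 0)
    (hK : ∀ t, (γ t).1 = 1 → |(γ t).2 - z| < r ∨ |-(γ t).2 - z| < r) :
    ∃ b y₃, γ b = (1, y₃) ∧ |y₃ - z| < r ∧
      spiral (-1 * M.κ ε) M.c y₂ = spiral (1 * M.κ ε) M.c y₃ := by
  have g := hg y₂ hy
  obtain ⟨b, hab, hb, hi, -, hlog⟩ := h.central_passage (M := M) (ε := ε) (a := a) rfl
    (Or.inl ⟨by rw [ha], by rw [ha]; exact g.crossing.2.2.2⟩)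
    (fun t h1 h2 => by
      rcases lt_or_ge (γ t).1 M.p with h3 | h3
      · exact Or.inl (by simp only [w]; nlinarith [M.ω_pos])
      · exact Or.inr (hs t h3 h2))
  rcases hb with ⟨hb, hpos⟩ | ⟨hb, hpos⟩
  · have eb : γ b = (1, (γ b).2) := Prod.ext hb rfl
    refine ⟨b, (γ b).2, eb, ?_⟩
    rcases hK b hb with h1 | h1
    · refine ⟨h1, ?_⟩
      have p2 := g.outer.pos
      have p3 := (hg _ h1).outer.pos
      rw [eb, ha, w_one, w_one, arg_eq_neg_ang p2, arg_eq_ang p3, log_norm_eq,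
        log_norm_eq] at hlog
      simp only [spiral]
      simp only [neg_sq] at hlog ⊢
      linarith
    · have := (hg _ h1).crossing.2.2.2
      rw [neg_neg, ← eb] at this
      exact absurd this hpos.not_gt
  · exact absurd hb (hx b).ne'

/-- A periodic solution close to a loop follows the return map. -/
lemma loop_return {γ : ℝ → ℝ × ℝ} {T : ℝ} (h : IsCrossingPeriodic (M.sys ε) γ T) {z r : ℝ}
    (hr : 0 < r) (hL : 0 < 1 + ε * M.L.d) (hg : ∀ y, |y - z| < r → M.Good τ ε y)
    (hx : ∀ t, -1 < (γ t).1) (hs : ∀ t, M.p ≤ (γ t).1 → (γ t).1 ≤ 1 → (γ t).2 ≠ 0)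
    (hK : ∀ t, (γ t).1 = 1 → |(γ t).2 - z| < r ∨ |-(γ t).2 - z| < r) :
    (∃ y, |y - z| < r ∧ (1, y) ∈ range γ) ∧
    ∀ y, |y - z| < r → (1, y) ∈ range γ → ∃ y₂ y', |y₂ - z| < r ∧ |y' - z| < r ∧
      (1, y') ∈ range γ ∧ M.LoopRel ε y y₂ y' := by
  have hγ := h.1
  constructor
  · obtain ⟨t, ht | ht⟩ := h.exists_lineTime (hg z (by simpa)).outer.d_pos hL (fun t h1 h2 => by
      rcases lt_or_ge (γ t).1 M.p with h3 | h3
      · exact Or.inl (by simp only [w]; nlinarith [M.ω_pos])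
      · exact Or.inr (hs t h3 h2))
    · exact absurd ht (hx t).ne'
    · rcases hK t ht with h1 | h1
      · exact ⟨_, h1, t, Prod.ext ht rfl⟩
      · obtain ⟨b, y₃, h2, h3, -⟩ := loop_step hγ (a := t) (y₂ := -(γ t).2)
          (by rw [neg_neg]; exact Prod.ext ht rfl) h1 hg hx hs hK
        exact ⟨y₃, h3, b, h2⟩
  · rintro y hy ⟨a, ha⟩
    obtain ⟨b, y₂, hb, h2, hF⟩ := outer_step hγ ha hy hg hK
    obtain ⟨c, y₃, hc, h3, hS⟩ := loop_step hγ hb h2 hg hx hs hK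
    exact ⟨y₂, y₃, h2, h3, ⟨c, hc⟩, hF, hS⟩

/-- The scheme of `bifurcates_three`, with a single loop in place of two half returns. No second
line has to be reached, so the threshold `τ` plays no role and any number below `c / z` serves. -/
theorem bifurcates_two {z : ℝ} (hz : 0 < z) (hS : z < M.R.S) (he : 0 < M.e)
    (hze : M.c ^ 2 + z ^ 2 < M.e ^ 2) (hs : SignChange M.mel₂ z) :
    M.Bifurcates (fun Γ => MeetsCentral Γ ∧ MeetsRight Γ ∧ ¬ MeetsLeft Γ) z := by
  obtain ⟨h, P, ha, hP, h0, P0, hrel, r₁, hr₁, hu⟩ := M.exists_loop_map hz hS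
  set τ := M.c / z - 1 with hτdef
  have hτ : τ < M.c / z := by linarith
  have lim : ∀ {f : ℝ × ℝ → ℝ} {v : ℝ}, AnalyticAt ℝ f (0, z) → f (0, z) = v →
      Tendsto (fun q : ℝ × ℝ => (q.1, f q)) (𝓝 (0, z)) (𝓝 (0, v)) := by
    rintro f v hf rfl
    exact (analyticAt_fst.prod hf).continuousAt.tendsto
  have good : ∀ᶠ q in 𝓝 ((0, z) : ℝ × ℝ), M.Good τ q.1 q.2 := Good.eventually hz hS hτ
  have inner : ∀ᶠ q in 𝓝 ((0, z) : ℝ × ℝ), M.Inner q.1 q.2 := Inner.eventually he hze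
  have hA : ∀ᶠ q in 𝓝 ((0, z) : ℝ × ℝ), AnalyticAt ℝ h q ∧ AnalyticAt ℝ P q :=
    ha.eventually_analyticAt.and hP.eventually_analyticAt
  have hG : ∀ᶠ q in 𝓝 ((0, z) : ℝ × ℝ), M.Good τ q.1 q.2 ∧ M.Good τ q.1 (h q) ∧
      M.Good τ q.1 (P q) ∧ M.Inner q.1 (h q) :=
    good.and (((lim ha h0).eventually good).and (((lim hP P0).eventually good).and
      ((lim ha h0).eventually inner)))
  have hall := hA.and (hrel.and hG)
  have zero : ∀ᶠ y in 𝓝 z, h (0, y) = y ∧ P (0, y) = y := by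
    filter_upwards [slice_snd (hrel.and hG)] with y hy
    obtain ⟨b, g1, g2, g3, -⟩ := hy
    have e2 := Outer.eq_of_F_zero g1.outer.pos g1.outer.lt g2.outer.pos g2.outer.lt b.1
    have e3 := b.2
    simp only [κ_zero, mul_zero] at e3
    have p1 := g1.outer.pos
    have p3 := g3.outer.pos
    have := spiral_zero_inj g2.outer.pos p3 e3
    rw [e2] at this
    refine ⟨e2, ?_⟩
    have : P (0, y) ^ 2 = y ^ 2 := by linarith
    rwa [sq_eq_sq₀ p3.le p1.le] at this
  have hderiv : ∀ᶠ y in 𝓝 z, 0 < 1 / y ∧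
      HasDerivAt (fun ε => P (ε, y)) (-(1 / y * M.mel₂ y)) 0 := by
    filter_upwards [zero, slice_snd hall.eventually_nhds] with y hy hq
    obtain ⟨⟨a1, a2⟩, -, g1, -⟩ := hq.self_of_nhds
    obtain ⟨z1, z2⟩ := hy
    obtain ⟨b1, hb1⟩ := hasDerivAt_fst_of_analyticAt a1
    obtain ⟨b2, hb2⟩ := hasDerivAt_fst_of_analyticAt a2
    have p1 : 0 < y := g1.outer.pos
    have f1 := loopRel_deriv (M := M) p1 g1.outer.lt (hasDerivAt_const 0 y) hb1 hb2 rfl z1 z2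
      ((slice_fst hq).mono fun ε hε => hε.2.1)
    refine ⟨by positivity, hb2.congr_deriv ?_⟩
    have : y * b2 = -M.mel₂ y := by rw [mel₂]; linear_combination f1
    have hy := p1.ne'
    rw [one_div, ← mul_neg, ← this]
    field_simp
  obtain ⟨⟨r₃, hr₃, hanti⟩, Y, hY, hfix⟩ := exists_fixed_points hP (zero.mono fun y hy => hy.2)
    hderiv hs
  obtain ⟨r₄, hr₄, hgood⟩ := eventually_box good
  have hε : Tendsto (fun ε : ℝ => (ε, Y ε)) (𝓝[>] 0) (𝓝 (0, z)) :=
    (tendsto_nhdsWithin_of_tendsto_nhds tendsto_id).prodMk_nhds hY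
  have th : Tendsto (fun ε => h (ε, Y ε)) (𝓝[>] 0) (𝓝 z) := by
    have := ha.continuousAt.tendsto.comp hε
    rwa [h0] at this
  refine ⟨hz, M.loopSet 0 z z, fun ε => M.loopSet ε (Y ε) (h (ε, Y ε)), Y, ?_, hY, ?_, ?_⟩
  · obtain ⟨-, b1, g1, g2, g3, g4⟩ := hall.self_of_nhds
    simp only [h0, P0] at b1 g1 g2 g3 g4
    obtain ⟨c1, c2, c3, c4⟩ := loopSet_spec g1 g2 g4 b1
    refine ⟨c1, c2, c3, fun y hy hmem => ?_⟩
    rcases c4 _ hmem with h | h | h | h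
    · exact absurd h (lt_irrefl _)
    · exact congrArg Prod.snd h
    · have := congrArg Prod.snd h; simp only at this; linarith
    · exact absurd h.2.2 (lt_irrefl _)
  · set r := min r₁ (min r₃ r₄) with hrdef
    have hr0 : 0 < r := lt_min hr₁ (lt_min hr₃ hr₄)
    have le1 : r ≤ r₁ := min_le_left _ _
    have le3 : r ≤ r₃ := (min_le_right _ _).trans (min_le_left _ _)
    have le4 : r ≤ r₄ := (min_le_right _ _).trans (min_le_right _ _)
    have near : ∀ {f : ℝ → ℝ} {v : ℝ}, Tendsto f (𝓝[>] 0) (𝓝 v) →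
        ∀ᶠ ε in 𝓝[>] (0 : ℝ), |f ε - v| < r := fun hf => by
      have := (Metric.tendsto_nhds.1 hf) r hr0
      simpa only [Real.dist_eq] using this
    have hLd : ∀ᶠ ε in 𝓝[>] (0 : ℝ), 0 < 1 + ε * M.L.d := by
      have : Continuous fun ε : ℝ => 1 + ε * M.L.d := by fun_prop
      exact nhdsWithin_le_nhds (this.continuousAt.eventually_const_lt (by simp))
    filter_upwards [hfix, hε.eventually hall, near hY, near th, hLd,
      near (f := fun ε => ε) (tendsto_nhdsWithin_of_tendsto_nhds tendsto_id)]
      with ε hfx hal n1 n2 hL n5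
    rw [sub_zero] at n5
    obtain ⟨hPY, ρ, hρ, huniq⟩ := hfx
    obtain ⟨-, b1, g1, g2, g3, g4⟩ := hal
    have b1 : M.LoopRel ε (Y ε) (h (ε, Y ε)) (P (ε, Y ε)) := b1
    rw [hPY] at b1
    obtain ⟨c1, c2, c3, c4⟩ := loopSet_spec g1 g2 g4 b1
    have hgr : ∀ y, |y - z| < r → M.Good τ ε y := fun y hy =>
      hgood ε y (n5.trans_le le4) (hy.trans_le le4)
    refine ⟨⟨c1, ?_⟩, c2, g1.outer.pos, c3, fun y hy hmem => ?_⟩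
    · let W₁ : Set ℝ := {y | (|y - z| < r ∧ |y - Y ε| < ρ) ∨ |-y - z| < r}
      have hW₁ : IsOpen W₁ := ((isOpen_window z r).inter (isOpen_window (Y ε) ρ)).union
        (isOpen_window_neg z r)
      -- Loops cross the axis to the left of the center, so only the part of the axis from the
      -- center to `x = 1` is removed. The half plane `x ≤ -1` is removed as well, which confines
      -- competitors to two zones.
      let K : Set (ℝ × ℝ) := {q | q.1 ≤ -1} ∪ ({q | (M.p ≤ q.1 ∧ q.1 ≤ 1) ∧ q.2 = 0} ∪
        {q | q.1 = 1 ∧ q.2 ∉ W₁})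
      have hK : IsClosed K := by
        refine (isClosed_le continuous_fst continuous_const).union
          (IsClosed.union (IsClosed.inter (IsClosed.inter ?_ ?_) ?_) (isClosed_line_diff 1 hW₁))
        · exact isClosed_le continuous_const continuous_fst
        · exact isClosed_le continuous_fst continuous_const
        · exact isClosed_eq continuous_snd continuous_const
      refine ⟨Kᶜ, hK.isOpen_compl, ?_, ?_⟩
      · intro q hq
        have m1 : Y ε ∈ W₁ := Or.inl ⟨n1, by simpa⟩
        have m2 : -h (ε, Y ε) ∈ W₁ := Or.inr (by rwa [neg_neg])
        have p1 : 0 < Y ε := g1.outer.pos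
        have p2 : 0 < h (ε, Y ε) := g2.outer.pos
        rintro (k1 | ⟨⟨k1, k2⟩, k3⟩ | ⟨k1, k2⟩)
        · have k1 : q.1 ≤ -1 := k1
          rcases c4 q hq with h | rfl | rfl | h
          · linarith
          · norm_num at k1
          · norm_num at k1
          · linarith [h.2.1]
        · rcases c4 q hq with h | rfl | rfl | h
          · linarith
          · simp only at k3; linarith
          · simp only at k3; linarith
          · linarith [h.1 k3]
        · rcases c4 q hq with h | rfl | rfl | h
          · linarith
          · exact k2 m1
          · exact k2 m2
          · linarith [h.2.2]
      · rintro Γ' hΓ' hsub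
        have hΓ'0 := hΓ'
        obtain ⟨γ, T, hγ, rfl⟩ := hΓ'
        have hnK : ∀ t, γ t ∉ K := fun t => hsub ⟨t, rfl⟩
        have k1 : ∀ t, M.p ≤ (γ t).1 → (γ t).1 ≤ 1 → (γ t).2 ≠ 0 := fun t h1 h2 h3 =>
          hnK t (Or.inr (Or.inl ⟨⟨h1, h2⟩, h3⟩))
        have k2 : ∀ t, (γ t).1 = 1 → (γ t).2 ∈ W₁ := fun t h1 => by
          by_contra hno; exact hnK t (Or.inr (Or.inr ⟨h1, hno⟩))
        have k3 : ∀ t, -1 < (γ t).1 := fun t => by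
          by_contra! hno; exact hnK t (Or.inl hno)
        obtain ⟨⟨y₀, hy₀, hy₀'⟩, hret⟩ := loop_return hγ hr0 hL hgr k3 k1
          (fun t h1 => (k2 t h1).imp_left fun h => h.1)
        set S : Set ℝ := {y | |y - z| < r ∧ (1, y) ∈ range γ} with hSdef
        have hfin : S.Finite := hγ.finite_section.subset fun y hy => hy.2
        have hSW : ∀ y ∈ S, |y - z| < r ∧ |y - Y ε| < ρ := by
          rintro y ⟨h1, t, ht⟩
          have := k2 t (by rw [ht])
          rw [ht] at this
          rcases this with h2 | h2
          · exact h2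
          · exfalso
            have := (hgr _ h1).outer.pos
            have := (hgr _ h2).outer.pos
            linarith
        have hIoo : ∀ y, |y - z| < r → y ∈ Ioo (z - r₃) (z + r₃) := fun y hy => by
          have := abs_lt.1 (hy.trans_le le3)
          constructor <;> linarith
        have hfixS := fixed_of_finite_invariant (S := S)
          (W := {y | |y - z| < r ∧ |y - Y ε| < ρ}) (A := fun y => -P (ε, y))
          (B := fun y => -y) (y₀ := Y ε) hfin hSW
          ((hanti ε (n5.trans_le le3)).mono fun y hy => hIoo y hy.1)
          (fun a _ b _ hab => neg_lt_neg hab)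
          (fun y hy => by
            obtain ⟨y₂, y', h2, h5, h6, h7⟩ := hret y hy.1 hy.2
            refine ⟨y', ⟨h5, h6⟩, ?_⟩
            have e1 := hu ε y y₂ y' (n5.trans_le le1) (hy.1.trans_le le1) (h2.trans_le le1)
              (h5.trans_le le1) h7
            rw [← e1])
          (fun y hy hAB => huniq y hy.2 (neg_injective hAB))
        have hyY : y₀ = Y ε := hfixS ⟨hy₀, hy₀'⟩
        rw [hyY] at hy₀'
        exact IsCrossingPeriodicOrbit.eq_of_mem isLipschitz_sys hΓ'0 c1 hy₀' c3
    · rcases c4 _ hmem with h | h | h | h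
      · exact absurd h (lt_irrefl _)
      · exact congrArg Prod.snd h
      · have := congrArg Prod.snd h; simp only at this; linarith [g2.outer.pos]
      · exact absurd h.2.2 (lt_irrefl _)
  · have e0 : Tendsto (fun ε : ℝ => ε) (𝓝[>] 0) (𝓝 0) :=
      tendsto_nhdsWithin_of_tendsto_nhds tendsto_id
    have t1 : Tendsto (fun ε => (ε, Y ε, h (ε, Y ε))) (𝓝[>] 0) (𝓝 (0, z, z)) :=
      e0.prodMk_nhds (hY.prodMk_nhds th)
    have t2 : Tendsto (fun ε => (ε, h (ε, Y ε), Y ε)) (𝓝[>] 0) (𝓝 (0, z, z)) :=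
      e0.prodMk_nhds (th.prodMk_nhds hY)
    have l1 := (tendsto_outerArc (M := M) hz hS).comp t1
    have l2 := (tendsto_loopArc (M := M) hz).comp t2
    unfold loopSet
    exact tendsto_hausdorffEDist_union l1 l2

end NF

end PWHam

namespace PWHam

/-! ### Elementary estimates -/

lemma nonneg_of_deriv_nonneg {f f' : ℝ → ℝ} {b : ℝ} (hb : 0 ≤ b) (h0 : f 0 = 0)
    (hd : ∀ x ∈ Icc 0 b, HasDerivAt f (f' x) x) (hp : ∀ x ∈ Ioo 0 b, 0 ≤ f' x) : 0 ≤ f b := by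
  have : MonotoneOn f (Icc 0 b) := by
    refine monotoneOn_of_deriv_nonneg (convex_Icc _ _)
      (fun x hx => (hd x hx).continuousAt.continuousWithinAt)
      (fun x hx => ?_) (fun x hx => ?_)
    · rw [interior_Icc] at hx
      exact (hd x ⟨hx.1.le, hx.2.le⟩).differentiableAt.differentiableWithinAt
    · rw [interior_Icc] at hx
      rw [(hd x ⟨hx.1.le, hx.2.le⟩).deriv]
      exact hp x hx
  have := this ⟨le_rfl, hb⟩ ⟨hb, le_rfl⟩ hb
  rwa [h0] at this

lemma pos_of_deriv_pos {f f' : ℝ → ℝ} {b : ℝ} (hb : 0 < b) (h0 : f 0 = 0)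
    (hd : ∀ x ∈ Icc 0 b, HasDerivAt f (f' x) x) (hp : ∀ x ∈ Ioo 0 b, 0 < f' x) : 0 < f b := by
  have : StrictMonoOn f (Icc 0 b) := by
    refine strictMonoOn_of_deriv_pos (convex_Icc _ _)
      (fun x hx => (hd x hx).continuousAt.continuousWithinAt) (fun x hx => ?_)
    rw [interior_Icc] at hx
    rw [(hd x ⟨hx.1.le, hx.2.le⟩).deriv]
    exact hp x hx
  have := this ⟨le_rfl, hb.le⟩ ⟨hb.le, le_rfl⟩ hb
  rwa [h0] at this

lemma arctan_le_self {x : ℝ} (hx : 0 ≤ x) : Real.arctan x ≤ x := by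
  have := nonneg_of_deriv_nonneg (f := fun x => x - Real.arctan x) hx (by simp)
    (fun x _ => (hasDerivAt_id x).sub (Real.hasDerivAt_arctan x)) (fun x _ => by
      have : 1 / (1 + x ^ 2) ≤ 1 := by rw [div_le_one (by positivity)]; nlinarith
      linarith)
  linarith

lemma self_sub_le_arctan {x : ℝ} (hx : 0 ≤ x) : x - x ^ 3 / 3 ≤ Real.arctan x := by
  have := nonneg_of_deriv_nonneg (f := fun x => Real.arctan x - (x - x ^ 3 / 3)) hx (by simp)
    (fun x _ => (Real.hasDerivAt_arctan x).sub ((hasDerivAt_id x).sub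
      ((hasDerivAt_pow 3 x).div_const 3))) (fun x _ => by
      have : 1 - x ^ 2 ≤ 1 / (1 + x ^ 2) := by rw [le_div_iff₀ (by positivity)]; nlinarith [sq_nonneg (x ^ 2)]
      have e : (3 : ℕ) * x ^ (3 - 1) / 3 = x ^ 2 := by norm_num
      rw [e]; linarith)
  linarith

/-- Twice the area function `artanh (y / S)`. -/
noncomputable def lg (S y : ℝ) : ℝ := Real.log (S + y) - Real.log (S - y)

/-- The first order displacement caused by a change of the divergence in an outer zone. -/
noncomputable def gf (S y : ℝ) : ℝ := (S ^ 2 - y ^ 2) / 2 * lg S y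

section lg

variable {S y : ℝ}

lemma lg_zero : lg S 0 = 0 := by simp [lg]

lemma gf_zero : gf S 0 = 0 := by simp [gf, lg_zero]

lemma hasDerivAt_lg (h1 : -S < y) (h2 : y < S) :
    HasDerivAt (lg S) (2 * S / (S ^ 2 - y ^ 2)) y := by
  have e1 : S + y ≠ 0 := by linarith
  have e2 : S - y ≠ 0 := by linarith
  have := (((hasDerivAt_id y).const_add S).log e1).sub (((hasDerivAt_id y).const_sub S).log e2)
  refine this.congr_deriv ?_
  simp only [id]
  rw [show S ^ 2 - y ^ 2 = (S - y) * (S + y) by ring]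
  field_simp; ring

lemma hasDerivAt_gf (h1 : -S < y) (h2 : y < S) :
    HasDerivAt (gf S) (S - y * lg S y) y := by
  have e3 : S ^ 2 - y ^ 2 ≠ 0 := by
    have : 0 < (S - y) * (S + y) := mul_pos (by linarith) (by linarith)
    nlinarith
  have := (((hasDerivAt_pow 2 y).const_sub (S ^ 2)).div_const 2).mul (hasDerivAt_lg h1 h2)
  refine this.congr_deriv ?_
  field_simp; norm_num; ring

lemma sq_sub_pos (h0 : 0 ≤ y) (h : y < S) : 0 < S ^ 2 - y ^ 2 := by nlinarith

/-- The derivative is `(2/S) / (1 - q)` with `q = x²/S²`; it is bounded below by the first two terms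
of the geometric series. -/
lemma lg_lower (h0 : 0 ≤ y) (h : y < S) : 2 * y / S + 2 * y ^ 3 / (3 * S ^ 3) ≤ lg S y := by
  have hS : 0 < S := by linarith
  have := nonneg_of_deriv_nonneg (f := fun y => lg S y - (2 * y / S + 2 * y ^ 3 / (3 * S ^ 3))) h0
    (by simp [lg_zero])
    (fun x hx => (hasDerivAt_lg (by linarith [hx.1]) (by linarith [hx.2])).sub
      ((((hasDerivAt_id x).const_mul 2).div_const S).add
        (((hasDerivAt_pow 3 x).const_mul 2).div_const (3 * S ^ 3)))) (fun x hx => by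
      have h1 := sq_sub_pos hx.1.le (hx.2.trans h)
      have : 2 / S + 2 * x ^ 2 / S ^ 3 ≤ 2 * S / (S ^ 2 - x ^ 2) := by
        rw [le_div_iff₀ h1, div_add_div _ _ hS.ne' (by positivity), div_mul_eq_mul_div,
          div_le_iff₀ (by positivity)]
        nlinarith [mul_nonneg hS.le (sq_nonneg (x ^ 2))]
      have e : (2 * 1 / S + 2 * ((3 : ℕ) * x ^ (3 - 1)) / (3 * S ^ 3)) =
        2 / S + 2 * x ^ 2 / S ^ 3 := by field_simp; norm_num; ring
      rw [e]; linarith)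
  linarith

/-- For `q = x²/S² ≤ 1/2` one has `1/(1 - q) ≤ 1 + 2q`: doubling the second term of the series
absorbs the tail. -/
lemma lg_upper (h0 : 0 ≤ y) (hS : 0 < S) (h : y ^ 2 ≤ S ^ 2 / 2) :
    lg S y ≤ 2 * y / S + 4 * y ^ 3 / (3 * S ^ 3) := by
  have hy : y < S := by nlinarith
  have := nonneg_of_deriv_nonneg (f := fun y => (2 * y / S + 4 * y ^ 3 / (3 * S ^ 3)) - lg S y) h0
    (by simp [lg_zero])
    (fun x hx => ((((hasDerivAt_id x).const_mul 2).div_const S).add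
        (((hasDerivAt_pow 3 x).const_mul 4).div_const (3 * S ^ 3))).sub
        (hasDerivAt_lg (by linarith [hx.1]) (by linarith [hx.2]))) (fun x hx => by
      have h1 := sq_sub_pos hx.1.le (hx.2.trans hy)
      have h2 : x ^ 2 ≤ S ^ 2 / 2 := by nlinarith [hx.1, hx.2]
      have : 2 * S / (S ^ 2 - x ^ 2) ≤ 2 / S + 4 * x ^ 2 / S ^ 3 := by
        rw [div_le_iff₀ h1, div_add_div _ _ hS.ne' (by positivity), div_mul_eq_mul_div,
          le_div_iff₀ (by positivity)]
        have : 0 ≤ S * (x ^ 2 * (S ^ 2 / 2 - x ^ 2)) :=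
          mul_nonneg hS.le (mul_nonneg (sq_nonneg _) (by linarith))
        nlinarith
      have e : (2 * 1 / S + 4 * ((3 : ℕ) * x ^ (3 - 1)) / (3 * S ^ 3)) =
        2 / S + 4 * x ^ 2 / S ^ 3 := by field_simp; norm_num; ring
      rw [e]; linarith)
  linarith

/-- The difference has derivative `4 S x² / (S² - x²)²`. The strict inequality is what excludes a
vanishing second derivative of the double zero function when `c = 0`. -/
lemma lg_lt (h0 : 0 < y) (h : y < S) : lg S y < 2 * S * y / (S ^ 2 - y ^ 2) := by
  have := pos_of_deriv_pos (f := fun y => 2 * S * y / (S ^ 2 - y ^ 2) - lg S y) h0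
    (by simp [lg_zero])
    (fun x hx => ((((hasDerivAt_id x).const_mul (2 * S)).div
        ((hasDerivAt_pow 2 x).const_sub (S ^ 2)) (sq_sub_pos hx.1 (hx.2.trans_lt h)).ne')).sub
        (hasDerivAt_lg (by linarith [hx.1]) (by linarith [hx.2]))) (fun x hx => by
      have h1 := sq_sub_pos hx.1.le (hx.2.trans h)
      have hS : 0 < S := by linarith
      have hx0 := hx.1
      have e : (2 * S * 1 * (S ^ 2 - x ^ 2) - 2 * S * id x * -((2 : ℕ) * x ^ (2 - 1))) /
          (S ^ 2 - x ^ 2) ^ 2 - 2 * S / (S ^ 2 - x ^ 2) = 4 * S * x ^ 2 / (S ^ 2 - x ^ 2) ^ 2 := by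
        simp only [id]; field_simp; norm_num; ring
      rw [e]; positivity)
  linarith

/-- Up to sign this is the Wronskian of the identity and `gf S`. Its positivity allows value and
slope at a point to be prescribed by a combination of the two, and it gives the positive slope of
`evenPart` at `s`. -/
lemma gf_sub_pos (h0 : 0 < y) (h : y < S) : 0 < gf S y - y * (S - y * lg S y) := by
  have h1 := lg_lower h0.le h
  have hS : 0 < S := by linarith
  have e : gf S y - y * (S - y * lg S y) = (S ^ 2 + y ^ 2) / 2 * lg S y - y * S := by
    rw [gf]; ring
  have h2 : 2 * y / S < lg S y := by
    have : 0 < 2 * y ^ 3 / (3 * S ^ 3) := by positivity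
    linarith
  rw [div_lt_iff₀ hS] at h2
  have h3 : 0 < lg S y := by
    by_contra! h4; nlinarith
  rw [e]
  nlinarith [mul_pos h3 (pow_pos h0 2)]

/-- The derivative of `S y - gf S y` is `y * lg S y`, at least `2 y²/S`. Together with the upper
bound this fixes the exact order 3 of `cubicPart`. -/
lemma mul_sub_gf_lower (h0 : 0 ≤ y) (h : y < S) : 2 / (3 * S) * y ^ 3 ≤ S * y - gf S y := by
  have hS : 0 < S := by linarith
  have := nonneg_of_deriv_nonneg (f := fun y => S * y - gf S y - 2 / (3 * S) * y ^ 3) h0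
    (by simp [gf_zero])
    (fun x hx => ((((hasDerivAt_id x).const_mul S).sub
        (hasDerivAt_gf (by linarith [hx.1]) (by linarith [hx.2]))).sub
        ((hasDerivAt_pow 3 x).const_mul (2 / (3 * S))))) (fun x hx => by
      have h1 := lg_lower hx.1.le (hx.2.trans h)
      have hx0 := hx.1
      have h2 : 0 < 2 * x ^ 3 / (3 * S ^ 3) := by positivity
      have h3 : 2 * x / S ≤ lg S x := by linarith
      have h4 := mul_le_mul_of_nonneg_left h3 hx0.le
      have e : 2 / (3 * S) * ((3 : ℕ) * x ^ (3 - 1)) = x * (2 * x / S) := by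
        field_simp; norm_num
      rw [e]; linarith)
  linarith

lemma mul_sub_gf_upper (h0 : 0 ≤ y) (hS : 0 < S) (h : y ^ 2 ≤ S ^ 2 / 2) :
    S * y - gf S y ≤ 8 / (9 * S) * y ^ 3 := by
  have hy : y < S := by nlinarith
  have := nonneg_of_deriv_nonneg (f := fun y => 8 / (9 * S) * y ^ 3 - (S * y - gf S y)) h0
    (by simp [gf_zero])
    (fun x hx => ((hasDerivAt_pow 3 x).const_mul (8 / (9 * S))).sub (((hasDerivAt_id x).const_mul S).sub
        (hasDerivAt_gf (by linarith [hx.1]) (by linarith [hx.2])))) (fun x hx => by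
      have hx0 := hx.1
      have h2 : x ^ 2 ≤ S ^ 2 / 2 := by nlinarith [hx.1, hx.2]
      have h1 := lg_upper hx0.le hS h2
      have h3 : 4 * x ^ 3 / (3 * S ^ 3) ≤ 2 * x / (3 * S) := by
        rw [div_le_div_iff₀ (by positivity) (by positivity)]
        have : 0 ≤ S * x * (S ^ 2 / 2 - x ^ 2) := mul_nonneg (by positivity) (by linarith)
        nlinarith
      have h4 := mul_le_mul_of_nonneg_left (h1.trans (add_le_add_right h3 _)) hx0.le
      have e : 8 / (9 * S) * ((3 : ℕ) * x ^ (3 - 1)) = x * (2 * x / S + 2 * x / (3 * S)) := by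
        field_simp; norm_num; ring
      rw [e]; linarith)
  linarith

end lg

/-- The odd part of the displacement that vanishes to fifth order. -/
noncomputable def oddPart (e S δ : ℝ) : ℝ :=
  -((e ^ 2 + δ ^ 2) * Real.arctan (δ / e)) - S / e * gf S δ + (e + S ^ 2 / e) * δ

section oddPart

variable {e S δ : ℝ}

/-- The coefficients of `oddPart` are chosen so that the constants cancel here and the linear terms
`2δ/e` of both functions in the bracket cancel too. What remains in the bracket is of order `δ³`, so
`oddPart` is of order 5. -/
lemma hasDerivAt_oddPart (he : 0 < e) (h1 : -S < δ) (h2 : δ < S) :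
    HasDerivAt (oddPart e S) (δ * (S / e * lg S δ - 2 * Real.arctan (δ / e))) δ := by
  have := ((((hasDerivAt_pow 2 δ).const_add (e ^ 2)).mul
    (((hasDerivAt_id δ).div_const e).arctan)).neg.sub
    ((hasDerivAt_gf h1 h2).const_mul (S / e))).add ((hasDerivAt_id δ).const_mul (e + S ^ 2 / e))
  refine this.congr_deriv ?_
  have : e ^ 2 + δ ^ 2 ≠ 0 := by positivity
  simp only [id]
  field_simp; norm_num; ring

lemma oddPart_zero : oddPart e S 0 = 0 := by simp [oddPart, gf_zero]

lemma oddPart_lower (he : 0 < e) (h0 : 0 ≤ δ) (h : δ < S) :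
    2 / (15 * e * S ^ 2) * δ ^ 5 ≤ oddPart e S δ := by
  have hS : 0 < S := by linarith
  have := nonneg_of_deriv_nonneg (f := fun y => oddPart e S y - 2 / (15 * e * S ^ 2) * y ^ 5) h0
    (by simp [oddPart_zero])
    (fun x hx => (hasDerivAt_oddPart he (by linarith [hx.1]) (by linarith [hx.2])).sub
        ((hasDerivAt_pow 5 x).const_mul (2 / (15 * e * S ^ 2)))) (fun x hx => by
      have hx0 := hx.1
      have h1 := lg_lower hx0.le (hx.2.trans h)
      have h2 := arctan_le_self (x := x / e) (by positivity)
      have h3 := mul_le_mul_of_nonneg_left h1 (by positivity : 0 ≤ S / e)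
      have h4 : S / e * (2 * x / S + 2 * x ^ 3 / (3 * S ^ 3)) - 2 * (x / e) ≤
        S / e * lg S x - 2 * Real.arctan (x / e) := by linarith
      have h5 := mul_le_mul_of_nonneg_left h4 hx0.le
      have e1 : 2 / (15 * e * S ^ 2) * ((5 : ℕ) * x ^ (5 - 1)) =
          x * (S / e * (2 * x / S + 2 * x ^ 3 / (3 * S ^ 3)) - 2 * (x / e)) := by
        field_simp; norm_num; ring
      rw [e1]; linarith)
  linarith

lemma oddPart_upper (he : 0 < e) (h0 : 0 ≤ δ) (hS : 0 < S) (h : δ ^ 2 ≤ S ^ 2 / 2) :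
    oddPart e S δ ≤ (4 / (3 * e * S ^ 2) + 2 / (3 * e ^ 3)) / 5 * δ ^ 5 := by
  have hy : δ < S := by nlinarith
  have := nonneg_of_deriv_nonneg
    (f := fun y => (4 / (3 * e * S ^ 2) + 2 / (3 * e ^ 3)) / 5 * y ^ 5 - oddPart e S y) h0
    (by simp [oddPart_zero])
    (fun x hx => ((hasDerivAt_pow 5 x).const_mul
      ((4 / (3 * e * S ^ 2) + 2 / (3 * e ^ 3)) / 5)).sub
      (hasDerivAt_oddPart he (by linarith [hx.1]) (by linarith [hx.2]))) (fun x hx => by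
      have hx0 := hx.1
      have h2 : x ^ 2 ≤ S ^ 2 / 2 := by nlinarith [hx.1, hx.2]
      have h1 := lg_upper hx0.le hS h2
      have h2 := self_sub_le_arctan (x := x / e) (by positivity)
      have h3 := mul_le_mul_of_nonneg_left h1 (by positivity : 0 ≤ S / e)
      have h4 : S / e * lg S x - 2 * Real.arctan (x / e) ≤
        S / e * (2 * x / S + 4 * x ^ 3 / (3 * S ^ 3)) - 2 * (x / e - (x / e) ^ 3 / 3) := by
          linarith
      have h5 := mul_le_mul_of_nonneg_left h4 hx0.le
      have e1 : (4 / (3 * e * S ^ 2) + 2 / (3 * e ^ 3)) / 5 * ((5 : ℕ) * x ^ (5 - 1)) =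
          x * (S / e * (2 * x / S + 4 * x ^ 3 / (3 * S ^ 3)) -
            2 * (x / e - (x / e) ^ 3 / 3)) := by
        field_simp; norm_num; ring
      rw [e1]; linarith)
  linarith

end oddPart

/-- Second order Taylor expansion at a critical zero of an analytic function. -/
lemma isBigO_taylor_two {f : ℝ → ℝ} {s : ℝ} (hf : AnalyticAt ℝ f s) (h0 : f s = 0)
    (h1 : deriv f s = 0) :
    (fun y => f y - deriv (deriv f) s / 2 * (y - s) ^ 2) =O[𝓝 s] fun y => (y - s) ^ 3 := by
  have h := hf.hasFPowerSeriesAt.isBigO_sub_partialSum_pow 3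
  have hlim : Tendsto (fun y : ℝ => y - s) (𝓝 s) (𝓝 0) := by
    have : Continuous fun y : ℝ => y - s := by fun_prop
    simpa using this.tendsto s
  have h2 := h.comp_tendsto hlim
  refine (h2.congr' ?_ ?_).trans (Asymptotics.isBigO_refl _ _ |>.norm_left)
  · filter_upwards with y
    simp [FormalMultilinearSeries.partialSum, Finset.sum_range_succ, iteratedDeriv_succ,
      FormalMultilinearSeries.ofScalars, h0, h1]
  · filter_upwards with y
    simp

end PWHam

namespace PWHam

/-! ### Sign patterns of the first order displacements -/

section signs

variable {α : Type*} {l : Filter α} {f g : α → ℝ} {k : ℝ}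

lemma eventually_pos_add_of_isLittleO (h : f =o[l] g) (hg : ∀ᶠ x in l, 0 < g x) (hk : 0 < k) :
    ∀ᶠ x in l, 0 < f x + k * g x := by
  filter_upwards [h.def (half_pos hk), hg] with x h1 h2
  rw [Real.norm_eq_abs, Real.norm_eq_abs, abs_of_pos h2] at h1
  have := neg_abs_le (f x)
  nlinarith

lemma eventually_neg_add_of_isLittleO (h : f =o[l] g) (hg : ∀ᶠ x in l, g x < 0) (hk : 0 < k) :
    ∀ᶠ x in l, f x + k * g x < 0 := by
  have := eventually_pos_add_of_isLittleO (f := fun x => -f x) (g := fun x => -g x)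
    (h.neg_left.neg_right) (hg.mono fun x hx => neg_pos.2 hx) hk
  exact this.mono fun x hx => by linarith

lemma eventually_small_pos {a : ℝ} (b : ℝ) (ha : 0 < a) : ∀ᶠ k in 𝓝[>] (0 : ℝ), 0 < a + k * b := by
  have : Continuous fun k : ℝ => a + k * b := by fun_prop
  exact nhdsWithin_le_nhds (this.continuousAt.eventually_const_lt (by simpa))

lemma eventually_small_neg {a : ℝ} (b : ℝ) (ha : a < 0) : ∀ᶠ k in 𝓝[>] (0 : ℝ), a + k * b < 0 := by
  have : Continuous fun k : ℝ => a + k * b := by fun_prop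
  exact nhdsWithin_le_nhds (this.continuousAt.eventually_lt_const (by simpa))

end signs

/-- Successive small perturbations of dominating order produce alternating signs. -/
lemma exists_sign_chain {T B T₂ T₁ T₀ : ℝ → ℝ} {s y₀ ya : ℝ} (hT : T =o[𝓝[>] s] T₂)
    (hneg : ∀ᶠ y in 𝓝[>] s, T y < 0) (h2 : ∀ᶠ y in 𝓝[>] s, 0 < T₂ y) (h21 : T₂ =o[𝓝[>] s] T₁)
    (h1 : ∀ᶠ y in 𝓝[>] s, T₁ y < 0) (h10 : T₁ =o[𝓝[>] s] T₀) (h0 : ∀ᶠ y in 𝓝[>] s, 0 < T₀ y)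
    (hB : B =o[𝓝[<] s] T₂) (h2' : ∀ᶠ y in 𝓝[<] s, T₂ y < 0) (h20 : T₂ =o[𝓝[<] s] T₀)
    (h0' : ∀ᶠ y in 𝓝[<] s, 0 < T₀ y) (hy₀ : s < y₀) (hya : ya < s) :
    ∃ k₂ k₁ k₀ y₁ y₂ y₃ y₄ yb yc : ℝ,
      (s < y₄ ∧ y₄ < y₃ ∧ y₃ < y₂ ∧ y₂ < y₁ ∧ y₁ < y₀) ∧ (ya < yb ∧ yb < yc ∧ yc < s) ∧
      (T y₁ + k₂ * T₂ y₁ + k₁ * T₁ y₁ + k₀ * T₀ y₁ < 0 ∧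
        0 < T y₂ + k₂ * T₂ y₂ + k₁ * T₁ y₂ + k₀ * T₀ y₂ ∧
        T y₃ + k₂ * T₂ y₃ + k₁ * T₁ y₃ + k₀ * T₀ y₃ < 0 ∧
        0 < T y₄ + k₂ * T₂ y₄ + k₁ * T₁ y₄ + k₀ * T₀ y₄) ∧
      (B yb + k₂ * T₂ yb + k₀ * T₀ yb < 0 ∧ 0 < B yc + k₂ * T₂ yc + k₀ * T₀ yc) ∧
      (0 < T y₀ → 0 < T y₀ + k₂ * T₂ y₀ + k₁ * T₁ y₀ + k₀ * T₀ y₀) ∧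
      (0 < B ya → 0 < B ya + k₂ * T₂ ya + k₀ * T₀ ya) := by
  -- The signs at `y₀` and `ya` are optional: they are preserved when the top terms are positive
  -- there, and ignored otherwise. Thus one chain serves both kinds of centers.
  have imp_pos : ∀ {p : Prop} {a b : ℝ}, (p → 0 < a) → ∀ᶠ k in 𝓝[>] (0 : ℝ), p → 0 < a + k * b :=
    fun {p a b} h => by
      by_cases hp : p
      · exact (eventually_small_pos b (h hp)).mono fun k hk _ => hk
      · exact Eventually.of_forall fun k hk => absurd hk hp
  have ioo : ∀ {a : ℝ}, s < a → ∀ᶠ y in 𝓝[>] s, y ∈ Ioo s a := fun h => Ioo_mem_nhdsGT h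
  have ioo' : ∀ {a : ℝ}, a < s → ∀ᶠ y in 𝓝[<] s, y ∈ Ioo a s := fun h => Ioo_mem_nhdsLT h
  -- Each coefficient is taken so small that all strict signs obtained so far survive; only then are
  -- new points chosen still closer to `s`, where the newly added term dominates. The term with `k₁`
  -- has no counterpart below `s`.
  obtain ⟨y₁, n1, hy₁⟩ := (hneg.and (ioo hy₀)).exists
  obtain ⟨k₂, ⟨a1, a2⟩, a3, hk₂⟩ := ((eventually_small_neg (T₂ y₁) n1).and
    (imp_pos (b := T₂ y₀) (fun h : 0 < T y₀ => h)) |>.and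
    ((imp_pos (b := T₂ ya) (fun h : 0 < B ya => h)).and self_mem_nhdsWithin)).exists
  obtain ⟨y₂, n2, hy₂⟩ := ((eventually_pos_add_of_isLittleO hT h2 hk₂).and (ioo hy₁.1)).exists
  obtain ⟨yb, nb, hyb⟩ := ((eventually_neg_add_of_isLittleO hB h2' hk₂).and (ioo' hya)).exists
  have hT1 : (fun y => T y + k₂ * T₂ y) =o[𝓝[>] s] T₁ :=
    (hT.trans h21).add (h21.const_mul_left k₂)
  obtain ⟨k₁, ⟨b1, b2⟩, b3, hk₁⟩ := ((eventually_small_neg (T₁ y₁) a1).and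
    (eventually_small_pos (T₁ y₂) n2) |>.and ((imp_pos (b := T₁ y₀) a2).and
      self_mem_nhdsWithin)).exists
  obtain ⟨y₃, n3, hy₃⟩ := ((eventually_neg_add_of_isLittleO hT1 h1 hk₁).and (ioo hy₂.1)).exists
  have hT0 : (fun y => T y + k₂ * T₂ y + k₁ * T₁ y) =o[𝓝[>] s] T₀ :=
    (hT1.trans h10).add (h10.const_mul_left k₁)
  have hB0 : (fun y => B y + k₂ * T₂ y) =o[𝓝[<] s] T₀ :=
    (hB.trans h20).add (h20.const_mul_left k₂)
  obtain ⟨k₀, ⟨⟨⟨c1, c2⟩, c3, c4⟩, c5⟩, c6, hk₀⟩ := ((eventually_small_neg (T₀ y₁) b1).and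
    (eventually_small_pos (T₀ y₂) b2) |>.and ((eventually_small_neg (T₀ y₃) n3).and
      (imp_pos (b := T₀ y₀) b3)) |>.and (eventually_small_neg (T₀ yb) nb) |>.and
      ((imp_pos (b := T₀ ya) a3).and self_mem_nhdsWithin)).exists
  obtain ⟨y₄, n4, hy₄⟩ := ((eventually_pos_add_of_isLittleO hT0 h0 hk₀).and (ioo hy₃.1)).exists
  obtain ⟨yc, nc, hyc⟩ := ((eventually_pos_add_of_isLittleO hB0 h0' hk₀).and (ioo' hyb.2)).exists
  exact ⟨k₂, k₁, k₀, y₁, y₂, y₃, y₄, yb, yc, ⟨hy₄.1, hy₄.2, hy₃.2, hy₂.2, hy₁.2⟩,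
    ⟨hyb.1, hyc.1, hyc.2⟩, ⟨c1, c2, c3, n4⟩, ⟨c5, nc⟩, c4, c6⟩

section functions

variable {S s c : ℝ}

lemma analyticAt_gf {y : ℝ} (h1 : -S < y) (h2 : y < S) : AnalyticAt ℝ (gf S) y := by
  have e1 : S + y ≠ 0 := by linarith
  have e2 : S - y ≠ 0 := by linarith
  refine ContDiffAt.analyticAt ?_
  unfold gf lg
  fun_prop (disch := assumption)

lemma analyticAt_ang (m : ℝ) {y : ℝ} (hy : y ≠ 0) : AnalyticAt ℝ (ang m) y := by
  have h2 : ContDiffAt ℝ ⊤ (fun y => m / y) y := by fun_prop (disch := assumption)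
  have h3 : ContDiffAt ℝ ⊤ (fun y => Real.arctan (m / y)) y :=
    Real.contDiff_arctan.contDiffAt.fun_comp y h2
  refine ContDiffAt.analyticAt ?_
  unfold ang
  exact contDiffAt_const.add h3

/-- The displacement through two zones that has a double zero at the height `s`. -/
lemma exists_double_zero (c : ℝ) (hs : 0 < s) (hS : s < S) : ∃ A B : ℝ,
    AnalyticAt ℝ (fun y => A * gf S y + B * y + (c ^ 2 + y ^ 2) * ang c y) s ∧
    A * gf S s + B * s + (c ^ 2 + s ^ 2) * ang c s = 0 ∧
    deriv (fun y => A * gf S y + B * y + (c ^ 2 + y ^ 2) * ang c y) s = 0 ∧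
    (c = 0 → deriv (deriv fun y => A * gf S y + B * y + (c ^ 2 + y ^ 2) * ang c y) s ≠ 0) := by
  -- Vanishing of value and slope at `s` is a linear system for `A` and `B` with determinant `±D`,
  -- nonzero by `gf_sub_pos`.
  set D := gf S s - s * (S - s * lg S s) with hD
  have hD0 : 0 < D := gf_sub_pos hs hS
  set h : ℝ → ℝ := fun y => (c ^ 2 + y ^ 2) * ang c y with hh
  have ha : AnalyticAt ℝ h s := by
    have h1 : AnalyticAt ℝ (fun y : ℝ => c ^ 2 + y ^ 2) s :=
      ContDiffAt.analyticAt (by fun_prop)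
    exact h1.mul (analyticAt_ang c hs.ne')
  set A := -(h s - s * deriv h s) / D with hA
  set B := -(A * (S - s * lg S s) + deriv h s) with hB
  have hd : HasDerivAt (fun y => A * gf S y + B * y + (c ^ 2 + y ^ 2) * ang c y)
      (A * (S - s * lg S s) + B * 1 + deriv h s) s :=
    (((hasDerivAt_gf (by linarith) hS).const_mul A).add ((hasDerivAt_id s).const_mul B)).add
      ha.differentiableAt.hasDerivAt
  have hAD : A * D = -(h s - s * deriv h s) := by rw [hA]; field_simp
  refine ⟨A, B, ?_, ?_, ?_, ?_⟩
  · have h1 : AnalyticAt ℝ (fun y : ℝ => B * y) s := ContDiffAt.analyticAt (by fun_prop)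
    exact ((analyticAt_const.mul (analyticAt_gf (by linarith) hS)).add h1).add ha
  · have : A * gf S s + B * s + h s = 0 := by
      rw [hB]; rw [hD] at hAD; linear_combination hAD
    exact this
  · rw [hd.deriv, hB]; ring
  · intro hc
    have hh' : ∀ y, h y = Real.pi / 2 * y ^ 2 := fun y => by
      simp only [hh, hc, ang]; simp; ring
    have hdh : ∀ y, HasDerivAt h (Real.pi * y) y := fun y => by
      rw [funext hh']
      refine ((hasDerivAt_pow 2 y).const_mul (Real.pi / 2)).congr_deriv ?_
      norm_num; ring
    have d1 : ∀ᶠ y in 𝓝 s, deriv (fun y => A * gf S y + B * y + (c ^ 2 + y ^ 2) * ang c y) y =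
        A * (S - y * lg S y) + B + Real.pi * y := by
      filter_upwards [Ioo_mem_nhds (show -S < s by linarith) hS] with y hy
      have : HasDerivAt (fun y => A * gf S y + B * y + h y)
          (A * (S - y * lg S y) + B * 1 + Real.pi * y) y :=
        (((hasDerivAt_gf hy.1 hy.2).const_mul A).add ((hasDerivAt_id y).const_mul B)).add (hdh y)
      have e := this.deriv
      rw [mul_one] at e
      exact e
    have d2 : HasDerivAt (fun y => A * (S - y * lg S y) + B + Real.pi * y)
        (A * -(1 * lg S s + s * (2 * S / (S ^ 2 - s ^ 2))) + Real.pi * 1) s :=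
      ((((hasDerivAt_id s).mul (hasDerivAt_lg (by linarith) hS)).const_sub S).const_mul A
        |>.add_const B).add ((hasDerivAt_id s).const_mul Real.pi)
    rw [EventuallyEq.deriv_eq d1, d2.deriv]
    intro h0
    rw [(hdh s).deriv, hh'] at hAD
    have hq : 0 < S ^ 2 - s ^ 2 := sq_sub_pos hs.le hS
    have hlt := lg_lt hs hS
    have hπ := Real.pi_pos
    set Q := 2 * S * s / (S ^ 2 - s ^ 2) with hQ
    have hQ' : s * (2 * S / (S ^ 2 - s ^ 2)) = Q := by rw [hQ]; ring
    have hQ2 : Q * (S ^ 2 - s ^ 2) = 2 * S * s := by rw [hQ]; field_simp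
    rw [hQ'] at h0
    have hAD' : A * D = Real.pi / 2 * s ^ 2 := by rw [hAD]; ring
    have hDe : D = (S ^ 2 + s ^ 2) / 2 * lg S s - s * S := by rw [hD, gf]; ring
    have hA0 : A * (lg S s + Q) = Real.pi := by linarith
    have hAne : A ≠ 0 := by
      intro h; rw [h, zero_mul] at hA0; exact hπ.ne hA0
    -- Eliminating `π` between the double zero condition and the vanishing of the second derivative
    -- leaves `lg S s = Q`, which `lg_lt` forbids.
    have : A * (S ^ 2 * (Q - lg S s)) = 0 := by
      have e1 : A * D * 2 = A * (lg S s + Q) * s ^ 2 := by rw [hAD', hA0]; ring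
      rw [hDe] at e1
      linear_combination (-1) * e1 + A * hQ2
    have h1 : 0 < S ^ 2 * (Q - lg S s) := by
      have : 0 < S := by linarith
      have : 0 < Q - lg S s := by linarith
      positivity
    rcases mul_eq_zero.1 this with h | h
    · exact hAne h
    · exact h1.ne' h

/-- For a center inside the right half of the central zone the displacement is positive for small
heights. -/
lemma eventually_double_zero_pos (A B : ℝ) (hc : 0 < c) (hS : 0 < S) :
    ∀ᶠ y in 𝓝[>] (0 : ℝ), 0 < A * gf S y + B * y + (c ^ 2 + y ^ 2) * ang c y := by
  have h1 : Tendsto (ang c) (𝓝[>] 0) (𝓝 Real.pi) := by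
    have : Tendsto (fun y : ℝ => c / y) (𝓝[>] 0) atTop := by
      simp only [div_eq_mul_inv]
      exact tendsto_inv_nhdsGT_zero.const_mul_atTop hc
    have := (Real.tendsto_arctan_atTop.mono_right nhdsWithin_le_nhds).comp this
    have := this.const_add (Real.pi / 2)
    rwa [add_halves] at this
  have h2 : Tendsto (fun y => A * gf S y + B * y) (𝓝[>] 0) (𝓝 0) := by
    have hc : ContinuousAt (fun y => A * gf S y + B * y) 0 :=
      ((analyticAt_gf (by linarith) hS).continuousAt.const_mul A).add (by fun_prop)
    have := hc.tendsto
    simp only [gf_zero, mul_zero, add_zero] at this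
    exact this.mono_left nhdsWithin_le_nhds
  have h3 : Tendsto (fun y : ℝ => c ^ 2 + y ^ 2) (𝓝[>] 0) (𝓝 (c ^ 2)) := by
    have hc : Continuous fun y : ℝ => c ^ 2 + y ^ 2 := by fun_prop
    have := hc.tendsto 0
    simp only [ne_eq, OfNat.ofNat_ne_zero, not_false_eq_true, zero_pow, add_zero] at this
    exact this.mono_left nhdsWithin_le_nhds
  have h4 := h2.add (h3.mul h1)
  rw [zero_add] at h4
  exact h4.eventually_const_lt (by positivity)

end functions

end PWHam
open Asymptotics

namespace PWHam

/-! ### Orders of the basic displacements -/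

/-- The height on the left line that corresponds to the height `y` on the right line. -/
noncomputable def del (s y : ℝ) : ℝ := √(y ^ 2 - s ^ 2)

section orders

variable {s S SL : ℝ}

lemma del_sq {y : ℝ} (hs : 0 < s) (hy : s < y) : del s y ^ 2 = (y - s) * (y + s) := by
  rw [del, Real.sq_sqrt (by nlinarith)]; ring

lemma del_pos {y : ℝ} (hs : 0 < s) (hy : s < y) : 0 < del s y := Real.sqrt_pos.2 (by nlinarith)

lemma tendsto_del (hs : 0 < s) : Tendsto (del s) (𝓝[>] s) (𝓝[>] 0) := by
  refine tendsto_nhdsWithin_iff.2 ⟨?_, ?_⟩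
  · have hc : Continuous (del s) := by unfold del; fun_prop
    have := hc.tendsto s
    simp only [del, sub_self, Real.sqrt_zero] at this
    exact this.mono_left nhdsWithin_le_nhds
  · filter_upwards [self_mem_nhdsWithin] with y hy using del_pos hs hy

lemma del_pow_isLittleO (hs : 0 < s) {m n : ℕ} (h : m < n) :
    (fun y => del s y ^ n) =o[𝓝[>] s] fun y => del s y ^ m :=
  (isLittleO_pow_pow h).comp_tendsto ((tendsto_del hs).mono_right nhdsWithin_le_nhds)

/-- From `δ² = (y - s)(y + s)`, where the second factor is bounded away from zero. Orders in `y - s`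
thus count double when measured in `δ`. -/
lemma sub_isBigO_del_sq (hs : 0 < s) : (fun y => y - s) =O[𝓝[>] s] fun y => del s y ^ 2 := by
  refine IsBigO.of_bound (1 / s) ?_
  filter_upwards [self_mem_nhdsWithin] with y (hy : s < y)
  rw [del_sq hs hy, Real.norm_of_nonneg (by linarith), Real.norm_of_nonneg (by nlinarith),
    div_mul_eq_mul_div, le_div_iff₀ hs]
  nlinarith

lemma del_sq_isBigO_sub (hs : 0 < s) : (fun y => del s y ^ 2) =O[𝓝[>] s] fun y => y - s := by
  refine IsBigO.of_bound (3 * s) ?_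
  filter_upwards [Ioo_mem_nhdsGT (show s < 2 * s by linarith)] with y hy
  rw [del_sq hs hy.1, Real.norm_of_nonneg (by nlinarith [hy.1]),
    Real.norm_of_nonneg (by linarith [hy.1])]
  nlinarith [hy.1, hy.2]

/-- The displacement of even order two at `s`. -/
noncomputable def evenPart (S s y : ℝ) : ℝ := y * (gf S s / s) - gf S y

lemma hasDerivAt_evenPart (hs : 0 < s) (hS : s < S) :
    ∃ D > 0, HasDerivAt (evenPart S s) D s := by
  refine ⟨1 * (gf S s / s) - (S - s * lg S s), ?_,
    ((hasDerivAt_id s).mul_const _).sub (hasDerivAt_gf (by linarith) hS)⟩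
  have := gf_sub_pos hs hS
  have e : 1 * (gf S s / s) - (S - s * lg S s) = (gf S s - s * (S - s * lg S s)) / s := by
    field_simp
  rw [e]
  positivity

lemma evenPart_self (hs : 0 < s) : evenPart S s s = 0 := by
  rw [evenPart, mul_div_cancel₀ _ hs.ne', sub_self]

lemma evenPart_isBigO (hs : 0 < s) (hS : s < S) : evenPart S s =O[𝓝 s] fun y => y - s := by
  obtain ⟨D, -, h⟩ := hasDerivAt_evenPart hs hS
  simpa [evenPart_self hs] using h.isBigO_sub

lemma evenPart_sub_isLittleO (hs : 0 < s) (hS : s < S) : ∃ D > 0,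
    (fun y => evenPart S s y - D * (y - s)) =o[𝓝 s] fun y => y - s := by
  obtain ⟨D, hD, h⟩ := hasDerivAt_evenPart hs hS
  refine ⟨D, hD, (hasDerivAt_iff_isLittleO.1 h).congr_left fun y => ?_⟩
  rw [evenPart_self hs, smul_eq_mul]; ring

lemma sub_isBigO_evenPart (hs : 0 < s) (hS : s < S) :
    (fun y => y - s) =O[𝓝 s] evenPart S s := by
  obtain ⟨D, hD, h⟩ := evenPart_sub_isLittleO hs hS
  have h1 : (fun y => evenPart S s y - D * (y - s)) =o[𝓝 s] fun y => D * (y - s) :=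
    h.trans_isBigO (isBigO_self_const_mul hD.ne' _ _)
  have h2 := h1.right_isBigO_add
  simp only [sub_add_cancel] at h2
  exact (isBigO_self_const_mul hD.ne' _ _).trans h2

lemma evenPart_pos (hs : 0 < s) (hS : s < S) : ∀ᶠ y in 𝓝[>] s, 0 < evenPart S s y := by
  obtain ⟨D, hD, h⟩ := evenPart_sub_isLittleO hs hS
  have := eventually_pos_add_of_isLittleO (h.mono (nhdsWithin_le_nhds (s := Ioi s)))
    (by filter_upwards [self_mem_nhdsWithin] with y hy using sub_pos.2 hy) hD
  exact this.mono fun y hy => by linarith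

lemma evenPart_neg (hs : 0 < s) (hS : s < S) : ∀ᶠ y in 𝓝[<] s, evenPart S s y < 0 := by
  obtain ⟨D, hD, h⟩ := evenPart_sub_isLittleO hs hS
  have := eventually_neg_add_of_isLittleO (h.mono (nhdsWithin_le_nhds (s := Iio s)))
    (by filter_upwards [self_mem_nhdsWithin] with y hy using sub_neg.2 hy) hD
  exact this.mono fun y hy => by linarith

lemma one_isBigO_id (hs : 0 < s) : (fun _ => (1 : ℝ)) =O[𝓝 s] fun y : ℝ => y := by
  refine IsBigO.of_bound (2 / s) ?_
  filter_upwards [lt_mem_nhds (show s / 2 < s by linarith)] with y hy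
  rw [norm_one, Real.norm_of_nonneg (by linarith), div_mul_eq_mul_div, le_div_iff₀ hs]
  linarith

/-- The displacement of odd order three at `s`. -/
noncomputable def cubicPart (S s y : ℝ) : ℝ := gf S (del s y) - S * del s y

lemma eventually_del_lt (hs : 0 < s) {a : ℝ} (ha : 0 < a) : ∀ᶠ y in 𝓝[>] s, del s y < a :=
  ((tendsto_del hs).mono_right nhdsWithin_le_nhds).eventually_lt_const ha

lemma eventually_del_sq_le (hs : 0 < s) (hL : 0 < SL) :
    ∀ᶠ y in 𝓝[>] s, 0 < del s y ∧ del s y < SL ∧ del s y ^ 2 ≤ SL ^ 2 / 2 := by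
  filter_upwards [self_mem_nhdsWithin, eventually_del_lt hs (half_pos hL)] with y hy h
  have := del_pos hs hy
  exact ⟨this, by linarith, by nlinarith⟩

lemma cubicPart_neg (hs : 0 < s) (hL : 0 < SL) : ∀ᶠ y in 𝓝[>] s, cubicPart SL s y < 0 := by
  filter_upwards [eventually_del_sq_le hs hL] with y ⟨h1, h2, h3⟩
  have := mul_sub_gf_lower h1.le h2
  have : 0 < 2 / (3 * SL) * del s y ^ 3 := by positivity
  rw [cubicPart]; linarith

lemma cubicPart_isBigO (hs : 0 < s) (hL : 0 < SL) :
    cubicPart SL s =O[𝓝[>] s] fun y => del s y ^ 3 := by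
  refine IsBigO.of_bound (8 / (9 * SL)) ?_
  filter_upwards [eventually_del_sq_le hs hL, cubicPart_neg hs hL] with y ⟨h1, h2, h3⟩ h4
  rw [Real.norm_of_nonpos h4.le, Real.norm_of_nonneg (by positivity), cubicPart]
  linarith [mul_sub_gf_upper h1.le hL h3]

lemma isBigO_cubicPart (hs : 0 < s) (hL : 0 < SL) :
    (fun y => del s y ^ 3) =O[𝓝[>] s] cubicPart SL s := by
  refine IsBigO.of_bound (3 * SL / 2) ?_
  filter_upwards [eventually_del_sq_le hs hL, cubicPart_neg hs hL] with y ⟨h1, h2, h3⟩ h4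
  rw [Real.norm_of_nonpos h4.le, Real.norm_of_nonneg (by positivity), cubicPart]
  have h5 := mul_sub_gf_lower h1.le h2
  rw [div_mul_eq_mul_div, div_le_iff₀ (by positivity)] at h5
  nlinarith

lemma cubicPart_isLittleO_evenPart (hs : 0 < s) (hS : s < S) (hL : 0 < SL) :
    cubicPart SL s =o[𝓝[>] s] evenPart S s :=
  ((cubicPart_isBigO hs hL).trans_isLittleO (del_pow_isLittleO hs (by norm_num : 2 < 3))).trans_isBigO
    ((del_sq_isBigO_sub hs).trans ((sub_isBigO_evenPart hs hS).mono nhdsWithin_le_nhds))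

lemma evenPart_isLittleO_del (hs : 0 < s) (hS : s < S) :
    evenPart S s =o[𝓝[>] s] fun y => -del s y := by
  have h := del_pow_isLittleO hs (by norm_num : 1 < 2)
  simp only [pow_one] at h
  exact ((((evenPart_isBigO hs hS).mono nhdsWithin_le_nhds).trans
    (sub_isBigO_del_sq hs)).trans_isLittleO h).neg_right

lemma del_isLittleO_id (hs : 0 < s) : (fun y => -del s y) =o[𝓝[>] s] fun y : ℝ => y := by
  have h := del_pow_isLittleO hs (by norm_num : 0 < 1)
  simp only [pow_one, pow_zero] at h
  exact (h.trans_isBigO ((one_isBigO_id hs).mono nhdsWithin_le_nhds)).neg_left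

lemma sub_pow_isLittleO {m n : ℕ} (h : m < n) :
    (fun y => (y - s) ^ n) =o[𝓝 s] fun y => (y - s) ^ m := by
  refine (isLittleO_pow_pow (𝕜 := ℝ) h).comp_tendsto (k := fun y => y - s) ?_
  have : Continuous fun y : ℝ => y - s := by fun_prop
  simpa using this.tendsto s

lemma evenPart_isLittleO_id (hs : 0 < s) (hS : s < S) : evenPart S s =o[𝓝 s] fun y : ℝ => y := by
  have h := sub_pow_isLittleO (s := s) (by norm_num : 0 < 1)
  simp only [pow_one, pow_zero] at h
  exact ((evenPart_isBigO hs hS).trans_isLittleO h).trans_isBigO (one_isBigO_id hs)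

lemma sub_sq_isLittleO_evenPart (hs : 0 < s) (hS : s < S) :
    (fun y => (y - s) ^ 2) =o[𝓝 s] evenPart S s := by
  have h := sub_pow_isLittleO (s := s) (by norm_num : 1 < 2)
  simp only [pow_one] at h
  exact h.trans_isBigO (sub_isBigO_evenPart hs hS)

lemma sub_pow_isBigO_del (hs : 0 < s) (n : ℕ) :
    (fun y => (y - s) ^ n) =O[𝓝[>] s] fun y => del s y ^ (2 * n) :=
  ((sub_isBigO_del_sq hs).pow n).congr_right fun _ => (pow_mul _ _ _).symm

lemma oddPart_isBigO {e : ℝ} (he : 0 < e) (hs : 0 < s) (hL : 0 < SL) :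
    (fun y => oddPart e SL (del s y)) =O[𝓝[>] s] fun y => del s y ^ 5 := by
  refine IsBigO.of_bound ((4 / (3 * e * SL ^ 2) + 2 / (3 * e ^ 3)) / 5) ?_
  filter_upwards [eventually_del_sq_le hs hL] with y ⟨h1, h2, h3⟩
  have := oddPart_lower he h1.le h2
  have h0 : 0 ≤ 2 / (15 * e * SL ^ 2) * del s y ^ 5 := by positivity
  rw [Real.norm_of_nonneg (h0.trans this), Real.norm_of_nonneg (by positivity)]
  exact oddPart_upper he h1.le hL h3

end orders

/-! ### Alternating signs on both sides of the separating orbit -/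

section patterns

variable {s S SL e c : ℝ}

/-- A combination of the displacements for orbits through three zones. -/
noncomputable def comb₃ (E : ℝ → ℝ) (e S SL s σ k₃ k₂ k₁ k₀ y : ℝ) : ℝ :=
  σ * (E y + oddPart e SL (del s y)) + k₃ * cubicPart SL s y + k₂ * evenPart S s y +
    k₁ * -del s y + k₀ * y

/-- A combination of the displacements for orbits through two zones. -/
noncomputable def comb₂ (E : ℝ → ℝ) (S s σ k₂ k₀ y : ℝ) : ℝ :=
  σ * E y + k₂ * evenPart S s y + k₀ * y

/-- With `σ = 0` the chain starts at `cubicPart`: orders 3, 2, 1, 0 in `δ` give four alternating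
signs above `s`, while below `s` only `evenPart` and `y` remain and give two. -/
lemma exists_pattern_virtual (E : ℝ → ℝ) (hs : 0 < s) (hS : s < S) (hL : 0 < SL) :
    ∃ k₂ k₁ k₀ y₁ y₂ y₃ y₄ yb yc : ℝ,
      (s < y₄ ∧ y₄ < y₃ ∧ y₃ < y₂ ∧ y₂ < y₁ ∧ y₁ < S ∧ del s y₁ < SL) ∧
      (0 < yb ∧ yb < yc ∧ yc < s) ∧
      (comb₃ E e S SL s 0 1 k₂ k₁ k₀ y₁ < 0 ∧ 0 < comb₃ E e S SL s 0 1 k₂ k₁ k₀ y₂ ∧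
        comb₃ E e S SL s 0 1 k₂ k₁ k₀ y₃ < 0 ∧ 0 < comb₃ E e S SL s 0 1 k₂ k₁ k₀ y₄) ∧
      (comb₂ E S s 0 k₂ k₀ yb < 0 ∧ 0 < comb₂ E S s 0 k₂ k₀ yc) := by
  obtain ⟨y₀, ⟨hy, hyS⟩, hyL⟩ := (Filter.Eventually.and (Ioo_mem_nhdsGT hS) (eventually_del_lt hs hL)).exists
  obtain ⟨k₂, k₁, k₀, y₁, y₂, y₃, y₄, yb, yc, ⟨a1, a2, a3, a4, a5⟩, ⟨b1, b2, b3⟩,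
    ⟨c1, c2, c3, c4⟩, ⟨d1, d2⟩, -, -⟩ := exists_sign_chain (B := fun _ => 0)
    (cubicPart_isLittleO_evenPart hs hS hL) (cubicPart_neg hs hL) (evenPart_pos hs hS)
    (evenPart_isLittleO_del hs hS)
    (by filter_upwards [self_mem_nhdsWithin] with y h using neg_neg_of_pos (del_pos hs h))
    (del_isLittleO_id hs) (by filter_upwards [self_mem_nhdsWithin] with y (h : s < y) using by linarith)
    (isLittleO_zero _ _) (evenPart_neg hs hS)
    ((evenPart_isLittleO_id hs hS).mono nhdsWithin_le_nhds)
    (nhdsWithin_le_nhds (lt_mem_nhds hs)) hy hs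
  refine ⟨k₂, k₁, k₀, y₁, y₂, y₃, y₄, yb, yc, ⟨a1, a2, a3, a4, a5.trans hyS, ?_⟩, ⟨b1, b2, b3⟩, ?_, ?_⟩
  · exact (Real.sqrt_le_sqrt (by nlinarith)).trans_lt hyL
  · simp only [comb₃, zero_mul, zero_add, one_mul]
    exact ⟨c1, c2, c3, c4⟩
  · simp only [comb₂, zero_mul]
    exact ⟨d1, d2⟩

/-- The sign of the displacement of highest order on both sides of `s`. -/
lemma exists_sign_top (hs : 0 < s) (hS : s < S) (hL : 0 < SL) (he : 0 < e) (hc : 0 ≤ c) {A B : ℝ}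
    {E : ℝ → ℝ} (hE : E = fun y => A * gf S y + B * y + (c ^ 2 + y ^ 2) * ang c y)
    (ha : AnalyticAt ℝ E s) (h0 : E s = 0) (h1 : deriv E s = 0)
    (h2 : c = 0 → deriv (deriv E) s ≠ 0) : ∃ σ : ℝ,
      (∀ᶠ y in 𝓝[>] s, 0 < σ * (E y + oddPart e SL (del s y))) ∧
      ∃ ya, 0 < ya ∧ ya < s ∧ 0 < σ * E ya := by
  have hT := isBigO_taylor_two ha h0 h1
  -- If the second derivative vanishes, `E` is of order 6 in `δ` and `oddPart`, of exact order 5,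
  -- decides above `s`.
  by_cases hq : deriv (deriv E) s = 0
  · refine ⟨1, ?_, ?_⟩
    · simp only [hq, zero_div, zero_mul, sub_zero] at hT
      have h3 : E =o[𝓝[>] s] fun y => del s y ^ 5 :=
        ((hT.mono nhdsWithin_le_nhds).trans (sub_pow_isBigO_del hs 3)).trans_isLittleO
          (del_pow_isLittleO hs (by norm_num))
      filter_upwards [eventually_pos_add_of_isLittleO h3 (k := 2 / (15 * e * SL ^ 2))
        (by filter_upwards [self_mem_nhdsWithin] with y h using pow_pos (del_pos hs h) 5)
        (by positivity), eventually_del_sq_le hs hL] with y h4 h5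
      linarith [oddPart_lower he h5.1.le h5.2.1]
    -- Below `s` the sign is not taken near `s` but near height zero, where `E` tends to `c² π`; by
    -- the choice of `E`, the case `c = 0` does not occur here.
    · have hc' : 0 < c := lt_of_le_of_ne hc fun h => h2 h.symm hq
      obtain ⟨ya, h3, h4⟩ := ((eventually_double_zero_pos A B hc' (hs.trans hS)).and
        (Ioo_mem_nhdsGT hs)).exists
      refine ⟨ya, h4.1, h4.2, ?_⟩
      rw [one_mul, hE]; exact h3
  -- Otherwise `E` behaves like `(q/2)(y - s)²` on both sides, and `oddPart` is negligible;
  -- multiplication by `q` makes the leading coefficient positive.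
  · set q := deriv (deriv E) s
    have hlo : (fun y => E y - q / 2 * (y - s) ^ 2) =o[𝓝 s] fun y => (y - s) ^ 2 :=
      hT.trans_isLittleO (sub_pow_isLittleO (by norm_num))
    have hq2 : 0 < q * q / 2 := half_pos (mul_self_pos.2 hq)
    refine ⟨q, ?_, ?_⟩
    · have hodd : (fun y => oddPart e SL (del s y)) =o[𝓝[>] s] fun y => (y - s) ^ 2 :=
        (oddPart_isBigO he hs hL).trans_isLittleO <|
          (del_pow_isLittleO hs (by norm_num : 4 < 5)).trans_isBigO <|
            ((del_sq_isBigO_sub hs).pow 2).congr_left fun y => by ring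
      filter_upwards [eventually_pos_add_of_isLittleO
        (((hlo.mono nhdsWithin_le_nhds).add hodd).const_mul_left q) (k := q * q / 2)
        (by filter_upwards [self_mem_nhdsWithin] with y h using pow_pos (sub_pos.2 h) 2) hq2]
        with y hy
      linarith
    · have := eventually_pos_add_of_isLittleO ((hlo.const_mul_left q).mono
        (nhdsWithin_le_nhds (s := Iio s))) (k := q * q / 2)
        (by filter_upwards [self_mem_nhdsWithin] with y (h : y < s)
            nlinarith) hq2
      obtain ⟨ya, h3, h4⟩ := (this.and (Ioo_mem_nhdsLT hs)).exists
      exact ⟨ya, h4.1, h4.2, by linarith⟩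

/-- Five orders above `s` and three below. The top term `σ (E + oddPart)` is positive at `y₀`, and
`σ E` is positive at `ya`. The chain is then started from the sum of the top term and a small
multiple of `cubicPart`, which is negative near `s`. -/
lemma exists_pattern_real (hs : 0 < s) (hS : s < S) (hL : 0 < SL) (he : 0 < e) (hc : 0 ≤ c) :
    ∃ A B σ k₃ k₂ k₁ k₀ y₀ y₁ y₂ y₃ y₄ ya yb yc : ℝ, ∃ E : ℝ → ℝ,
      E = (fun y => A * gf S y + B * y + (c ^ 2 + y ^ 2) * ang c y) ∧
      (s < y₄ ∧ y₄ < y₃ ∧ y₃ < y₂ ∧ y₂ < y₁ ∧ y₁ < y₀ ∧ y₀ < S ∧ del s y₀ < SL) ∧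
      (0 < ya ∧ ya < yb ∧ yb < yc ∧ yc < s) ∧
      (0 < comb₃ E e S SL s σ k₃ k₂ k₁ k₀ y₀ ∧ comb₃ E e S SL s σ k₃ k₂ k₁ k₀ y₁ < 0 ∧
        0 < comb₃ E e S SL s σ k₃ k₂ k₁ k₀ y₂ ∧ comb₃ E e S SL s σ k₃ k₂ k₁ k₀ y₃ < 0 ∧
        0 < comb₃ E e S SL s σ k₃ k₂ k₁ k₀ y₄) ∧
      (0 < comb₂ E S s σ k₂ k₀ ya ∧ comb₂ E S s σ k₂ k₀ yb < 0 ∧ 0 < comb₂ E S s σ k₂ k₀ yc) := by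
  obtain ⟨A, B, ha, h0, h1, h2⟩ := exists_double_zero c hs hS
  obtain ⟨E, hE⟩ : ∃ E : ℝ → ℝ, E = fun y => A * gf S y + B * y + (c ^ 2 + y ^ 2) * ang c y :=
    ⟨_, rfl⟩
  have h0 : E s = 0 := by rw [hE]; exact h0
  rw [← hE] at ha h1 h2
  obtain ⟨σ, hσ, ya, hya, hyas, hEa⟩ := exists_sign_top hs hS hL he hc hE ha h0 h1 h2
  have hE2 : E =O[𝓝 s] fun y => (y - s) ^ 2 := by
    have := ((isBigO_taylor_two ha h0 h1).trans (sub_pow_isLittleO (by norm_num : 2 < 3)).isBigO).add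
      (isBigO_const_mul_self (deriv (deriv E) s / 2) (fun y => (y - s) ^ 2) _)
    exact this.congr_left fun y => by ring
  obtain ⟨y₀, ⟨⟨hy, hyS⟩, hyL⟩, hpos⟩ :=
    ((Filter.Eventually.and (Ioo_mem_nhdsGT hS) (eventually_del_lt hs hL)).and hσ).exists
  have hT4 : (fun y => σ * (E y + oddPart e SL (del s y))) =o[𝓝[>] s] cubicPart SL s := by
    refine IsLittleO.const_mul_left (IsLittleO.add ?_ ?_) σ
    · exact (((hE2.mono nhdsWithin_le_nhds).trans (sub_pow_isBigO_del hs 2)).trans_isLittleO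
        (del_pow_isLittleO hs (by norm_num))).trans_isBigO (isBigO_cubicPart hs hL)
    · exact ((oddPart_isBigO he hs hL).trans_isLittleO
        (del_pow_isLittleO hs (by norm_num))).trans_isBigO (isBigO_cubicPart hs hL)
  -- The coefficient of the third order term is small enough to keep the positive sign already found
  -- at `y₀`.
  obtain ⟨k₃, hk, hk₃⟩ := ((eventually_small_pos (cubicPart SL s y₀) hpos).and
    self_mem_nhdsWithin).exists
  obtain ⟨k₂, k₁, k₀, y₁, y₂, y₃, y₄, yb, yc, ⟨a1, a2, a3, a4, a5⟩, ⟨b1, b2, b3⟩,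
    ⟨c1, c2, c3, c4⟩, ⟨d1, d2⟩, e1, e2⟩ := exists_sign_chain (B := fun y => σ * E y)
    (T := fun y => σ * (E y + oddPart e SL (del s y)) + k₃ * cubicPart SL s y)
    (((hT4.trans (cubicPart_isLittleO_evenPart hs hS hL)).add
      ((cubicPart_isLittleO_evenPart hs hS hL).const_mul_left k₃)))
    (eventually_neg_add_of_isLittleO hT4 (cubicPart_neg hs hL) hk₃) (evenPart_pos hs hS)
    (evenPart_isLittleO_del hs hS)
    (by filter_upwards [self_mem_nhdsWithin] with y h using neg_neg_of_pos (del_pos hs h))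
    (del_isLittleO_id hs) (by filter_upwards [self_mem_nhdsWithin] with y (h : s < y) using by linarith)
    ((((hE2.trans_isLittleO (sub_sq_isLittleO_evenPart hs hS)).const_mul_left σ).mono
      nhdsWithin_le_nhds)) (evenPart_neg hs hS)
    ((evenPart_isLittleO_id hs hS).mono nhdsWithin_le_nhds)
    (nhdsWithin_le_nhds (lt_mem_nhds hs)) hy hyas
  exact ⟨A, B, σ, k₃, k₂, k₁, k₀, y₀, y₁, y₂, y₃, y₄, ya, yb, yc, E, hE,
    ⟨a1, a2, a3, a4, a5, hyS, hyL⟩, ⟨hya, b1, b2, b3⟩, ⟨e1 hk, c1, c2, c3, c4⟩, ⟨e2 hEa, d1, d2⟩⟩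

end patterns

end PWHam

/-! ### Choice of the perturbation parameters and the count of limit cycles -/

namespace PWHam

namespace NF

/-- The normal form with other perturbation parameters. -/
def pert (M : NF) (dC dR sR dL sL : ℝ) : NF :=
  { M with dC := dC, R := { M.R with d := dR, s := sR }, L := { M.L with d := dL, s := sL } }

variable {M : NF} {s : ℝ}

lemma sqrt_eq_del (hs2 : M.c ^ 2 + s ^ 2 = M.e ^ 2) (y : ℝ) :
    √(M.c ^ 2 + y ^ 2 - M.e ^ 2) = del s y := by
  rw [del, ← hs2]; ring_nf

lemma analyticAt_mel {O : Outer} {y : ℝ} (h0 : 0 < y) (h : y < O.S) : AnalyticAt ℝ O.mel y :=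
  (analyticAt_const.mul (analyticAt_gf (by linarith) h)).add (analyticAt_const.mul analyticAt_id)

lemma analyticAt_mel₂ {y : ℝ} (h0 : 0 < y) (h : y < M.R.S) : AnalyticAt ℝ M.mel₂ y :=
  (analyticAt_mel h0 h).sub ((analyticAt_const.mul (analyticAt_const.add (analyticAt_id.pow 2))).mul
    (analyticAt_ang _ h0.ne'))

lemma analyticAt_del {y : ℝ} (hs : 0 < s) (hy : s < y) : AnalyticAt ℝ (del s) y :=
  ContDiffAt.analyticAt (ContDiffAt.sqrt (by fun_prop) (by nlinarith))

lemma analyticAt_mel₃ {y : ℝ} (hs : 0 < s) (hs2 : M.c ^ 2 + s ^ 2 = M.e ^ 2) (hy : s < y)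
    (h : y < M.R.S) (hL : del s y < M.L.S) : AnalyticAt ℝ M.mel₃ y := by
  have hd := analyticAt_del hs hy
  have e : M.mel₃ = fun y => M.R.mel y + M.L.mel (del s y) -
      2 * (M.dC / M.ω) * (M.c ^ 2 + y ^ 2) * (ang M.c y - ang (-M.e) (del s y)) := by
    funext y; rw [mel₃, sqrt_eq_del hs2, sweep]
  rw [e]
  have h1 : AnalyticAt ℝ (fun y => M.L.mel (del s y)) y :=
    AnalyticAt.fun_comp (analyticAt_mel (del_pos hs hy) hL) hd
  have h2 : AnalyticAt ℝ (fun y => ang (-M.e) (del s y)) y :=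
    AnalyticAt.fun_comp (analyticAt_ang _ (del_pos hs hy).ne') hd
  exact ((analyticAt_mel (hs.trans hy) h).add h1).sub
    ((analyticAt_const.mul (analyticAt_const.add (analyticAt_id.pow 2))).mul
      ((analyticAt_ang _ (hs.trans hy).ne').sub h2))

lemma exists_bifurcates_three {a b : ℝ} (hs : 0 < s) (hs2 : M.c ^ 2 + s ^ 2 = M.e ^ 2)
    (he : 0 < M.e) (ha : s < a) (hab : a < b) (hb : b < M.R.S) (hL : del s b < M.L.S)
    (h : M.mel₃ a * M.mel₃ b < 0) : ∃ z ∈ Ioo a b, M.Bifurcates ThreeZones z := by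
  have hle : ∀ y ∈ Icc a b, del s y < M.L.S := fun y hy =>
    (Real.sqrt_le_sqrt (by nlinarith [hy.1, hy.2])).trans_lt hL
  obtain ⟨z, hz, hsz⟩ := exists_signChange hab (fun y hy =>
    analyticAt_mel₃ hs hs2 (ha.trans_le hy.1) (hy.2.trans_lt hb) (hle y hy)) h
  have hz1 : s < z := ha.trans hz.1
  have hd := del_pos hs hz1
  have hd2 := del_sq hs hz1
  have hdz : del s z < z := lt_of_pow_lt_pow_left₀ 2 (by linarith) (by nlinarith)
  have hce : -M.e < M.c := by nlinarith
  -- Amounts to `-e z < c δ`, which follows from `0 < δ < z` and `c > -e`; a threshold `τ` fits in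
  -- between.
  have hτ : -(M.e / del s z) < M.c / z := by
    rw [← neg_div, div_lt_div_iff₀ hd (by linarith)]
    nlinarith
  obtain ⟨τ, h1, h2⟩ := exists_between hτ
  exact ⟨z, hz, bifurcates_three (hs.trans hz1) (hz.2.trans hb) hd (hle z ⟨hz.1.le, hz.2.le⟩)
    (by rw [hd2]; linarith) h2 (by linarith) hsz⟩

lemma exists_bifurcates_two {a b : ℝ} (hs2 : M.c ^ 2 + s ^ 2 = M.e ^ 2)
    (he : 0 < M.e) (ha : 0 < a) (hab : a < b) (hb : b < s) (hS : s < M.R.S)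
    (h : M.mel₂ a * M.mel₂ b < 0) : ∃ z ∈ Ioo a b,
      M.Bifurcates (fun Γ => MeetsCentral Γ ∧ MeetsRight Γ ∧ ¬ MeetsLeft Γ) z := by
  obtain ⟨z, hz, hsz⟩ := exists_signChange hab (fun y hy =>
    analyticAt_mel₂ (ha.trans_le hy.1) (by linarith [hy.2])) h
  have h1 : 0 < z := ha.trans hz.1
  have h2 : z < s := hz.2.trans hb
  exact ⟨z, hz, bifurcates_two h1 (h2.trans hS) he (by nlinarith) hsz⟩

section melnikov

variable (A B σ k₃ k₂ k₁ k₀ : ℝ) (M s)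

/-- The perturbation whose first order displacements are prescribed combinations. -/
noncomputable def tuned : NF :=
  M.pert (-(σ * M.ω / 2)) (σ * A - k₂) (σ * B + k₂ * (gf M.R.S s / s) + k₀)
    (-(σ * M.L.S / M.e) + k₃) (σ * (M.e + M.L.S ^ 2 / M.e) - k₃ * M.L.S - k₁)

variable {M s}

lemma mel₂_tuned (y : ℝ) : (M.tuned s A B σ k₃ k₂ k₁ k₀).mel₂ y =
    comb₂ (fun y => A * gf M.R.S y + B * y + (M.c ^ 2 + y ^ 2) * ang M.c y) M.R.S s σ k₂ k₀ y := by
  have := M.ω_pos.ne'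
  change (σ * A - k₂) * gf M.R.S y + (σ * B + k₂ * (gf M.R.S s / s) + k₀) * y -
    2 * (-(σ * M.ω / 2) / M.ω) * (M.c ^ 2 + y ^ 2) * ang M.c y = _
  rw [comb₂, evenPart]
  field_simp
  ring

/-- The swept angle is `ang c y - arctan (δ/e)`. The first angle combines with the right zone to
`E`, the second with the left zone to `oddPart`, using `c² + y² = e² + δ²`. The parameters of the
left zone supply the `gf` and linear terms of `oddPart`, the cubic term and the free term `-k₁ δ`.
-/
lemma mel₃_tuned (hs : 0 < s) (hs2 : M.c ^ 2 + s ^ 2 = M.e ^ 2) (he : 0 < M.e) {y : ℝ} (hy : s < y) :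
    (M.tuned s A B σ k₃ k₂ k₁ k₀).mel₃ y =
      comb₃ (fun y => A * gf M.R.S y + B * y + (M.c ^ 2 + y ^ 2) * ang M.c y) M.e M.R.S M.L.S s
        σ k₃ k₂ k₁ k₀ y := by
  have hω := M.ω_pos.ne'
  have hd := del_pos hs hy
  have hr : M.c ^ 2 + y ^ 2 = M.e ^ 2 + del s y ^ 2 := by rw [del_sq hs hy, ← hs2]; ring
  have ha : ang (-M.e) (del s y) = Real.arctan (del s y / M.e) := by
    have := Real.arctan_inv_of_pos (div_pos he hd)
    rw [inv_div] at this
    rw [this, ang, neg_div, Real.arctan_neg]; ring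
  have e : (M.tuned s A B σ k₃ k₂ k₁ k₀).mel₃ y =
    (σ * A - k₂) * gf M.R.S y + (σ * B + k₂ * (gf M.R.S s / s) + k₀) * y +
    ((-(σ * M.L.S / M.e) + k₃) * gf M.L.S (del s y) +
      (σ * (M.e + M.L.S ^ 2 / M.e) - k₃ * M.L.S - k₁) * del s y) -
    2 * (-(σ * M.ω / 2) / M.ω) * (M.c ^ 2 + y ^ 2) * (ang M.c y - ang (-M.e) (del s y)) := by
    rw [← sqrt_eq_del hs2]; rfl
  -- The divergence parameter `-σω/2` is chosen to give the angular term the coefficient `σ`.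
  have e2 : 2 * (-(σ * M.ω / 2) / M.ω) = -σ := by field_simp
  rw [e, e2, comb₃, evenPart, cubicPart, oddPart, ha, hr]
  ring

end melnikov

lemma injective_four {a b c d : ℝ} (h1 : a < b) (h2 : b < c) (h3 : c < d) :
    Function.Injective ![a, b, c, d] := by
  refine StrictMono.injective (Fin.strictMono_iff_lt_succ.2 fun i => ?_)
  fin_cases i <;> assumption

lemma injective_three {a b c : ℝ} (h1 : a < b) (h2 : b < c) : Function.Injective ![a, b, c] := by
  refine StrictMono.injective (Fin.strictMono_iff_lt_succ.2 fun i => ?_)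
  fin_cases i <;> assumption

lemma injective_two {a b : ℝ} (h1 : a < b) : Function.Injective ![a, b] := by
  refine StrictMono.injective (Fin.strictMono_iff_lt_succ.2 fun i => ?_)
  fin_cases i; assumption

/-- Some perturbation of the normal form produces `m` limit cycles through three zones and `n`
limit cycles through the central and the right zone. -/
def HasCycles (M : NF) (m n : ℕ) : Prop :=
  ∃ dC dR sR dL sL : ℝ, ∃ (z : Fin m → ℝ) (w : Fin n → ℝ), Function.Injective z ∧
    Function.Injective w ∧ (∀ i, (M.pert dC dR sR dL sL).Bifurcates ThreeZones (z i)) ∧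
    ∀ j, (M.pert dC dR sR dL sL).Bifurcates
      (fun Γ => MeetsCentral Γ ∧ MeetsRight Γ ∧ ¬ MeetsLeft Γ) (w j)

lemma HasCycles.of_tuned {m n : ℕ} (s A B σ k₃ k₂ k₁ k₀ : ℝ) (z : Fin m → ℝ) (w : Fin n → ℝ)
    (hz : Function.Injective z) (hw : Function.Injective w)
    (h₃ : ∀ i, (M.tuned s A B σ k₃ k₂ k₁ k₀).Bifurcates ThreeZones (z i))
    (h₂ : ∀ j, (M.tuned s A B σ k₃ k₂ k₁ k₀).Bifurcates
      (fun Γ => MeetsCentral Γ ∧ MeetsRight Γ ∧ ¬ MeetsLeft Γ) (w j)) : M.HasCycles m n :=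
  ⟨_, _, _, _, _, z, w, hz, hw, h₃, h₂⟩

/-- The four gaps between the five signs above `s` and the two gaps between the three signs below
each contain a sign change. The gaps are disjoint and ordered, so the heights found in them are
distinct. -/
theorem hasCycles_four_two (hs : 0 < s) (hs2 : M.c ^ 2 + s ^ 2 = M.e ^ 2) (he : 0 < M.e)
    (hS : s < M.R.S) (hL : 0 < M.L.S) (hc : 0 ≤ M.c) : M.HasCycles 4 2 := by
  obtain ⟨A, B, σ, k₃, k₂, k₁, k₀, y₀, y₁, y₂, y₃, y₄, ya, yb, yc, E, rfl,
    ⟨a1, a2, a3, a4, a5, a6, a7⟩, ⟨b1, b2, b3, b4⟩, ⟨c0, c1, c2, c3, c4⟩, d1, d2, d3⟩ :=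
    exists_pattern_real (S := M.R.S) hs hS hL he hc
  have hle : ∀ {y}, s < y → y ≤ y₀ → del s y < M.L.S := fun h h' =>
    (Real.sqrt_le_sqrt (by nlinarith)).trans_lt a7
  have m3 : ∀ {y}, s < y → _ := fun {y} hy => mel₃_tuned A B σ k₃ k₂ k₁ k₀ hs hs2 he hy
  have m2 := mel₂_tuned (M := M) (s := s) A B σ k₃ k₂ k₁ k₀
  have l3 := a1.trans a2
  have l2 := l3.trans a3
  have l1 := l2.trans a4
  have l0 := l1.trans a5
  have ex3 : ∀ {a b}, s < a → a < b → b ≤ y₀ → (M.tuned s A B σ k₃ k₂ k₁ k₀).mel₃ a * (M.tuned s A B σ k₃ k₂ k₁ k₀).mel₃ b < 0 → _ :=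
    fun {a b} h1 h2 h3 h4 => exists_bifurcates_three (M := M.tuned s A B σ k₃ k₂ k₁ k₀) hs hs2 he h1 h2
      (h3.trans_lt a6) (hle (h1.trans h2) h3) h4
  have ex2 : ∀ {a b}, 0 < a → a < b → b < s → (M.tuned s A B σ k₃ k₂ k₁ k₀).mel₂ a * (M.tuned s A B σ k₃ k₂ k₁ k₀).mel₂ b < 0 → _ :=
    fun {a b} h1 h2 h3 h4 => exists_bifurcates_two (M := M.tuned s A B σ k₃ k₂ k₁ k₀) hs2 he h1 h2 h3 hS h4
  obtain ⟨z₁, h1, p1⟩ := ex3 a1 a2 (by linarith)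
    (by rw [m3 a1, m3 l3]; exact mul_neg_of_pos_of_neg c4 c3)
  obtain ⟨z₂, h2, p2⟩ := ex3 l3 a3 (by linarith)
    (by rw [m3 l3, m3 l2]; exact mul_neg_of_neg_of_pos c3 c2)
  obtain ⟨z₃, h3, p3⟩ := ex3 l2 a4 (by linarith)
    (by rw [m3 l2, m3 l1]; exact mul_neg_of_pos_of_neg c2 c1)
  obtain ⟨z₄, h4, p4⟩ := ex3 l1 a5 le_rfl
    (by rw [m3 l1, m3 l0]; exact mul_neg_of_neg_of_pos c1 c0)
  obtain ⟨w₁, g1, q1⟩ := ex2 b1 b2 (by linarith)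
    (by rw [m2, m2]; exact mul_neg_of_pos_of_neg d1 d2)
  obtain ⟨w₂, g2, q2⟩ := ex2 (b1.trans b2) b3 b4
    (by rw [m2, m2]; exact mul_neg_of_neg_of_pos d2 d3)
  refine .of_tuned s A B σ k₃ k₂ k₁ k₀ ![z₁, z₂, z₃, z₄] ![w₁, w₂]
    (injective_four (h1.2.trans h2.1) (h2.2.trans h3.1) (h3.2.trans h4.1))
    (injective_two (g1.2.trans g2.1)) (fun i => ?_) fun j => ?_
  · fin_cases i <;> assumption
  · fin_cases j <;> assumption

/-- No sign of `c` is needed, since `σ = 0` removes the divergence of the central zone from the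
perturbation. -/
theorem hasCycles_three_one (hs : 0 < s) (hs2 : M.c ^ 2 + s ^ 2 = M.e ^ 2) (he : 0 < M.e)
    (hS : s < M.R.S) (hL : 0 < M.L.S) : M.HasCycles 3 1 := by
  obtain ⟨k₂, k₁, k₀, y₁, y₂, y₃, y₄, yb, yc, ⟨a1, a2, a3, a4, a5, a6⟩, ⟨b1, b2, b3⟩,
    ⟨c1, c2, c3, c4⟩, d1, d2⟩ := exists_pattern_virtual (S := M.R.S) (e := M.e)
      (fun y => 0 * gf M.R.S y + 0 * y + (M.c ^ 2 + y ^ 2) * ang M.c y) hs hS hL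
  have hle : ∀ {y}, s < y → y ≤ y₁ → del s y < M.L.S := fun h h' =>
    (Real.sqrt_le_sqrt (by nlinarith)).trans_lt a6
  have m3 : ∀ {y}, s < y → _ := fun {y} hy => mel₃_tuned 0 0 0 1 k₂ k₁ k₀ hs hs2 he hy
  have m2 := mel₂_tuned (M := M) (s := s) 0 0 0 1 k₂ k₁ k₀
  have l3 := a1.trans a2
  have l2 := l3.trans a3
  have l1 := l2.trans a4
  have ex3 : ∀ {a b}, s < a → a < b → b ≤ y₁ → (M.tuned s 0 0 0 1 k₂ k₁ k₀).mel₃ a * (M.tuned s 0 0 0 1 k₂ k₁ k₀).mel₃ b < 0 → _ :=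
    fun {a b} h1 h2 h3 h4 => exists_bifurcates_three (M := M.tuned s 0 0 0 1 k₂ k₁ k₀) hs hs2 he h1 h2
      (h3.trans_lt a5) (hle (h1.trans h2) h3) h4
  obtain ⟨z₁, h1, p1⟩ := ex3 a1 a2 (by linarith)
    (by rw [m3 a1, m3 l3]; exact mul_neg_of_pos_of_neg c4 c3)
  obtain ⟨z₂, h2, p2⟩ := ex3 l3 a3 (by linarith)
    (by rw [m3 l3, m3 l2]; exact mul_neg_of_neg_of_pos c3 c2)
  obtain ⟨z₃, h3, p3⟩ := ex3 l2 a4 le_rfl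
    (by rw [m3 l2, m3 l1]; exact mul_neg_of_pos_of_neg c2 c1)
  obtain ⟨w₁, g1, q1⟩ := exists_bifurcates_two (M := M.tuned s 0 0 0 1 k₂ k₁ k₀) hs2 he b1 b2 b3 hS
    (by rw [m2, m2]; exact mul_neg_of_neg_of_pos d1 d2)
  refine .of_tuned s 0 0 0 1 k₂ k₁ k₀ ![z₁, z₂, z₃] ![w₁] (injective_three (h1.2.trans h2.1) (h2.2.trans h3.1))
    (Function.injective_of_subsingleton _) (fun i => ?_) fun j => ?_
  · fin_cases i <;> assumption
  · fin_cases j; assumption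

end NF

end PWHam

namespace PWHam

/-! ### Geometry of the unperturbed normal form -/

lemma exists_last_zero {f : ℝ → ℝ} {t : ℝ} (hf : Continuous f) (ht : 0 < f t)
    (h : ∃ s, s < t ∧ f s ≤ 0) : ∃ b, b < t ∧ f b = 0 ∧ ∀ r ∈ Ioc b t, 0 < f r := by
  obtain ⟨s, hs, hs'⟩ := h
  obtain ⟨b, hb, hb0, hb'⟩ := exists_first_zero (f := fun r => f (-r)) (a := -t)
    (hf.comp continuous_neg)
    (nhdsWithin_le_nhds ((hf.comp continuous_neg).continuousAt.eventually_const_lt (by simpa)))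
    ⟨-s, by linarith, by simpa⟩
  refine ⟨-b, by linarith, hb0, fun r hr => ?_⟩
  rcases hr.2.eq_or_lt with rfl | h1
  · exact ht
  · simpa using hb' (-r) ⟨by linarith, by linarith [hr.1]⟩

namespace IsCrossingSolution

variable {X : PWField} {γ : ℝ → ℝ × ℝ} {a b : ℝ}

lemma central_pos_of_gt (h : IsCrossingSolution X γ) (ha : (γ a).1 = -1 ∨ (γ a).1 = 1)
    (hab : a < b) (hi : ∀ t ∈ Ioo a b, (γ a).1 < (γ t).1) : 0 < (X.central (γ a)).1 := by
  rcases (h.crossing a ha).central_ne.lt_or_gt with h1 | h1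
  · obtain ⟨t, h2, h3⟩ := ((h.eventually_of_neg ha h1).2.and (Ioo_mem_nhdsGT hab)).exists
    exact absurd (hi t h3) (not_lt.2 h2.le)
  · exact h1

lemma central_neg_of_lt (h : IsCrossingSolution X γ) (ha : (γ a).1 = -1 ∨ (γ a).1 = 1)
    (hab : a < b) (hi : ∀ t ∈ Ioo a b, (γ t).1 < (γ a).1) : (X.central (γ a)).1 < 0 := by
  rcases (h.crossing a ha).central_ne.lt_or_gt with h1 | h1
  · exact h1
  · obtain ⟨t, h2, h3⟩ := ((h.eventually_of_pos ha h1).2.and (Ioo_mem_nhdsGT hab)).exists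
    exact absurd (hi t h3) (not_lt.2 h2.le)

end IsCrossingSolution

namespace NF

variable {M : NF} {γ : ℝ → ℝ × ℝ} {a b : ℝ}

lemma central_zero (q : ℝ × ℝ) : (M.sys 0).central q = (q.2, -M.ω ^ 2 * (q.1 - M.p)) := by
  simp [sys, central]

lemma energy_eq (hγ : IsCrossingSolution (M.sys 0) γ)
    (hd : ∀ t ∈ Ico a b, HasDerivWithinAt γ ((M.sys 0).central (γ t)) (Ici t) t) :
    ∀ t ∈ Icc a b, M.ω ^ 2 * ((γ t).1 - M.p) ^ 2 + (γ t).2 ^ 2 =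
      M.ω ^ 2 * ((γ a).1 - M.p) ^ 2 + (γ a).2 ^ 2 := by
  refine constant_of_has_deriv_right_zero (a := a) (b := b)
    (f := fun t => M.ω ^ 2 * ((γ t).1 - M.p) ^ 2 + (γ t).2 ^ 2) ?_ fun t ht => ?_
  · exact ((continuous_const.mul ((hγ.continuous_fst.sub continuous_const).pow 2)).add
      (hγ.continuous_snd.pow 2)).continuousOn
  · have h := hd t ht
    rw [central_zero] at h
    refine ((((h.prodFst.sub_const M.p).pow 2).const_mul (M.ω ^ 2)).add (h.prodSnd.pow 2)).congr_deriv ?_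
    simp only
    norm_num
    ring

/-- The heights at both ends of an excursion into the right zone. -/
lemma right_heights (hγ : IsCrossingSolution (M.sys 0) γ) (ha : (γ a).1 = 1)
    (hb : (γ b).1 = 1) (hab : a < b) (hi : ∀ t ∈ Ioo a b, 1 < (γ t).1) :
    0 < (γ a).2 ∧ (γ a).2 < M.R.S ∧ (γ b).2 = -(γ a).2 := by
  have hp := hγ.central_pos_of_gt (Or.inr ha) hab (by rwa [ha])
  have hn := hγ.central_neg_of_gt hab (Or.inr hb) (by rwa [hb])
  have hd : ∀ t ∈ Ico a b, HasDerivWithinAt γ (M.R.field 0 (γ t)) (Ici t) t := fun t ht =>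
    hγ.deriv_right ha hp (fun h => hi t ⟨h, ht.2⟩) ht.1
  obtain ⟨hu, hv⟩ := Outer.evolution hab.le hγ.continuous.continuousOn hd
  rw [central_zero] at hp hn
  simp only [Outer.u, Outer.v, ha, hb, sub_self, mul_zero, add_zero, sub_zero, zero_mul,
    mul_one] at hu hv hp hn
  have hlt : 0 < M.R.lam * (b - a) := mul_pos M.R.lam_pos (sub_pos.2 hab)
  have hE : 1 < Real.exp (M.R.lam * (b - a)) := Real.one_lt_exp_iff.2 hlt
  have hEE : Real.exp (M.R.lam * (b - a)) * Real.exp (-(M.R.lam * (b - a))) = 1 := by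
    rw [← Real.exp_add]; simp
  set E := Real.exp (M.R.lam * (b - a))
  set E' := Real.exp (-(M.R.lam * (b - a)))
  -- The product `u v` is conserved by the unperturbed saddle and equals `y² - S²` on the line.
  have h1 : (γ b).2 ^ 2 = (γ a).2 ^ 2 := by
    have : ((γ b).2 - M.R.S) * ((γ b).2 + M.R.S) = ((γ a).2 - M.R.S) * ((γ a).2 + M.R.S) := by
      rw [hu, hv]; linear_combination ((γ a).2 - M.R.S) * ((γ a).2 + M.R.S) * hEE
    linarith
  have h2 : (γ b).2 = -(γ a).2 := by
    rcases sq_eq_sq_iff_eq_or_eq_neg.1 h1 with h | h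
    · linarith
    · exact h
  refine ⟨hp, ?_, h2⟩
  -- For `y ≥ S` the coordinate `u` would stay nonnegative, while at the exit it equals `-y - S`.
  by_contra! hle
  rw [h2] at hu
  nlinarith

/-- A crossing periodic solution makes an excursion into the right zone around each time it spends
there. -/
lemma exists_excursion {T t s : ℝ} (h : IsCrossingPeriodic (M.sys 0) γ T) (ht : 1 < (γ t).1)
    (hs : (γ s).1 ≤ 1) : ∃ a b, a < b ∧ (γ a).1 = 1 ∧ (γ b).1 = 1 ∧ ∀ r ∈ Ioo a b, 1 < (γ r).1 := by
  have hc : Continuous fun r => (γ r).1 - 1 := h.1.continuous_fst.sub continuous_const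
  obtain ⟨n, hn⟩ := exists_nat_gt (|t - s| / T)
  rw [div_lt_iff₀ h.2.1] at hn
  have p1 := h.2.2.1.nat_mul n s
  have p2 := h.2.2.1.sub_nat_mul_eq n (x := s)
  obtain ⟨a, ha, ha0, ha'⟩ := exists_last_zero hc (t := t) (by linarith)
    ⟨s - n * T, by linarith [(abs_lt.1 hn).1], by rw [p2]; linarith⟩
  obtain ⟨b, hb, hb0, hb'⟩ := exists_first_zero hc (a := t)
    (nhdsWithin_le_nhds (hc.continuousAt.eventually_const_lt (by linarith)))
    ⟨s + n * T, by linarith [(abs_lt.1 hn).2], by rw [p1]; linarith⟩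
  refine ⟨a, b, ha.trans hb, by linarith, by linarith, fun r hr => ?_⟩
  rcases le_or_gt r t with h1 | h1
  · linarith [ha' r ⟨hr.1, h1⟩]
  · linarith [hb' r ⟨h1, hr.2⟩]

lemma right_S_pos {Γ : Set (ℝ × ℝ)} (h : IsCrossingPeriodicOrbit (M.sys 0) Γ)
    (hC : MeetsCentral Γ) (hR : MeetsRight Γ) : 0 < M.R.S := by
  obtain ⟨γ, T, h, rfl⟩ := h
  obtain ⟨_, ⟨t, rfl⟩, ht⟩ := hR
  obtain ⟨_, ⟨s, rfl⟩, hs⟩ := hC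
  obtain ⟨a, b, hab, ha, hb, hi⟩ := exists_excursion h ht hs.2.le
  obtain ⟨h1, h2, -⟩ := right_heights h.1 ha hb hab hi
  exact h1.trans h2

/-- An orbit through three zones passes between the two saddles and the center. -/
lemma sq_e_lt {Γ : Set (ℝ × ℝ)} (h : IsCrossingPeriodicOrbit (M.sys 0) Γ) (h3 : ThreeZones Γ) :
    M.e ^ 2 < M.c ^ 2 + M.R.S ^ 2 := by
  obtain ⟨γ, T, h, rfl⟩ := h
  obtain ⟨⟨_, ⟨l, rfl⟩, hl⟩, -, ⟨_, ⟨r, rfl⟩, hr⟩⟩ := h3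
  have hγ := h.1
  have hc1 : Continuous fun r => (γ r).1 + 1 := hγ.continuous_fst.add continuous_const
  have hc2 : Continuous fun r => (γ r).1 - 1 := hγ.continuous_fst.sub continuous_const
  have hc3 : Continuous fun r => 1 - (γ r).1 := continuous_const.sub hγ.continuous_fst
  obtain ⟨n, hn⟩ := exists_nat_gt (|r - l| / T)
  rw [div_lt_iff₀ h.2.1] at hn
  have p1 := h.2.2.1.nat_mul n l
  have p2 := h.2.2.1.sub_nat_mul_eq n (x := l)
  -- A descent through the whole central zone is isolated: `t` is the first arrival at `x = -1`
  -- after a time in the right zone, and `b` the last time before `t` on `x = 1`. The excursion that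
  -- ends at `b` bounds the height there by `S`, and conservation of energy from `b` to `t` gives
  -- the inequality.
  obtain ⟨t, ht, ht0, ht'⟩ := exists_first_zero hc1 (a := r)
    (nhdsWithin_le_nhds (hc1.continuousAt.eventually_const_lt (by linarith)))
    ⟨l + n * T, by linarith [(abs_lt.1 hn).2], by rw [p1]; linarith⟩
  obtain ⟨b, hb, hb0, hb'⟩ := exists_last_zero hc3 (t := t) (by linarith)
    ⟨r, ht, by linarith⟩
  have hb1 : (γ b).1 = 1 := by linarith
  have ht1 : (γ t).1 = -1 := by linarith
  have hrb : r < b := by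
    by_contra! hle
    linarith [hb' r ⟨lt_of_le_of_ne hle fun h => by rw [h] at hb1; linarith, ht.le⟩]
  have hin : ∀ s ∈ Ioo b t, -1 < (γ s).1 ∧ (γ s).1 < 1 := fun s hs =>
    ⟨by linarith [ht' s ⟨hrb.trans hs.1, hs.2⟩], by linarith [hb' s ⟨hs.1, hs.2.le⟩]⟩
  have hneg : ((M.sys 0).central (γ b)).1 < 0 :=
    hγ.central_neg_of_lt (Or.inr hb1) hb fun s hs => by rw [hb1]; exact (hin s hs).2
  have hneg' : ((M.sys 0).central (γ t)).1 < 0 :=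
    hγ.central_neg_of_gt hb (Or.inl ht1) fun s hs => by rw [ht1]; exact (hin s hs).1
  have hE := energy_eq hγ (fun s hs => hγ.deriv_central (Or.inl ⟨hb1, hneg⟩)
    (fun h => hin s ⟨h, hs.2⟩) hs.1) t ⟨hb.le, le_rfl⟩
  obtain ⟨q, hq, hqb⟩ := (mem_nhdsLT_iff_exists_Ioo_subset.1 (hγ.eventually_of_neg (Or.inr hb1) hneg).1)
  have hq : q < b := hq
  obtain ⟨s, hs1, hs2⟩ := exists_between (max_lt hq hrb)
  obtain ⟨hs1, hrs⟩ := max_lt_iff.1 hs1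
  have hs3 : (γ b).1 < (γ s).1 := hqb ⟨hs1, hs2⟩
  obtain ⟨a, ha, ha0, ha'⟩ := exists_last_zero hc2 (t := s) (by linarith)
    ⟨l - n * T, by linarith [(abs_lt.1 hn).1], by rw [p2]; linarith⟩
  obtain ⟨h1, h2, h4⟩ := right_heights hγ (a := a) (b := b) (by linarith) hb1 (ha.trans hs2)
    fun u hu => by
      rcases le_or_gt u s with h5 | h5
      · linarith [ha' u ⟨hu.1, h5⟩]
      · have : (γ b).1 < (γ u).1 := hqb ⟨hs1.trans h5, hu.2⟩
        linarith
  rw [central_zero] at hneg'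
  simp only at hneg'
  rw [h4, hb1, ht1] at hE
  have h6 : 0 < (γ t).2 ^ 2 := by nlinarith
  have h7 : (γ a).2 ^ 2 < M.R.S ^ 2 := by nlinarith
  simp only [c, e]
  nlinarith

/-- If an orbit stays to the right of `x = -1` then the center is on the right. -/
lemma p_pos {Γ : Set (ℝ × ℝ)} (h : IsCrossingPeriodicOrbit (M.sys 0) Γ)
    (hC : MeetsCentral Γ) (hR : MeetsRight Γ) (hL : ¬ MeetsLeft Γ) : 0 < M.p := by
  obtain ⟨γ, T, h, rfl⟩ := h
  obtain ⟨_, ⟨t, rfl⟩, ht⟩ := hR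
  obtain ⟨_, ⟨s, rfl⟩, hs⟩ := hC
  have hγ := h.1
  have hge : ∀ t, -1 ≤ (γ t).1 := fun t => by
    by_contra! hlt
    exact hL ⟨_, ⟨t, rfl⟩, hlt⟩
  obtain ⟨a, b, hab, ha, hb, hi⟩ := exists_excursion h ht hs.2.le
  obtain ⟨h1, h2, h3⟩ := right_heights hγ ha hb hab hi
  have hneg : ((M.sys 0).central (γ b)).1 < 0 := by rw [central_zero, h3]; simpa
  obtain ⟨n, hn⟩ := exists_nat_gt (|b - t| / T)
  rw [div_lt_iff₀ h.2.1] at hn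
  obtain ⟨d, hd, hdend, hin, hder⟩ := hγ.exists_central_excursion (Or.inl ⟨hb, hneg⟩)
    ⟨t + n * T, by linarith [(abs_lt.1 hn).2], by
      have p1 := h.2.2.1.nat_mul n t
      rw [p1]; exact fun h => by linarith [h.2]⟩
  rcases hdend with ⟨hd1, hd2⟩ | ⟨hd1, hd2⟩
  · rw [central_zero] at hd2
    simp only at hd2
    -- The excursion starts with negative and ends with positive height, so it crosses height zero
    -- at some abscissa `x` strictly between the lines. Energy gives `(1 - x)(2p - 1 - x) > 0`,
    -- hence `2p > 1 + x > 0`.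
    obtain ⟨u, hu, hu0⟩ := intermediate_value_Ioo hd.le hγ.continuous_snd.continuousOn
      (show (0 : ℝ) ∈ Ioo _ _ from ⟨by rw [h3]; linarith, hd2⟩)
    simp only at hu0
    have hE := energy_eq hγ hder u ⟨hu.1.le, hu.2.le⟩
    rw [hu0, hb, h3] at hE
    obtain ⟨h4, h5⟩ := hin u hu
    have h6 : 0 < (M.ω ^ 2) * ((1 - (γ u).1) * (2 * M.p - 1 - (γ u).1)) := by nlinarith
    have h7 := pos_of_mul_pos_right h6 (sq_nonneg _)
    have h8 := pos_of_mul_pos_right h7 (by linarith)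
    linarith
  · obtain ⟨u, hu⟩ := (hγ.eventually_of_neg (Or.inl hd1) hd2).2.exists
    linarith [hge u]

end NF

end PWHam

namespace PWHam

/-! ### Orientation -/

/-- The quotient of the horizontal velocity and the height in the unperturbed normal form. -/
noncomputable def NF.weight (M : NF) (x : ℝ) : ℝ :=
  if x < -1 then M.L.lam / M.L.k else if 1 < x then M.R.lam / M.R.k else 1

namespace NF

variable {M : NF}

lemma weight_pos (x : ℝ) : 0 < M.weight x := by
  unfold weight
  split_ifs
  exacts [div_pos M.L.lam_pos M.L.k_pos, div_pos M.R.lam_pos M.R.k_pos, one_pos]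

lemma measurable_weight : Measurable M.weight :=
  Measurable.ite measurableSet_Iio measurable_const
    (Measurable.ite measurableSet_Ioi measurable_const measurable_const)

lemma exists_weight_bounds : ∃ A B, 0 < A ∧ ∀ x, A ≤ M.weight x ∧ M.weight x ≤ B := by
  have hL := div_pos M.L.lam_pos M.L.k_pos
  have hR := div_pos M.R.lam_pos M.R.k_pos
  refine ⟨min (M.L.lam / M.L.k) (min (M.R.lam / M.R.k) 1),
    max (M.L.lam / M.L.k) (max (M.R.lam / M.R.k) 1), by positivity, fun x => ?_⟩
  unfold weight
  split_ifs <;> simp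

/-- In normal form the horizontal velocity is a positive, zonewise constant multiple of the height.
Thus `∮ Y dx` has a nonnegative integrand in time. -/
lemma horizVelocity_eq (q : ℝ × ℝ) : horizVelocity (M.sys 0) q = M.weight q.1 * q.2 := by
  have h1 := M.R.k_pos.ne'
  have h2 := M.L.k_pos.ne'
  unfold horizVelocity weight
  split_ifs
  · simp [sys, negField, Outer.field, Outer.u, Outer.v]; field_simp; ring
  · simp [sys, Outer.field, Outer.u, Outer.v]; field_simp; ring
  · simp [sys, central]

end NF

lemma IsCrossingSolution.hasDerivAt_fst {X : PWField} {γ : ℝ → ℝ × ℝ} (h : IsCrossingSolution X γ)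
    {t : ℝ} (ht : ¬ ((γ t).1 = -1 ∨ (γ t).1 = 1)) :
    HasDerivAt (fun t => (γ t).1) (horizVelocity X (γ t)) t := by
  rw [not_or] at ht
  unfold horizVelocity
  split_ifs with h1 h2
  · exact (h.in_left t h1).prodFst
  · exact (h.in_right t h2).prodFst
  · exact (h.in_central t (lt_of_le_of_ne (not_lt.1 h1) (Ne.symm ht.1))
      (lt_of_le_of_ne (not_lt.1 h2) ht.2)).prodFst

section orientation

variable {M : NF} {γ : ℝ → ℝ × ℝ} {T : ℝ}

lemma intervalIntegrable_weight (hγ : IsCrossingSolution (M.sys 0) γ) {g : ℝ → ℝ}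
    (hg : Continuous g) (a b : ℝ) : IntervalIntegrable (fun t => M.weight (γ t).1 * g t)
      MeasureTheory.volume a b := by
  obtain ⟨A, B, hA, hAB⟩ := M.exists_weight_bounds
  have := hg.intervalIntegrable (μ := MeasureTheory.volume) a b
  rw [intervalIntegrable_iff] at this ⊢
  refine this.bdd_mul (c := B)
    (NF.measurable_weight.comp hγ.continuous_fst.measurable).aestronglyMeasurable ?_
  filter_upwards with t
  rw [Real.norm_of_nonneg (NF.weight_pos _).le]
  exact (hAB _).2

/-- An exact form integrates to zero along a crossing periodic solution. -/
lemma integral_exact (h : IsCrossingPeriodic (M.sys 0) γ T) {ψ : ℝ → ℝ} (hψ : Continuous ψ) :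
    ∫ t in (0 : ℝ)..T, M.weight (γ t).1 * (ψ (γ t).1 * (γ t).2) = 0 := by
  have hγ := h.1
  have hF : ∀ x, HasDerivAt (fun x => ∫ r in (0 : ℝ)..x, ψ r) (ψ x) x := fun x =>
    intervalIntegral.integral_hasDerivAt_right (hψ.intervalIntegrable _ _)
      hψ.aestronglyMeasurable.stronglyMeasurableAtFilter hψ.continuousAt
  have hFc : Continuous fun x => ∫ r in (0 : ℝ)..x, ψ r :=
    continuous_iff_continuousAt.2 fun x => (hF x).continuousAt
  refine (MeasureTheory.integral_eq_of_hasDerivAt_off_countable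
    (fun t => ∫ r in (0 : ℝ)..(γ t).1, ψ r)
    (fun t => M.weight (γ t).1 * (ψ (γ t).1 * (γ t).2)) hγ.countable_lineTimes
    (hFc.comp hγ.continuous_fst).continuousOn (fun t ht => ?_)
    (intervalIntegrable_weight hγ ((hψ.comp hγ.continuous_fst).mul hγ.continuous_snd) _ _)).trans ?_
  · have h1 := (hF (γ t).1).comp t (hγ.hasDerivAt_fst ht.2)
    rw [NF.horizVelocity_eq] at h1
    exact h1.congr_deriv (by ring)
  · have := h.2.2.1 0
    rw [zero_add] at this
    simp only [this, sub_self]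

variable {HL HC HR : HamCoeff} {S : Shear}

lemma Shear.Carries.horizVelocity_map {X N : PWField} (hS : S.Carries X N) (q : ℝ × ℝ) :
    horizVelocity X q = horizVelocity N (S.map q) := by
  have e : (S.map q).1 = q.1 := rfl
  unfold horizVelocity
  rw [e]
  split_ifs with h1 h2
  · rw [hS.left q h1.le]; rfl
  · rw [hS.right q h2.le]; rfl
  · rw [hS.central q (not_lt.1 h1) (not_lt.1 h2)]; rfl

lemma continuous_ψ : Continuous S.ψ := S.uniformContinuous_ψ.continuous

/-- The area integral in the coordinates of the normal form. -/
lemma area_eq {X : PWField} (hS : S.Carries X (M.sys 0)) (h : IsCrossingPeriodic X γ T) :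
    S.κ * ∫ t in (0 : ℝ)..T, (γ t).2 * horizVelocity X (γ t) =
      ∫ t in (0 : ℝ)..T, M.weight (γ t).1 * (S.map (γ t)).2 ^ 2 := by
  have h' := hS.isConjugacy.isCrossingPeriodic h
  have hc := h'.1.continuous_snd
  have h0 := integral_exact h' (continuous_ψ (S := S))
  have i1 := intervalIntegrable_weight h'.1 (hc.pow 2) 0 T
  have i2 := intervalIntegrable_weight h'.1
    ((continuous_ψ (S := S)).comp h'.1.continuous_fst |>.mul hc) 0 T
  rw [← intervalIntegral.integral_const_mul]
  have e : ∀ t, S.κ * ((γ t).2 * horizVelocity X (γ t)) =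
      M.weight (γ t).1 * (S.map (γ t)).2 ^ 2 -
        M.weight (γ t).1 * (S.ψ (γ t).1 * (S.map (γ t)).2) := fun t => by
    rw [hS.horizVelocity_map, NF.horizVelocity_eq]
    simp only [Shear.map]; ring
  simp only [e]
  exact (intervalIntegral.integral_sub i1 i2).trans (by
    have h0 : ∫ t in (0 : ℝ)..T, M.weight (γ t).1 * (S.ψ (γ t).1 * (S.map (γ t)).2) = 0 := h0
    exact (congrArg _ h0).trans (sub_zero _))

/-- The offset `ψ(x) dx` is exact and does not contribute, so `κ ∮ y dx = ∮ Y dx ≥ 0`; a positive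
area integral forces `κ > 0`. -/
lemma κ_pos_of_clockwise {X : PWField} (hS : S.Carries X (M.sys 0)) {Γ : Set (ℝ × ℝ)}
    (h : IsClockwiseOrbit X Γ) : 0 < S.κ := by
  obtain ⟨γ, T, h, hcw, rfl⟩ := h
  have h1 := area_eq hS h
  have h2 : 0 ≤ ∫ t in (0 : ℝ)..T, M.weight (γ t).1 * (S.map (γ t)).2 ^ 2 :=
    intervalIntegral.integral_nonneg h.2.1.le fun t _ =>
      mul_nonneg (NF.weight_pos _).le (sq_nonneg _)
  rw [← h1] at h2
  exact lt_of_le_of_ne (nonneg_of_mul_nonneg_left h2 hcw) (Ne.symm S.κ_ne)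

/-- Conversely, for `κ > 0` one point of nonzero height makes `∮ Y dx` strictly positive. In this
way the orbits found in the normal form are recognised as members of the clockwise annulus. -/
lemma clockwise_of_mem {X : PWField} (hS : S.Carries X (M.sys 0)) (hκ : 0 < S.κ)
    {Γ : Set (ℝ × ℝ)} (h : IsCrossingPeriodicOrbit X Γ) {q : ℝ × ℝ} (hq : q ∈ S.map '' Γ)
    (hq0 : q.2 ≠ 0) : IsClockwiseOrbit X Γ := by
  obtain ⟨γ, T, h, rfl⟩ := h
  refine ⟨γ, T, h, ?_, rfl⟩
  obtain ⟨_, ⟨t, rfl⟩, rfl⟩ := hq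
  obtain ⟨s, hs, hst⟩ := h.2.2.1.exists_mem_Ico₀ h.2.1 t
  rw [hst] at hq0
  have h' := hS.isConjugacy.isCrossingPeriodic h
  have hc : Continuous fun t => (S.map (γ t)).2 ^ 2 := h'.1.continuous_snd.pow 2
  obtain ⟨A, B, hA, hAB⟩ := M.exists_weight_bounds
  have h1 : 0 < ∫ t in (0 : ℝ)..T, A * (S.map (γ t)).2 ^ 2 :=
    intervalIntegral.integral_pos h.2.1 (hc.const_mul A).continuousOn
      (fun t _ => by positivity) ⟨s, ⟨hs.1, hs.2.le⟩, by positivity⟩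
  have h2 : ∫ t in (0 : ℝ)..T, A * (S.map (γ t)).2 ^ 2 ≤
      ∫ t in (0 : ℝ)..T, M.weight (γ t).1 * (S.map (γ t)).2 ^ 2 :=
    intervalIntegral.integral_mono h.2.1.le ((hc.const_mul A).intervalIntegrable _ _)
      (intervalIntegrable_weight h'.1 hc _ _)
      fun t => mul_le_mul_of_nonneg_right (hAB _).1 (sq_nonneg _)
  rw [← area_eq hS h] at h2
  exact pos_of_mul_pos_right (h1.trans_le h2) hκ.le

end orientation

end PWHam

namespace PWHam

/-! ### Reduction to the normal form -/

namespace HamCoeff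

variable (P : HamCoeff)

lemma field_eq (q : ℝ × ℝ) : P.field q =
    (P.b * q.2 + P.a * q.1 + P.α, P.c * q.1 - P.a * q.2 + P.β) := by
  have h1 : HasDerivAt (fun y => P.ham q.1 y) (P.b * q.2 + P.a * q.1 + P.α) q.2 := by
    have := (((((hasDerivAt_pow 2 q.2).const_mul (P.b / 2)).sub_const (P.c / 2 * q.1 ^ 2)).add
      ((hasDerivAt_id q.2).const_mul (P.a * q.1))).add
      ((hasDerivAt_id q.2).const_mul P.α)).sub_const (P.β * q.1)
    refine this.congr_deriv ?_
    norm_num; ring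
  have h2 : HasDerivAt (fun x => P.ham x q.2) (-(P.c * q.1 - P.a * q.2 + P.β)) q.1 := by
    have := (((((hasDerivAt_pow 2 q.1).const_mul (P.c / 2)).const_sub (P.b / 2 * q.2 ^ 2)).add
      (((hasDerivAt_id q.1).const_mul P.a).mul_const q.2)).add_const
      (P.α * q.2)).sub ((hasDerivAt_id q.1).const_mul P.β)
    refine this.congr_deriv ?_
    norm_num; ring
  rw [field, h1.deriv, h2.deriv, neg_neg]

/-- Minus the determinant of the linear part. -/
def disc : ℝ := P.a ^ 2 + P.b * P.c

lemma jacobian_field (q : ℝ × ℝ) : jacobian P.field q = !![P.a, P.b; P.c, -P.a] := by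
  have l : ∀ m n : ℝ, deriv (fun x : ℝ => m * x + n) = fun _ => m := fun m n => by
    funext x
    simp
  have e1 : (fun x => (P.field (x, q.2)).1) = fun x => P.a * x + (P.b * q.2 + P.α) := by
    funext x; rw [field_eq]; ring
  have e2 : (fun y => (P.field (q.1, y)).1) = fun y => P.b * y + (P.a * q.1 + P.α) := by
    funext x; rw [field_eq]; ring
  have e3 : (fun x => (P.field (x, q.2)).2) = fun x => P.c * x + (-P.a * q.2 + P.β) := by
    funext x; rw [field_eq]; ring
  have e4 : (fun y => (P.field (q.1, y)).2) = fun y => -P.a * y + (P.c * q.1 + P.β) := by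
    funext x; rw [field_eq]; ring
  simp only [jacobian, e1, e2, e3, e4, l]

end HamCoeff

/-- A traceless 2 × 2 matrix squares to `a² + bc` times the identity. -/
lemma eigenvalue_sq {K : Type*} [Field K] {a b c μ : K}
    (h : Module.End.HasEigenvalue (Matrix.toLin' !![a, b; c, -a]) μ) : μ ^ 2 = a ^ 2 + b * c := by
  obtain ⟨v, hv⟩ := h.exists_hasEigenvector
  have h1 := hv.apply_eq_smul
  have h2 := congrFun h1 0
  have h3 := congrFun h1 1
  simp [Matrix.toLin'_apply, Matrix.mulVec, dotProduct, Fin.sum_univ_two] at h2 h3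
  by_contra hne
  have hne : μ ^ 2 - (a ^ 2 + b * c) ≠ 0 := sub_ne_zero.2 hne
  have h4 : (μ ^ 2 - (a ^ 2 + b * c)) * v 0 = 0 := by linear_combination (-μ - a) * h2 - b * h3
  have h5 : (μ ^ 2 - (a ^ 2 + b * c)) * v 1 = 0 := by linear_combination (a - μ) * h3 - c * h2
  have h4 := (mul_eq_zero.1 h4).resolve_left hne
  have h5 := (mul_eq_zero.1 h5).resolve_left hne
  refine hv.2 (funext fun i => ?_)
  fin_cases i
  · exact h4
  · exact h5

namespace HamCoeff

variable {P : HamCoeff}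

lemma disc_pos_of_saddle {q : ℝ × ℝ} (h : IsLinearSaddle P.field q) : 0 < P.disc := by
  obtain ⟨-, μ, ν, hμ, -, h1, -⟩ := h
  rw [jacobian_field] at h1
  rw [disc, ← eigenvalue_sq h1]
  have := hμ.ne
  positivity

lemma disc_neg_of_center {q : ℝ × ℝ} (h : IsLinearCenter P.field q) : P.disc < 0 := by
  obtain ⟨-, ω, hω, h1, -⟩ := h
  have e : (jacobian P.field q).map (fun r : ℝ => (r : ℂ)) =
      !![(P.a : ℂ), (P.b : ℂ); (P.c : ℂ), -(P.a : ℂ)] := by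
    rw [jacobian_field]
    ext i j
    fin_cases i <;> fin_cases j <;> simp
  rw [e] at h1
  have h2 := eigenvalue_sq h1
  have h3 : ((-ω ^ 2 : ℝ) : ℂ) = ((P.a ^ 2 + P.b * P.c : ℝ) : ℂ) := by
    push_cast; rw [← h2, mul_pow, Complex.I_sq]; ring
  have h4 : -ω ^ 2 = P.disc := Complex.ofReal_injective h3
  rw [← h4, neg_lt_zero]
  positivity

/-- The abscissa of the singular point. -/
lemma disc_mul_fst {q : ℝ × ℝ} (h : P.field q = 0) :
    P.disc * q.1 = -(P.b * P.β + P.a * P.α) := by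
  rw [field_eq, Prod.mk_eq_zero] at h
  rw [disc]; linear_combination P.a * h.1 + P.b * h.2

variable (P)

/-- The point reflection of a Hamiltonian. -/
def refl : HamCoeff := ⟨P.b, P.c, P.a, -P.α, -P.β⟩

lemma negField_refl : negField P.refl.field = P.field := by
  funext q
  simp only [negField, field_eq, refl, Prod.fst_neg, Prod.snd_neg, Prod.neg_mk]
  ext
  · simp only; ring
  · simp only; ring

/-- The normal form of a saddle in the right zone. -/
noncomputable def outer (r : ℝ) (hr : 0 < r) (hP : 0 < P.disc) : Outer where
  k := r * √P.disc
  S := -(r * (P.disc + (P.b * P.β + P.a * P.α))) / √P.disc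
  lam := √P.disc
  d := 0
  s := 0
  k_pos := mul_pos hr (Real.sqrt_pos.2 hP)
  lam_pos := Real.sqrt_pos.2 hP

/-- With the height `Y` equal to `r` times the horizontal velocity, the eigendirections become `Y =
±k (x - x₀)`, where `x₀` is the abscissa of the saddle and `k = r √disc`. The parameter `S` is `k
(x₀ - 1)`. -/
lemma outer_field {r : ℝ} (hr : 0 < r) (hP : 0 < P.disc) (x y : ℝ) :
    (P.outer r hr hP).field 0 (x, r * (P.b * y + P.a * x + P.α)) =
      ((P.field (x, y)).1, r * P.b * (P.field (x, y)).2 + r * P.a * (P.field (x, y)).1) := by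
  have h1 := Real.sq_sqrt hP.le
  have h2 := Real.sqrt_pos.2 hP
  rw [field_eq]
  simp only [Outer.field, Outer.u, Outer.v, outer, zero_mul, add_zero, mul_one, sub_zero]
  set l := √P.disc
  have h3 : P.disc = l ^ 2 := h1.symm
  have h4 : P.b * P.c = l ^ 2 - P.a ^ 2 := by rw [← h3, disc]; ring
  rw [h3]
  ext
  · simp only; field_simp; ring
  · simp only; field_simp
    linear_combination (-2 * x) * h4

end HamCoeff

/-- Two affine functions on a line whose product is nonnegative and not identically zero. -/
lemma proportional {b₁ c₁ b₂ c₂ : ℝ} (hb : b₁ ≠ 0)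
    (h : ∀ y, 0 < (b₁ * y + c₁) * (b₂ * y + c₂) ∨ b₁ * y + c₁ = 0 ∨ b₂ * y + c₂ = 0)
    (hx : ∃ y, 0 < (b₁ * y + c₁) * (b₂ * y + c₂)) : 0 < b₁ / b₂ ∧ c₁ = b₁ / b₂ * c₂ := by
  have h0 : ∀ y, 0 ≤ (b₁ * b₂) * (y * y) + (b₁ * c₂ + b₂ * c₁) * y + c₁ * c₂ := fun y => by
    have e : (b₁ * b₂) * (y * y) + (b₁ * c₂ + b₂ * c₁) * y + c₁ * c₂ =
        (b₁ * y + c₁) * (b₂ * y + c₂) := by ring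
    rw [e]
    rcases h y with h | h | h
    · exact h.le
    · rw [h, zero_mul]
    · rw [h, mul_zero]
  -- The discriminant of the product is the square of `b₁ c₂ - b₂ c₁`, so a product that is nowhere
  -- negative forces proportionality. The point where the product is positive excludes `b₂ = 0` and
  -- fixes the sign of the factor.
  have h1 := discrim_le_zero h0
  have h2 : (b₁ * c₂ - b₂ * c₁) ^ 2 ≤ 0 := by rw [discrim] at h1; linarith
  have h3 : b₁ * c₂ = b₂ * c₁ := by
    have := pow_eq_zero_iff (two_ne_zero) |>.1 (le_antisymm h2 (sq_nonneg _)); linarith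
  obtain ⟨y, hy⟩ := hx
  have hb₂ : b₂ ≠ 0 := by
    rintro rfl
    rw [zero_mul, mul_eq_zero] at h3
    rw [h3.resolve_left hb] at hy
    simp at hy
  have h4 : b₁ ^ 2 * ((b₁ * y + c₁) * (b₂ * y + c₂)) = b₁ * b₂ * (b₁ * y + c₁) ^ 2 := by
    linear_combination (b₁ * (b₁ * y + c₁)) * h3
  have h5 : 0 < b₁ * b₂ * (b₁ * y + c₁) ^ 2 := by rw [← h4]; positivity
  have h6 := pos_of_mul_pos_left h5 (sq_nonneg _)
  refine ⟨?_, by field_simp; linarith⟩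
  have : b₁ / b₂ = b₁ * b₂ / b₂ ^ 2 := by field_simp
  rw [this]; positivity

lemma IsCrossingPeriodicOrbit.exists_crossing {X : PWField} {Γ : Set (ℝ × ℝ)}
    (h : IsCrossingPeriodicOrbit X Γ) {x : ℝ} (hx : x = -1 ∨ x = 1) (h1 : ∃ p ∈ Γ, p.1 ≤ x)
    (h2 : ∃ p ∈ Γ, x ≤ p.1) : ∃ y, IsCrossingPoint X (x, y) := by
  obtain ⟨γ, T, h, rfl⟩ := h
  obtain ⟨_, ⟨s, rfl⟩, hs⟩ := h1
  obtain ⟨_, ⟨t, rfl⟩, ht⟩ := h2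
  obtain ⟨r, hr⟩ := mem_range_of_exists_le_of_exists_ge h.1.continuous_fst ⟨s, hs⟩ ⟨t, ht⟩
  have hr : (γ r).1 = x := hr
  have := h.1.crossing r (by rwa [hr])
  rw [← hr]
  exact ⟨_, this⟩

variable {HL HC HR : HamCoeff}

/-- A system that satisfies the hypotheses has a normal form. -/
theorem exists_normal_form (h1 : Hyp1 HL HC HR) (h2 : Hyp2 (unperturbed HL HC HR))
    (h3 : Hyp3 (unperturbed HL HC HR)) : ∃ (S : Shear) (M : NF),
      S.Carries (unperturbed HL HC HR) (M.sys 0) ∧ ∀ p, IsLinearCenter HC.field p → p.1 = M.p := by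
  obtain ⟨⟨pC, hC⟩, ⟨pL, hL⟩, ⟨pR, hR⟩⟩ := h1
  have hC := HamCoeff.disc_neg_of_center hC
  have hL := HamCoeff.disc_pos_of_saddle hL
  have hR := HamCoeff.disc_pos_of_saddle hR
  obtain ⟨Γ, ⟨γ, T, hγ, -, hΓ⟩, ⟨ql, mql, hql⟩, ⟨qc, mqc, hqc⟩, ⟨qr, mqr, hqr⟩⟩ := h3.1
  have hΓ : IsCrossingPeriodicOrbit (unperturbed HL HC HR) Γ := ⟨γ, T, hγ, hΓ⟩
  have hb : HC.b ≠ 0 := by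
    intro h
    rw [HamCoeff.disc, h] at hC
    nlinarith [sq_nonneg HC.a]
  obtain ⟨yr, hyr⟩ := hΓ.exists_crossing (Or.inr rfl) ⟨qc, mqc, hqc.2.le⟩ ⟨qr, mqr, hqr.le⟩
  obtain ⟨yl, hyl⟩ := hΓ.exists_crossing (Or.inl rfl) ⟨ql, mql, hql.le⟩ ⟨qc, mqc, hqc.1.le⟩
  have crR : ∀ y, IsCrossingPoint (unperturbed HL HC HR) (1, y) →
      0 < (HC.b * y + (HC.a + HC.α)) * (HR.b * y + (HR.a + HR.α)) := fun y h => by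
    rcases h with ⟨h, -⟩ | ⟨-, h⟩
    · norm_num at h
    · simp only [unperturbed, HamCoeff.field_eq, mul_one] at h
      linarith
  have crL : ∀ y, IsCrossingPoint (unperturbed HL HC HR) (-1, y) →
      0 < (HC.b * y + (-HC.a + HC.α)) * (HL.b * y + (-HL.a + HL.α)) := fun y h => by
    rcases h with ⟨-, h⟩ | ⟨h, -⟩
    · simp only [unperturbed, HamCoeff.field_eq] at h
      linarith
    · norm_num at h
  obtain ⟨rR, mR⟩ := proportional hb (fun y => by
    rcases h2 (1, y) (Or.inr rfl) with h | ⟨h, -⟩ | ⟨-, h⟩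
    · exact Or.inl (crR y h)
    · norm_num at h
    · simp only [unperturbed, HamCoeff.field_eq, mul_one] at h
      rcases h with h | h
      · exact Or.inr (Or.inl (by linarith))
      · exact Or.inr (Or.inr (by linarith))) ⟨yr, crR yr hyr⟩
  obtain ⟨rL, mL⟩ := proportional hb (fun y => by
    rcases h2 (-1, y) (Or.inl rfl) with h | ⟨-, h⟩ | ⟨h, -⟩
    · exact Or.inl (crL y h)
    · simp only [unperturbed, HamCoeff.field_eq] at h
      rcases h with h | h
      · exact Or.inr (Or.inr (by linarith))
      · exact Or.inr (Or.inl (by linarith))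
    · norm_num at h) ⟨yl, crL yl hyl⟩
  have hL' : 0 < HL.refl.disc := hL
  have kR : HC.b / HR.b * HR.b = HC.b := div_mul_cancel₀ _ fun h => by rw [h] at rR; simp at rR
  have kL : HC.b / HL.b * HL.b = HC.b := div_mul_cancel₀ _ fun h => by rw [h] at rL; simp at rL
  have hω : √(-HC.disc) ^ 2 = -HC.disc := Real.sq_sqrt (by linarith)
  -- In each zone the new height is the horizontal velocity of the subsystem, rescaled by `b_C /
  -- b_i` in the outer zones. The proportionality on the lines is exactly the continuity of this
  -- map. The left zone is described by its reflection.
  refine ⟨⟨HC.b, HC.b / HL.b * HL.a, HC.b / HL.b * HL.α, HC.a, HC.α, HC.b / HR.b * HR.a,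
    HC.b / HR.b * HR.α, hb, by linarith, by linarith⟩,
    ⟨-(HC.b * HC.β + HC.a * HC.α) / HC.disc, √(-HC.disc), 0, HR.outer _ rR hR,
      HL.refl.outer _ rL hL', Real.sqrt_pos.2 (by linarith)⟩, ⟨?_, ?_, ?_⟩, ?_⟩
  · rintro ⟨x, y⟩ hx
    rw [Shear.map, Shear.ψ_left _ hx]
    have := HL.refl.outer_field rL hL' (-x) (-y)
    have e : ((x, HC.b * y + (HC.b / HL.b * HL.a * x + HC.b / HL.b * HL.α)) : ℝ × ℝ) =
        -(-x, HC.b / HL.b * (HL.refl.b * -y + HL.refl.a * -x + HL.refl.α)) := by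
      ext
      · simp
      · simp only [HamCoeff.refl, Prod.snd_neg]; linear_combination (-y) * kL
    simp only [NF.sys]
    rw [e, negField, neg_neg, this]
    have hf := congrFun HL.negField_refl (x, y)
    simp only [unperturbed]
    rw [← hf, negField, Prod.neg_mk]
    ext
    · rfl
    · simp only [Shear.push, HamCoeff.refl, Prod.snd_neg, Prod.fst_neg, Prod.neg_mk]
      rw [kL]; ring
  · rintro ⟨x, y⟩ hx hx'
    rw [Shear.map, Shear.ψ_central _ hx hx', NF.central_zero]
    simp only [Shear.push, unperturbed, HamCoeff.field_eq]
    rw [hω]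
    ext
    · simp only; ring
    · simp only
      have h0 := hC.ne
      field_simp
      rw [HamCoeff.disc]; ring
  · rintro ⟨x, y⟩ hx
    rw [Shear.map, Shear.ψ_right _ hx]
    have := HR.outer_field rR hR x y
    rw [mul_add, mul_add, ← mul_assoc, kR] at this
    simp only [NF.sys, unperturbed, Shear.push]
    rw [← this]
    congr 2
    ring
  · intro p hp
    have := HamCoeff.disc_mul_fst hp.1
    rw [eq_div_iff hC.ne]
    linarith

end PWHam

namespace PWHam

/-! ### Perturbations in the original coordinates -/

/-- An affine field in the coordinates `(x, κ y + m x + n)`, pulled back. -/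
noncomputable def PertCoeff.pull (A : PertCoeff) (κ m n : ℝ) : PertCoeff where
  f10 := A.f10 + A.f01 * m
  f01 := A.f01 * κ
  f00 := A.f00 + A.f01 * n
  g10 := (A.g10 + A.g01 * m - m * (A.f10 + A.f01 * m)) / κ
  g01 := (A.g01 * κ - m * (A.f01 * κ)) / κ
  g00 := (A.g00 + A.g01 * n - m * (A.f00 + A.f01 * n)) / κ

/-- The shear is affine in each zone, so an affine perturbation of the normal form pulls back to an
affine perturbation. -/
lemma Shear.push_pull (S : Shear) (A : PertCoeff) (m n x y : ℝ) :
    S.push m ((A.pull S.κ m n).field (x, y)) = A.field (x, S.κ * y + (m * x + n)) := by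
  have := S.κ_ne
  ext
  · simp only [push, PertCoeff.pull, PertCoeff.field]; ring
  · simp only [push, PertCoeff.pull, PertCoeff.field]; field_simp; ring

lemma Shear.push_add_smul (S : Shear) (m ε : ℝ) (v w : ℝ × ℝ) :
    S.push m (v + ε • w) = S.push m v + ε • S.push m w := by
  ext
  · rfl
  · simp only [push, Prod.fst_add, Prod.snd_add, Prod.smul_fst, Prod.smul_snd, smul_eq_mul]; ring

/-- The perturbation of an outer zone in normal form. -/
noncomputable def Outer.pertCoeff (O : Outer) : PertCoeff where
  f10 := O.lam * O.d / 2
  f01 := O.lam * O.d / (2 * O.k)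
  f00 := O.lam * (O.d * (-O.k - O.S) - O.s) / (2 * O.k)
  g10 := O.lam * O.d * O.k / 2
  g01 := O.lam * O.d / 2
  g00 := O.lam * (O.d * (-O.k - O.S) + O.s) / 2

/-- The perturbed saddle depends on `ε` affinely, with no second order term, so it has the
prescribed form of a field plus `ε` times an affine field. -/
lemma Outer.field_eq_add (O : Outer) (ε : ℝ) (q : ℝ × ℝ) :
    O.field ε q = O.field 0 q + ε • O.pertCoeff.field q := by
  have := O.k_pos.ne'
  ext
  · simp only [field, pertCoeff, PertCoeff.field, u, v, Prod.fst_add, Prod.smul_fst, smul_eq_mul]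
    field_simp; ring
  · simp only [field, pertCoeff, PertCoeff.field, u, v, Prod.snd_add, Prod.smul_snd, smul_eq_mul]
    field_simp; ring

/-- The reflected affine field. -/
def PertCoeff.refl (A : PertCoeff) : PertCoeff := ⟨A.f10, A.f01, -A.f00, A.g10, A.g01, -A.g00⟩

lemma PertCoeff.negField_field (A : PertCoeff) (q : ℝ × ℝ) :
    -A.field (-q) = A.refl.field q := by
  ext
  · simp only [field, refl, Prod.fst_neg, Prod.snd_neg]; ring
  · simp only [field, refl, Prod.fst_neg, Prod.snd_neg]; ring

/-- The perturbation of the central zone in normal form. -/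
def NF.pertCoeff (M : NF) : PertCoeff := ⟨M.dC, 0, -(M.dC * M.p), 0, M.dC, 0⟩

lemma NF.central_eq_add (M : NF) (ε : ℝ) (q : ℝ × ℝ) :
    M.central ε q = M.central 0 q + ε • M.pertCoeff.field q := by
  ext
  · simp only [central, pertCoeff, PertCoeff.field, Prod.fst_add, Prod.smul_fst, smul_eq_mul]; ring
  · simp only [central, pertCoeff, PertCoeff.field, Prod.snd_add, Prod.smul_snd, smul_eq_mul]; ring

lemma NF.pert_sys_zero (M : NF) (dC dR sR dL sL : ℝ) :
    (M.pert dC dR sR dL sL).sys 0 = M.sys 0 := by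
  simp only [sys, pert]
  congr 1
  · funext q; simp only [negField, Outer.field, zero_mul, add_zero, sub_zero]; rfl
  · funext q; simp only [central, zero_mul, add_zero]
  · funext q; simp only [Outer.field, zero_mul, add_zero, sub_zero]; rfl

variable {HL HC HR : HamCoeff}

/-- Every perturbation of the normal form comes from a perturbation of the original system. -/
theorem Shear.Carries.exists_perturbed {S : Shear} {M : NF}
    (h : S.Carries (unperturbed HL HC HR) (M.sys 0)) :
    ∃ QL QC QR : PertCoeff, ∀ ε, S.Carries (perturbed HL HC HR QL QC QR ε) (M.sys ε) := by
  refine ⟨M.L.pertCoeff.refl.pull S.κ S.mL S.nL, M.pertCoeff.pull S.κ S.mC S.nC,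
    M.R.pertCoeff.pull S.κ S.mR S.nR, fun ε => ⟨fun q hq => ?_, fun q hq hq' => ?_, fun q hq => ?_⟩⟩
  · have h0 := h.left q hq
    simp only [perturbed, NF.sys, unperturbed] at h0 ⊢
    rw [S.push_add_smul, ← h0, S.push_pull, negField, negField, Outer.field_eq_add, neg_add,
      ← smul_neg, PertCoeff.negField_field, map, S.ψ_left hq]
  · have h0 := h.central q hq hq'
    simp only [perturbed, NF.sys, unperturbed] at h0 ⊢
    rw [S.push_add_smul, ← h0, S.push_pull, NF.central_eq_add, map, S.ψ_central hq hq']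
  · have h0 := h.right q hq
    simp only [perturbed, NF.sys, unperturbed] at h0 ⊢
    rw [S.push_add_smul, ← h0, S.push_pull, Outer.field_eq_add, map, S.ψ_right hq]

lemma perturbed_zero (QL QC QR : PertCoeff) :
    perturbed HL HC HR QL QC QR 0 = unperturbed HL HC HR := by
  simp [perturbed, unperturbed]

lemma IsConjugacy.trans {φ φ' χ χ' : ℝ × ℝ → ℝ × ℝ} {X N K : PWField} (h : IsConjugacy φ φ' X N)
    (h' : IsConjugacy χ χ' N K) : IsConjugacy (fun q => χ (φ q)) (fun q => φ' (χ' q)) X K where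
  cont := h'.cont.comp h.cont
  cont' := h.cont'.comp h'.cont'
  left_inv p := by rw [h'.left_inv, h.left_inv]
  right_inv p := by rw [h.right_inv, h'.right_inv]
  sol γ hγ := h'.sol _ (h.sol γ hγ)
  sol' γ hγ := h.sol' _ (h'.sol' γ hγ)

/-- Bifurcations in the normal form give bifurcations in the original system. -/
lemma limitCyclesBifurcate_of_conj {QL QC QR : PertCoeff} {M : NF} {φ φ' : ℝ × ℝ → ℝ × ℝ} {m n : ℕ}
    (hc : ∀ ε, IsConjugacy φ φ' (perturbed HL HC HR QL QC QR ε) (M.sys ε))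
    (hcw : ∀ Γ, IsCrossingPeriodicOrbit (unperturbed HL HC HR) Γ → (∃ z > 0, (1, z) ∈ φ '' Γ) →
      IsClockwiseOrbit (unperturbed HL HC HR) Γ)
    (h3 : ∀ Γ, ThreeZones Γ → ThreeZones (φ' '' Γ))
    (h2 : ∀ Γ, MeetsCentral Γ ∧ MeetsRight Γ ∧ ¬ MeetsLeft Γ → TwoZones (φ' '' Γ))
    {z : Fin m → ℝ} {w : Fin n → ℝ} (hz : Function.Injective z) (hw : Function.Injective w)
    (hz3 : ∀ i, M.Bifurcates ThreeZones (z i))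
    (hw2 : ∀ j, M.Bifurcates (fun Γ => MeetsCentral Γ ∧ MeetsRight Γ ∧ ¬ MeetsLeft Γ) (w j)) :
    LimitCyclesBifurcate HL HC HR m n := by
  have key : ∀ {k : ℕ} {Q : Set (ℝ × ℝ) → Prop} {z : Fin k → ℝ}, Function.Injective z →
      (∀ i, M.Bifurcates Q (z i)) → ∃ (Γ : Fin k → Set (ℝ × ℝ)) (c : Fin k → ℝ → Set (ℝ × ℝ)),
        Function.Injective (fun i => φ' '' Γ i) ∧
        (∀ i, IsClockwiseOrbit (unperturbed HL HC HR) (φ' '' Γ i) ∧ Q (Γ i)) ∧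
        (∀ᶠ ε in 𝓝[>] (0 : ℝ), Function.Injective (fun i => φ' '' c i ε) ∧
          ∀ i, IsLimitCycle (perturbed HL HC HR QL QC QR ε) (φ' '' c i ε) ∧ Q (c i ε)) ∧
        ∀ i, Tendsto (fun ε => Metric.hausdorffEDist (φ' '' c i ε) (φ' '' Γ i)) (𝓝[>] 0) (𝓝 0) := by
    intro k Q z hz hb
    choose hpos Γ c Y hΓ hY hcy hd using hb
    have hinj : ∀ {A B : Set (ℝ × ℝ)}, φ' '' A = φ' '' B → A = B := fun {A B} h => by
      rw [← (hc 0).symm.image_image A, h, (hc 0).symm.image_image]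
    refine ⟨Γ, c, fun i j hij => hz ?_, fun i => ⟨?_, (hΓ i).2.1⟩, ?_, fun i =>
      tendsto_hausdorffEDist_image (hc 0).cont' (hd i)⟩
    -- Each orbit meets `x = 1` at exactly one positive height, so equal orbits have equal heights.
    · have := (hΓ i).2.2.1
      rw [hinj hij] at this
      exact (hΓ j).2.2.2 _ (hpos i) this
    · have h0 := hc 0
      rw [perturbed_zero] at h0
      refine hcw _ (h0.symm.isCrossingPeriodicOrbit (hΓ i).1) ⟨z i, hpos i, ?_⟩
      rw [h0.symm.image_image]
      exact (hΓ i).2.2.1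
    -- The heights `Y i ε` tend to distinct limits and are therefore distinct for small `ε`.
    · have hne : ∀ᶠ ε in 𝓝[>] (0 : ℝ), ∀ i j, i ≠ j → Y i ε ≠ Y j ε := by
        refine eventually_all.2 fun i => eventually_all.2 fun j => ?_
        by_cases hij : i = j
        · exact Eventually.of_forall fun ε h => absurd hij h
        · have := ((hY i).prodMk_nhds (hY j)).eventually
            (isOpen_ne_fun continuous_fst continuous_snd |>.mem_nhds
              (show (z i, z j) ∈ {q : ℝ × ℝ | q.1 ≠ q.2} from fun h => hij (hz h)))
          exact this.mono fun ε h _ => h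
      filter_upwards [hne, eventually_all.2 hcy] with ε h4 h5
      refine ⟨fun i j hij => ?_, fun i => ⟨(hc ε).symm.isLimitCycle (h5 i).1, (h5 i).2.1⟩⟩
      by_contra hne
      have := (h5 i).2.2.2.1
      rw [hinj hij] at this
      exact h4 i j hne ((h5 j).2.2.2.2 _ (h5 i).2.2.1 this)
  obtain ⟨Γ₃, c₃, a1, a2, a3, a4⟩ := key hz hz3
  obtain ⟨Γ₂, c₂, b1, b2, b3, b4⟩ := key hw hw2
  obtain ⟨ε₀, hε₀, hsub⟩ := mem_nhdsGT_iff_exists_Ioo_subset.1 (a3.and b3)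
  refine ⟨QL, QC, QR, _, _, a1, b1, fun i => ⟨(a2 i).1, h3 _ (a2 i).2⟩,
    fun j => ⟨(b2 j).1, h2 _ (b2 j).2⟩, fun i ε => φ' '' c₃ i ε, fun j ε => φ' '' c₂ j ε,
    ⟨ε₀, hε₀, fun ε h h' => ?_⟩, a4, b4⟩
  obtain ⟨⟨p1, p2⟩, q1, q2⟩ := hsub ⟨h, h'⟩
  exact ⟨p1, q1, fun i => ⟨(p2 i).1, h3 _ (p2 i).2⟩, fun j => ⟨(q2 j).1, h2 _ (q2 j).2⟩⟩

section zones

variable {φ : ℝ × ℝ → ℝ × ℝ} {Γ : Set (ℝ × ℝ)}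

lemma meetsLeft_image (h : ∀ p, (φ p).1 = p.1) : MeetsLeft (φ '' Γ) ↔ MeetsLeft Γ := by
  simp only [MeetsLeft, exists_mem_image, h]

lemma meetsCentral_image (h : ∀ p, (φ p).1 = p.1) : MeetsCentral (φ '' Γ) ↔ MeetsCentral Γ := by
  simp only [MeetsCentral, exists_mem_image, h]

lemma meetsRight_image (h : ∀ p, (φ p).1 = p.1) : MeetsRight (φ '' Γ) ↔ MeetsRight Γ := by
  simp only [MeetsRight, exists_mem_image, h]

lemma meetsLeft_image_neg (h : ∀ p, (φ p).1 = -p.1) : MeetsLeft (φ '' Γ) ↔ MeetsRight Γ := by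
  simp only [MeetsLeft, MeetsRight, exists_mem_image, h, neg_lt_neg_iff]

lemma meetsCentral_image_neg (h : ∀ p, (φ p).1 = -p.1) :
    MeetsCentral (φ '' Γ) ↔ MeetsCentral Γ := by
  simp only [MeetsCentral, exists_mem_image, h]
  exact exists_congr fun p => and_congr_right fun _ =>
    ⟨fun h => ⟨by linarith, by linarith⟩, fun h => ⟨by linarith, by linarith⟩⟩

lemma meetsRight_image_neg (h : ∀ p, (φ p).1 = -p.1) : MeetsRight (φ '' Γ) ↔ MeetsLeft Γ := by
  simp only [MeetsLeft, MeetsRight, exists_mem_image, h]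
  exact exists_congr fun p => and_congr_right fun _ =>
    ⟨fun h => by linarith, fun h => by linarith⟩

end zones

/-- Limit cycles of a normal form of the system. -/
lemma limitCyclesBifurcate_of_hasCycles {S : Shear} {M : NF} {m n : ℕ}
    (hS : S.Carries (unperturbed HL HC HR) (M.sys 0)) (hκ : 0 < S.κ) (h : M.HasCycles m n) :
    LimitCyclesBifurcate HL HC HR m n := by
  obtain ⟨dC, dR, sR, dL, sL, z, w, hz, hw, h3, h2⟩ := h
  obtain ⟨QL, QC, QR, hQ⟩ := Shear.Carries.exists_perturbed
    (M := M.pert dC dR sR dL sL) (by rwa [NF.pert_sys_zero])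
  have hfst : ∀ p, (S.inv.map p).1 = p.1 := fun _ => rfl
  refine limitCyclesBifurcate_of_conj (fun ε => (hQ ε).isConjugacy) (fun Γ hΓ ⟨z, hz, hmem⟩ =>
    clockwise_of_mem hS hκ hΓ hmem hz.ne') (fun Γ hΓ => ?_) (fun Γ hΓ => ?_) hz hw h3 h2
  · rwa [ThreeZones, meetsLeft_image hfst, meetsCentral_image hfst, meetsRight_image hfst]
  · rw [TwoZones, meetsLeft_image hfst, meetsCentral_image hfst, meetsRight_image hfst]
    exact ⟨hΓ.1, Or.inl hΓ.2⟩

/-- Limit cycles of the reflection of a normal form of the system. -/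
lemma limitCyclesBifurcate_of_hasCycles_refl {S : Shear} {M : NF} {m n : ℕ}
    (hS : S.Carries (unperturbed HL HC HR) (M.sys 0)) (hκ : 0 < S.κ) (h : M.refl.HasCycles m n) :
    LimitCyclesBifurcate HL HC HR m n := by
  obtain ⟨dC, dR, sR, dL, sL, z, w, hz, hw, h3, h2⟩ := h
  -- The reflection exchanges the outer zones, hence the exchanged parameters.
  obtain ⟨QL, QC, QR, hQ⟩ := Shear.Carries.exists_perturbed
    (M := M.pert dC dL sL dR sR) (by rwa [NF.pert_sys_zero])
  have hfst : ∀ p, (S.inv.map (-p)).1 = -p.1 := fun _ => rfl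
  refine limitCyclesBifurcate_of_conj (QL := QL) (QC := QC) (QR := QR)
    (M := (M.pert dC dL sL dR sR).refl)
    (φ := fun q => -S.map q) (φ' := fun q => S.inv.map (-q)) (fun ε => ?_)
    (fun Γ hΓ ⟨z, hz, q, hq, hqz⟩ => clockwise_of_mem hS hκ hΓ (mem_image_of_mem _ hq) ?_)
    (fun Γ hΓ => ?_) (fun Γ hΓ => ?_) hz hw h3 h2
  · rw [NF.refl_sys]
    exact (hQ ε).isConjugacy.trans (isConjugacy_neg _)
  · rw [neg_eq_iff_eq_neg] at hqz
    rw [hqz]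
    exact neg_ne_zero.2 hz.ne'
  · rw [ThreeZones, meetsLeft_image_neg hfst, meetsCentral_image_neg hfst,
      meetsRight_image_neg hfst]
    exact ⟨hΓ.2.2, hΓ.2.1, hΓ.1⟩
  · rw [TwoZones, meetsLeft_image_neg hfst, meetsCentral_image_neg hfst,
      meetsRight_image_neg hfst]
    exact ⟨hΓ.1, Or.inr hΓ.2⟩

namespace NF

/-- The number of limit cycles of a normal form with the center in the right half plane. -/
theorem hasCycles_of_p_pos {M : NF} (hp : 0 < M.p) {Γ : Set (ℝ × ℝ)}
    (h : IsCrossingPeriodicOrbit (M.sys 0) Γ) (h3 : ThreeZones Γ) :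
    (M.p ≤ 1 → M.HasCycles 4 2) ∧ M.HasCycles 3 1 := by
  have hω := M.ω_pos
  have hS := right_S_pos h h3.2.1 h3.2.2
  have hneg := (isConjugacy_neg (M.sys 0)).isCrossingPeriodicOrbit h
  have hfst : ∀ p : ℝ × ℝ, (-p).1 = -p.1 := fun _ => rfl
  have hL : 0 < M.L.S := by
    rw [← refl_sys] at hneg
    exact right_S_pos hneg ((meetsCentral_image_neg hfst).2 h3.2.1)
      ((meetsRight_image_neg hfst).2 h3.1)
  have hlt := sq_e_lt h h3
  have he : 0 < M.e := mul_pos hω (by linarith)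
  -- Positivity of `p` is exactly the existence of the critical height `s = √(e² - c²)`, the height
  -- on `x = 1` of the orbit tangent to `x = -1`.
  have hs : 0 < M.e ^ 2 - M.c ^ 2 := by
    have : M.e ^ 2 - M.c ^ 2 = 4 * M.ω ^ 2 * M.p := by simp only [c, e]; ring
    rw [this]; positivity
  have hs2 : M.c ^ 2 + √(M.e ^ 2 - M.c ^ 2) ^ 2 = M.e ^ 2 := by rw [Real.sq_sqrt hs.le]; ring
  -- An orbit through three zones exists only if the critical height lies below the separatrices of
  -- the right saddle.
  have hsS : √(M.e ^ 2 - M.c ^ 2) < M.R.S := (Real.sqrt_lt' hS).2 (by linarith)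
  exact ⟨fun h1 => hasCycles_four_two (Real.sqrt_pos.2 hs) hs2 he hsS hL
    (mul_nonneg hω.le (by linarith)), hasCycles_three_one (Real.sqrt_pos.2 hs) hs2 he hsS hL⟩

end NF

/-- Both counts of limit cycles, in terms of a common abscissa of the centers. -/
theorem limitCyclesBifurcate_aux (h1 : Hyp1 HL HC HR) (h2 : Hyp2 (unperturbed HL HC HR))
    (h3 : Hyp3 (unperturbed HL HC HR)) : ∃ p₀ : ℝ, (∀ p, IsLinearCenter HC.field p → p.1 = p₀) ∧
      (|p₀| ≤ 1 → LimitCyclesBifurcate HL HC HR 4 2) ∧ LimitCyclesBifurcate HL HC HR 3 1 := by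
  obtain ⟨S, M, hS, hp⟩ := exists_normal_form h1 h2 h3
  obtain ⟨⟨Γ, hcw, hΓ⟩, ⟨Γ', hcw', hΓC, hΓ'⟩⟩ := h3
  have hκ := κ_pos_of_clockwise hS hcw
  have orb : ∀ {Γ}, IsClockwiseOrbit (unperturbed HL HC HR) Γ →
      IsCrossingPeriodicOrbit (M.sys 0) (S.map '' Γ) := fun {Γ} ⟨γ, T, h, _, h'⟩ =>
    hS.isConjugacy.isCrossingPeriodicOrbit ⟨γ, T, h, h'⟩
  have hfst : ∀ p, (S.map p).1 = p.1 := fun _ => rfl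
  have hfst' : ∀ p, (-S.map p).1 = -p.1 := fun _ => rfl
  have orb' : ∀ {Γ}, IsClockwiseOrbit (unperturbed HL HC HR) Γ →
      IsCrossingPeriodicOrbit (M.refl.sys 0) ((fun q => -S.map q) '' Γ) := fun {Γ} h => by
    rw [NF.refl_sys, ← image_image (fun q => -q) S.map]
    exact (isConjugacy_neg _).isCrossingPeriodicOrbit (orb h)
  refine ⟨M.p, hp, ?_⟩
  -- If the two-zone orbits use the left zone, the point reflection of the normal form puts them
  -- into the right zone and the center to the right of `x = 0`.
  rcases hΓ' with ⟨hR, hL⟩ | ⟨hL, hR⟩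
  · have hpos := NF.p_pos (orb hcw') ((meetsCentral_image hfst).2 hΓC)
      ((meetsRight_image hfst).2 hR) (by rwa [meetsLeft_image hfst])
    obtain ⟨c1, c2⟩ := NF.hasCycles_of_p_pos hpos (orb hcw)
      ⟨(meetsLeft_image hfst).2 hΓ.1, (meetsCentral_image hfst).2 hΓ.2.1,
        (meetsRight_image hfst).2 hΓ.2.2⟩
    exact ⟨fun h => limitCyclesBifurcate_of_hasCycles hS hκ (c1 (abs_le.1 h).2),
      limitCyclesBifurcate_of_hasCycles hS hκ c2⟩
  · have hpos := NF.p_pos (orb' hcw') ((meetsCentral_image_neg hfst').2 hΓC)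
      ((meetsRight_image_neg hfst').2 hL) (by rwa [meetsLeft_image_neg hfst'])
    obtain ⟨c1, c2⟩ := NF.hasCycles_of_p_pos hpos (orb' hcw)
      ⟨(meetsLeft_image_neg hfst').2 hΓ.2.2, (meetsCentral_image_neg hfst').2 hΓ.2.1,
        (meetsRight_image_neg hfst').2 hΓ.1⟩
    exact ⟨fun h => limitCyclesBifurcate_of_hasCycles_refl hS hκ
      (c1 (neg_le.1 (abs_le.1 h).1)), limitCyclesBifurcate_of_hasCycles_refl hS hκ c2⟩

end PWHam
theorem theorem1 (HL HC HR : PWHam.HamCoeff)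
    (h1 : PWHam.Hyp1 HL HC HR)
    (h2 : PWHam.Hyp2 (PWHam.unperturbed HL HC HR))
    (h3 : PWHam.Hyp3 (PWHam.unperturbed HL HC HR)) :
    (∀ p : ℝ × ℝ, PWHam.IsLinearCenter HC.field p →
      (PWHam.IsRealCentral p ∨ PWHam.IsBoundaryCentral p) →
        PWHam.LimitCyclesBifurcate HL HC HR 4 2) ∧
    (∀ p : ℝ × ℝ, PWHam.IsLinearCenter HC.field p → PWHam.IsVirtualCentral p →
        PWHam.LimitCyclesBifurcate HL HC HR 3 1) := by
  obtain ⟨p₀, hp, h42, h31⟩ := PWHam.limitCyclesBifurcate_aux h1 h2 h3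
  -- All centers share the abscissa `p₀`, and a real or boundary center means `|p₀| ≤ 1`. The weaker
  -- count needs no restriction on the center.
  refine ⟨fun p hc h => h42 ?_, fun p _ _ => h31⟩
  rw [← hp p hc, abs_le]
  rcases h with h | h | h
  · exact ⟨h.1.le, h.2.le⟩
  · rw [h]; norm_num
  · rw [h]; norm_num
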